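/- Let $n\ge 2$ and $c\neq 0$. For $c>0$ let $\mathbb{C}P^n(c)$, and for $c<0$ let $\mathbb{C}H^n(c)$, denote the complex projective, respectively complex hyperbolic, space of complex dimension $n$ and constant holomorphic sectional curvature $c$, with Riemannian metric $\langle\cdot,\cdot\rangle$, complex structure $J$ and Levi-Civita connection $\bar\nabla$. Let $M$ be a real hypersurface (an immersed smooth submanifold of real codimension one), not assumed to be orientable. For a (local) unit normal field $\xi$ the shape operator is $SX=-\bar\nabla_X\xi$, its eigenvalues are the principal curvatures, $T_\lambda$ is the distribution of principal curvature spaces of the principal curvature $\lambda$, $J\xi$ is the Hopf vector field, and $h$ is the number of principal curvature spaces onto which $J\xi$ has nonzero orthogonal projection. $M$ has constant principal curvatures if every point has a neighbourhood with a unit normal field $\xi$ for which the eigenvalues of $S$ are constant. $\Gamma(T_\lambda)$ denotes the smooth sections of $T_\lambda$, and $\ominus$ denotes orthogonal complement. A subspace $V$ is called (totally) real if $JV\perp V$. (a) If $c>0$, there is no (nonempty) real hypersurface in $\mathbb{C}P^n(c)$ with constant principal curvatures and $h=2$ at every point. (b) Let $c<0$ and let $M$ be a connected real hypersurface in $\mathbb{C}H^n(c)$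 with constant principal curvatures and $h=2$ at every point. Then there are a global smooth unit normal field $\xi$ on $M$, a number $g\in\{3,4\}$ and distinct real numbers $\lambda_1,\dots,\lambda_g$, which are exactly the principal curvatures of $M$ with respect to $\xi$ at every point, such that: (i) $J\xi=b_1U_1+b_2U_2$, where $U_i\in\Gamma(T_{\lambda_i})$, $i\in\{1,2\}$, are unit vector fields and $b_1,b_2$ are positive constants with $$b_i^2=\frac{4(\lambda_j-2\lambda_3)(\lambda_i-\lambda_3)^2}{c(\lambda_i-\lambda_j)}\qquad(\{i,j\}=\{1,2\}).$$ (ii) There is a unit vector field $A\in\Gamma(T_{\lambda_3})$ with $JU_i=(-1)^ib_jA-b_i\xi$ for $\{i,j\}=\{1,2\}$, and $JA=b_2U_1-b_1U_2$. (iii) $0\le\lambda_3<\tfrac12\sqrt{-c}$ and $\lambda_i=\tfrac12\bigl(3\lambda_3+(-1)^i\sqrt{-c-3\lambda_3^2}\bigr)$ for $i\in\{1,2\}$. (iv) $\dim T_{\lambda_1}=1$. (v) If $g=4$, then $\dim T_{\lambda_2}=1$; the number $k=\dim T_{\lambda_4}+1$ is constant on $M$ and lies in $\{2,\dots,n-1\}$;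 $T_{\lambda_4}$ is totally real with $JT_{\lambda_4}\subset T_{\lambda_3}\ominus\mathbb{R}A$; $0\ne\lambda_3\ne\frac{\sqrt{-c}}{2\sqrt3}$; and $\lambda_4=-\frac{c}{4\lambda_3}$. (vi) If $g=3$, then either (A) $\dim T_{\lambda_2}=1$ at every point, or (B) $k=\dim T_{\lambda_2}$ is constant on $M$ and lies in $\{2,\dots,n-1\}$, $T_{\lambda_2}\ominus\mathbb{R}U_2$ is a real distribution with $J(T_{\lambda_2}\ominus\mathbb{R}U_2)\subset T_{\lambda_3}\ominus\mathbb{R}A$, and $\lambda_1=0$, $\lambda_2=\frac{\sqrt{-3c}}{2}$, $\lambda_3=\frac{\sqrt{-c}}{2\sqrt3}$. -/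

import Mathlib

open Set Matrix
open scoped Manifold ContDiff

noncomputable section

/-- Complex `(n+1) × (n+1)` matrices. -/
abbrev Mat (n : ℕ) : Type := Matrix (Fin (n + 1)) (Fin (n + 1)) ℂ

/-! ### The complex space forms `ℂPⁿ(c)` (`c > 0`) and `ℂHⁿ(c)` (`c < 0`)

A point is a complex line in `ℂⁿ⁺¹`. For `c > 0` all lines are allowed and `ℂⁿ⁺¹` carries the
standard Hermitian form; for `c < 0` the form has signature `(n, 1)` and the lines are the negative
ones. A line is represented by the orthogonal projector onto it, so that the space form becomes a
submanifold of the real vector space of matrices that are self-adjoint for the form. -/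

/-- Gram matrix of the Hermitian form on `ℂⁿ⁺¹`: `diag(1, …, 1)` if `c ≥ 0` and
`diag(-1, 1, …, 1)` if `c < 0`. -/
def gramMatrix (n : ℕ) (c : ℝ) : Mat n :=
  Matrix.diagonal fun i => if i = 0 ∧ c < 0 then -1 else 1

/-- The Hermitian form `⟨z, w⟩ = z* ε w` on `ℂⁿ⁺¹`. -/
def hermForm {n : ℕ} (c : ℝ) (z w : Fin (n + 1) → ℂ) : ℂ :=
  star z ⬝ᵥ (gramMatrix n c *ᵥ w)

/-- The operator `u ↦ ⟨w, u⟩ z`. -/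
def rankOne {n : ℕ} (c : ℝ) (z w : Fin (n + 1) → ℂ) : Mat n :=
  Matrix.vecMulVec z (star w) * gramMatrix n c

/-- The projector `u ↦ (⟨z, u⟩ / ⟨z, z⟩) z` onto the line `ℂ z`. -/
def lineProjector {n : ℕ} (c : ℝ) (z : Fin (n + 1) → ℂ) : Mat n :=
  (hermForm c z z)⁻¹ • rankOne c z z

/-- The complex space form of complex dimension `n` and constant holomorphic sectional curvature
`c ≠ 0`: `ℂPⁿ(c)` if `c > 0`, and `ℂHⁿ(c)` if `c < 0`. -/
def complexSpaceForm (n : ℕ) (c : ℝ) : Set (Mat n) :=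
  {P | ∃ z : Fin (n + 1) → ℂ, 0 < c * (hermForm c z z).re ∧ P = lineProjector c z}

/-- The tangent space of the complex space form at `P`: the self-adjoint `X` that satisfy the
linearization `X P + P X = X` of the equation `P² = P`. At `P = lineProjector c z` these are the
matrices `horizontalVec c z v` below, with `v` orthogonal to `z`. -/
def ambientTangent {n : ℕ} (c : ℝ) (P : Mat n) : Submodule ℝ (Mat n) where
  carrier := {X | Xᴴ * gramMatrix n c = gramMatrix n c * X ∧ X * P + P * X = X}
  zero_mem' := by simp
  add_mem' := by
    rintro X Y ⟨hX, hX'⟩ ⟨hY, hY'⟩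
    refine ⟨by simp [add_mul, mul_add, hX, hY], ?_⟩
    calc (X + Y) * P + P * (X + Y) = (X * P + P * X) + (Y * P + P * Y) := by noncomm_ring
      _ = X + Y := by rw [hX', hY']
  smul_mem' := by
    rintro r X ⟨hX, hX'⟩
    refine ⟨by simp [hX], ?_⟩
    calc (r • X) * P + P * (r • X) = r • (X * P + P * X) := by simp
      _ = r • X := by rw [hX']

/-- The Riemannian metric `(2 / c) tr(X Y)`. By `ambientMetric_horizontalVec` it is the
Fubini–Study, respectively Bergman, metric of constant holomorphic sectional curvature `c`. -/
def ambientMetric {n : ℕ} (c : ℝ) (X Y : Mat n) : ℝ :=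
  (2 / c) * (Matrix.trace (X * Y)).re

/-- The complex structure `J` on the tangent space at `P`. By `ambientJ_horizontalVec` it is
multiplication by `i` on horizontal lifts. -/
def ambientJ {n : ℕ} (P X : Mat n) : Mat n :=
  Complex.I • (X * P - P * X)

/-- Orthogonal projection, for the trace form, of the self-adjoint matrices onto the tangent space
of the complex space form at `P`. -/
def tangentialProj {n : ℕ} (P : Mat n) : Mat n →ₗ[ℝ] Mat n where
  toFun Y := P * Y * (1 - P) + (1 - P) * Y * P
  map_add' X Y := by noncomm_ring
  map_smul' r X := by simp [smul_add]

/-- The tangent vector at the line `ℂ z` whose horizontal lift to `z` is `v` (with `⟨z, v⟩ = 0`),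
that is, the derivative at `t = 0` of `t ↦ lineProjector c (z + t v)`. -/
def horizontalVec {n : ℕ} (c : ℝ) (z v : Fin (n + 1) → ℂ) : Mat n :=
  (hermForm c z z)⁻¹ • (rankOne c v z + rankOne c z v)

theorem rankOne_mul {n : ℕ} (c : ℝ) (a b v w : Fin (n + 1) → ℂ) :
    rankOne c a b * rankOne c v w = hermForm c b v • rankOne c a w := by
  unfold rankOne hermForm
  calc vecMulVec a (star b) * gramMatrix n c * (vecMulVec v (star w) * gramMatrix n c)
      = vecMulVec a (star b) * (gramMatrix n c * vecMulVec v (star w)) * gramMatrix n c := by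
        simp only [Matrix.mul_assoc]
    _ = _ := by
        rw [Matrix.mul_vecMulVec, Matrix.vecMulVec_mul_vecMulVec, Matrix.vecMulVec_smul,
          Matrix.smul_mul]

theorem trace_rankOne {n : ℕ} (c : ℝ) (v w : Fin (n + 1) → ℂ) :
    (rankOne c v w).trace = hermForm c w v := by
  unfold rankOne hermForm
  rw [Matrix.trace_mul_comm, Matrix.mul_vecMulVec, Matrix.trace_vecMulVec, dotProduct_comm]

/-- On horizontal vectors the metric is `(4 / c) Re ⟨v, w⟩ / ⟨z, z⟩`. -/
theorem ambientMetric_horizontalVec {n : ℕ} (c : ℝ) (z v w : Fin (n + 1) → ℂ)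
    (hz : hermForm c z z ≠ 0) (hv : hermForm c v z = 0) (hv' : hermForm c z v = 0)
    (hw : hermForm c w z = 0) (hw' : hermForm c z w = 0) :
    ambientMetric c (horizontalVec c z v) (horizontalVec c z w) =
      (2 / c) * ((hermForm c v w + hermForm c w v) / hermForm c z z).re := by
  unfold ambientMetric horizontalVec
  congr 2
  simp only [Matrix.smul_mul, Matrix.mul_smul, add_mul, mul_add, rankOne_mul, hv, hv', hw, hw',
    Matrix.trace_add, Matrix.trace_smul, trace_rankOne, smul_eq_mul]
  field_simp
  ring

/-- On horizontal vectors the complex structure is multiplication by `i`. -/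
theorem ambientJ_horizontalVec {n : ℕ} (c : ℝ) (z v : Fin (n + 1) → ℂ)
    (hz : hermForm c z z ≠ 0) (hv : hermForm c v z = 0) (hv' : hermForm c z v = 0) :
    ambientJ (lineProjector c z) (horizontalVec c z v) =
      horizontalVec c z (Complex.I • v) := by
  have h1 : rankOne c (Complex.I • v) z = Complex.I • rankOne c v z := by
    simp [rankOne, Matrix.smul_vecMulVec]
  have h2 : rankOne c z (Complex.I • v) = -(Complex.I • rankOne c z v) := by
    simp [rankOne, Matrix.vecMulVec_smul]
  unfold ambientJ lineProjector horizontalVec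
  rw [h1, h2]
  simp only [Matrix.smul_mul, Matrix.mul_smul, add_mul, mul_add, rankOne_mul, hv, hv', smul_smul,
    zero_smul, smul_zero, add_zero, zero_add, inv_mul_cancel₀ hz, one_smul, smul_add, smul_sub,
    smul_neg]
  simp [mul_comm, sub_eq_add_neg]

/-! ### Real hypersurfaces -/

section Hypersurface

variable {n : ℕ} {M : Type*} [TopologicalSpace M]
  [ChartedSpace (EuclideanSpace ℝ (Fin (2 * n - 1))) M]

/-- A matrix-valued map, regarded as a map into the normed space of arrays of entries. -/
def entries (f : M → Mat n) : M → Fin (n + 1) → Fin (n + 1) → ℂ :=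
  fun p i j => f p i j

/-- The differential of a matrix-valued map on `M`. -/
def diffAt (f : M → Mat n) (p : M) : TangentSpace (𝓡 (2 * n - 1)) p →ₗ[ℝ] Mat n :=
  (Matrix.ofLinearEquiv ℝ).toLinearMap ∘ₗ
    (mfderiv (𝓡 (2 * n - 1)) 𝓘(ℝ, Fin (n + 1) → Fin (n + 1) → ℂ) (entries f) p).toLinearMap

/-- Smoothness of a matrix-valued map on a subset of `M`. -/
def SmoothOn (f : M → Mat n) (W : Set M) : Prop :=
  ContMDiffOn (𝓡 (2 * n - 1)) 𝓘(ℝ, Fin (n + 1) → Fin (n + 1) → ℂ) ∞ (entries f) W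

/-- `f` is a smooth immersion of the `(2n-1)`-dimensional manifold `M` into the complex space form,
that is, `M` (with `f`) is a real hypersurface. -/
structure IsRealHypersurface (c : ℝ) (f : M → Mat n) : Prop where
  smooth : SmoothOn f univ
  mem_spaceForm : ∀ p, f p ∈ complexSpaceForm n c
  immersive : ∀ p, Function.Injective (diffAt f p)

/-- `ξ` is, on the set `W`, a smooth unit normal vector field of the hypersurface `f`. -/
structure IsUnitNormalOn (c : ℝ) (f ξ : M → Mat n) (W : Set M) : Prop where
  smooth : SmoothOn ξ W
  tangent : ∀ p ∈ W, ξ p ∈ ambientTangent c (f p)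
  unit : ∀ p ∈ W, ambientMetric c (ξ p) (ξ p) = 1
  normal : ∀ p ∈ W, ∀ v, ambientMetric c (ξ p) (diffAt f p v) = 0

/-- The Levi-Civita derivative `v ↦ ∇̄_v ξ` at `p` of a vector field `ξ` of the space form along
`f`. The space form is a (pseudo-)Riemannian submanifold of the flat space of self-adjoint matrices,
so this is the tangential part of the flat derivative. -/
def covDerivAt (f ξ : M → Mat n) (p : M) : TangentSpace (𝓡 (2 * n - 1)) p →ₗ[ℝ] Mat n :=
  tangentialProj (f p) ∘ₗ diffAt ξ p

/-- The shape operator `v ↦ S v = -∇̄_v ξ` at `p`; its values are vectors tangent to the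
hypersurface, written as elements `df(w)` of the tangent space of the space form. -/
def shapeOperator (f ξ : M → Mat n) (p : M) : TangentSpace (𝓡 (2 * n - 1)) p →ₗ[ℝ] Mat n :=
  -covDerivAt f ξ p

/-- The space `T_μ(p) = {X ∈ T_pM | S X = μ X}`, where `T_pM` is identified with its image under
the differential of `f`. -/
def principalSpace (f ξ : M → Mat n) (p : M) (μ : ℝ) : Submodule ℝ (Mat n) :=
  (LinearMap.ker (shapeOperator f ξ p - μ • diffAt f p)).map (diffAt f p)

/-- The principal curvatures at `p` with respect to `ξ`: the eigenvalues of the shape operator. -/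
def principalCurvatures (f ξ : M → Mat n) (p : M) : Set ℝ :=
  {μ | principalSpace f ξ p μ ≠ ⊥}

/-- The number of principal curvature spaces at `p` onto which the Hopf vector `J ξ_p` has nonzero
orthogonal projection, i.e. to which it is not orthogonal. -/
def hopfNumber (c : ℝ) (f ξ : M → Mat n) (p : M) : ℕ :=
  {μ : ℝ | ∃ X ∈ principalSpace f ξ p μ, ambientMetric c (ambientJ (f p) (ξ p)) X ≠ 0}.ncard

/-- The principal curvatures, with respect to a suitable unit normal field near any given point, are
locally constant. (No global unit normal field is assumed; on a connected hypersurface that has one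
this says that the eigenvalues of its shape operator are constant.) -/
def HasConstantPrincipalCurvatures (c : ℝ) (f : M → Mat n) : Prop :=
  ∀ p : M, ∃ W : Set M, IsOpen W ∧ p ∈ W ∧ ∃ ξ : M → Mat n, IsUnitNormalOn c f ξ W ∧
    ∃ Λ : Set ℝ, ∀ q ∈ W, principalCurvatures f ξ q = Λ

/-- At every point, the Hopf vector field has exactly `h` nontrivial projections onto the principal
curvature spaces; this does not depend on the choice of the local unit normal field. -/
def HasHopfNumber (c : ℝ) (f : M → Mat n) (h : ℕ) : Prop :=
  ∀ (W : Set M) (ξ : M → Mat n), IsOpen W → IsUnitNormalOn c f ξ W →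
    ∀ p ∈ W, hopfNumber c f ξ p = h

/-- `X` is a smooth unit section over `M` of the distribution `T_μ`. -/
structure IsUnitSection (c : ℝ) (f ξ : M → Mat n) (μ : ℝ) (X : M → Mat n) : Prop where
  smooth : SmoothOn X univ
  mem : ∀ p, X p ∈ principalSpace f ξ p μ
  unit : ∀ p, ambientMetric c (X p) (X p) = 1

end Hypersurface

end

/-! ### Pointwise algebra of the lifted shape operator -/

/-! Put κ = c/4 and pull the hypersurface back to the circle bundle over the space form, that is, to
a hypersurface F of the quadric ⟨z, z⟩ = 1/κ in ℂⁿ⁺¹. The quadric has constant curvature, so the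
Codazzi equation says that ∇S is symmetric. Let V be the vertical field iF and φ the tangential part
of i. Then ∇V = φ, ∇(SV) = φS, and SV is minus the lift of the Hopf vector. The condition h = 2
makes V, SV, S²V span an S-invariant space on which S has the characteristic polynomial χ = X³ -
e₁X² + e₂X - e₃ with e₁ = λ₁ + λ₂ and e₂ = λ₁λ₂ - κ. Only e₃, equivalently the weights b₁² and b₂²,
could vary.

Let a = φS²V, let g be the gradient of e₃, and ψ = (X - λ₁)(X - λ₂). Differentiating χ(S)V = 0 and
using Codazzi leads to 3κχ(S)a + ψ(S)g = 0 and 2κχ'(S)a + ψ'(S)g = 0 (`chi_rel'`, `chi_deriv_rel'`).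
Elimination of g relates e₃ to any eigenvalue μ for which a has a component, and determines e₃
unless μ = e₁/2; that exception dies on the bracket of SV and S²V (`fderiv_e₃`). With g = 0 each
such μ is a double root l of χ. If ν is the third root, then |a|² = -(κ + l²)(κ + lν)²/κ², which
must be positive: hence κ + l² < 0 and c < 0, which is part (a). The Gauss equation for a and (S -
l)²V then forces ν = l (`triple`). So λ₁ + λ₂ = 3l and λ₁λ₂ = 3l² + κ, and λ₃ = l; the formulas for
the λᵢ and bᵢ² and the frame U₁, U₂, A are linear algebra from here.

For a triple root, w = (S - l)²V is a null geodesic field. A Riccati-type argument, by induction on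
the distance of an eigenvalue from l, shows that ∇_w S vanishes on all other eigenvectors orthogonal
to the cyclic space (`covOp_w₂_eigen`). Feeding this into the derivative of a leaves only μ = -κ/l
as a further eigenvalue (`eigenvalue_eq`). Its eigenspace K orthogonal to the cyclic space is
totally real, and φ maps it into the l-eigenspace. Counting K, φK, V, U₁, U₂, A bounds dim K by n -
2, and a trace formula makes dim K locally constant. The coincidence -κ/l = λ₂ gives case (B).

Orientation: changing the sign of ξ changes the sign of l. If l ≠ 0, the requirement l > 0 singles
out one local normal, and these fit together. If l = 0, then w is recurrent up to phase: its complex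
line, a point at infinity of the hyperbolic space, is constant. The matrices ww* and ηw*, with η the
lifted normal, obey linear first order equations; a linear functional that kills the first and not
the second then never vanishes on the second, and its sign orients M
(`exists_global_normal_of_zero`). -/

section CoreAlgebra

variable {E : Type*} [NormedAddCommGroup E] [NormedSpace ℝ E]

/-- The relations, at one point of the lifted hypersurface, between the metric `G`, the shape
operator `S` (or a translate `S - λ`), the structure tensor `φ`, the covariant derivative
`P X = ∇_X S`, and the vertical vector `V`. -/
structure CoreAlg (G : E →L[ℝ] E →L[ℝ] ℝ) (S φ : E →L[ℝ] E) (P : E →L[ℝ] E →L[ℝ] E) (V : E) :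
    Prop where
  symm : ∀ x y, G x y = G y x
  nondeg : ∀ x, (∀ y, G x y = 0) → x = 0
  S_symm : ∀ x y, G (S x) y = G x (S y)
  φ_skew : ∀ x y, G (φ x) y = -G x (φ y)
  P_symm : ∀ x y, P x y = P y x
  P_adj : ∀ x y z, G (P x y) z = G y (P x z)
  P_V : ∀ x, P V x = φ (S x) - S (φ x)
  φ_V : φ V = 0
  φ_SV : φ (S V) = 0

/-- The cubic relation `S³V = e₁S²V - e₂SV + e₃V` and its covariant derivative, in which only
`e₃` varies, with gradient `g`. -/
structure CubicAlg (G : E →L[ℝ] E →L[ℝ] ℝ) (S φ : E →L[ℝ] E) (P : E →L[ℝ] E →L[ℝ] E) (V : E)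
    (e₁ e₂ e₃ : ℝ) (g : E) : Prop extends CoreAlg G S φ P V where
  cubic : S (S (S V)) = e₁ • S (S V) - e₂ • S V + e₃ • V
  deriv : ∀ x, P (S (S V)) x + S (P (S V) x) + S (S (φ (S x))) =
    e₁ • (P (S V) x + S (φ (S x))) - e₂ • φ (S x) + e₃ • φ x + G g x • V

namespace CubicAlg

variable {G : E →L[ℝ] E →L[ℝ] ℝ} {S φ : E →L[ℝ] E} {P : E →L[ℝ] E →L[ℝ] E} {V : E}
  {e₁ e₂ e₃ : ℝ} {g : E}

/-- Pairing `deriv` with a vector and moving every operator to the other argument gives the adjoint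
identity, which nondegeneracy of `G` turns back into an equation of vectors. Both identities will be
evaluated at V, SV and S²V. -/
theorem deriv_adjoint (h : CubicAlg G S φ P V e₁ e₂ e₃ g) (x : E) :
    P (S (S V)) x + P (S V) (S x) - S (φ (S (S x))) =
      e₁ • (P (S V) x - S (φ (S x))) + e₂ • S (φ x) - e₃ • φ x + G V x • g := by
  rw [← sub_eq_zero]
  refine h.nondeg _ fun y => ?_
  have := congrArg (G x) (h.deriv y)
  simp only [map_add, map_sub, map_smul, smul_eq_mul, _root_.add_apply,
    _root_.sub_apply, _root_.smul_apply, h.P_adj, h.S_symm, h.φ_skew]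
    at this ⊢
  have h1 := h.symm x (S (P (S V) y))
  simp only [← h.S_symm] at this ⊢
  simp only [← h.P_adj] at this ⊢
  rw [h.symm x V] at this
  linear_combination this

theorem S_V_three (h : CubicAlg G S φ P V e₁ e₂ e₃ g) : φ (S (S (S V))) = e₁ • φ (S (S V)) := by
  rw [h.cubic]; simp [h.φ_V, h.φ_SV]

theorem P_SV_V (h : CubicAlg G S φ P V e₁ e₂ e₃ g) : P (S V) V = φ (S (S V)) := by
  rw [h.P_symm, h.P_V, h.φ_SV]; simp

theorem P_SSV_V (h : CubicAlg G S φ P V e₁ e₂ e₃ g) :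
    P (S (S V)) V = e₁ • φ (S (S V)) - S (φ (S (S V))) := by
  rw [h.P_symm, h.P_V, h.S_V_three]

theorem grad_V (h : CubicAlg G S φ P V e₁ e₂ e₃ g) (hV : V ≠ 0) : G g V = 0 := by
  have := h.deriv V
  rw [h.P_SV_V, h.P_SSV_V, h.φ_V, h.φ_SV] at this
  have h2 : G g V • V = 0 := by
    simp only [map_zero, smul_zero] at this
    linear_combination (norm := module) (-1 : ℝ) • this
  exact (smul_eq_zero.1 h2).resolve_right hV

theorem P_SV_SV (h : CubicAlg G S φ P V e₁ e₂ e₃ g) :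
    P (S V) (S V) = (2 : ℝ) • S (φ (S (S V))) + G V V • g := by
  have := h.deriv_adjoint V
  rw [h.P_SV_V, h.P_SSV_V, h.φ_V, h.φ_SV] at this
  simp only [map_zero, smul_zero] at this
  linear_combination (norm := module) this

theorem two_P_SV_SSV (h : CubicAlg G S φ P V e₁ e₂ e₃ g) (hV1 : G V (S V) = 0) :
    (2 : ℝ) • P (S V) (S (S V)) = (2 * e₁) • S (φ (S (S V))) + (e₁ * G V V) • g := by
  have := h.deriv_adjoint (S V)
  rw [h.P_symm (S (S V)), h.P_SV_SV, h.φ_SV, h.S_V_three, hV1] at this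
  simp only [map_zero, smul_zero, map_smul] at this
  linear_combination (norm := module) this

/-- The derivative identity at SV, with the P-terms eliminated by the adjoint identity at V and SV.
For a = φS²V and the cubic χ, the terms in a are 2χ'(S)a; the gradient enters through 2S - e₁. -/
theorem chi_deriv_rel (h : CubicAlg G S φ P V e₁ e₂ e₃ g) (hV1 : G V (S V) = 0) :
    (6 : ℝ) • S (S (φ (S (S V)))) - (4 * e₁) • S (φ (S (S V))) + (2 * e₂) • φ (S (S V))
      + G V V • ((2 : ℝ) • S g - e₁ • g) - (2 * G g (S V)) • V = 0 := by
  have h1 := h.deriv (S V)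
  have h2 := h.two_P_SV_SSV hV1
  rw [h.P_symm (S (S V)), h.P_SV_SV, h.φ_SV] at h1
  simp only [smul_zero, map_smul, map_add] at h1
  linear_combination (norm := module) (2 : ℝ) • h1 - h2

/-- At S²V the derivative identity and its adjoint share the unknown term P(S²V)(S²V), so their
difference is free of it. The terms in a = φS²V add up to 3χ(S)a, and the right-hand side stays in
the span of V and SV. -/
theorem chi_rel (h : CubicAlg G S φ P V e₁ e₂ e₃ g) (hV1 : G V (S V) = 0) :
    (3 : ℝ) • (S (S (S (φ (S (S V))))) - e₁ • S (S (φ (S (S V))))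
      + e₂ • S (φ (S (S V))) - e₃ • φ (S (S V)))
      + G V V • (S (S g) - e₁ • S g + e₂ • g) + G V (S (S V)) • g
      = (G g (S (S V)) - e₁ * G g (S V)) • V + G g (S V) • S V := by
  have h1 := h.deriv (S (S V))
  have h2 := h.two_P_SV_SSV hV1
  have h3 := h.deriv_adjoint (S (S V))
  have h4 := congrArg S h2
  have h6 := h.chi_deriv_rel hV1
  have h7 := congrArg S h6
  have h5 : φ (S (S (S (S V)))) = (e₁ ^ 2 - e₂) • φ (S (S V)) := by
    rw [h.cubic]
    simp only [map_add, map_sub, map_smul, h.S_V_three, h.φ_SV, smul_zero]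
    module
  rw [h.S_V_three] at h1 h3
  rw [h5] at h3
  rw [h.cubic] at h3
  simp only [map_zero, map_smul, map_add, map_sub, h.P_SV_V, h.P_SV_SV] at h1 h3 h4 h7
  linear_combination (norm := module) h1 - h3 + (e₁ / 2) • h2 - (1 / 2 : ℝ) • h4
    + (1 / 2 : ℝ) • h7 - (e₁ / 2) • h6

end CubicAlg

end CoreAlgebra

/-! ### Elimination of the gradient of `e₃`, and the double root -/

section QuadricAlgebra

variable {E : Type*} [NormedAddCommGroup E] [NormedSpace ℝ E]

/-- The relations of `CubicAlg` for a hypersurface of the quadric `⟨z, z⟩ = 1 / κ`; `Λ` contains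
the eigenvalues of `S` on the orthogonal complement of the cyclic space generated by `V`. -/
structure QuadricAlg (κ : ℝ) (Λ : Set ℝ) (G : E →L[ℝ] E →L[ℝ] ℝ) (S φ : E →L[ℝ] E)
    (P : E →L[ℝ] E →L[ℝ] E) (V : E) (e₁ e₂ e₃ : ℝ) (g : E) : Prop
    extends CubicAlg G S φ P V e₁ e₂ e₃ g where
  κ_ne : κ ≠ 0
  V_V : G V V = κ⁻¹
  V_SV : G V (S V) = 0
  SV_SV : G (S V) (S V) = 1
  φ_φ : ∀ x, φ (φ x) = -x + G x (S V) • S V + (κ * G x V) • V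
  e₃_eq : e₃ = κ * (G (S V) (S (S V)) - e₁)
  disc : e₁ ^ 2 - 4 * (e₂ + κ) ≠ 0
  pos : ∀ x, G x V = 0 → x ≠ 0 → 0 < G x x
  a_ne : φ (S (S V)) ≠ 0
  complete : ∀ u, G u V = 0 → G u (S V) = 0 → G u (S (S V)) = 0 →
    (∀ μ ∈ Λ, ∀ Z, S Z = μ • Z → G Z V = 0 → G Z (S V) = 0 → G Z (S (S V)) = 0 → G u Z = 0) →
    u = 0

namespace QuadricAlg

variable {κ : ℝ} {Λ : Set ℝ} {G : E →L[ℝ] E →L[ℝ] ℝ} {S φ : E →L[ℝ] E}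
  {P : E →L[ℝ] E →L[ℝ] E} {V : E} {e₁ e₂ e₃ : ℝ} {g : E}

theorem V_SSV (h : QuadricAlg κ Λ G S φ P V e₁ e₂ e₃ g) : G V (S (S V)) = 1 := by
  rw [← h.S_symm, h.SV_SV]

theorem V_ne (h : QuadricAlg κ Λ G S φ P V e₁ e₂ e₃ g) : V ≠ 0 := by
  intro h0
  have := h.V_V
  rw [h0] at this
  simp only [map_zero] at this
  exact inv_ne_zero h.κ_ne this.symm

theorem a_V (h : QuadricAlg κ Λ G S φ P V e₁ e₂ e₃ g) : G (φ (S (S V))) V = 0 := by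
  rw [h.φ_skew, h.φ_V]; simp

theorem a_SV (h : QuadricAlg κ Λ G S φ P V e₁ e₂ e₃ g) : G (φ (S (S V))) (S V) = 0 := by
  rw [h.φ_skew, h.φ_SV]; simp

theorem a_SSV (h : QuadricAlg κ Λ G S φ P V e₁ e₂ e₃ g) : G (φ (S (S V))) (S (S V)) = 0 := by
  have := h.φ_skew (S (S V)) (S (S V))
  rw [h.symm (S (S V))] at this
  linarith

theorem a_SSSV (h : QuadricAlg κ Λ G S φ P V e₁ e₂ e₃ g) :
    G (φ (S (S V))) (S (S (S V))) = 0 := by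
  rw [h.cubic]
  simp [h.a_V, h.a_SV, h.a_SSV]

/-- Pairing `chi_deriv_rel` with SV and S²V removes all terms in a, which is orthogonal to the
cyclic space. The two linear equations that remain have only the zero solution because the
discriminant, which will be (λ₁ - λ₂)², is not zero. -/
theorem grad_SV_SSV (h : QuadricAlg κ Λ G S φ P V e₁ e₂ e₃ g) :
    G g (S V) = 0 ∧ G g (S (S V)) = 0 := by
  have h0 := h.grad_V h.V_ne
  have hr := h.chi_deriv_rel h.V_SV
  have h1 := congrArg (fun u => G u (S V)) hr
  have h2 := congrArg (fun u => G u (S (S V))) hr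
  simp only [map_add, map_sub, map_smul, _root_.add_apply, _root_.sub_apply, _root_.smul_apply, smul_eq_mul,
    map_zero, _root_.zero_apply, h.S_symm, h.cubic, h.a_V, h.a_SV, h.a_SSV, h.V_SV, h.V_SSV, h.V_V, h0]
    at h1 h2
  have hκ := h.κ_ne
  field_simp at h1 h2
  ring_nf at h1 h2
  have h3 : (e₁ ^ 2 - 4 * (e₂ + κ)) * G g (S V) = 0 := by
    linear_combination 2 * h2 - e₁ * h1
  have h4 := (mul_eq_zero.1 h3).resolve_left h.disc
  refine ⟨h4, ?_⟩
  rw [h4] at h1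
  linarith

theorem chi_rel' (h : QuadricAlg κ Λ G S φ P V e₁ e₂ e₃ g) :
    (3 * κ) • (S (S (S (φ (S (S V))))) - e₁ • S (S (φ (S (S V))))
      + e₂ • S (φ (S (S V))) - e₃ • φ (S (S V)))
      + (S (S g) - e₁ • S g + (e₂ + κ) • g) = 0 := by
  have hr := congrArg (κ • ·) (h.chi_rel h.V_SV)
  obtain ⟨h1, h2⟩ := h.grad_SV_SSV
  simp only [h1, h2, h.V_SSV, h.V_V, smul_add, smul_smul, ← mul_assoc,
    mul_inv_cancel₀ h.κ_ne] at hr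
  linear_combination (norm := module) hr

theorem chi_deriv_rel' (h : QuadricAlg κ Λ G S φ P V e₁ e₂ e₃ g) :
    (2 * κ) • ((3 : ℝ) • S (S (φ (S (S V)))) - (2 * e₁) • S (φ (S (S V))) + e₂ • φ (S (S V)))
      + ((2 : ℝ) • S g - e₁ • g) = 0 := by
  have hr := congrArg (κ • ·) (h.chi_deriv_rel h.V_SV)
  obtain ⟨h1, h2⟩ := h.grad_SV_SSV
  simp only [h1, h.V_V, smul_add, smul_sub, smul_smul, ← mul_assoc,
    mul_inv_cancel₀ h.κ_ne] at hr
  linear_combination (norm := module) hr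

theorem chi_pair (h : QuadricAlg κ Λ G S φ P V e₁ e₂ e₃ g) {μ : ℝ} {Z : E} (hZ : S Z = μ • Z) :
    3 * κ * (μ ^ 3 - e₁ * μ ^ 2 + e₂ * μ - e₃) * G (φ (S (S V))) Z
      + (μ ^ 2 - e₁ * μ + e₂ + κ) * G g Z = 0 := by
  have := congrArg (fun u => G u Z) h.chi_rel'
  simp only [map_add, map_sub, map_smul, _root_.add_apply, _root_.sub_apply, _root_.smul_apply, smul_eq_mul,
    map_zero, _root_.zero_apply, h.S_symm _ Z, hZ] at this
  linear_combination this

theorem chi_deriv_pair (h : QuadricAlg κ Λ G S φ P V e₁ e₂ e₃ g) {μ : ℝ} {Z : E}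
    (hZ : S Z = μ • Z) :
    2 * κ * (3 * μ ^ 2 - 2 * e₁ * μ + e₂) * G (φ (S (S V))) Z + (2 * μ - e₁) * G g Z = 0 := by
  have := congrArg (fun u => G u Z) h.chi_deriv_rel'
  simp only [map_add, map_sub, map_smul, _root_.add_apply, _root_.sub_apply, _root_.smul_apply, smul_eq_mul,
    map_zero, _root_.zero_apply, h.S_symm _ Z, hZ] at this
  linear_combination this

/-- Elimination of `G g Z` between the two relations: 3ψ'χ = 2ψχ' at μ. The equation is linear in
`e₃` with coefficient proportional to 2μ - e₁, so a constant μ other than e₁/2 determines `e₃`. -/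
theorem theta_pair (h : QuadricAlg κ Λ G S φ P V e₁ e₂ e₃ g) {μ : ℝ} {Z : E}
    (hZ : S Z = μ • Z) (ha : G (φ (S (S V))) Z ≠ 0) :
    3 * (2 * μ - e₁) * (μ ^ 3 - e₁ * μ ^ 2 + e₂ * μ - e₃) =
      2 * (μ ^ 2 - e₁ * μ + e₂ + κ) * (3 * μ ^ 2 - 2 * e₁ * μ + e₂) := by
  have h1 := h.chi_pair hZ
  have h2 := h.chi_deriv_pair hZ
  have h3 : κ * G (φ (S (S V))) Z ≠ 0 := mul_ne_zero h.κ_ne ha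
  apply mul_right_cancel₀ h3
  linear_combination (2 * μ - e₁) * h1 - (μ ^ 2 - e₁ * μ + e₂ + κ) * h2

/-- The vector S a - l a is still orthogonal to the cyclic space, and pairs with an eigenvector for
μ to (μ - l) times the pairing of a. By assumption this product is always zero, so `complete`
applies. -/
theorem eigen_of_pair (h : QuadricAlg κ Λ G S φ P V e₁ e₂ e₃ g) {l : ℝ}
    (hl : ∀ μ ∈ Λ, ∀ Z, S Z = μ • Z → G Z V = 0 → G (φ (S (S V))) Z ≠ 0 → μ = l) :
    S (φ (S (S V))) = l • φ (S (S V)) := by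
  rw [← sub_eq_zero]
  apply h.complete
  · simp [h.S_symm, h.a_V, h.a_SV]
  · simp [h.S_symm, h.a_SSV, h.a_SV]
  · simp [h.S_symm, h.a_SSV, h.a_SSSV]
  · intro μ hμ Z hZ hZV _ _
    simp only [map_sub, map_smul, _root_.sub_apply, _root_.smul_apply, h.S_symm, hZ, smul_eq_mul]
    by_cases h0 : G (φ (S (S V))) Z = 0
    · simp [h0]
    · rw [hl μ hμ Z hZ hZV h0]; ring

theorem exists_pair (h : QuadricAlg κ Λ G S φ P V e₁ e₂ e₃ g) :
    ∃ μ ∈ Λ, ∃ Z, S Z = μ • Z ∧ G Z V = 0 ∧ G Z (S V) = 0 ∧ G Z (S (S V)) = 0 ∧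
      G (φ (S (S V))) Z ≠ 0 := by
  by_contra! hc
  exact h.a_ne (h.complete _ h.a_V h.a_SV h.a_SSV
    fun μ hμ Z hZ h1 h2 h3 => hc μ hμ Z hZ h1 h2 h3)

/-- At μ = e₁/2 the derivative ψ' vanishes but ψ does not, so `theta_pair` gives χ'(μ) = 0, that is,
e₂ = e₁²/4. Then `chi_deriv_rel'` makes g an eigenvector for e₁/2 as well, and since χ(e₁/2) = -e₃
and ψ(e₁/2) = κ the factor can be read off from `chi_rel'`. -/
theorem grad_eq (h : QuadricAlg κ Λ G S φ P V e₁ e₂ e₃ g)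
    (ha : S (φ (S (S V))) = (e₁ / 2) • φ (S (S V))) : g = (3 * e₃) • φ (S (S V)) := by
  have hψ : e₂ + κ - e₁ ^ 2 / 4 = κ := by
    have h0 := h.theta_pair ha (h.pos _ h.a_V h.a_ne).ne'
    have h1 : (e₁ ^ 2 - 4 * (e₂ + κ)) * (e₂ - e₁ ^ 2 / 4) = 0 := by linear_combination 2 * h0
    have := (mul_eq_zero.1 h1).resolve_left h.disc
    linarith
  have h1 := h.chi_rel'
  have h2 := h.chi_deriv_rel'
  simp only [ha, map_smul] at h1 h2
  have h3 : S g = (e₁ / 2) • g := by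
    have : e₂ = e₁ ^ 2 / 4 := by linarith
    rw [this] at h2
    linear_combination (norm := module) (1 / 2 : ℝ) • h2
  simp only [h3, map_smul] at h1
  have h4 : κ • g = κ • ((3 * e₃) • φ (S (S V))) := by
    have : e₂ = e₁ ^ 2 / 4 := by linarith
    rw [this] at h1
    linear_combination (norm := module) h1
  exact smul_right_injective _ h.κ_ne h4

theorem a_a (h : QuadricAlg κ Λ G S φ P V e₁ e₂ e₃ g) :
    G (φ (S (S V))) (φ (S (S V))) =
      (e₁ - G (S V) (S (S V))) * G (S V) (S (S V)) - e₂ - κ := by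
  have h1 : G (S (S V)) (S (S V)) = e₁ * G (S V) (S (S V)) - e₂ := by
    rw [h.S_symm, h.cubic]
    simp only [map_add, map_sub, map_smul, smul_eq_mul, h.SV_SV, h.symm (S V) V, h.V_SV]
    ring
  rw [h.φ_skew, h.φ_φ]
  simp only [map_add, map_neg, map_smul, smul_eq_mul, h.symm (S (S V)) V, h.V_SSV, h1,
    h.symm (S (S V)) (S V)]
  ring

theorem chi_pair_zero (h : QuadricAlg κ Λ G S φ P V e₁ e₂ e₃ 0) {μ : ℝ} {Z : E}
    (hZ : S Z = μ • Z) (ha : G (φ (S (S V))) Z ≠ 0) :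
    μ ^ 3 - e₁ * μ ^ 2 + e₂ * μ - e₃ = 0 ∧ 3 * μ ^ 2 - 2 * e₁ * μ + e₂ = 0 := by
  have h1 := h.chi_pair hZ
  have h2 := h.chi_deriv_pair hZ
  simp only [map_zero, _root_.zero_apply, mul_zero, add_zero, mul_eq_zero, ha, or_false, h.κ_ne,
    OfNat.ofNat_ne_zero, false_or] at h1 h2
  exact ⟨h1, h2⟩

/-- If `e₃` is stationary, then the cubic has a double root `l`, and `φ S² V` is an eigenvector for
it. -/
theorem exists_double_root (h : QuadricAlg κ Λ G S φ P V e₁ e₂ e₃ 0) :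
    ∃ l ν, e₁ = 2 * l + ν ∧ e₂ = l ^ 2 + 2 * l * ν ∧ e₃ = l ^ 2 * ν ∧
      S (φ (S (S V))) = l • φ (S (S V)) := by
  obtain ⟨l, hl, Z, hZ, -, -, -, ha⟩ := h.exists_pair
  obtain ⟨h1, h2⟩ := h.chi_pair_zero hZ ha
  refine ⟨l, e₁ - 2 * l, by ring, by linarith, by linear_combination h2 * l - h1, ?_⟩
  apply h.eigen_of_pair
  intro μ hμ Y hY _ hYa
  obtain ⟨h3, h4⟩ := h.chi_pair_zero hY hYa
  -- This combination of χ and χ' at μ and at l is an identity for monic cubics: two double roots of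
  -- one cubic coincide.
  have h5 : (μ - l) ^ 3 = 0 := by
    linear_combination (-2) * h3 + (μ - l) * h4 + 2 * h1 + (μ - l) * h2
  have := pow_eq_zero_iff (three_ne_zero) |>.1 h5
  linarith

theorem a_a_of_double_root (h : QuadricAlg κ Λ G S φ P V e₁ e₂ e₃ g) {l ν : ℝ}
    (h1 : e₁ = 2 * l + ν) (h2 : e₂ = l ^ 2 + 2 * l * ν) (h3 : e₃ = l ^ 2 * ν) :
    G (φ (S (S V))) (φ (S (S V))) = -((κ + l ^ 2) * (κ + l * ν) ^ 2 / κ ^ 2) := by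
  have hκ := h.κ_ne
  have h4 : G (S V) (S (S V)) = e₁ + e₃ / κ := by
    rw [h.e₃_eq]; field_simp; ring
  rw [h.a_a, h4, h3, h2, h1]
  field_simp
  ring

/-- The vector φS²V is horizontal and nonzero, hence of positive square, while `a_a_of_double_root`
writes this square as -(κ + l²) times a square. This is the step that excludes c > 0. -/
theorem neg_of_double_root (h : QuadricAlg κ Λ G S φ P V e₁ e₂ e₃ g) {l ν : ℝ}
    (h1 : e₁ = 2 * l + ν) (h2 : e₂ = l ^ 2 + 2 * l * ν) (h3 : e₃ = l ^ 2 * ν) :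
    κ + l ^ 2 < 0 ∧ κ + l * ν ≠ 0 := by
  have h4 := h.pos _ h.a_V h.a_ne
  rw [h.a_a_of_double_root h1 h2 h3] at h4
  constructor
  · by_contra! h5
    have : 0 ≤ (κ + l ^ 2) * (κ + l * ν) ^ 2 / κ ^ 2 := by positivity
    linarith
  · intro h5
    rw [h5] at h4
    simp at h4

end QuadricAlg

end QuadricAlgebra

/-! ### Covariant calculus on the lifted hypersurface in a chart -/

noncomputable section Model

variable {E : Type*} [NormedAddCommGroup E] [NormedSpace ℝ E]

/-- The covariant derivative, with Christoffel symbols `Γ`, of a vector field. -/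
def cov (Γ : E → E →L[ℝ] E →L[ℝ] E) (u : E → E) (x X : E) : E :=
  fderiv ℝ u x X + Γ x X (u x)

/-- The covariant derivative of a field of endomorphisms. -/
def covOp (Γ : E → E →L[ℝ] E →L[ℝ] E) (A : E → E →L[ℝ] E) (x : E) : E →L[ℝ] E →L[ℝ] E :=
  fderiv ℝ A x + ((ContinuousLinearMap.compL ℝ E E E).flip (A x)).comp (Γ x)
    - ((ContinuousLinearMap.compL ℝ E E E) (A x)).comp (Γ x)

theorem covOp_apply (Γ : E → E →L[ℝ] E →L[ℝ] E) (A : E → E →L[ℝ] E) (x X Y : E) :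
    covOp Γ A x X Y = fderiv ℝ A x X Y + Γ x X (A x Y) - A x (Γ x X Y) := by
  simp [covOp]

/-- The fields induced on a chart domain `Ω` of a hypersurface of the quadric `⟨z, z⟩ = 1 / κ` in
a complex vector space, that is invariant under the unit complex scalars: the metric `G`, the
Christoffel symbols `Γ`, the shape operator `S`, the structure tensor `φ` and the vertical
field `V`. -/
structure IsModel (κ : ℝ) (Ω : Set E) (G : E → E →L[ℝ] E →L[ℝ] ℝ) (Γ : E → E →L[ℝ] E →L[ℝ] E)
    (S φ : E → E →L[ℝ] E) (V : E) : Prop where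
  isOpen : IsOpen Ω
  G_smooth : ContDiffOn ℝ ∞ G Ω
  Γ_smooth : ContDiffOn ℝ ∞ Γ Ω
  S_smooth : ContDiffOn ℝ ∞ S Ω
  φ_smooth : ContDiffOn ℝ ∞ φ Ω
  κ_ne : κ ≠ 0
  symm : ∀ x ∈ Ω, ∀ u v, G x u v = G x v u
  nondeg : ∀ x ∈ Ω, ∀ u, (∀ v, G x u v = 0) → u = 0
  compat : ∀ x ∈ Ω, ∀ X u v, fderiv ℝ G x X u v = G x (Γ x X u) v + G x u (Γ x X v)
  Γ_symm : ∀ x ∈ Ω, ∀ u v, Γ x u v = Γ x v u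
  S_symm : ∀ x ∈ Ω, ∀ u v, G x (S x u) v = G x u (S x v)
  φ_skew : ∀ x ∈ Ω, ∀ u v, G x (φ x u) v = -G x u (φ x v)
  codazzi : ∀ x ∈ Ω, ∀ X Y, covOp Γ S x X Y = covOp Γ S x Y X
  cov_V : ∀ x ∈ Ω, ∀ X, Γ x X V = φ x X
  cov_SV : ∀ x ∈ Ω, ∀ X, cov Γ (fun y => S y V) x X = φ x (S x X)
  cov_φ : ∀ x ∈ Ω, ∀ X Y, covOp Γ φ x X Y =
    -(G x (S x X) Y • S x V) - (κ * G x X Y) • V + G x Y (S x V) • S x X + (κ * G x Y V) • X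
  φ_V : ∀ x ∈ Ω, φ x V = 0
  φ_SV : ∀ x ∈ Ω, φ x (S x V) = 0
  φ_φ : ∀ x ∈ Ω, ∀ u, φ x (φ x u) = -u + G x u (S x V) • S x V + (κ * G x u V) • V
  V_V : ∀ x ∈ Ω, G x V V = κ⁻¹
  V_SV : ∀ x ∈ Ω, G x V (S x V) = 0
  SV_SV : ∀ x ∈ Ω, G x (S x V) (S x V) = 1
  gauss : ∀ x ∈ Ω, ∀ X Y Z, fderiv ℝ Γ x X Y Z + Γ x X (Γ x Y Z)
      - (fderiv ℝ Γ x Y X Z + Γ x Y (Γ x X Z)) =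
    κ • (G x Y Z • X - G x X Z • Y) + G x (S x Y) Z • S x X - G x (S x X) Z • S x Y

theorem cov_op_apply {Γ : E → E →L[ℝ] E →L[ℝ] E} {A : E → E →L[ℝ] E} {u : E → E} {x : E}
    (hA : DifferentiableAt ℝ A x) (hu : DifferentiableAt ℝ u x) (X : E) :
    cov Γ (fun y => A y (u y)) x X = covOp Γ A x X (u x) + A x (cov Γ u x X) := by
  rw [covOp_apply, cov, cov, fderiv_clm_apply hA hu]
  simp
  abel

theorem cov_smul {Γ : E → E →L[ℝ] E →L[ℝ] E} {f : E → ℝ} {u : E → E} {x : E}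
    (hf : DifferentiableAt ℝ f x) (hu : DifferentiableAt ℝ u x) (X : E) :
    cov Γ (fun y => f y • u y) x X = fderiv ℝ f x X • u x + f x • cov Γ u x X := by
  rw [cov, cov, fderiv_fun_smul hf hu]
  simp
  module

theorem cov_const_smul {Γ : E → E →L[ℝ] E →L[ℝ] E} (r : ℝ) {u : E → E} {x : E}
    (hu : DifferentiableAt ℝ u x) (X : E) :
    cov Γ (fun y => r • u y) x X = r • cov Γ u x X := by
  rw [cov, cov, fderiv_fun_const_smul hu]
  simp

theorem cov_add {Γ : E → E →L[ℝ] E →L[ℝ] E} {u v : E → E} {x : E}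
    (hu : DifferentiableAt ℝ u x) (hv : DifferentiableAt ℝ v x) (X : E) :
    cov Γ (fun y => u y + v y) x X = cov Γ u x X + cov Γ v x X := by
  rw [cov, cov, cov, fderiv_fun_add hu hv]
  simp
  abel

theorem cov_sub {Γ : E → E →L[ℝ] E →L[ℝ] E} {u v : E → E} {x : E}
    (hu : DifferentiableAt ℝ u x) (hv : DifferentiableAt ℝ v x) (X : E) :
    cov Γ (fun y => u y - v y) x X = cov Γ u x X - cov Γ v x X := by
  rw [cov, cov, cov, fderiv_fun_sub hu hv]
  simp
  abel

theorem cov_congr {Γ : E → E →L[ℝ] E →L[ℝ] E} {u v : E → E} {x : E}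
    (h : u =ᶠ[nhds x] v) (X : E) : cov Γ u x X = cov Γ v x X := by
  rw [cov, cov, h.fderiv_eq, h.self_of_nhds]

theorem two_le_infty : (2 : WithTop ℕ∞) ≤ ∞ := by
  exact WithTop.coe_le_coe.2 (le_top : (2 : ℕ∞) ≤ ⊤)

/-- Differentiate df(u) = 0 along v and df(v) = 0 along u. The second derivative is symmetric and
cancels in the difference, which leaves df on the bracket of u and v. -/
theorem fderiv_apply_of_stationary {f : E → ℝ} {u v : E → E} {x : E}
    (hf : ContDiffAt ℝ 2 f x) (hu : DifferentiableAt ℝ u x) (hv : DifferentiableAt ℝ v x)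
    (h₁ : ∀ᶠ y in nhds x, fderiv ℝ f y (u y) = 0) (h₂ : ∀ᶠ y in nhds x, fderiv ℝ f y (v y) = 0) :
    fderiv ℝ f x (fderiv ℝ v x (u x) - fderiv ℝ u x (v x)) = 0 := by
  have hd : DifferentiableAt ℝ (fderiv ℝ f) x :=
    (hf.fderiv_right (m := 1) (by norm_num)).differentiableAt (by norm_num)
  have e1 : fderiv ℝ (fun y => fderiv ℝ f y (u y)) x (v x) = 0 := by
    rw [Filter.EventuallyEq.fderiv_eq (f := fun _ => (0 : ℝ)) h₁]; simp
  have e2 : fderiv ℝ (fun y => fderiv ℝ f y (v y)) x (u x) = 0 := by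
    rw [Filter.EventuallyEq.fderiv_eq (f := fun _ => (0 : ℝ)) h₂]; simp
  rw [fderiv_clm_apply hd hu] at e1
  rw [fderiv_clm_apply hd hv] at e2
  have hs : IsSymmSndFDerivAt ℝ f x := hf.isSymmSndFDerivAt (by simp)
  have := hs (u x) (v x)
  simp at e1 e2
  rw [map_sub]
  linarith

namespace IsModel

variable {κ : ℝ} {Ω : Set E} {G : E → E →L[ℝ] E →L[ℝ] ℝ} {Γ : E → E →L[ℝ] E →L[ℝ] E}
    {S φ : E → E →L[ℝ] E} {V : E}

theorem contDiffAt {F : Type*} [NormedAddCommGroup F] [NormedSpace ℝ F] {f : E → F} {x : E}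
    (h : IsModel κ Ω G Γ S φ V) (hx : x ∈ Ω) (hf : ContDiffOn ℝ ∞ f Ω) : ContDiffAt ℝ ∞ f x :=
  hf.contDiffAt (h.isOpen.mem_nhds hx)

theorem diffAt {F : Type*} [NormedAddCommGroup F] [NormedSpace ℝ F] {f : E → F} {x : E}
    (h : IsModel κ Ω G Γ S φ V) (hx : x ∈ Ω) (hf : ContDiffOn ℝ ∞ f Ω) :
    DifferentiableAt ℝ f x :=
  (h.contDiffAt hx hf).differentiableAt (by simp)

theorem cov_smooth {u X : E → E} (h : IsModel κ Ω G Γ S φ V)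
    (hu : ContDiffOn ℝ ∞ u Ω) (hX : ContDiffOn ℝ ∞ X Ω) :
    ContDiffOn ℝ ∞ (fun y => cov Γ u y (X y)) Ω :=
  ((hu.fderiv_of_isOpen h.isOpen (by simp)).clm_apply hX).add
    ((h.Γ_smooth.clm_apply hX).clm_apply hu)

theorem cov_S_apply {u : E → E} {x : E} (h : IsModel κ Ω G Γ S φ V) (hx : x ∈ Ω)
    (hu : ContDiffOn ℝ ∞ u Ω) (X : E) :
    cov Γ (fun y => S y (u y)) x X = covOp Γ S x X (u x) + S x (cov Γ u x X) :=
  cov_op_apply (h.diffAt hx h.S_smooth) (h.diffAt hx hu) X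

theorem cov_φ_apply {u : E → E} {x : E} (h : IsModel κ Ω G Γ S φ V) (hx : x ∈ Ω)
    (hu : ContDiffOn ℝ ∞ u Ω) (X : E) :
    cov Γ (fun y => φ y (u y)) x X = covOp Γ φ x X (u x) + φ x (cov Γ u x X) :=
  cov_op_apply (h.diffAt hx h.φ_smooth) (h.diffAt hx hu) X

theorem fderiv_G {u v : E → E} {x : E} (h : IsModel κ Ω G Γ S φ V) (hx : x ∈ Ω)
    (hu : ContDiffOn ℝ ∞ u Ω) (hv : ContDiffOn ℝ ∞ v Ω) (X : E) :
    fderiv ℝ (fun y => G y (u y) (v y)) x X =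
      G x (cov Γ u x X) (v x) + G x (u x) (cov Γ v x X) := by
  have hG := h.diffAt hx h.G_smooth
  have hu' := h.diffAt hx hu
  rw [fderiv_clm_apply (hG.clm_apply hu') (h.diffAt hx hv), fderiv_clm_apply hG hu']
  simp only [ContinuousLinearMap.comp_apply, _root_.add_apply, ContinuousLinearMap.flip_apply, cov,
    h.compat x hx, map_add]
  ring

/-- The Gauss equation for vector fields. -/
theorem curvature {u X Y : E → E} {x : E} (h : IsModel κ Ω G Γ S φ V) (hx : x ∈ Ω)
    (hu : ContDiffOn ℝ ∞ u Ω) (hX : ContDiffOn ℝ ∞ X Ω) (hY : ContDiffOn ℝ ∞ Y Ω) :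
    cov Γ (fun y => cov Γ u y (Y y)) x (X x) - cov Γ (fun y => cov Γ u y (X y)) x (Y x)
      - cov Γ u x (cov Γ Y x (X x) - cov Γ X x (Y x)) =
    κ • (G x (Y x) (u x) • X x - G x (X x) (u x) • Y x) + G x (S x (Y x)) (u x) • S x (X x)
      - G x (S x (X x)) (u x) • S x (Y x) := by
  rw [← h.gauss x hx]
  have hu' := h.diffAt hx hu
  have hX' := h.diffAt hx hX
  have hY' := h.diffAt hx hY
  have hΓ := h.diffAt hx h.Γ_smooth
  have hdu := h.diffAt hx (hu.fderiv_of_isOpen h.isOpen (m := ∞) (by simp))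
  have hs : IsSymmSndFDerivAt ℝ u x :=
    ((h.contDiffAt hx hu).of_le (m := 2) two_le_infty).isSymmSndFDerivAt (by simp)
  have key : ∀ Z : E → E, DifferentiableAt ℝ Z x → ∀ w,
      cov Γ (fun y => cov Γ u y (Z y)) x w = fderiv ℝ (fderiv ℝ u) x w (Z x)
        + fderiv ℝ u x (fderiv ℝ Z x w) + (fderiv ℝ Γ x w (Z x) (u x)
        + Γ x (fderiv ℝ Z x w) (u x) + Γ x (Z x) (fderiv ℝ u x w))
        + Γ x w (fderiv ℝ u x (Z x) + Γ x (Z x) (u x)) := by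
    intro Z hZ w
    rw [cov]
    have : (fun y => cov Γ u y (Z y)) = fun y => fderiv ℝ u y (Z y) + Γ y (Z y) (u y) := rfl
    rw [this, fderiv_fun_add (hdu.clm_apply hZ) ((hΓ.clm_apply hZ).clm_apply hu'),
      fderiv_clm_apply hdu hZ, fderiv_clm_apply (hΓ.clm_apply hZ) hu', fderiv_clm_apply hΓ hZ]
    simp [cov]
    abel
  rw [key Y hY', key X hX', hs (Y x) (X x)]
  simp only [cov, map_add, map_sub, h.Γ_symm x hx (Y x) (X x), _root_.add_apply,
    _root_.sub_apply]
  abel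

theorem cov_Vfield {x : E} (h : IsModel κ Ω G Γ S φ V) (hx : x ∈ Ω) (X : E) :
    cov Γ (fun _ => V) x X = φ x X := by
  simp [cov, h.cov_V x hx]

/-- Codazzi moves V into the second slot, where ∇(SV) = φS and ∇V = φ are known. -/
theorem covOp_S_V {x : E} (h : IsModel κ Ω G Γ S φ V) (hx : x ∈ Ω) (X : E) :
    covOp Γ S x V X = φ x (S x X) - S x (φ x X) := by
  rw [h.codazzi x hx, ← h.cov_SV x hx, h.cov_S_apply hx contDiffOn_const, h.cov_Vfield hx]
  simp

/-- Differentiate G(Su, v) = G(Sv, u) for constant vectors u, v; the Christoffel terms cancel by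
symmetry of S. -/
theorem covOp_S_adj {x : E} (h : IsModel κ Ω G Γ S φ V) (hx : x ∈ Ω) (X u v : E) :
    G x (covOp Γ S x X u) v = G x u (covOp Γ S x X v) := by
  have e : ∀ u v : E, fderiv ℝ (fun y => G y (S y u) v) x X =
      G x (covOp Γ S x X u) v + G x (S x (Γ x X u)) v + G x (S x u) (Γ x X v) := by
    intro u v
    rw [h.fderiv_G hx (h.S_smooth.clm_apply contDiffOn_const) contDiffOn_const,
      h.cov_S_apply hx contDiffOn_const]
    simp [cov]
  have e1 := e u v
  have e2 := e v u
  have : (fun y => G y (S y u) v) =ᶠ[nhds x] fun y => G y (S y v) u := by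
    filter_upwards [h.isOpen.mem_nhds hx] with y hy
    rw [h.S_symm y hy, h.symm y hy]
  rw [this.fderiv_eq, e2] at e1
  have a1 : ∀ u v : E, G x (S x (Γ x X u)) v = G x (S x v) (Γ x X u) := fun u v => by
    rw [h.S_symm x hx, h.symm x hx]
  rw [a1 u v, a1 v u] at e1
  rw [h.symm x hx u]
  linarith

theorem coreAlg {x : E} (h : IsModel κ Ω G Γ S φ V) (hx : x ∈ Ω) :
    CoreAlg (G x) (S x) (φ x) (covOp Γ S x) V where
  symm := h.symm x hx
  nondeg := h.nondeg x hx
  S_symm := h.S_symm x hx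
  φ_skew := h.φ_skew x hx
  P_symm := h.codazzi x hx
  P_adj := h.covOp_S_adj hx
  P_V := h.covOp_S_V hx
  φ_V := h.φ_V x hx
  φ_SV := h.φ_SV x hx

end IsModel

end Model

/-! ### Eigenvector fields on the complement of the cyclic space, and constancy of `e₃` -/

section ModelTwo

open Polynomial

variable {E : Type*} [NormedAddCommGroup E] [NormedSpace ℝ E]

/-- A `IsModel` hypersurface for which `V` generates a three-dimensional cyclic space of the shape
operator, with all but one of the coefficients of its characteristic polynomial constant, such that
the shape operator is diagonalizable with constant eigenvalues on the orthogonal complement. -/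
structure IsModelTwo (κ e₁ e₂ : ℝ) (Λ : Finset ℝ) (Ω : Set E) (G : E → E →L[ℝ] E →L[ℝ] ℝ)
    (Γ : E → E →L[ℝ] E →L[ℝ] E) (S φ : E → E →L[ℝ] E) (V : E) : Prop
    extends IsModel κ Ω G Γ S φ V where
  cubic : ∀ x ∈ Ω, S x (S x (S x V)) = e₁ • S x (S x V) - e₂ • S x V
    + (κ * (G x (S x V) (S x (S x V)) - e₁)) • V
  disc : e₁ ^ 2 - 4 * (e₂ + κ) ≠ 0
  pos : ∀ x ∈ Ω, ∀ u, G x u V = 0 → u ≠ 0 → 0 < G x u u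
  a_ne : ∀ x ∈ Ω, φ x (S x (S x V)) ≠ 0
  spectral : ∀ x ∈ Ω, ∀ u, G x u V = 0 → G x u (S x V) = 0 → G x u (S x (S x V)) = 0 →
    aeval (S x) (∏ μ ∈ Λ, (X - C μ)) u = 0

theorem aeval_apply_of_eigen {S : E →L[ℝ] E} {u : E} {μ : ℝ} (h : S u = μ • u) (p : ℝ[X]) :
    aeval S p u = p.eval μ • u := by
  induction p using Polynomial.induction_on' with
  | add p q hp hq => simp [hp, hq, add_smul]
  | monomial n r =>
    have : ∀ n : ℕ, (S ^ n) u = μ ^ n • u := by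
      intro n
      induction n with
      | zero => simp
      | succ k ih => rw [pow_succ, mul_apply_eq_comp, h, map_smul, ih, smul_smul,
          pow_succ, mul_comm]
    simp [aeval_monomial, Algebra.algebraMap_eq_smul_one, this, smul_smul]

theorem aeval_mem_of_invariant {S : E →L[ℝ] E} {p : Submodule ℝ E} (h : ∀ u ∈ p, S u ∈ p)
    (q : ℝ[X]) {u : E} (hu : u ∈ p) : aeval S q u ∈ p := by
  induction q using Polynomial.induction_on' with
  | add q r hq hr => simpa using p.add_mem hq hr
  | monomial n r =>
    have : ∀ n : ℕ, (S ^ n) u ∈ p := by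
      intro n
      induction n with
      | zero => simpa
      | succ k ih => rw [pow_succ', mul_apply_eq_comp]; exact h _ ih
    simpa [aeval_monomial, Algebra.algebraMap_eq_smul_one] using p.smul_mem r (this n)

theorem ContDiffOn.aeval {F : Type*} [NormedAddCommGroup F] [NormedSpace ℝ F]
    {S : F → E →L[ℝ] E} {Ω : Set F} (h : ContDiffOn ℝ ∞ S Ω) (q : ℝ[X]) :
    ContDiffOn ℝ ∞ (fun x => aeval (S x) q) Ω := by
  induction q using Polynomial.induction_on' with
  | add q r hq hr => simpa using hq.add hr
  | monomial n r =>
    have hp : ContDiffOn ℝ ∞ (fun x => S x ^ n) Ω := by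
      induction n with
      | zero => simpa using contDiffOn_const
      | succ k ih => simp only [pow_succ]; exact ih.mul h
    simpa [aeval_monomial, Algebra.algebraMap_eq_smul_one] using hp.const_smul r

/-- When ∏(X - ν) annihilates S on an invariant space, this identity makes the Lagrange polynomials
of S the spectral projections there. They depend smoothly on S, which is how smooth fields of
eigenvectors are produced. -/
theorem sub_mul_lagrange_basis (Λ : Finset ℝ) {μ : ℝ} (hμ : μ ∈ Λ) :
    ∃ r : ℝ, (X - C μ) * Lagrange.basis Λ id μ = C r * ∏ ν ∈ Λ, (X - C ν) := by
  refine ⟨∏ ν ∈ Λ.erase μ, (μ - ν)⁻¹, ?_⟩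
  rw [← Finset.mul_prod_erase Λ _ hμ]
  simp only [Lagrange.basis, Lagrange.basisDivisor, id, Finset.prod_mul_distrib, map_prod]
  ring

/-- The orthogonal complement of the cyclic space generated by `V`. -/
def cyclicOrth (G : E →L[ℝ] E →L[ℝ] ℝ) (S : E →L[ℝ] E) (V : E) : Submodule ℝ E where
  carrier := {u | G u V = 0 ∧ G u (S V) = 0 ∧ G u (S (S V)) = 0}
  zero_mem' := by simp
  add_mem' := by
    rintro u v ⟨h1, h2, h3⟩ ⟨h4, h5, h6⟩
    simp [h1, h2, h3, h4, h5, h6]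
  smul_mem' := by
    rintro r u ⟨h1, h2, h3⟩
    simp [h1, h2, h3]

namespace IsModelTwo

variable {κ e₁ e₂ : ℝ} {Λ : Finset ℝ} {Ω : Set E} {G : E → E →L[ℝ] E →L[ℝ] ℝ}
    {Γ : E → E →L[ℝ] E →L[ℝ] E} {S φ : E → E →L[ℝ] E} {V : E}

theorem S_mem_cyclicOrth (h : IsModelTwo κ e₁ e₂ Λ Ω G Γ S φ V) {x : E} (hx : x ∈ Ω) (u : E)
    (hu : u ∈ cyclicOrth (G x) (S x) V) : S x u ∈ cyclicOrth (G x) (S x) V := by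
  obtain ⟨h1, h2, h3⟩ := hu
  refine ⟨?_, ?_, ?_⟩ <;> rw [h.S_symm x hx]
  · exact h2
  · exact h3
  · rw [h.cubic x hx]; simp [h1, h2, h3]

theorem mem_cyclicOrth_of_eigen (h : IsModelTwo κ e₁ e₂ Λ Ω G Γ S φ V) {x : E} (hx : x ∈ Ω)
    {u : E} {μ : ℝ} (hu : S x u = μ • u) (hV : G x u V = 0) :
    u ∈ cyclicOrth (G x) (S x) V := by
  have h1 : G x u (S x V) = 0 := by rw [← h.S_symm x hx, hu]; simp [hV]
  refine ⟨hV, h1, ?_⟩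
  rw [← h.S_symm x hx, hu]; simp [h1]

theorem S_lagrange (h : IsModelTwo κ e₁ e₂ Λ Ω G Γ S φ V) {x : E} (hx : x ∈ Ω) {μ : ℝ}
    (hμ : μ ∈ Λ) {u : E} (hu : u ∈ cyclicOrth (G x) (S x) V) :
    S x (aeval (S x) (Lagrange.basis Λ id μ) u) = μ • aeval (S x) (Lagrange.basis Λ id μ) u := by
  obtain ⟨r, hr⟩ := sub_mul_lagrange_basis Λ hμ
  have h1 := congrArg (fun p => aeval (S x) p u) hr
  simp only [map_mul, mul_apply_eq_comp, h.spectral x hx u hu.1 hu.2.1 hu.2.2,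
    map_zero, map_sub, aeval_X, aeval_C, _root_.sub_apply, Algebra.algebraMap_eq_smul_one,
    _root_.smul_apply, one_apply_eq_self] at h1
  exact sub_eq_zero.1 h1

/-- The Lagrange polynomials sum to 1, so u is a sum of eigenvectors, each of which pairs to zero
with u. Hence G(u, u) = 0, and `pos` gives u = 0. -/
theorem complete (h : IsModelTwo κ e₁ e₂ Λ Ω G Γ S φ V) {x : E} (hx : x ∈ Ω) {u : E}
    (hu : u ∈ cyclicOrth (G x) (S x) V)
    (hZ : ∀ μ ∈ Λ, ∀ Z, S x Z = μ • Z → Z ∈ cyclicOrth (G x) (S x) V → G x u Z = 0) : u = 0 := by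
  rcases Λ.eq_empty_or_nonempty with h0 | h0
  · have := h.spectral x hx u hu.1 hu.2.1 hu.2.2
    rw [h0] at this
    simpa using this
  · by_contra hne
    have h1 := h.pos x hx u hu.1 hne
    have h2 := congrArg (fun p => aeval (S x) p u)
      (Lagrange.sum_basis (s := Λ) (v := id) (injOn_id _) h0)
    simp only [map_sum, map_one, one_apply_eq_self, _root_.sum_apply] at h2
    have h3 : G x u u = 0 := by
      nth_rewrite 2 [← h2]
      rw [map_sum]
      refine Finset.sum_eq_zero fun μ hμ => hZ μ hμ _ (h.S_lagrange hx hμ hu) ?_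
      exact aeval_mem_of_invariant (h.S_mem_cyclicOrth hx) _ hu
    exact h1.ne' h3

/-- The function `e₃`. -/
noncomputable def e₃ (κ e₁ : ℝ) (G : E → E →L[ℝ] E →L[ℝ] ℝ) (S : E → E →L[ℝ] E) (V : E)
    (x : E) : ℝ :=
  κ * (G x (S x V) (S x (S x V)) - e₁)

theorem SV_smooth (h : IsModelTwo κ e₁ e₂ Λ Ω G Γ S φ V) :
    ContDiffOn ℝ ∞ (fun x => S x V) Ω := h.S_smooth.clm_apply contDiffOn_const

theorem SSV_smooth (h : IsModelTwo κ e₁ e₂ Λ Ω G Γ S φ V) :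
    ContDiffOn ℝ ∞ (fun x => S x (S x V)) Ω := h.S_smooth.clm_apply h.SV_smooth

theorem a_smooth (h : IsModelTwo κ e₁ e₂ Λ Ω G Γ S φ V) :
    ContDiffOn ℝ ∞ (fun x => φ x (S x (S x V))) Ω := h.φ_smooth.clm_apply h.SSV_smooth

theorem G_apply_smooth (h : IsModelTwo κ e₁ e₂ Λ Ω G Γ S φ V) {u v : E → E}
    (hu : ContDiffOn ℝ ∞ u Ω) (hv : ContDiffOn ℝ ∞ v Ω) :
    ContDiffOn ℝ ∞ (fun x => G x (u x) (v x)) Ω := (h.G_smooth.clm_apply hu).clm_apply hv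

theorem e₃_smooth (h : IsModelTwo κ e₁ e₂ Λ Ω G Γ S φ V) :
    ContDiffOn ℝ ∞ (e₃ κ e₁ G S V) Ω :=
  contDiffOn_const.mul ((h.G_apply_smooth h.SV_smooth h.SSV_smooth).sub contDiffOn_const)

theorem cov_SSV (h : IsModelTwo κ e₁ e₂ Λ Ω G Γ S φ V) {x : E} (hx : x ∈ Ω) (X : E) :
    cov Γ (fun y => S y (S y V)) x X = covOp Γ S x (S x V) X + S x (φ x (S x X)) := by
  rw [h.cov_S_apply hx h.SV_smooth, h.cov_SV x hx, h.codazzi x hx]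

theorem exists_gradient [FiniteDimensional ℝ E] (h : IsModelTwo κ e₁ e₂ Λ Ω G Γ S φ V) {x : E}
    (hx : x ∈ Ω) (l : E →L[ℝ] ℝ) : ∃ g, ∀ X, l X = G x g X := by
  let T : E →ₗ[ℝ] Module.Dual ℝ E :=
    { toFun := fun u => (G x u).toLinearMap
      map_add' := fun u v => by ext; simp
      map_smul' := fun r u => by ext; simp }
  have hT : Function.Injective T := by
    rw [injective_iff_map_eq_zero]
    intro u hu
    exact h.nondeg x hx u fun v => LinearMap.congr_fun hu v
  have hT' : Function.Surjective T :=
    (LinearMap.injective_iff_surjective_of_finrank_eq_finrank Subspace.dual_finrank_eq.symm).1 hT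
  obtain ⟨g, hg⟩ := hT' l.toLinearMap
  exact ⟨g, fun X => (LinearMap.congr_fun hg X).symm⟩

theorem quadricAlg (h : IsModelTwo κ e₁ e₂ Λ Ω G Γ S φ V) {x : E}
    (hx : x ∈ Ω) {g : E} (hg : ∀ X, fderiv ℝ (e₃ κ e₁ G S V) x X = G x g X) :
    QuadricAlg κ Λ (G x) (S x) (φ x) (covOp Γ S x) V e₁ e₂ (e₃ κ e₁ G S V x) g where
  toCoreAlg := h.coreAlg hx
  cubic := h.cubic x hx
  deriv := by
    intro X
    have h1 : (fun y => S y (S y (S y V))) =ᶠ[nhds x]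
        fun y => e₁ • S y (S y V) - e₂ • S y V + e₃ κ e₁ G S V y • V := by
      filter_upwards [h.isOpen.mem_nhds hx] with y hy using h.cubic y hy
    have d1 := h.diffAt hx h.SSV_smooth
    have d2 := h.diffAt hx h.SV_smooth
    have d3 := h.diffAt hx h.e₃_smooth
    have dV : DifferentiableAt ℝ (fun _ : E => V) x := differentiableAt_const V
    have h2 := cov_congr (Γ := Γ) h1 X
    rw [h.cov_S_apply hx h.SSV_smooth, h.cov_SSV hx,
      cov_add ((d1.fun_const_smul e₁).fun_sub (d2.fun_const_smul e₂)) (d3.fun_smul dV),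
      cov_sub (d1.fun_const_smul e₁) (d2.fun_const_smul e₂), cov_const_smul e₁ d1, cov_const_smul e₂ d2,
      cov_smul d3 dV, h.cov_SSV hx, h.cov_SV x hx, h.cov_Vfield hx, h.codazzi x hx X, hg,
      map_add] at h2
    rw [add_assoc, h2]
    abel
  κ_ne := h.κ_ne
  V_V := h.V_V x hx
  V_SV := h.V_SV x hx
  SV_SV := h.SV_SV x hx
  φ_φ := h.φ_φ x hx
  e₃_eq := rfl
  disc := h.disc
  pos := h.pos x hx
  a_ne := h.a_ne x hx
  complete := fun u h1 h2 h3 h4 =>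
    h.complete hx ⟨h1, h2, h3⟩ fun μ hμ Z hZ hZ' => h4 μ hμ Z hZ hZ'.1 hZ'.2.1 hZ'.2.2

/-- Every eigenvector of the shape operator orthogonal to the cyclic space extends to a field of
such eigenvectors. -/
theorem exists_eigensection [FiniteDimensional ℝ E] (h : IsModelTwo κ e₁ e₂ Λ Ω G Γ S φ V) {x : E}
    (hx : x ∈ Ω) {μ : ℝ} (hμ : μ ∈ Λ) {Z : E} (hZ : S x Z = μ • Z) (hZV : G x Z V = 0) :
    ∃ Y : E → E, ContDiffOn ℝ ∞ Y Ω ∧ Y x = Z ∧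
      ∀ y ∈ Ω, S y (Y y) = μ • Y y ∧ Y y ∈ cyclicOrth (G y) (S y) V := by
  -- By φ² the vector w is -S²V plus a combination of V and SV, so V, SV, w is an orthogonal basis
  -- of the cyclic space, and w has the same square `N` > 0 as φS²V. Thus π y is the orthogonal
  -- projection of the constant vector Z to the complement at y.
  let w : E → E := fun y => φ y (φ y (S y (S y V)))
  let N : E → ℝ := fun y => G y (φ y (S y (S y V))) (φ y (S y (S y V)))
  let π : E → E := fun y => Z - (κ * G y Z V) • V - G y Z (S y V) • S y V
    - ((N y)⁻¹ * G y Z (w y)) • w y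
  have hNpos : ∀ y ∈ Ω, N y ≠ 0 := by
    intro y hy
    obtain ⟨g, hg⟩ := h.exists_gradient hy (fderiv ℝ (e₃ κ e₁ G S V) y)
    have q := h.quadricAlg hy hg
    exact (h.pos y hy _ q.a_V q.a_ne).ne'
  have hw : ContDiffOn ℝ ∞ w Ω := h.φ_smooth.clm_apply h.a_smooth
  have hπ : ContDiffOn ℝ ∞ π Ω := by
    refine ((contDiffOn_const.sub ?_).sub ?_).sub ?_
    · exact (contDiffOn_const.mul (h.G_apply_smooth contDiffOn_const contDiffOn_const)).smul
        contDiffOn_const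
    · exact (h.G_apply_smooth contDiffOn_const h.SV_smooth).smul h.SV_smooth
    · refine ContDiffOn.smul (ContDiffOn.mul (ContDiffOn.inv ?_ hNpos) ?_) hw
      · exact h.G_apply_smooth h.a_smooth h.a_smooth
      · exact h.G_apply_smooth contDiffOn_const hw
  have hπmem : ∀ y ∈ Ω, π y ∈ cyclicOrth (G y) (S y) V := by
    intro y hy
    obtain ⟨g, hg⟩ := h.exists_gradient hy (fderiv ℝ (e₃ κ e₁ G S V) y)
    have q := h.quadricAlg hy hg
    have w0 : G y (w y) V = 0 := by rw [h.φ_skew y hy, h.φ_V y hy]; simp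
    have w1 : G y (w y) (S y V) = 0 := by rw [h.φ_skew y hy, h.φ_SV y hy]; simp
    have ww : w y = -S y (S y V) + G y (S y (S y V)) (S y V) • S y V + κ • V := by
      have := h.φ_φ y hy (S y (S y V))
      rw [h.symm y hy _ V, q.V_SSV, mul_one] at this
      exact this
    have wN : G y (w y) (w y) = N y := by
      rw [h.φ_skew y hy, h.φ_φ y hy, q.a_V, q.a_SV]
      simp [N]
    have p0 : G y (π y) V = 0 := by
      simp [π, w0, h.V_V y hy, h.symm y hy (S y V) V, h.V_SV y hy]
      field_simp [h.κ_ne]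
      ring
    have p1 : G y (π y) (S y V) = 0 := by
      simp [π, w1, h.SV_SV y hy, h.V_SV y hy]
    have p2 : G y (π y) (w y) = 0 := by
      simp [π, wN, h.symm y hy _ (w y), w0, w1]
      field_simp [hNpos y hy]
      ring
    refine ⟨p0, p1, ?_⟩
    rw [ww] at p2
    simpa [p0, p1] using p2
  refine ⟨fun y => aeval (S y) (Lagrange.basis Λ id μ) (π y),
    (h.S_smooth.aeval _).clm_apply hπ, ?_, fun y hy => ⟨h.S_lagrange hy hμ (hπmem y hy),
      aeval_mem_of_invariant (h.S_mem_cyclicOrth hy) _ (hπmem y hy)⟩⟩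
  obtain ⟨h1, h2, h3⟩ := h.mem_cyclicOrth_of_eigen hx hZ hZV
  have hπx : π x = Z := by
    obtain ⟨g, hg⟩ := h.exists_gradient hx (fderiv ℝ (e₃ κ e₁ G S V) x)
    have q := h.quadricAlg hx hg
    have : G x Z (w x) = 0 := by
      simp only [w]
      rw [h.φ_φ x hx]
      simp [h1, h2, h3]
    simp [π, this, h1, h2]
  simp only [hπx]
  rw [aeval_apply_of_eigen hZ]
  have : (Lagrange.basis Λ id μ).eval (id μ) = 1 := Lagrange.eval_basis_self (injOn_id _) hμ
  rw [id] at this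
  rw [this, one_smul]

/-- The function `e₃` is stationary. -/
theorem fderiv_e₃ [FiniteDimensional ℝ E] (h : IsModelTwo κ e₁ e₂ Λ Ω G Γ S φ V) {x : E}
    (hx : x ∈ Ω) : fderiv ℝ (e₃ κ e₁ G S V) x = 0 := by
  by_contra hne
  have hcont : ContinuousOn (fderiv ℝ (e₃ κ e₁ G S V)) Ω :=
    h.e₃_smooth.continuousOn_fderiv_of_isOpen h.isOpen (by simp)
  have hnear : ∀ᶠ y in nhds x, y ∈ Ω ∧ fderiv ℝ (e₃ κ e₁ G S V) y ≠ 0 :=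
    Filter.Eventually.and (h.isOpen.mem_nhds hx)
      ((hcont.continuousAt (h.isOpen.mem_nhds hx)).eventually_ne hne)
  -- Wherever the differential is nonzero, `e₃` takes one fixed value. Since nonvanishing is an open
  -- condition, `e₃` is then constant near x, a contradiction.
  have key : ∀ y ∈ Ω, fderiv ℝ (e₃ κ e₁ G S V) y ≠ 0 →
      e₃ κ e₁ G S V y = -(κ * e₁ / 6) := by
    intro y hy hne
    obtain ⟨g, hg⟩ := h.exists_gradient hy (fderiv ℝ (e₃ κ e₁ G S V) y)
    have q := h.quadricAlg hy hg
    have hSa : S y (φ y (S y (S y V))) = (e₁ / 2) • φ y (S y (S y V)) := by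
      refine q.eigen_of_pair fun μ hμ Z hZ hZV hpair => ?_
      -- An eigenvalue μ ≠ e₁/2 that pairs nontrivially with a at y does so nearby, along a field of
      -- eigenvectors. There `theta_pair` expresses `e₃` through the constants μ, e₁, e₂, κ.
      by_contra hμe
      apply hne
      obtain ⟨Y, hY, hYy, hYe⟩ := h.exists_eigensection hy hμ hZ hZV
      have hc : ContinuousAt (fun z => G z (φ z (S z (S z V))) (Y z)) y :=
        ((h.G_apply_smooth h.a_smooth hY).continuousOn).continuousAt (h.isOpen.mem_nhds hy)
      have hev : e₃ κ e₁ G S V =ᶠ[nhds y] fun _ => μ ^ 3 - e₁ * μ ^ 2 + e₂ * μ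
          - 2 * (μ ^ 2 - e₁ * μ + e₂ + κ) * (3 * μ ^ 2 - 2 * e₁ * μ + e₂)
            / (3 * (2 * μ - e₁)) := by
        filter_upwards [h.isOpen.mem_nhds hy, hc.eventually_ne (y := 0) (by rwa [hYy])]
          with z hz hzne
        obtain ⟨g', hg'⟩ := h.exists_gradient hz (fderiv ℝ (e₃ κ e₁ G S V) z)
        have h1 := (h.quadricAlg hz hg').theta_pair (hYe z hz).1 hzne
        have h2 : 3 * (2 * μ - e₁) ≠ 0 := by
          intro h0
          apply hμe
          linarith
        rw [← h1, mul_div_cancel_left₀ _ h2]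
        ring
      rw [hev.fderiv_eq]
      simp
    have hgr := q.grad_eq hSa
    -- By `grad_SV_SSV` the function is stationary along SV and S²V, hence along their bracket,
    -- which is computed below from covariant derivatives. With g = 3e₃a this becomes an algebraic
    -- equation for `e₃`.
    have hst := fderiv_apply_of_stationary (f := e₃ κ e₁ G S V) (x := y)
      ((h.contDiffAt hy h.e₃_smooth).of_le two_le_infty) (h.diffAt hy h.SV_smooth)
      (h.diffAt hy h.SSV_smooth)
      (by
        filter_upwards [h.isOpen.mem_nhds hy] with z hz
        obtain ⟨g', hg'⟩ := h.exists_gradient hz (fderiv ℝ (e₃ κ e₁ G S V) z)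
        rw [hg']
        exact (h.quadricAlg hz hg').grad_SV_SSV.1)
      (by
        filter_upwards [h.isOpen.mem_nhds hy] with z hz
        obtain ⟨g', hg'⟩ := h.exists_gradient hz (fderiv ℝ (e₃ κ e₁ G S V) z)
        rw [hg']
        exact (h.quadricAlg hz hg').grad_SV_SSV.2)
    have hbr : fderiv ℝ (fun z => S z (S z V)) y (S y V) - fderiv ℝ (fun z => S z V) y (S y (S y V))
        = cov Γ (fun z => S z (S z V)) y (S y V) - cov Γ (fun z => S z V) y (S y (S y V)) := by
      simp only [cov, h.Γ_symm y hy (S y V)]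
      abel
    rw [hbr, h.cov_SSV hy, h.cov_SV y hy, q.P_SV_SV, q.S_V_three, hg, h.V_V y hy, hSa] at hst
    have hN := h.pos y hy _ q.a_V q.a_ne
    have he : e₃ κ e₁ G S V y ≠ 0 := by
      intro h0
      apply hne
      ext X
      rw [hg, hgr, h0]
      simp
    rw [hgr] at hst
    have h3 : G y (φ y (S y (S y V))) (φ y (S y (S y V))) * e₃ κ e₁ G S V y
        * (κ * e₁ / 6 + e₃ κ e₁ G S V y) = 0 := by
      have hκ := h.κ_ne
      simp only [map_smul, map_add, map_sub, _root_.smul_apply, smul_eq_mul] at hst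
      field_simp at hst
      linear_combination hst / 18
    have h4 := (mul_eq_zero.1 h3).resolve_left (mul_ne_zero hN.ne' he)
    linarith
  apply hne
  have : e₃ κ e₁ G S V =ᶠ[nhds x] fun _ => -(κ * e₁ / 6) := by
    filter_upwards [hnear] with y hy using key y hy.1 hy.2
  rw [this.fderiv_eq]
  simp

theorem quadricAlg_zero [FiniteDimensional ℝ E] (h : IsModelTwo κ e₁ e₂ Λ Ω G Γ S φ V) {x : E}
    (hx : x ∈ Ω) :
    QuadricAlg κ Λ (G x) (S x) (φ x) (covOp Γ S x) V e₁ e₂ (e₃ κ e₁ G S V x) 0 :=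
  h.quadricAlg hx (by simp [h.fderiv_e₃ hx])

end IsModelTwo

end ModelTwo

/-! ### The double root is triple: the operator `S - l` and the Gauss equation -/

section DoubleRoot

variable {E : Type*} [NormedAddCommGroup E] [NormedSpace ℝ E]

/-- The translate `S - l` of an endomorphism. -/
noncomputable def shiftOp (l : ℝ) (S : E →L[ℝ] E) : E →L[ℝ] E :=
  S - l • ContinuousLinearMap.id ℝ E

theorem shiftOp_apply (l : ℝ) (S : E →L[ℝ] E) (u : E) : shiftOp l S u = S u - l • u := rfl

theorem apply_eq_shiftOp (l : ℝ) (S : E →L[ℝ] E) (u : E) : S u = shiftOp l S u + l • u := by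
  simp [shiftOp_apply]

/-- A constant multiple of the identity is parallel and commutes with φ, so ∇S and `P_V` do not
change. The new coefficients are those of χ(X + l). -/
theorem CubicAlg.shift {G : E →L[ℝ] E →L[ℝ] ℝ} {S φ : E →L[ℝ] E} {P : E →L[ℝ] E →L[ℝ] E} {V : E}
    {e₁ e₂ e₃ : ℝ} {g : E} (h : CubicAlg G S φ P V e₁ e₂ e₃ g) (l : ℝ) :
    CubicAlg G (shiftOp l S) φ P V (e₁ - 3 * l) (e₂ - 2 * l * e₁ + 3 * l ^ 2)
      (e₃ - l * e₂ + l ^ 2 * e₁ - l ^ 3) g where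
  symm := h.symm
  nondeg := h.nondeg
  S_symm x y := by simp [shiftOp_apply, h.S_symm]
  φ_skew := h.φ_skew
  P_symm := h.P_symm
  P_adj := h.P_adj
  P_V x := by simp [shiftOp_apply, h.P_V]
  φ_V := h.φ_V
  φ_SV := by simp [shiftOp_apply, h.φ_V, h.φ_SV]
  cubic := by
    simp only [shiftOp_apply, map_sub, map_smul, h.cubic]
    module
  deriv x := by
    have h1 := h.deriv x
    have h2 := h.P_V x
    have h3 := congrArg S h2
    simp only [shiftOp_apply, map_sub, map_smul, _root_.sub_apply, _root_.smul_apply] at h3 ⊢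
    linear_combination (norm := module) h1 + (l * e₁ - l ^ 2) • h2 - l • h3

theorem CubicAlg.P_SV_SSV_of_stationary {G : E →L[ℝ] E →L[ℝ] ℝ} {S φ : E →L[ℝ] E}
    {P : E →L[ℝ] E →L[ℝ] E} {V : E} {e₁ e₂ e₃ : ℝ} (h : CubicAlg G S φ P V e₁ e₂ e₃ 0) :
    P (S V) (S (S V)) = e₁ • S (φ (S (S V))) := by
  have := h.deriv_adjoint (S V)
  rw [h.P_symm (S (S V)), h.P_SV_SV, h.φ_SV, h.S_V_three] at this
  simp only [map_zero, smul_zero, map_smul] at this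
  linear_combination (norm := module) (1 / 2 : ℝ) • this

/-- A hypersurface as in `IsModelTwo` for which the characteristic polynomial of the shape operator
on the cyclic space is `(X - l)² (X - ν)`. -/
structure IsModelDouble (κ l ν : ℝ) (Λ : Finset ℝ) (Ω : Set E) (G : E → E →L[ℝ] E →L[ℝ] ℝ)
    (Γ : E → E →L[ℝ] E →L[ℝ] E) (S φ : E → E →L[ℝ] E) (V : E) : Prop
    extends IsModelTwo κ (2 * l + ν) (l ^ 2 + 2 * l * ν) Λ Ω G Γ S φ V where
  e₃_eq : ∀ x ∈ Ω, IsModelTwo.e₃ κ (2 * l + ν) G S V x = l ^ 2 * ν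
  S_a : ∀ x ∈ Ω, S x (φ x (S x (S x V))) = l • φ x (S x (S x V))

variable {κ e₁ e₂ : ℝ} {Λ : Finset ℝ} {Ω : Set E} {G : E → E →L[ℝ] E →L[ℝ] ℝ}
    {Γ : E → E →L[ℝ] E →L[ℝ] E} {S φ : E → E →L[ℝ] E} {V : E}

theorem IsModelTwo.mono (h : IsModelTwo κ e₁ e₂ Λ Ω G Γ S φ V) {Ω' : Set E} (hΩ : Ω' ⊆ Ω)
    (ho : IsOpen Ω') : IsModelTwo κ e₁ e₂ Λ Ω' G Γ S φ V where
  isOpen := ho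
  G_smooth := h.G_smooth.mono hΩ
  Γ_smooth := h.Γ_smooth.mono hΩ
  S_smooth := h.S_smooth.mono hΩ
  φ_smooth := h.φ_smooth.mono hΩ
  κ_ne := h.κ_ne
  symm x hx := h.symm x (hΩ hx)
  nondeg x hx := h.nondeg x (hΩ hx)
  compat x hx := h.compat x (hΩ hx)
  Γ_symm x hx := h.Γ_symm x (hΩ hx)
  S_symm x hx := h.S_symm x (hΩ hx)
  φ_skew x hx := h.φ_skew x (hΩ hx)
  codazzi x hx := h.codazzi x (hΩ hx)
  cov_V x hx := h.cov_V x (hΩ hx)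
  cov_SV x hx := h.cov_SV x (hΩ hx)
  cov_φ x hx := h.cov_φ x (hΩ hx)
  φ_V x hx := h.φ_V x (hΩ hx)
  φ_SV x hx := h.φ_SV x (hΩ hx)
  φ_φ x hx := h.φ_φ x (hΩ hx)
  V_V x hx := h.V_V x (hΩ hx)
  V_SV x hx := h.V_SV x (hΩ hx)
  SV_SV x hx := h.SV_SV x (hΩ hx)
  gauss x hx := h.gauss x (hΩ hx)
  cubic x hx := h.cubic x (hΩ hx)
  disc := h.disc
  pos x hx := h.pos x (hΩ hx)
  a_ne x hx := h.a_ne x (hΩ hx)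
  spectral x hx := h.spectral x (hΩ hx)

/-- Serves to identify the double roots found at the different points of a ball on which e₁, e₂, e₃
are constant. -/
theorem double_root_unique {l ν l' ν' : ℝ} (h1 : 2 * l + ν = 2 * l' + ν')
    (h2 : l ^ 2 + 2 * l * ν = l' ^ 2 + 2 * l' * ν') (h3 : l ^ 2 * ν = l' ^ 2 * ν') : l = l' := by
  have hν : ν' = 2 * l + ν - 2 * l' := by linarith
  subst hν
  have h4 : (l' - l) * (2 * (l' - ν) + (l' - l)) = 0 := by
    linear_combination h2
  have h5 : (l' - l) ^ 2 * (l' - ν) = 0 := by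
    linear_combination l' * h2 - h3
  by_contra hne
  have hne' : l' - l ≠ 0 := fun h0 => hne (by linarith)
  have h6 := (mul_eq_zero.1 h4).resolve_left hne'
  have h7 := (mul_eq_zero.1 h5).resolve_left (pow_ne_zero 2 hne')
  apply hne'
  linarith

theorem IsModelTwo.exists_isModelDouble [FiniteDimensional ℝ E]
    (h : IsModelTwo κ e₁ e₂ Λ Ω G Γ S φ V) {x : E} (hx : x ∈ Ω) :
    ∃ Ω' ⊆ Ω, x ∈ Ω' ∧ ∃ l ν, e₁ = 2 * l + ν ∧ e₂ = l ^ 2 + 2 * l * ν ∧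
      IsModelDouble κ l ν Λ Ω' G Γ S φ V := by
  obtain ⟨r, hr, hball⟩ := Metric.isOpen_iff.1 h.isOpen x hx
  obtain ⟨l, ν, h1, h2, h3, h4⟩ := (h.quadricAlg_zero hx).exists_double_root
  have hconst : ∀ y ∈ Metric.ball x r, e₃ κ e₁ G S V y = e₃ κ e₁ G S V x := by
    intro y hy
    refine (convex_ball x r).is_const_of_fderivWithin_eq_zero (𝕜 := ℝ)
      (f := e₃ κ e₁ G S V) (fun z hz => (h.diffAt (hball hz) h.e₃_smooth).differentiableWithinAt)
      (fun z hz => ?_) hy (Metric.mem_ball_self hr)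
    rw [fderivWithin_of_isOpen Metric.isOpen_ball hz, h.fderiv_e₃ (hball hz)]
  refine ⟨Metric.ball x r, hball, Metric.mem_ball_self hr, l, ν, h1, h2, ?_⟩
  have h' := h.mono hball Metric.isOpen_ball
  rw [h1, h2] at h'
  refine { h' with e₃_eq := fun y hy => by rw [← h1, hconst y hy, h3], S_a := fun y hy => ?_ }
  obtain ⟨l', ν', h1', h2', h3', h4'⟩ := (h.quadricAlg_zero (hball hy)).exists_double_root
  rw [double_root_unique (h1.symm.trans h1') (h2.symm.trans h2')
    (h3.symm.trans ((hconst y hy).symm.trans h3'))]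
  exact h4'

namespace IsModelDouble

variable {l ν : ℝ}

/-- The polynomial (X - l)²(X - ν) becomes X²(X - δ) with δ = ν - l. Two of the three coefficients
vanish, which keeps all later formulas short. -/
theorem shift_alg [FiniteDimensional ℝ E] (h : IsModelDouble κ l ν Λ Ω G Γ S φ V) {x : E}
    (hx : x ∈ Ω) :
    CubicAlg (G x) (shiftOp l (S x)) (φ x) (covOp Γ S x) V (ν - l) 0 0 0 := by
  have := (h.quadricAlg_zero hx).toCubicAlg.shift l
  rw [h.e₃_eq x hx] at this
  convert this using 1 <;> ring

theorem a_eq (h : IsModelDouble κ l ν Λ Ω G Γ S φ V) {x : E} (hx : x ∈ Ω) :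
    φ x (shiftOp l (S x) (shiftOp l (S x) V)) = φ x (S x (S x V)) := by
  simp [shiftOp_apply, h.φ_V x hx, h.φ_SV x hx]

theorem neg [FiniteDimensional ℝ E] (h : IsModelDouble κ l ν Λ Ω G Γ S φ V) {x : E} (hx : x ∈ Ω) :
    κ + l ^ 2 < 0 ∧ κ + l * ν ≠ 0 :=
  (h.quadricAlg_zero hx).neg_of_double_root rfl rfl (h.e₃_eq x hx)

/-- The relations at a point for the translated shape operator `T = S - l` and `a = φ T² V`. -/
structure Shifted (κ l δ : ℝ) (G : E →L[ℝ] E →L[ℝ] ℝ) (T φ : E →L[ℝ] E)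
    (P : E →L[ℝ] E →L[ℝ] E) (V a : E) : Prop extends CubicAlg G T φ P V δ 0 0 0 where
  a_def : φ (T (T V)) = a
  T_a : T a = 0
  V_TV : G V (T V) = -(l / κ)
  V_TTV : G V (T (T V)) = (κ + l ^ 2) / κ

namespace Shifted

variable {δ : ℝ} {G : E →L[ℝ] E →L[ℝ] ℝ} {T φ : E →L[ℝ] E} {P : E →L[ℝ] E →L[ℝ] E} {V a : E}

theorem TTTV (h : Shifted κ l δ G T φ P V a) : T (T (T V)) = δ • T (T V) := by
  simpa using h.cubic

theorem TV_TV (h : Shifted κ l δ G T φ P V a) : G (T V) (T V) = (κ + l ^ 2) / κ := by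
  rw [h.S_symm, h.V_TTV]

theorem TV_TTV (h : Shifted κ l δ G T φ P V a) :
    G (T V) (T (T V)) = δ * ((κ + l ^ 2) / κ) := by
  rw [h.S_symm, h.TTTV]; simp [h.V_TTV]

theorem TTV_TTV (h : Shifted κ l δ G T φ P V a) :
    G (T (T V)) (T (T V)) = δ ^ 2 * ((κ + l ^ 2) / κ) := by
  rw [h.S_symm, h.TTTV, map_smul, h.TV_TTV, smul_eq_mul]; ring

theorem a_V (h : Shifted κ l δ G T φ P V a) : G a V = 0 := by
  rw [← h.a_def, h.φ_skew, h.φ_V]; simp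

theorem a_TV (h : Shifted κ l δ G T φ P V a) : G a (T V) = 0 := by
  rw [← h.a_def, h.φ_skew, h.φ_SV]; simp

theorem a_TTV (h : Shifted κ l δ G T φ P V a) : G a (T (T V)) = 0 := by
  have := h.φ_skew (T (T V)) (T (T V))
  rw [h.symm (T (T V)), h.a_def] at this
  linarith

theorem P_TV_V (h : Shifted κ l δ G T φ P V a) : P (T V) V = a := by
  rw [h.P_SV_V, h.a_def]

theorem P_TV_TV (h : Shifted κ l δ G T φ P V a) : P (T V) (T V) = 0 := by
  rw [h.P_SV_SV, h.a_def, h.T_a]; simp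

theorem P_TV_TTV (h : Shifted κ l δ G T φ P V a) : P (T V) (T (T V)) = 0 := by
  rw [h.P_SV_SSV_of_stationary, h.a_def, h.T_a]; simp

end Shifted

/-- The field `T² V` for `T = S - l`. -/
noncomputable def w₂ (l : ℝ) (S : E → E →L[ℝ] E) (V : E) (x : E) : E :=
  shiftOp l (S x) (shiftOp l (S x) V)

theorem shifted [FiniteDimensional ℝ E] (h : IsModelDouble κ l ν Λ Ω G Γ S φ V) {x : E}
    (hx : x ∈ Ω) :
    Shifted κ l (ν - l) (G x) (shiftOp l (S x)) (φ x) (covOp Γ S x) V (φ x (S x (S x V))) where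
  toCubicAlg := h.shift_alg hx
  a_def := h.a_eq hx
  T_a := by simp [shiftOp_apply, h.S_a x hx]
  V_TV := by
    simp [shiftOp_apply, h.V_V x hx, h.V_SV x hx]
    field_simp
  V_TTV := by
    have := h.κ_ne
    simp [shiftOp_apply, h.V_V x hx, h.V_SV x hx, (h.quadricAlg_zero hx).V_SSV]
    field_simp

theorem shiftOp_V_smooth (h : IsModelDouble κ l ν Λ Ω G Γ S φ V) :
    ContDiffOn ℝ ∞ (fun x => shiftOp l (S x) V) Ω :=
  h.SV_smooth.sub contDiffOn_const

theorem w₂_smooth (h : IsModelDouble κ l ν Λ Ω G Γ S φ V) : ContDiffOn ℝ ∞ (w₂ l S V) Ω :=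
  (h.S_smooth.clm_apply h.shiftOp_V_smooth).sub (contDiffOn_const.smul h.shiftOp_V_smooth)

theorem cov_shiftOp_apply (h : IsModelDouble κ l ν Λ Ω G Γ S φ V) {u : E → E} {x : E} (hx : x ∈ Ω)
    (hu : ContDiffOn ℝ ∞ u Ω) (X : E) :
    cov Γ (fun y => shiftOp l (S y) (u y)) x X =
      covOp Γ S x X (u x) + shiftOp l (S x) (cov Γ u x X) := by
  simp only [shiftOp_apply]
  have hd := h.diffAt hx hu
  rw [cov_sub (h.diffAt hx (h.S_smooth.clm_apply hu)) (hd.fun_const_smul l),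
    cov_const_smul l hd, h.cov_S_apply hx hu]
  abel

theorem cov_TV (h : IsModelDouble κ l ν Λ Ω G Γ S φ V) {x : E} (hx : x ∈ Ω) (X : E) :
    cov Γ (fun y => shiftOp l (S y) V) x X = φ x (shiftOp l (S x) X) := by
  simp only [shiftOp_apply]
  have hV : DifferentiableAt ℝ (fun _ : E => V) x := differentiableAt_const V
  rw [cov_sub (h.diffAt hx h.SV_smooth) (hV.fun_const_smul l), cov_const_smul l hV,
    h.cov_SV x hx, h.cov_Vfield hx]
  simp

theorem cov_w₂ (h : IsModelDouble κ l ν Λ Ω G Γ S φ V) {x : E} (hx : x ∈ Ω) (X : E) :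
    cov Γ (w₂ l S V) x X = covOp Γ S x (shiftOp l (S x) V) X
      + shiftOp l (S x) (φ x (shiftOp l (S x) X)) := by
  have : w₂ l S V = fun y => shiftOp l (S y) (shiftOp l (S y) V) := rfl
  rw [this, h.cov_shiftOp_apply hx h.shiftOp_V_smooth, h.cov_TV hx, h.codazzi x hx]

theorem cov_a [FiniteDimensional ℝ E] (h : IsModelDouble κ l ν Λ Ω G Γ S φ V) {x : E} (hx : x ∈ Ω)
    (X : E) :
    cov Γ (fun y => φ y (S y (S y V))) x X =
      -(G x (shiftOp l (S x) X + l • X) (w₂ l S V x) • (shiftOp l (S x) V + l • V))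
      - (κ * G x X (w₂ l S V x)) • V
      + (ν * ((κ + l ^ 2) / κ)) • (shiftOp l (S x) X + l • X) + (κ + l ^ 2) • X
      + φ x (cov Γ (w₂ l S V) x X) := by
  have hs := h.shifted hx
  have h1 : (fun y => φ y (S y (S y V))) =ᶠ[nhds x] fun y => φ y (w₂ l S V y) := by
    filter_upwards [h.isOpen.mem_nhds hx] with y hy using (h.a_eq hy).symm
  have h2 : G x (w₂ l S V x) (S x V) = ν * ((κ + l ^ 2) / κ) := by
    rw [apply_eq_shiftOp l (S x) V, w₂, map_add, map_smul, hs.symm, hs.TV_TTV, hs.symm,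
      hs.V_TTV, smul_eq_mul]
    ring
  have h3 : κ * G x (w₂ l S V x) V = κ + l ^ 2 := by
    rw [w₂, hs.symm, hs.V_TTV]
    field_simp [h.κ_ne]
  rw [cov_congr h1, h.cov_φ_apply hx h.w₂_smooth, h.cov_φ x hx, h2, h3,
    apply_eq_shiftOp l (S x) V, apply_eq_shiftOp l (S x) X]

/-- For T = S - l, differentiate T a = 0 along TV. The term with ∇w₂ in `cov_a` drops out, because
P(TV)(TV) = 0 and T a = 0. -/
theorem cov_a_TV [FiniteDimensional ℝ E] (h : IsModelDouble κ l ν Λ Ω G Γ S φ V) {x : E}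
    (hx : x ∈ Ω) :
    covOp Γ S x (shiftOp l (S x) V) (φ x (S x (S x V))) =
      -((κ + l * ν) * ((κ + l ^ 2) / κ)) • (w₂ l S V x - (ν - l) • shiftOp l (S x) V) := by
  have hs := h.shifted hx
  have h1 : (fun y => shiftOp l (S y) (φ y (S y (S y V)))) =ᶠ[nhds x] fun _ => 0 := by
    filter_upwards [h.isOpen.mem_nhds hx] with y hy using (h.shifted hy).T_a
  have h2 := cov_congr (Γ := Γ) h1 (shiftOp l (S x) V)
  rw [h.cov_shiftOp_apply hx h.a_smooth, h.cov_a hx, h.cov_w₂ hx, hs.P_TV_TV, hs.a_def, hs.T_a,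
    w₂] at h2
  have hκ := h.κ_ne
  simp only [map_add, map_sub, map_neg, map_smul, map_zero, _root_.add_apply, _root_.smul_apply,
    hs.TTV_TTV, hs.TV_TTV, hs.TTTV, smul_eq_mul, add_zero] at h2
  simp only [cov, fderiv_const_apply, map_zero] at h2
  rw [w₂]
  simp at h2
  rw [add_eq_zero_iff_eq_neg] at h2
  rw [h2]
  match_scalars <;> field_simp <;> ring

/-- Both terms of `cov_w₂` vanish: P(TV)(T²V) = 0, and TφTw₂ is a multiple of T a = 0. So w₂ is
geodesic; it will turn out to be null once ν = l. -/
theorem cov_w₂_w₂ [FiniteDimensional ℝ E] (h : IsModelDouble κ l ν Λ Ω G Γ S φ V) {x : E}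
    (hx : x ∈ Ω) : cov Γ (w₂ l S V) x (w₂ l S V x) = 0 := by
  have hs := h.shifted hx
  rw [h.cov_w₂ hx, w₂, hs.P_TV_TTV, hs.TTTV, map_smul, hs.a_def, map_smul, hs.T_a]
  simp

theorem cov_a_a [FiniteDimensional ℝ E] (h : IsModelDouble κ l ν Λ Ω G Γ S φ V) {x : E}
    (hx : x ∈ Ω) :
    cov Γ (fun y => φ y (S y (S y V))) x (φ x (S x (S x V))) = 0 := by
  have hs := h.shifted hx
  have hκ := h.κ_ne
  rw [h.cov_a hx, h.cov_w₂ hx, h.cov_a_TV hx, hs.T_a, w₂, zero_add]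
  simp only [map_add, map_sub, map_smul, map_zero, _root_.smul_apply, hs.a_TTV,
    hs.a_def, hs.φ_SV, smul_eq_mul, smul_zero]
  match_scalars <;> field_simp <;> ring

theorem cov_a_w₂ [FiniteDimensional ℝ E] (h : IsModelDouble κ l ν Λ Ω G Γ S φ V) {x : E}
    (hx : x ∈ Ω) :
    cov Γ (fun y => φ y (S y (S y V))) x (w₂ l S V x) =
      (-((ν - l) ^ 2 * ν * ((κ + l ^ 2) / κ))) • shiftOp l (S x) V
      + (-((ν - l) ^ 2 * ((κ + l * ν) * ((κ + l ^ 2) / κ)))) • V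
      + ((κ + l ^ 2) / κ * (κ + ν ^ 2)) • w₂ l S V x := by
  have hs := h.shifted hx
  have hκ := h.κ_ne
  rw [h.cov_a hx, h.cov_w₂_w₂ hx, w₂]
  simp only [hs.TTTV, map_add, map_zero, map_smul, _root_.add_apply, _root_.smul_apply,
    hs.TTV_TTV, smul_eq_mul]
  match_scalars <;> field_simp <;> ring

/-- The double root is a triple root. -/
theorem triple [FiniteDimensional ℝ E] (h : IsModelDouble κ l ν Λ Ω G Γ S φ V) {x : E}
    (hx : x ∈ Ω) : ν = l := by
  have hs := h.shifted hx
  have hκ := h.κ_ne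
  -- The Gauss equation for the curvature of w₂ and a applied to a; it is paired with w₂ below.
  -- Since ∇_a a = 0 the first second-order term is zero, and the second is computed from
  -- `cov_a_w₂`.
  have hc := h.curvature hx h.a_smooth h.w₂_smooth h.a_smooth
  have h1 : (fun y => cov Γ (fun y => φ y (S y (S y V))) y (φ y (S y (S y V)))) =ᶠ[nhds x]
      fun _ => 0 := by
    filter_upwards [h.isOpen.mem_nhds hx] with y hy using h.cov_a_a hy
  have h2 : (fun y => cov Γ (fun y => φ y (S y (S y V))) y (w₂ l S V y)) =ᶠ[nhds x] fun y =>
      (-((ν - l) ^ 2 * ν * ((κ + l ^ 2) / κ))) • shiftOp l (S y) V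
      + (-((ν - l) ^ 2 * ((κ + l * ν) * ((κ + l ^ 2) / κ)))) • V
      + ((κ + l ^ 2) / κ * (κ + ν ^ 2)) • w₂ l S V y := by
    filter_upwards [h.isOpen.mem_nhds hx] with y hy using h.cov_a_w₂ hy
  have d1 := h.diffAt hx h.shiftOp_V_smooth
  have d2 : DifferentiableAt ℝ (fun _ : E => V) x := differentiableAt_const V
  have d3 := h.diffAt hx h.w₂_smooth
  have hW : cov Γ (w₂ l S V) x (φ x (S x (S x V))) =
      -((κ + l * ν) * ((κ + l ^ 2) / κ)) • (w₂ l S V x - (ν - l) • shiftOp l (S x) V) := by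
    rw [h.cov_w₂ hx, h.cov_a_TV hx, hs.T_a]
    simp
  rw [cov_congr h1, cov_congr h2,
    cov_add ((d1.fun_const_smul _).fun_add (d2.fun_const_smul _)) (d3.fun_const_smul _),
    cov_add (d1.fun_const_smul _) (d2.fun_const_smul _), cov_const_smul _ d1,
    cov_const_smul _ d2, cov_const_smul _ d3, h.cov_a_w₂ hx, hW, h.cov_TV hx, h.cov_Vfield hx,
    hs.T_a, h.S_a x hx, apply_eq_shiftOp l (S x) (w₂ l S V x)] at hc
  have hc' := congrArg (fun u => G x u (w₂ l S V x)) hc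
  -- From G(a, w₂) = 0 one has G(∇_X a, w₂) = -G(a, ∇_X w₂); symmetry of ∇S transfers this to the
  -- known vector of `cov_a_TV`. It evaluates the bracket term of the curvature.
  have hpair : ∀ X, G x (cov Γ (fun y => φ y (S y (S y V))) x X) (w₂ l S V x) =
      (κ + l * ν) * ((κ + l ^ 2) / κ) * G x (w₂ l S V x - (ν - l) • shiftOp l (S x) V) X := by
    intro X
    have e0 : (fun y => G y (φ y (S y (S y V))) (w₂ l S V y)) =ᶠ[nhds x] fun _ => 0 := by
      filter_upwards [h.isOpen.mem_nhds hx] with y hy using (h.shifted hy).a_TTV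
    have e1 := h.fderiv_G hx h.a_smooth h.w₂_smooth X
    rw [e0.fderiv_eq, h.cov_w₂ hx, map_add, ← hs.P_adj, h.cov_a_TV hx, ← hs.S_symm, hs.T_a] at e1
    simp at e1
    simp
    linear_combination -e1
  have hwV : G x (φ x (φ x (S x (S x V)))) (w₂ l S V x) =
      -G x (φ x (S x (S x V))) (φ x (S x (S x V))) := by
    rw [hs.φ_skew, w₂, hs.a_def]
  simp only [map_add, map_sub, map_zero, map_smul, _root_.add_apply, _root_.sub_apply,
    _root_.smul_apply, _root_.zero_apply, hpair, hwV, smul_eq_mul] at hc'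
  simp only [w₂, hs.TTTV, hs.TTV_TTV, hs.TV_TTV, hs.TV_TV, hs.V_TTV, hs.V_TV,
    hs.symm (shiftOp l (S x) (shiftOp l (S x) V)) V, hs.symm (shiftOp l (S x) V) V, map_smul,
    hs.symm (shiftOp l (S x) (shiftOp l (S x) V)) (shiftOp l (S x) V), _root_.smul_apply,
    hs.a_TTV, hs.symm (shiftOp l (S x) (shiftOp l (S x) V)) (φ x (S x (S x V))),
    smul_eq_mul] at hc'
  have hN := (h.quadricAlg_zero hx).a_a_of_double_root rfl rfl (h.e₃_eq x hx)
  simp only [cov, fderiv_const_apply, _root_.zero_apply, map_zero, zero_add] at hc'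
  rw [hN] at hc'
  obtain ⟨hn1, hn2⟩ := h.neg hx
  -- The whole Gauss equation collapses to this product; its first two factors are nonzero by `neg`.
  have key : (κ + l ^ 2) ^ 2 * (κ + l * ν) ^ 3 * (ν - l) ^ 2 = 0 := by
    field_simp at hc'
    ring_nf at hc' ⊢
    linarith
  have h5 : (ν - l) ^ 2 = 0 := by
    rcases mul_eq_zero.1 key with h6 | h6
    · exact absurd h6 (mul_ne_zero (pow_ne_zero 2 hn1.ne) (pow_ne_zero 3 hn2))
    · exact h6
  have := pow_eq_zero_iff two_ne_zero |>.1 h5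
  linarith

end IsModelDouble

end DoubleRoot

/-! ### The triple root, and the eigenvalues on the complement of the cyclic space -/

section TripleRoot

variable {E : Type*} [NormedAddCommGroup E] [NormedSpace ℝ E]

variable {κ e₁ e₂ l : ℝ} {Λ : Finset ℝ} {Ω : Set E} {G : E → E →L[ℝ] E →L[ℝ] ℝ}
    {Γ : E → E →L[ℝ] E →L[ℝ] E} {S φ : E → E →L[ℝ] E} {V : E}

namespace IsModelTwo

theorem exists_eigendecomposition (h : IsModelTwo κ e₁ e₂ Λ Ω G Γ S φ V) {x : E} (hx : x ∈ Ω)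
    {u : E} (hu : u ∈ cyclicOrth (G x) (S x) V) :
    ∃ c : ℝ → E, (∀ μ ∈ Λ, S x (c μ) = μ • c μ ∧ c μ ∈ cyclicOrth (G x) (S x) V) ∧
      ∑ μ ∈ Λ, c μ = u := by
  refine ⟨fun μ => Polynomial.aeval (S x) (Lagrange.basis Λ id μ) u, fun μ hμ =>
    ⟨h.S_lagrange hx hμ hu, aeval_mem_of_invariant (h.S_mem_cyclicOrth hx) _ hu⟩, ?_⟩
  rcases Λ.eq_empty_or_nonempty with h0 | h0
  · have := h.spectral x hx u hu.1 hu.2.1 hu.2.2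
    rw [h0] at this ⊢
    simpa using this.symm
  · have h2 := congrArg (fun p => Polynomial.aeval (S x) p u)
      (Lagrange.sum_basis (s := Λ) (v := id) (injOn_id _) h0)
    simpa only [map_sum, map_one, one_apply_eq_self, _root_.sum_apply] using h2

theorem eigen_orthogonal (h : IsModelTwo κ e₁ e₂ Λ Ω G Γ S φ V) {x : E} (hx : x ∈ Ω) {μ ν : ℝ}
    {u v : E} (hu : S x u = μ • u) (hv : S x v = ν • v) (hne : μ ≠ ν) : G x u v = 0 := by
  have h1 := h.S_symm x hx u v
  rw [hu, hv] at h1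
  simp only [map_smul, _root_.smul_apply, smul_eq_mul] at h1
  have h2 : (μ - ν) * G x u v = 0 := by linarith
  exact (mul_eq_zero.1 h2).resolve_left (sub_ne_zero.2 hne)

/-- The covariant derivative of the shape operator vanishes on each eigenspace. -/
theorem covOp_eigen_eigen [FiniteDimensional ℝ E] (h : IsModelTwo κ e₁ e₂ Λ Ω G Γ S φ V) {x : E}
    (hx : x ∈ Ω) {μ : ℝ} (hμ : μ ∈ Λ) {X Z : E} (hX : S x X = μ • X)
    (hXV : G x X V = 0) (hZ : S x Z = μ • Z) (Y : E) : G x (covOp Γ S x Y X) Z = 0 := by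
  obtain ⟨X', hs, hx', he⟩ := h.exists_eigensection hx hμ hX hXV
  have h1 : (fun y => S y (X' y)) =ᶠ[nhds x] fun y => μ • X' y := by
    filter_upwards [h.isOpen.mem_nhds hx] with y hy using (he y hy).1
  have h2 := cov_congr (Γ := Γ) h1 Y
  rw [h.cov_S_apply hx hs, cov_const_smul μ (h.diffAt hx hs), hx'] at h2
  have h3 := congrArg (fun u => G x u Z) h2
  simp only [map_add, map_smul, _root_.add_apply, _root_.smul_apply, h.S_symm x hx, hZ,
    smul_eq_mul] at h3
  linarith

end IsModelTwo

namespace IsModelDouble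

theorem w₂_pair {x u : E} (hu : u ∈ cyclicOrth (G x) (S x) V) : G x u (w₂ l S V x) = 0 := by
  simp [w₂, shiftOp_apply, hu.1, hu.2.1, hu.2.2]

theorem φ_mem (h : IsModelDouble κ l l Λ Ω G Γ S φ V) {x : E} (hx : x ∈ Ω) {X : E}
    (hXa : G x X (φ x (S x (S x V))) = 0) : φ x X ∈ cyclicOrth (G x) (S x) V := by
  refine ⟨?_, ?_, ?_⟩ <;> rw [h.φ_skew x hx]
  · rw [h.φ_V x hx]; simp
  · rw [h.φ_SV x hx]; simp
  · rw [hXa, neg_zero]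

variable [FiniteDimensional ℝ E]

theorem S_w₂ (h : IsModelDouble κ l l Λ Ω G Γ S φ V) {x : E} (hx : x ∈ Ω) :
    S x (w₂ l S V x) = l • w₂ l S V x := by
  have := (h.shifted hx).TTTV
  rw [sub_self, zero_smul, shiftOp_apply, sub_eq_zero] at this
  exact this

/-- With ν = l the relation (S - l)w₂ = 0 holds identically on Ω; this is its derivative. The
companion `covOp_a` differentiates (S - l)a = 0 in the same way. -/
theorem covOp_w₂ (h : IsModelDouble κ l l Λ Ω G Γ S φ V) {x : E} (hx : x ∈ Ω) (X : E) :
    covOp Γ S x (w₂ l S V x) X = -shiftOp l (S x) (cov Γ (w₂ l S V) x X) := by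
  have h1 : (fun y => shiftOp l (S y) (w₂ l S V y)) =ᶠ[nhds x] fun _ => 0 := by
    filter_upwards [h.isOpen.mem_nhds hx] with y hy
    rw [shiftOp_apply, h.S_w₂ hy, sub_self]
  have h2 := cov_congr (Γ := Γ) h1 X
  rw [h.cov_shiftOp_apply hx h.w₂_smooth] at h2
  simp only [cov, fderiv_const_apply, _root_.zero_apply, map_zero, zero_add] at h2
  rw [h.codazzi x hx]
  exact eq_neg_of_add_eq_zero_left h2

theorem covOp_a (h : IsModelDouble κ l l Λ Ω G Γ S φ V) {x : E} (hx : x ∈ Ω) (X : E) :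
    covOp Γ S x (φ x (S x (S x V))) X =
      -shiftOp l (S x) (cov Γ (fun y => φ y (S y (S y V))) x X) := by
  have h1 : (fun y => shiftOp l (S y) (φ y (S y (S y V)))) =ᶠ[nhds x] fun _ => 0 := by
    filter_upwards [h.isOpen.mem_nhds hx] with y hy using (h.shifted hy).T_a
  have h2 := cov_congr (Γ := Γ) h1 X
  rw [h.cov_shiftOp_apply hx h.a_smooth] at h2
  simp only [cov, fderiv_const_apply, _root_.zero_apply, map_zero, zero_add] at h2
  rw [h.codazzi x hx]
  exact eq_neg_of_add_eq_zero_left h2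

theorem a_mem (h : IsModelDouble κ l l Λ Ω G Γ S φ V) {x : E} (hx : x ∈ Ω) :
    φ x (S x (S x V)) ∈ cyclicOrth (G x) (S x) V :=
  ⟨(h.quadricAlg_zero hx).a_V, (h.quadricAlg_zero hx).a_SV, (h.quadricAlg_zero hx).a_SSV⟩

/-- The symmetric operator ∇_{w₂}S kills V, TV and T²V, where T = S - l, so its image is orthogonal
to the cyclic space. -/
theorem covOp_w₂_mem (h : IsModelDouble κ l l Λ Ω G Γ S φ V) {x : E} (hx : x ∈ Ω) (X : E) :
    covOp Γ S x (w₂ l S V x) X ∈ cyclicOrth (G x) (S x) V := by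
  have hs := h.shifted hx
  have h0 : covOp Γ S x (w₂ l S V x) V = 0 := by
    rw [h.codazzi x hx, hs.P_V, w₂, hs.a_def, hs.TTTV, hs.T_a]; simp
  have h1 : covOp Γ S x (w₂ l S V x) (shiftOp l (S x) V) = 0 := by
    rw [h.codazzi x hx, w₂, hs.P_TV_TTV]
  have h2 : covOp Γ S x (w₂ l S V x) (shiftOp l (S x) (shiftOp l (S x) V)) = 0 := by
    have := h.covOp_w₂ hx (w₂ l S V x)
    rw [h.cov_w₂_w₂ hx] at this
    simpa [w₂] using this
  have p0 : G x (covOp Γ S x (w₂ l S V x) X) V = 0 := by rw [hs.P_adj, h0, map_zero]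
  have p1 : G x (covOp Γ S x (w₂ l S V x) X) (shiftOp l (S x) V) = 0 := by
    rw [hs.P_adj, h1, map_zero]
  have p2 : G x (covOp Γ S x (w₂ l S V x) X) (shiftOp l (S x) (shiftOp l (S x) V)) = 0 := by
    rw [hs.P_adj, h2, map_zero]
  simp only [shiftOp_apply, map_sub, map_smul, p0, smul_zero, sub_zero] at p1 p2
  refine ⟨p0, p1, ?_⟩
  simpa [p0, p1] using p2

/-- The second-order identity along the null geodesic field `w₂`. -/
theorem riccati_pair (h : IsModelDouble κ l l Λ Ω G Γ S φ V) {x : E} (hx : x ∈ Ω) {μ : ℝ}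
    (hμ : μ ∈ Λ) (hμl : μ ≠ l) {X : E} (hX : S x X = μ • X) (hXV : G x X V = 0) :
    ∃ D, (∀ Z, G x (covOp Γ S x (w₂ l S V x) X) Z = G x D (μ • Z - S x Z)) ∧
      G x (cov Γ (w₂ l S V) x X) (covOp Γ S x (w₂ l S V x) X) =
        G x D (covOp Γ S x (w₂ l S V x) X) := by
  obtain ⟨X', hs, hx', he⟩ := h.exists_eigensection hx hμ hX hXV
  have hμl' : μ - l ≠ 0 := sub_ne_zero.2 hμl
  have h1 : (fun y => S y (X' y)) =ᶠ[nhds x] fun y => μ • X' y := by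
    filter_upwards [h.isOpen.mem_nhds hx] with y hy using (he y hy).1
  have h2 := cov_congr (Γ := Γ) h1 (w₂ l S V x)
  rw [h.cov_S_apply hx hs, cov_const_smul μ (h.diffAt hx hs), hx'] at h2
  set D := cov Γ X' x (w₂ l S V x) with hD
  have hp : ∀ Z, G x (covOp Γ S x (w₂ l S V x) X) Z = G x D (μ • Z - S x Z) := by
    intro Z
    rw [eq_sub_of_add_eq h2]
    simp [h.S_symm x hx]
  have hT : ∀ y ∈ Ω, ∀ u, G y (covOp Γ S y (w₂ l S V y) u) (X' y) =
      -((μ - l) * G y (cov Γ (w₂ l S V) y u) (X' y)) := by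
    intro y hy u
    rw [h.covOp_w₂ hy, shiftOp_apply]
    simp only [map_neg, map_sub, map_smul, _root_.neg_apply, _root_.sub_apply,
      _root_.smul_apply, smul_eq_mul, h.S_symm y hy, (he y hy).1]
    ring
  -- Diagonal entries of ∇S on an eigenspace vanish, and `hT` rewrites this as the vanishing of
  -- G(∇_{X'}w₂, X') near x. Its derivative along w₂ is the Riccati-type relation.
  have h3 : (fun y => G y (cov Γ (w₂ l S V) y (X' y)) (X' y)) =ᶠ[nhds x] fun _ => 0 := by
    filter_upwards [h.isOpen.mem_nhds hx] with y hy
    have := h.covOp_eigen_eigen hy hμ (he y hy).1 (he y hy).2.1 (he y hy).1 (w₂ l S V y)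
    rw [hT y hy, neg_eq_zero, mul_eq_zero] at this
    exact this.resolve_left hμl'
  have h4 := h.fderiv_G hx (h.cov_smooth h.w₂_smooth hs) hs (w₂ l S V x)
  rw [h3.fderiv_eq] at h4
  have h5 : (fun y => cov Γ (w₂ l S V) y (w₂ l S V y)) =ᶠ[nhds x] fun _ => 0 := by
    filter_upwards [h.isOpen.mem_nhds hx] with y hy using h.cov_w₂_w₂ hy
  -- The curvature term R(w₂, X)w₂ is zero: w₂ is null, an eigenvector of S, and orthogonal to X.
  have hc := h.curvature hx h.w₂_smooth h.w₂_smooth hs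
  have hmem := h.mem_cyclicOrth_of_eigen hx hX hXV
  have hww : G x (w₂ l S V x) (w₂ l S V x) = 0 := by
    have := (h.shifted hx).TTV_TTV
    simpa [w₂] using this
  rw [cov_congr h5, hx', w₂_pair hmem, hX, h.S_w₂ hx] at hc
  simp only [cov, fderiv_const_apply, _root_.zero_apply, map_zero, sub_zero,
    map_smul, _root_.smul_apply, hww, w₂_pair hmem, smul_zero, zero_smul, add_zero] at hc
  rw [sub_eq_zero] at hc
  have hc' : cov Γ (fun y => cov Γ (w₂ l S V) y (X' y)) x (w₂ l S V x) =
      cov Γ (w₂ l S V) x (D - cov Γ (w₂ l S V) x X) := by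
    simp only [cov, hD, hx'] at hc ⊢
    exact hc
  rw [hc', hx', ← hD] at h4
  have h6 := hT x hx (D - cov Γ (w₂ l S V) x X)
  rw [hx', (h.coreAlg hx).P_adj] at h6
  have h7 : (μ - l) * G x (cov Γ (w₂ l S V) x X) D =
      G x (cov Γ (w₂ l S V) x X) (covOp Γ S x (w₂ l S V x) X)
        - G x (covOp Γ S x (w₂ l S V x) X) D := by
    have h8 := h.covOp_w₂ hx X
    have h9 := congrArg (fun u => G x u D) h8
    have h10 := congrArg (G x (cov Γ (w₂ l S V) x X)) h2
    simp only [shiftOp_apply, map_neg, map_sub, map_add, map_smul, _root_.neg_apply,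
      _root_.sub_apply, _root_.smul_apply, smul_eq_mul, h.S_symm x hx] at h9 h10
    linarith
  refine ⟨D, hp, ?_⟩
  simp only [fderiv_const_apply, _root_.zero_apply] at h4
  have h11 := h.symm x hx D (covOp Γ S x (w₂ l S V x) X)
  simp only [map_sub, _root_.sub_apply] at h6
  have h12 : (μ - l) * 0 = (μ - l) * _ := congrArg _ h4
  linarith

/-- `∇_{w₂} S` vanishes on the eigenvectors for eigenvalues other than the triple root. -/
theorem covOp_w₂_eigen (h : IsModelDouble κ l l Λ Ω G Γ S φ V) {x : E} (hx : x ∈ Ω) {μ : ℝ}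
    (hμ : μ ∈ Λ) (hμl : μ ≠ l) {X : E} (hX : S x X = μ • X) (hXV : G x X V = 0) :
    covOp Γ S x (w₂ l S V x) X = 0 := by
  -- Strong induction on the number of elements of Λ that are strictly closer to l than μ.
  induction hn : (Λ.filter fun ν => |ν - l| < |μ - l|).card using Nat.strong_induction_on
    generalizing μ X with
  | _ n ih =>
  have hμl' : μ - l ≠ 0 := sub_ne_zero.2 hμl
  obtain ⟨D, hD, hR⟩ := h.riccati_pair hx hμ hμl hX hXV
  have hmem := h.mem_cyclicOrth_of_eigen hx hX hXV
  obtain ⟨c, hc, hsum⟩ := h.exists_eigendecomposition hx (h.covOp_w₂_mem hx X)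
  set p := covOp Γ S x (w₂ l S V x) X with hp
  have hcc : ∀ ν ∈ Λ, G x p (c ν) = G x (c ν) (c ν) := by
    intro ν hν
    rw [← hsum, map_sum, _root_.sum_apply, Finset.sum_eq_single_of_mem ν hν]
    intro ν' hν' hne
    exact h.eigen_orthogonal hx (hc ν' hν').1 (hc ν hν).1 hne
  have hzero : ∀ ν ∈ Λ, G x (c ν) (c ν) = 0 → c ν = 0 := by
    intro ν hν h0
    by_contra hne
    exact (h.pos x hx _ (hc ν hν).2.1 hne).ne' h0
  have hLp : ∀ ν ∈ Λ, (ν - l) * G x (cov Γ (w₂ l S V) x X) (c ν) = -G x (c ν) (c ν) := by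
    intro ν hν
    rw [← hcc ν hν, hp, h.covOp_w₂ hx, shiftOp_apply]
    simp only [map_neg, map_sub, map_smul, _root_.neg_apply, _root_.sub_apply,
      _root_.smul_apply, smul_eq_mul, h.S_symm x hx, (hc ν hν).1]
    ring
  have hDp : ∀ ν ∈ Λ, (μ - ν) * G x D (c ν) = G x (c ν) (c ν) := by
    intro ν hν
    rw [← hcc ν hν, hD, (hc ν hν).1, ← sub_smul, map_smul, smul_eq_mul]
  -- A nonzero component c ν of (∇_{w₂}S)X contributes (μ - l)²|c ν|² / ((ν - l)(μ - ν)). All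
  -- contributions are shown to be nonpositive, and by `riccati_pair` they sum to zero.
  have hterm : ∀ ν ∈ Λ, (μ - l) * (G x D (c ν) - G x (cov Γ (w₂ l S V) x X) (c ν)) ≤ 0 ∧
      ((μ - l) * (G x D (c ν) - G x (cov Γ (w₂ l S V) x X) (c ν)) = 0 → c ν = 0) := by
    intro ν hν
    by_cases h0 : c ν = 0
    · simp [h0]
    have hpos := h.pos x hx _ (hc ν hν).2.1 h0
    have h1 := hLp ν hν
    have h2 := hDp ν hν
    have hνl : ν - l ≠ 0 := by
      intro h3
      rw [h3] at h1
      linarith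
    have hνμ : μ - ν ≠ 0 := by
      intro h3
      rw [h3] at h2
      linarith
    -- If ν is closer to l than μ, the induction hypothesis gives (∇_{w₂}S)(c ν) = 0, and symmetry
    -- of ∇_{w₂}S makes the component c ν itself vanish.
    have habs : |μ - l| ≤ |ν - l| := by
      by_contra! hlt
      apply h0
      apply hzero ν hν
      rw [← hcc ν hν, hp, (h.coreAlg hx).P_adj,
        ih _ ?_ hν (sub_ne_zero.1 hνl) (hc ν hν).1 (hc ν hν).2.1 rfl, map_zero]
      rw [← hn]
      apply Finset.card_lt_card
      rw [Finset.ssubset_iff_of_subset]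
      · exact ⟨ν, by simp [hν, hlt], by simp⟩
      · intro ν' h'
        simp only [Finset.mem_filter] at h' ⊢
        exact ⟨h'.1, h'.2.trans hlt⟩
    have hneg : (ν - l) * (μ - ν) < 0 := by
      have h3 : (ν - l) * (μ - l) ≤ (ν - l) ^ 2 := by
        calc (ν - l) * (μ - l) ≤ |(ν - l) * (μ - l)| := le_abs_self _
          _ = |ν - l| * |μ - l| := abs_mul _ _
          _ ≤ |ν - l| * |ν - l| := by gcongr
          _ = (ν - l) ^ 2 := by rw [← sq, sq_abs]
      have h4 : (ν - l) * (μ - ν) ≤ 0 := by linarith [h3, sq (ν - l)]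
      exact lt_of_le_of_ne h4 (mul_ne_zero hνl hνμ)
    have hval : (ν - l) * (μ - ν) * ((μ - l) * (G x D (c ν)
        - G x (cov Γ (w₂ l S V) x X) (c ν))) = (μ - l) ^ 2 * G x (c ν) (c ν) := by
      linear_combination (μ - l) * (ν - l) * h2 - (μ - l) * (μ - ν) * h1
    have hrhs : 0 < (μ - l) ^ 2 * G x (c ν) (c ν) := by positivity
    rw [← hval] at hrhs
    have := neg_of_mul_pos_right hrhs hneg.le
    exact ⟨this.le, fun h5 => absurd h5 this.ne⟩
  have hs0 : ∑ ν ∈ Λ, (μ - l) * (G x D (c ν) - G x (cov Γ (w₂ l S V) x X) (c ν)) = 0 := by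
    rw [← Finset.mul_sum, Finset.sum_sub_distrib, ← map_sum, ← map_sum, hsum, hR, sub_self,
      mul_zero]
  rw [Finset.sum_eq_zero_iff_of_nonpos fun ν hν => (hterm ν hν).1] at hs0
  rw [← hsum]
  exact Finset.sum_eq_zero fun ν hν => (hterm ν hν).2 (hs0 ν hν)

/-- The difference of `deriv` and `deriv_adjoint` at X, paired with Z, for the operator S - l: the
terms with P(T²V), T = S - l, cancel. -/
theorem eigen_commutator (h : IsModelDouble κ l l Λ Ω G Γ S φ V) {x : E} (hx : x ∈ Ω) {μ ν : ℝ}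
    {X Z : E} (hX : S x X = μ • X) (hZ : S x Z = ν • Z) :
    (ν - μ) * G x (covOp Γ S x (shiftOp l (S x) V) X) Z =
      -((ν - l) * (μ - l) * (ν + μ - 2 * l) * G x (φ x X) Z) := by
  have hs := h.shift_alg hx
  have h1 := congrArg (fun u => G x u Z) (hs.deriv X)
  have h2 := congrArg (fun u => G x u Z) (hs.deriv_adjoint X)
  have hX' : shiftOp l (S x) X = (μ - l) • X := by rw [shiftOp_apply, hX, sub_smul]
  have hZ' : shiftOp l (S x) Z = (ν - l) • Z := by rw [shiftOp_apply, hZ, sub_smul]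
  simp only [hX', map_add, map_sub, map_smul, _root_.add_apply, _root_.sub_apply,
    _root_.smul_apply, smul_eq_mul, hs.S_symm, hZ', map_zero, _root_.zero_apply] at h1 h2
  linear_combination h1 - h2

/-- For equal eigenvalues the left side of `eigen_commutator` is zero and the right side is -2(μ -
l)³G(φX, Z). -/
theorem φ_eigen_eigen (h : IsModelDouble κ l l Λ Ω G Γ S φ V) {x : E} (hx : x ∈ Ω) {μ : ℝ}
    (hμl : μ ≠ l) {X Z : E} (hX : S x X = μ • X) (hZ : S x Z = μ • Z) : G x (φ x X) Z = 0 := by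
  have h1 := h.eigen_commutator hx hX hZ
  have h2 : (μ - l) ^ 3 * G x (φ x X) Z = 0 := by linear_combination (1 / 2) * h1
  exact (mul_eq_zero.1 h2).resolve_left (pow_ne_zero 3 (sub_ne_zero.2 hμl))

/-- An eigenvalue on the orthogonal complement of the cyclic space, other than the triple root `l`,
is `-κ / l`. -/
theorem eigenvalue_eq (h : IsModelDouble κ l l Λ Ω G Γ S φ V) {x : E} (hx : x ∈ Ω) {μ : ℝ}
    (hμ : μ ∈ Λ) (hμl : μ ≠ l) {X : E} (hX : S x X = μ • X) (hXV : G x X V = 0) (hX0 : X ≠ 0) :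
    κ + l * μ = 0 := by
  have hmem := h.mem_cyclicOrth_of_eigen hx hX hXV
  have hXa : G x X (φ x (S x (S x V))) = 0 := h.eigen_orthogonal hx hX (h.S_a x hx) hμl
  have hμl' : μ - l ≠ 0 := sub_ne_zero.2 hμl
  -- A diagonal entry of ∇_a S; through `covOp_a` it becomes G(∇_X a, X) = 0, and `cov_a` makes that
  -- explicit.
  have h1 := h.covOp_eigen_eigen hx hμ hX hXV hX (φ x (S x (S x V)))
  -- This controls the only term of `cov_a` not known explicitly. Split φX into eigenvectors: on the
  -- l-part use `eigen_commutator`, on the others use that (S - l)∇_X w₂ = 0 by `covOp_w₂_eigen`.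
  have hL : G x (cov Γ (w₂ l S V) x X) (φ x X) = 0 := by
    obtain ⟨c, hc, hsum⟩ := h.exists_eigendecomposition hx (h.φ_mem hx hXa)
    rw [← hsum, map_sum]
    refine Finset.sum_eq_zero fun ν hν => ?_
    by_cases hνl : ν = l
    · have h2 := h.eigen_commutator hx hX (hc ν hν).1
      rw [hνl, sub_self, zero_mul, zero_mul, zero_mul, neg_zero, mul_eq_zero] at h2
      have h3 := h2.resolve_left (sub_ne_zero.2 (Ne.symm hμl))
      have h4 : shiftOp l (S x) (c l) = 0 := by
        rw [shiftOp_apply, ← hνl, (hc ν hν).1, sub_self]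
      rw [h.cov_w₂ hx, map_add, _root_.add_apply, (h.shift_alg hx).S_symm, hνl, h4, map_zero,
        add_zero, h3]
    · have h2 := h.covOp_w₂_eigen hx hμ hμl hX hXV
      rw [h.covOp_w₂ hx, neg_eq_zero] at h2
      have h3 := congrArg (fun u => G x u (c ν)) h2
      simp only [(h.shift_alg hx).S_symm, map_zero, _root_.zero_apply] at h3
      rw [shiftOp_apply, (hc ν hν).1, ← sub_smul, map_smul, smul_eq_mul, mul_eq_zero] at h3
      exact h3.resolve_left (sub_ne_zero.2 hνl)
  have hTX : shiftOp l (S x) X = (μ - l) • X := by rw [shiftOp_apply, hX, sub_smul]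
  rw [h.covOp_a hx, map_neg, _root_.neg_apply, (h.shift_alg hx).S_symm, hTX, map_smul,
    smul_eq_mul, neg_eq_zero, mul_eq_zero] at h1
  have h2 := h1.resolve_left hμl'
  rw [h.cov_a hx, hTX] at h2
  have hX1 := h.mem_cyclicOrth_of_eigen hx hX hXV
  have hφL : G x (φ x (cov Γ (w₂ l S V) x X)) X = 0 := by
    rw [h.φ_skew x hx, hL, neg_zero]
  simp only [map_add, map_sub, map_neg, map_smul, _root_.add_apply, _root_.sub_apply,
    _root_.neg_apply, _root_.smul_apply, smul_eq_mul, w₂_pair hX1, hφL] at h2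
  have hpos := h.pos x hx X hXV hX0
  have hκ := h.κ_ne
  have hn := (h.neg hx).1
  have h3 : (κ + l ^ 2) * G x X X * (κ + l * μ) = 0 := by
    field_simp at h2
    linear_combination h2
  exact (mul_eq_zero.1 h3).resolve_left (mul_ne_zero hn.ne hpos.ne')

/-- For l = 0 a nonzero eigenvalue on the complement would give κ = 0 in `eigenvalue_eq`. -/
theorem S_of_zero (h : IsModelDouble κ 0 0 Λ Ω G Γ S φ V) {x : E} (hx : x ∈ Ω) {u : E}
    (hu : u ∈ cyclicOrth (G x) (S x) V) : S x u = 0 := by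
  obtain ⟨c, hc, hsum⟩ := h.exists_eigendecomposition hx hu
  rw [← hsum, map_sum]
  refine Finset.sum_eq_zero fun μ hμ => ?_
  rw [(hc μ hμ).1, smul_eq_zero]
  by_contra! h0
  have := h.eigenvalue_eq hx hμ h0.1 (hc μ hμ).1 (hc μ hμ).2.1 h0.2
  rw [zero_mul, add_zero] at this
  exact h.κ_ne this

theorem zero_mem_of_zero (h : IsModelDouble κ 0 0 Λ Ω G Γ S φ V) {x : E} (hx : x ∈ Ω) :
    (0 : ℝ) ∈ Λ := by
  obtain ⟨c, hc, hsum⟩ := h.exists_eigendecomposition hx (h.a_mem hx)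
  by_contra h0
  refine h.a_ne x hx ?_
  rw [← hsum]
  refine Finset.sum_eq_zero fun μ hμ => ?_
  have h1 := h.S_of_zero hx (hc μ hμ).2
  rw [(hc μ hμ).1, smul_eq_zero] at h1
  exact h1.resolve_left fun h2 => h0 (h2 ▸ hμ)

theorem a_a_of_zero (h : IsModelDouble κ 0 0 Λ Ω G Γ S φ V) {x : E} (hx : x ∈ Ω) :
    G x (φ x (S x (S x V))) (φ x (S x (S x V))) = -κ := by
  have hs := h.shifted hx
  have h1 : shiftOp 0 (S x) = S x := by ext; simp [shiftOp_apply]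
  have h2 := hs.V_TTV
  have h3 := hs.TTV_TTV
  have h4 := hs.TV_TTV
  rw [h1] at h2 h3 h4
  rw [h.φ_skew x hx, h.φ_φ x hx]
  have hκ := h.κ_ne
  simp only [map_add, map_neg, map_smul, h.symm x hx (S x (S x V)) (S x V), h4, h3, smul_eq_mul,
    h.symm x hx (S x (S x V)) V, h2]
  field_simp
  ring

/-- If the triple root vanishes then the null field `S² V` is recurrent up to phase. -/
theorem cov_w₂_of_zero (h : IsModelDouble κ 0 0 Λ Ω G Γ S φ V) {x : E} (hx : x ∈ Ω) (X : E) :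
    cov Γ (fun y => S y (S y V)) x X = G x X (S x (S x V)) • φ x (S x (S x V))
      + G x X (φ x (S x (S x V))) • S x (S x V) := by
  have hs := h.shifted hx
  have hκ := h.κ_ne
  have h1 : ∀ y, shiftOp 0 (S y) = S y := fun y => by ext; simp [shiftOp_apply]
  have hw : w₂ 0 S V = fun y => S y (S y V) := by
    funext y; rw [w₂, h1]
  have haTV := h.cov_a_TV hx
  simp only [h1, hw] at haTV hs
  have hcov := h.cov_w₂ hx
  simp only [h1, hw] at hcov
  rw [hcov]
  have hVW : G x V (S x (S x V)) = 1 := by rw [hs.V_TTV]; field_simp; ring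
  have hWW : G x (S x (S x V)) (S x (S x V)) = 0 := by rw [hs.TTV_TTV]; ring
  have hTW : G x (S x V) (S x (S x V)) = 0 := by rw [hs.TV_TTV]; ring
  have hWV : G x (S x (S x V)) V = 1 := by rw [h.symm x hx, hVW]
  have hWT : G x (S x (S x V)) (S x V) = 0 := by rw [h.symm x hx, hTW]
  have haa := h.a_a_of_zero hx
  have hSW : S x (S x (S x V)) = 0 := by simpa using hs.TTTV
  set a := φ x (S x (S x V)) with ha
  set W := S x (S x V) with hW
  -- For such u the vector (∇_{SV}S)u pairs to zero with the complement, since S vanishes there and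
  -- `covOp_eigen_eigen` applies to the eigenvalue 0, and with V, SV, S²V by the known values of
  -- P(SV).
  have hu : ∀ u ∈ cyclicOrth (G x) (S x) V, G x u a = 0 → covOp Γ S x (S x V) u = 0 := by
    intro u hu hua
    have hSu := h.S_of_zero hx hu
    refine h.nondeg x hx _ fun z => ?_
    have hz : z - G x z W • V - G x z (S x V) • S x V - (G x z V - G x z W / κ) • W ∈
        cyclicOrth (G x) (S x) V := by
      refine ⟨?_, ?_, ?_⟩ <;>
        simp only [← hW, map_sub, map_smul, _root_.sub_apply, _root_.smul_apply, smul_eq_mul,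
          h.V_V x hx, h.V_SV x hx, hVW, hWW, hTW, hWV, hWT, h.SV_SV x hx,
          h.symm x hx (S x V) V]
      · field_simp; ring
      · ring
      · ring
    have h0 := h.covOp_eigen_eigen hx (h.zero_mem_of_zero hx) (X := u) (by rw [hSu, zero_smul])
      hu.1 (Z := z - G x z W • V - G x z (S x V) • S x V - (G x z V - G x z W / κ) • W)
      (by rw [h.S_of_zero hx hz, zero_smul]) (S x V)
    have p0 : G x (covOp Γ S x (S x V) u) V = 0 := by rw [hs.P_adj, hs.P_TV_V, hua]
    have p1 : G x (covOp Γ S x (S x V) u) (S x V) = 0 := by rw [hs.P_adj, hs.P_TV_TV, map_zero]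
    have p2 : G x (covOp Γ S x (S x V) u) W = 0 := by rw [hs.P_adj, hW, hs.P_TV_TTV, map_zero]
    simpa [p0, p1, p2] using h0
  -- Coordinates of X along V, SV, W = S²V and a. The field W is null with G(V, W) = 1, which
  -- explains the correction -G(X, W)/κ in its coefficient; the square of a is -κ.
  have hX1 : X - G x X W • V - G x X (S x V) • S x V - (G x X V - G x X W / κ) • W
      - (-G x X a / κ) • a ∈ cyclicOrth (G x) (S x) V := by
    refine ⟨?_, ?_, ?_⟩ <;>
      simp only [← hW, map_sub, map_smul, _root_.sub_apply, _root_.smul_apply, smul_eq_mul,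
        h.V_V x hx, h.V_SV x hx, hVW, hWW, hTW, hWV, hWT, h.SV_SV x hx, hs.a_V, hs.a_TV,
        h.symm x hx (S x V) V]
    · field_simp; ring
    · ring
    · rw [hW, hs.a_TTV]; ring
  have haW : G x a W = 0 := hs.a_TTV
  have hX2 := hu _ hX1 (by
    simp only [map_sub, map_smul, _root_.sub_apply, _root_.smul_apply, smul_eq_mul, haa,
      h.symm x hx V a, h.symm x hx (S x V) a, h.symm x hx W a, hs.a_V, hs.a_TV, haW]
    field_simp; ring)
  have hX3 : φ x (S x (X - G x X W • V - G x X (S x V) • S x V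
      - (G x X V - G x X W / κ) • W - (-G x X a / κ) • a)) = 0 := by
    rw [h.S_of_zero hx hX1, map_zero]
  have hPW : covOp Γ S x (S x V) W = 0 := by rw [hW, hs.P_TV_TTV]
  simp only [map_sub, map_smul, hs.P_TV_V, hs.P_TV_TV, hPW, haTV, hs.T_a, hSW,
    h.φ_SV x hx, smul_zero, sub_zero, ← hW, ← ha] at hX2 hX3
  have hX4 := congrArg (S x) hX3
  simp only [map_sub, map_smul, hs.T_a, smul_zero, sub_zero, map_zero] at hX4
  rw [hX4]
  linear_combination (norm := skip) hX2
  match_scalars <;> field_simp <;> ring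

end IsModelDouble

theorem IsModelTwo.exists_isModelTriple [FiniteDimensional ℝ E]
    (h : IsModelTwo κ e₁ e₂ Λ Ω G Γ S φ V) {x : E} (hx : x ∈ Ω) :
    ∃ Ω' ⊆ Ω, x ∈ Ω' ∧ ∃ l, e₁ = 3 * l ∧ e₂ = 3 * l ^ 2 ∧ κ + l ^ 2 < 0 ∧
      IsModelDouble κ l l Λ Ω' G Γ S φ V := by
  obtain ⟨Ω', hΩ, hx', l, ν, h1, h2, h'⟩ := h.exists_isModelDouble hx
  have hν := h'.triple hx'
  subst hν
  exact ⟨Ω', hΩ, hx', ν, by rw [h1]; ring, by rw [h2]; ring, (h'.neg hx').1, h'⟩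

end TripleRoot

/-! ### Fundamental equations of a hypersurface of the quadric -/

noncomputable section Lift

variable {E W : Type*} [NormedAddCommGroup E] [NormedSpace ℝ E] [NormedAddCommGroup W]
  [NormedSpace ℝ W]

/-- A nondegenerate symmetric form and an orthogonal complex structure. -/
structure IsHermitianPair (B : W →L[ℝ] W →L[ℝ] ℝ) (I : W →L[ℝ] W) : Prop where
  symm : ∀ u v, B u v = B v u
  nondeg : ∀ u, (∀ v, B u v = 0) → u = 0
  isom : ∀ u v, B (I u) (I v) = B u v
  sq : ∀ u, I (I u) = -u

theorem IsHermitianPair.skew {B : W →L[ℝ] W →L[ℝ] ℝ} {I : W →L[ℝ] W} (h : IsHermitianPair B I)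
    (u v : W) : B (I u) v = -B u (I v) := by
  rw [← h.isom u (I v), h.sq]; simp

theorem fderiv_fun_linear_comp {X Y Z : Type*} [NormedAddCommGroup X] [NormedSpace ℝ X]
    [NormedAddCommGroup Y] [NormedSpace ℝ Y] [NormedAddCommGroup Z] [NormedSpace ℝ Z]
    (L : Y →L[ℝ] Z) {f : X → Y} {x : X} (hf : DifferentiableAt ℝ f x) :
    fderiv ℝ (fun y => L (f y)) x = L.comp (fderiv ℝ f x) :=
  (L.hasFDerivAt.comp x hf.hasFDerivAt).fderiv

/-- A parametrized hypersurface `F` of the quadric `B z z = 1 / κ` with unit normal `η`, such that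
the constant field `V` generates the complex phase. The field `ℓ` is the left inverse of the
differential of `F` that vanishes on `F` and `η`. -/
structure IsLift (B : W →L[ℝ] W →L[ℝ] ℝ) (I : W →L[ℝ] W) (κ : ℝ) (Ω : Set E) (F η : E → W)
    (ℓ : E → W →L[ℝ] E) (V : E) : Prop where
  pair : IsHermitianPair B I
  isOpen : IsOpen Ω
  κ_ne : κ ≠ 0
  F_smooth : ContDiffOn ℝ ∞ F Ω
  η_smooth : ContDiffOn ℝ ∞ η Ω
  ℓ_smooth : ContDiffOn ℝ ∞ ℓ Ω
  F_F : ∀ x ∈ Ω, B (F x) (F x) = κ⁻¹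
  η_η : ∀ x ∈ Ω, B (η x) (η x) = 1
  F_η : ∀ x ∈ Ω, B (F x) (η x) = 0
  η_dF : ∀ x ∈ Ω, ∀ v, B (η x) (fderiv ℝ F x v) = 0
  dF_V : ∀ x ∈ Ω, fderiv ℝ F x V = I (F x)
  dη_V : ∀ x ∈ Ω, fderiv ℝ η x V = I (η x)
  ℓ_dF : ∀ x ∈ Ω, ∀ v, ℓ x (fderiv ℝ F x v) = v
  dF_ℓ : ∀ x ∈ Ω, ∀ w, fderiv ℝ F x (ℓ x w) = w - (κ * B w (F x)) • F x - B w (η x) • η x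

/-- The metric induced by `F`. -/
def liftMetric (B : W →L[ℝ] W →L[ℝ] ℝ) (F : E → W) (x : E) : E →L[ℝ] E →L[ℝ] ℝ :=
  B.bilinearComp (fderiv ℝ F x) (fderiv ℝ F x)

/-- The Christoffel symbols induced by `F`. -/
def liftGamma (F : E → W) (ℓ : E → W →L[ℝ] E) (x : E) : E →L[ℝ] E →L[ℝ] E :=
  (ContinuousLinearMap.compL ℝ E W E (ℓ x)).comp (fderiv ℝ (fderiv ℝ F) x)

/-- The shape operator induced by the normal field `η`. -/
def liftShape (η : E → W) (ℓ : E → W →L[ℝ] E) (x : E) : E →L[ℝ] E :=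
  -(ℓ x).comp (fderiv ℝ η x)

/-- The tangential part of the complex structure. -/
def liftPhi (I : W →L[ℝ] W) (F : E → W) (ℓ : E → W →L[ℝ] E) (x : E) : E →L[ℝ] E :=
  (ℓ x).comp (I.comp (fderiv ℝ F x))

theorem liftMetric_apply (B : W →L[ℝ] W →L[ℝ] ℝ) (F : E → W) (x u v : E) :
    liftMetric B F x u v = B (fderiv ℝ F x u) (fderiv ℝ F x v) := rfl

theorem liftGamma_apply (F : E → W) (ℓ : E → W →L[ℝ] E) (x u v : E) :
    liftGamma F ℓ x u v = ℓ x (fderiv ℝ (fderiv ℝ F) x u v) := rfl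

theorem liftShape_apply (η : E → W) (ℓ : E → W →L[ℝ] E) (x u : E) :
    liftShape η ℓ x u = -ℓ x (fderiv ℝ η x u) := rfl

theorem liftPhi_apply (I : W →L[ℝ] W) (F : E → W) (ℓ : E → W →L[ℝ] E) (x u : E) :
    liftPhi I F ℓ x u = ℓ x (I (fderiv ℝ F x u)) := rfl

namespace IsLift

variable {B : W →L[ℝ] W →L[ℝ] ℝ} {I : W →L[ℝ] W} {κ : ℝ} {Ω : Set E} {F η : E → W}
  {ℓ : E → W →L[ℝ] E} {V : E}

theorem diffAt {Z : Type*} [NormedAddCommGroup Z] [NormedSpace ℝ Z] {f : E → Z} {x : E}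
    (h : IsLift B I κ Ω F η ℓ V) (hx : x ∈ Ω) (hf : ContDiffOn ℝ ∞ f Ω) :
    DifferentiableAt ℝ f x :=
  (hf.contDiffAt (h.isOpen.mem_nhds hx)).differentiableAt (by simp)

theorem dF_smooth (h : IsLift B I κ Ω F η ℓ V) : ContDiffOn ℝ ∞ (fderiv ℝ F) Ω :=
  h.F_smooth.fderiv_of_isOpen h.isOpen (by simp)

theorem dη_smooth (h : IsLift B I κ Ω F η ℓ V) : ContDiffOn ℝ ∞ (fderiv ℝ η) Ω :=
  h.η_smooth.fderiv_of_isOpen h.isOpen (by simp)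

theorem fderiv_B (h : IsLift B I κ Ω F η ℓ V) {x : E} (hx : x ∈ Ω) {f g : E → W}
    (hf : ContDiffOn ℝ ∞ f Ω) (hg : ContDiffOn ℝ ∞ g Ω) (X : E) :
    fderiv ℝ (fun y => B (f y) (g y)) x X =
      B (fderiv ℝ f x X) (g x) + B (f x) (fderiv ℝ g x X) := by
  have h1 : DifferentiableAt ℝ (fun y => B (f y)) x := B.differentiableAt.comp x (h.diffAt hx hf)
  rw [fderiv_clm_apply h1 (h.diffAt hx hg)]
  have : fderiv ℝ (fun y => B (f y)) x = B.comp (fderiv ℝ f x) :=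
    fderiv_fun_linear_comp B (h.diffAt hx hf)
  rw [this]
  simp [add_comm]

theorem fderiv_B_const (h : IsLift B I κ Ω F η ℓ V) {x : E} (hx : x ∈ Ω) {f g : E → W}
    (hf : ContDiffOn ℝ ∞ f Ω) (hg : ContDiffOn ℝ ∞ g Ω) {r : ℝ}
    (hr : ∀ y ∈ Ω, B (f y) (g y) = r) (X : E) :
    B (fderiv ℝ f x X) (g x) = -B (f x) (fderiv ℝ g x X) := by
  have h1 := h.fderiv_B hx hf hg X
  have h2 : (fun y => B (f y) (g y)) =ᶠ[nhds x] fun _ => r := by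
    filter_upwards [h.isOpen.mem_nhds hx] with y hy using hr y hy
  rw [h2.fderiv_eq] at h1
  simp only [fderiv_const_apply, _root_.zero_apply] at h1
  linarith

theorem fderiv_eq_of_eqOn (h : IsLift B I κ Ω F η ℓ V) {Z : Type*} [NormedAddCommGroup Z]
    [NormedSpace ℝ Z] {x : E} (hx : x ∈ Ω) {f g : E → Z} (hfg : ∀ y ∈ Ω, f y = g y) :
    fderiv ℝ f x = fderiv ℝ g x :=
  Filter.EventuallyEq.fderiv_eq (by
    filter_upwards [h.isOpen.mem_nhds hx] with y hy using hfg y hy)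

theorem dF_F (h : IsLift B I κ Ω F η ℓ V) {x : E} (hx : x ∈ Ω) (u : E) :
    B (fderiv ℝ F x u) (F x) = 0 := by
  have := h.fderiv_B_const hx h.F_smooth h.F_smooth h.F_F u
  rw [h.pair.symm (F x)] at this
  linarith

theorem dη_η (h : IsLift B I κ Ω F η ℓ V) {x : E} (hx : x ∈ Ω) (u : E) :
    B (fderiv ℝ η x u) (η x) = 0 := by
  have := h.fderiv_B_const hx h.η_smooth h.η_smooth h.η_η u
  rw [h.pair.symm (η x)] at this
  linarith

theorem dη_F (h : IsLift B I κ Ω F η ℓ V) {x : E} (hx : x ∈ Ω) (u : E) :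
    B (fderiv ℝ η x u) (F x) = 0 := by
  have := h.fderiv_B_const hx h.F_smooth h.η_smooth h.F_η u
  rw [h.pair.symm _ (η x), h.η_dF x hx, h.pair.symm (F x)] at this
  linarith

theorem dF_injective (h : IsLift B I κ Ω F η ℓ V) {x : E} (hx : x ∈ Ω) {u v : E}
    (huv : fderiv ℝ F x u = fderiv ℝ F x v) : u = v := by
  rw [← h.ℓ_dF x hx u, huv, h.ℓ_dF x hx]

theorem ℓ_F (h : IsLift B I κ Ω F η ℓ V) {x : E} (hx : x ∈ Ω) : ℓ x (F x) = 0 := by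
  apply h.dF_injective hx
  rw [h.dF_ℓ x hx, h.F_F x hx, h.F_η x hx, mul_inv_cancel₀ h.κ_ne]
  simp

theorem ℓ_η (h : IsLift B I κ Ω F η ℓ V) {x : E} (hx : x ∈ Ω) : ℓ x (η x) = 0 := by
  apply h.dF_injective hx
  rw [h.dF_ℓ x hx, h.η_η x hx, h.pair.symm, h.F_η x hx]
  simp

theorem dF_shape (h : IsLift B I κ Ω F η ℓ V) {x : E} (hx : x ∈ Ω) (u : E) :
    fderiv ℝ F x (liftShape η ℓ x u) = -fderiv ℝ η x u := by
  rw [liftShape_apply, map_neg, h.dF_ℓ x hx, h.dη_F hx, h.dη_η hx]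
  simp

theorem ℓ_dη (_ : IsLift B I κ Ω F η ℓ V) {x : E} (u : E) :
    ℓ x (fderiv ℝ η x u) = -liftShape η ℓ x u := by
  rw [liftShape_apply, neg_neg]

theorem dF_shape_V (h : IsLift B I κ Ω F η ℓ V) {x : E} (hx : x ∈ Ω) :
    fderiv ℝ F x (liftShape η ℓ x V) = -I (η x) := by
  rw [h.dF_shape hx, h.dη_V x hx]

theorem ℓ_I_η (h : IsLift B I κ Ω F η ℓ V) {x : E} (hx : x ∈ Ω) :
    ℓ x (I (η x)) = -liftShape η ℓ x V := by
  rw [← h.dη_V x hx, h.ℓ_dη]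

theorem ℓ_I_F (h : IsLift B I κ Ω F η ℓ V) {x : E} (hx : x ∈ Ω) : ℓ x (I (F x)) = V := by
  rw [← h.dF_V x hx, h.ℓ_dF x hx]

theorem I_dF_F (h : IsLift B I κ Ω F η ℓ V) {x : E} (hx : x ∈ Ω) (u : E) :
    B (I (fderiv ℝ F x u)) (F x) = -liftMetric B F x u V := by
  rw [h.pair.skew, liftMetric_apply, h.dF_V x hx]

theorem I_dF_η (h : IsLift B I κ Ω F η ℓ V) {x : E} (hx : x ∈ Ω) (u : E) :
    B (I (fderiv ℝ F x u)) (η x) = liftMetric B F x u (liftShape η ℓ x V) := by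
  rw [h.pair.skew, liftMetric_apply, h.dF_shape_V hx, map_neg]

theorem dF_phi (h : IsLift B I κ Ω F η ℓ V) {x : E} (hx : x ∈ Ω) (u : E) :
    fderiv ℝ F x (liftPhi I F ℓ x u) = I (fderiv ℝ F x u)
      + (κ * liftMetric B F x u V) • F x - liftMetric B F x u (liftShape η ℓ x V) • η x := by
  rw [liftPhi_apply, h.dF_ℓ x hx, h.I_dF_F hx, h.I_dF_η hx]
  module

theorem snd_symm (h : IsLift B I κ Ω F η ℓ V) {x : E} (hx : x ∈ Ω) (u v : E) :
    fderiv ℝ (fderiv ℝ F) x u v = fderiv ℝ (fderiv ℝ F) x v u :=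
  (((h.F_smooth.contDiffAt (h.isOpen.mem_nhds hx)).of_le (m := 2)
    two_le_infty).isSymmSndFDerivAt (by simp)) u v

theorem fderiv_dF_apply (h : IsLift B I κ Ω F η ℓ V) {x : E} (hx : x ∈ Ω) {Z : E → E}
    (hZ : ContDiffOn ℝ ∞ Z Ω) (X : E) :
    fderiv ℝ (fun y => fderiv ℝ F y (Z y)) x X =
      fderiv ℝ (fderiv ℝ F) x X (Z x) + fderiv ℝ F x (fderiv ℝ Z x X) := by
  rw [fderiv_clm_apply (h.diffAt hx h.dF_smooth) (h.diffAt hx hZ)]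
  simp [add_comm]

theorem snd_F (h : IsLift B I κ Ω F η ℓ V) {x : E} (hx : x ∈ Ω) (u v : E) :
    B (fderiv ℝ (fderiv ℝ F) x u v) (F x) = -liftMetric B F x u v := by
  have := h.fderiv_B_const hx (h.dF_smooth.clm_apply contDiffOn_const) h.F_smooth
    (fun y hy => h.dF_F hy v) u
  rw [h.fderiv_dF_apply hx contDiffOn_const] at this
  simp only [fderiv_const_apply, _root_.zero_apply, map_zero, add_zero] at this
  rw [this, h.pair.symm, liftMetric_apply]

theorem snd_η (h : IsLift B I κ Ω F η ℓ V) {x : E} (hx : x ∈ Ω) (u v : E) :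
    B (fderiv ℝ (fderiv ℝ F) x u v) (η x) = liftMetric B F x (liftShape η ℓ x u) v := by
  have := h.fderiv_B_const hx (h.dF_smooth.clm_apply contDiffOn_const) h.η_smooth
    (fun y hy => (h.pair.symm _ _).trans (h.η_dF y hy v)) u
  rw [h.fderiv_dF_apply hx contDiffOn_const] at this
  simp only [fderiv_const_apply, _root_.zero_apply, map_zero, add_zero] at this
  rw [this, liftMetric_apply, h.dF_shape hx, h.pair.symm]
  simp

/-- The Gauss formula. -/
theorem snd_eq (h : IsLift B I κ Ω F η ℓ V) {x : E} (hx : x ∈ Ω) (u v : E) :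
    fderiv ℝ (fderiv ℝ F) x u v = fderiv ℝ F x (liftGamma F ℓ x u v)
      - (κ * liftMetric B F x u v) • F x + liftMetric B F x (liftShape η ℓ x u) v • η x := by
  rw [liftGamma_apply, h.dF_ℓ x hx, h.snd_F hx, h.snd_η hx]
  module

theorem liftMetric_smooth (h : IsLift B I κ Ω F η ℓ V) : ContDiffOn ℝ ∞ (liftMetric B F) Ω := by
  have h1 : ContDiffOn ℝ ∞ (fun x => (ContinuousLinearMap.compL ℝ E W ℝ).flip (fderiv ℝ F x)) Ω :=
    (ContinuousLinearMap.contDiff _).comp_contDiffOn h.dF_smooth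
  exact h1.clm_comp (contDiffOn_const.clm_comp h.dF_smooth)

theorem liftGamma_smooth (h : IsLift B I κ Ω F η ℓ V) : ContDiffOn ℝ ∞ (liftGamma F ℓ) Ω := by
  have h1 : ContDiffOn ℝ ∞ (fun x => ContinuousLinearMap.compL ℝ E W E (ℓ x)) Ω :=
    (ContinuousLinearMap.contDiff _).comp_contDiffOn h.ℓ_smooth
  exact h1.clm_comp (h.dF_smooth.fderiv_of_isOpen h.isOpen (by simp))

theorem liftShape_smooth (h : IsLift B I κ Ω F η ℓ V) : ContDiffOn ℝ ∞ (liftShape η ℓ) Ω :=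
  (h.ℓ_smooth.clm_comp h.dη_smooth).neg

theorem liftPhi_smooth (h : IsLift B I κ Ω F η ℓ V) : ContDiffOn ℝ ∞ (liftPhi I F ℓ) Ω :=
  h.ℓ_smooth.clm_comp (contDiffOn_const.clm_comp h.dF_smooth)

theorem shape_symm (h : IsLift B I κ Ω F η ℓ V) {x : E} (hx : x ∈ Ω) (u v : E) :
    liftMetric B F x (liftShape η ℓ x u) v = liftMetric B F x u (liftShape η ℓ x v) := by
  rw [← h.snd_η hx, h.snd_symm hx, h.snd_η hx, liftMetric_apply, liftMetric_apply, h.pair.symm]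

theorem gamma_symm (h : IsLift B I κ Ω F η ℓ V) {x : E} (hx : x ∈ Ω) (u v : E) :
    liftGamma F ℓ x u v = liftGamma F ℓ x v u := by
  rw [liftGamma_apply, h.snd_symm hx, liftGamma_apply]

theorem cov_eq (h : IsLift B I κ Ω F η ℓ V) {x : E} (hx : x ∈ Ω) {Z : E → E}
    (hZ : ContDiffOn ℝ ∞ Z Ω) (X : E) :
    cov (liftGamma F ℓ) Z x X = ℓ x (fderiv ℝ (fun y => fderiv ℝ F y (Z y)) x X) := by
  rw [h.fderiv_dF_apply hx hZ, map_add, h.ℓ_dF x hx, cov, liftGamma_apply, add_comm]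

theorem covOp_shape (h : IsLift B I κ Ω F η ℓ V) {x : E} (hx : x ∈ Ω) (X Y : E) :
    covOp (liftGamma F ℓ) (liftShape η ℓ) x X Y = -ℓ x (fderiv ℝ (fderiv ℝ η) x X Y)
      - liftShape η ℓ x (liftGamma F ℓ x X Y) := by
  have h1 := h.cov_eq hx (h.liftShape_smooth.clm_apply (contDiffOn_const (c := Y))) X
  rw [cov_op_apply (h.diffAt hx h.liftShape_smooth) (differentiableAt_const Y),
    h.fderiv_eq_of_eqOn hx (fun y hy => h.dF_shape hy Y), fderiv_fun_neg,
    fderiv_clm_apply (h.diffAt hx h.dη_smooth) (differentiableAt_const Y)] at h1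
  simp only [cov, fderiv_fun_const, Pi.zero_apply, _root_.zero_apply, zero_add,
    ContinuousLinearMap.comp_zero, ContinuousLinearMap.flip_apply, _root_.neg_apply, map_neg] at h1
  rw [← h1]
  abel

/-- Both terms of `covOp_shape` are symmetric: one is a second derivative of η, the other a
Christoffel symbol. -/
theorem codazzi (h : IsLift B I κ Ω F η ℓ V) {x : E} (hx : x ∈ Ω) (X Y : E) :
    covOp (liftGamma F ℓ) (liftShape η ℓ) x X Y = covOp (liftGamma F ℓ) (liftShape η ℓ) x Y X := by
  have hs : fderiv ℝ (fderiv ℝ η) x X Y = fderiv ℝ (fderiv ℝ η) x Y X :=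
    (((h.η_smooth.contDiffAt (h.isOpen.mem_nhds hx)).of_le (m := 2)
      two_le_infty).isSymmSndFDerivAt (by simp)) X Y
  rw [h.covOp_shape hx, h.covOp_shape hx, hs, h.gamma_symm hx]

/-- Differentiate dF(φY) = I dF(Y) + (multiples of F and η) and apply ℓ. The structure I is
constant, so only the normal components in the Gauss formula and the derivatives of F and η
contribute. -/
theorem covOp_phi (h : IsLift B I κ Ω F η ℓ V) {x : E} (hx : x ∈ Ω) (X Y : E) :
    covOp (liftGamma F ℓ) (liftPhi I F ℓ) x X Y =
    -(liftMetric B F x (liftShape η ℓ x X) Y • liftShape η ℓ x V)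
      - (κ * liftMetric B F x X Y) • V
      + liftMetric B F x Y (liftShape η ℓ x V) • liftShape η ℓ x X
      + (κ * liftMetric B F x Y V) • X := by
  have h1 := h.cov_eq hx (h.liftPhi_smooth.clm_apply (contDiffOn_const (c := Y))) X
  have hG : ∀ Z : E → E, ContDiffOn ℝ ∞ Z Ω →
      DifferentiableAt ℝ (fun y => liftMetric B F y Y (Z y)) x := fun Z hZ =>
    h.diffAt hx ((h.liftMetric_smooth.clm_apply contDiffOn_const).clm_apply hZ)
  have hF := h.diffAt hx h.F_smooth
  have hη := h.diffAt hx h.η_smooth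
  have hd : DifferentiableAt ℝ (fun y => fderiv ℝ F y Y) x :=
    h.diffAt hx (h.dF_smooth.clm_apply contDiffOn_const)
  have hV := hG _ (contDiffOn_const (c := V))
  have hSV := hG _ (h.liftShape_smooth.clm_apply (contDiffOn_const (c := V)))
  have hI : DifferentiableAt ℝ (fun y => I (fderiv ℝ F y Y)) x := I.differentiableAt.comp x hd
  have hVκ : DifferentiableAt ℝ (fun y => κ * liftMetric B F y Y V) x := hV.const_mul κ
  have hVF : DifferentiableAt ℝ (fun y => (κ * liftMetric B F y Y V) • F y) x := hVκ.smul hF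
  have hSVη : DifferentiableAt ℝ (fun y => liftMetric B F y Y (liftShape η ℓ y V) • η y) x :=
    hSV.smul hη
  rw [cov_op_apply (h.diffAt hx h.liftPhi_smooth) (differentiableAt_const Y),
    h.fderiv_eq_of_eqOn hx (fun y hy => h.dF_phi hy Y), fderiv_fun_sub (hI.fun_add hVF) hSVη,
    fderiv_fun_add hI hVF, fderiv_fun_smul hVκ hF, fderiv_fun_smul hSV hη,
    fderiv_const_mul hV, fderiv_fun_linear_comp I hd] at h1
  simp only [_root_.add_apply, _root_.sub_apply, _root_.smul_apply,
    ContinuousLinearMap.smulRight_apply, map_add, map_sub, map_smul, h.ℓ_F hx, h.ℓ_η hx,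
    smul_zero, add_zero, h.ℓ_dF x hx, h.ℓ_dη, ContinuousLinearMap.comp_apply] at h1
  rw [h.fderiv_dF_apply hx contDiffOn_const] at h1
  simp only [cov, fderiv_const_apply, _root_.zero_apply, map_zero, zero_add, add_zero,
    h.snd_eq hx, map_add, map_sub, map_smul, h.ℓ_I_F hx, h.ℓ_I_η hx, ← liftPhi_apply] at h1
  linear_combination (norm := module) h1

/-- The second derivative of y ↦ dF(Z) is symmetric in X and Y. Its tangential part, computed with
the Gauss formula in `key`, is the Christoffel expression minus the curvature terms. -/
theorem gauss (h : IsLift B I κ Ω F η ℓ V) {x : E} (hx : x ∈ Ω) (X Y Z : E) :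
    fderiv ℝ (liftGamma F ℓ) x X Y Z + liftGamma F ℓ x X (liftGamma F ℓ x Y Z)
      - (fderiv ℝ (liftGamma F ℓ) x Y X Z + liftGamma F ℓ x Y (liftGamma F ℓ x X Z)) =
    κ • (liftMetric B F x Y Z • X - liftMetric B F x X Z • Y)
      + liftMetric B F x (liftShape η ℓ x Y) Z • liftShape η ℓ x X
      - liftMetric B F x (liftShape η ℓ x X) Z • liftShape η ℓ x Y := by
  have hF := h.diffAt hx h.F_smooth
  have hη := h.diffAt hx h.η_smooth
  have hg : ContDiffOn ℝ ∞ (fun y => fderiv ℝ F y Z) Ω := h.dF_smooth.clm_apply contDiffOn_const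
  have key : ∀ X Y : E, ℓ x (fderiv ℝ (fderiv ℝ (fun y => fderiv ℝ F y Z)) x X Y) =
      fderiv ℝ (liftGamma F ℓ) x X Y Z + liftGamma F ℓ x X (liftGamma F ℓ x Y Z)
        - (κ * liftMetric B F x Y Z) • X
        - liftMetric B F x (liftShape η ℓ x Y) Z • liftShape η ℓ x X := by
    intro X Y
    have hΓ : ContDiffOn ℝ ∞ (fun y => liftGamma F ℓ y Y Z) Ω :=
      (h.liftGamma_smooth.clm_apply contDiffOn_const).clm_apply contDiffOn_const
    have hG : DifferentiableAt ℝ (fun y => liftMetric B F y Y Z) x :=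
      h.diffAt hx ((h.liftMetric_smooth.clm_apply contDiffOn_const).clm_apply contDiffOn_const)
    have hGS : DifferentiableAt ℝ (fun y => liftMetric B F y (liftShape η ℓ y Y) Z) x :=
      h.diffAt hx ((h.liftMetric_smooth.clm_apply
        (h.liftShape_smooth.clm_apply contDiffOn_const)).clm_apply contDiffOn_const)
    have e1 : fderiv ℝ (fderiv ℝ (fun y => fderiv ℝ F y Z)) x X Y =
        fderiv ℝ (fun y => fderiv ℝ (fun y => fderiv ℝ F y Z) y Y) x X := by
      rw [fderiv_clm_apply (h.diffAt hx (hg.fderiv_of_isOpen h.isOpen (m := ∞) (by simp)))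
        (differentiableAt_const Y)]
      simp
    have e2 : ∀ y ∈ Ω, fderiv ℝ (fun y => fderiv ℝ F y Z) y Y =
        fderiv ℝ F y (liftGamma F ℓ y Y Z)
      - (κ * liftMetric B F y Y Z) • F y + liftMetric B F y (liftShape η ℓ y Y) Z • η y := by
      intro y hy
      rw [← h.snd_eq hy, h.fderiv_dF_apply hy contDiffOn_const]
      simp
    have hd : DifferentiableAt ℝ (fun y => fderiv ℝ F y (liftGamma F ℓ y Y Z)) x :=
      h.diffAt hx (h.dF_smooth.clm_apply hΓ)
    have hGκ : DifferentiableAt ℝ (fun y => κ * liftMetric B F y Y Z) x := hG.const_mul κ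
    have hGF : DifferentiableAt ℝ (fun y => (κ * liftMetric B F y Y Z) • F y) x := hGκ.smul hF
    have hGη : DifferentiableAt ℝ (fun y => liftMetric B F y (liftShape η ℓ y Y) Z • η y) x :=
      hGS.smul hη
    rw [e1, h.fderiv_eq_of_eqOn hx e2, fderiv_fun_add (hd.fun_sub hGF) hGη,
      fderiv_fun_sub hd hGF, fderiv_fun_smul hGκ hF, fderiv_fun_smul hGS hη]
    simp only [_root_.add_apply, _root_.sub_apply, _root_.smul_apply,
      ContinuousLinearMap.smulRight_apply, map_add, map_sub, map_smul, h.ℓ_F hx, h.ℓ_η hx,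
      smul_zero, add_zero, h.ℓ_dF x hx, h.ℓ_dη]
    rw [← h.cov_eq hx hΓ, cov, fderiv_clm_apply (h.diffAt hx
      (h.liftGamma_smooth.clm_apply (contDiffOn_const (c := Y)))) (differentiableAt_const Z),
      fderiv_clm_apply (h.diffAt hx h.liftGamma_smooth) (differentiableAt_const Y)]
    simp only [fderiv_fun_const, Pi.zero_apply, ContinuousLinearMap.comp_zero, zero_add,
      ContinuousLinearMap.flip_apply]
    module
  have hs : fderiv ℝ (fderiv ℝ (fun y => fderiv ℝ F y Z)) x X Y =
      fderiv ℝ (fderiv ℝ (fun y => fderiv ℝ F y Z)) x Y X :=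
    (((hg.contDiffAt (h.isOpen.mem_nhds hx)).of_le (m := 2)
      two_le_infty).isSymmSndFDerivAt (by simp)) X Y
  have e := key X Y
  rw [hs, key Y X] at e
  linear_combination (norm := module) -e

theorem compat (h : IsLift B I κ Ω F η ℓ V) {x : E} (hx : x ∈ Ω) (X u v : E) :
    fderiv ℝ (liftMetric B F) x X u v = liftMetric B F x (liftGamma F ℓ x X u) v
      + liftMetric B F x u (liftGamma F ℓ x X v) := by
  have e : fderiv ℝ (liftMetric B F) x X u v = fderiv ℝ (fun y => liftMetric B F y u v) x X := by
    rw [fderiv_clm_apply (h.diffAt hx (h.liftMetric_smooth.clm_apply (contDiffOn_const (c := u))))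
      (differentiableAt_const v),
      fderiv_clm_apply (h.diffAt hx h.liftMetric_smooth) (differentiableAt_const u)]
    simp
  rw [e]
  have h2 := h.fderiv_B hx (h.dF_smooth.clm_apply (contDiffOn_const (c := u)))
    (h.dF_smooth.clm_apply (contDiffOn_const (c := v))) X
  rw [h.fderiv_dF_apply hx contDiffOn_const, h.fderiv_dF_apply hx contDiffOn_const] at h2
  have h3 : (fun y => liftMetric B F y u v) = fun y => B (fderiv ℝ F y u) (fderiv ℝ F y v) := rfl
  rw [h3, h2]
  simp only [fderiv_const_apply, _root_.zero_apply, map_zero, add_zero, h.snd_eq hx, map_add,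
    map_sub, map_smul, _root_.add_apply, _root_.sub_apply, _root_.smul_apply, smul_eq_mul,
    h.dF_F hx, h.pair.symm (F x), h.η_dF x hx, h.pair.symm _ (η x), liftMetric_apply]
  ring

theorem isModel (h : IsLift B I κ Ω F η ℓ V) :
    IsModel κ Ω (liftMetric B F) (liftGamma F ℓ) (liftShape η ℓ) (liftPhi I F ℓ) V where
  isOpen := h.isOpen
  G_smooth := h.liftMetric_smooth
  Γ_smooth := h.liftGamma_smooth
  S_smooth := h.liftShape_smooth
  φ_smooth := h.liftPhi_smooth
  κ_ne := h.κ_ne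
  symm x _ u v := by rw [liftMetric_apply, liftMetric_apply, h.pair.symm]
  nondeg x hx u hu := by
    apply h.dF_injective hx
    rw [map_zero]
    refine h.pair.nondeg _ fun w => ?_
    have h1 := hu (ℓ x w)
    rw [liftMetric_apply, h.dF_ℓ x hx] at h1
    simpa [h.dF_F hx, h.pair.symm _ (η x), h.η_dF x hx] using h1
  compat x hx := h.compat hx
  Γ_symm x hx := h.gamma_symm hx
  S_symm x hx := h.shape_symm hx
  φ_skew x hx u v := by
    have h1 : ∀ u v, liftMetric B F x (liftPhi I F ℓ x u) v =
        B (I (fderiv ℝ F x u)) (fderiv ℝ F x v) := by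
      intro u v
      rw [liftMetric_apply, h.dF_phi hx]
      simp [h.pair.symm (F x), h.dF_F hx, h.η_dF x hx]
    have h2 : liftMetric B F x u (liftPhi I F ℓ x v) =
        liftMetric B F x (liftPhi I F ℓ x v) u := by
      rw [liftMetric_apply, liftMetric_apply, h.pair.symm]
    rw [h2, h1, h1, h.pair.skew, h.pair.symm]
  codazzi x hx := h.codazzi hx
  cov_V x hx X := by
    rw [liftPhi_apply, liftGamma_apply]
    have h1 := h.fderiv_dF_apply hx (contDiffOn_const (c := V)) X
    rw [h.fderiv_eq_of_eqOn hx (fun y hy => h.dF_V y hy),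
      fderiv_fun_linear_comp I (h.diffAt hx h.F_smooth)] at h1
    simp only [fderiv_const_apply, _root_.zero_apply, map_zero, add_zero,
      ContinuousLinearMap.comp_apply] at h1
    rw [h1]
  cov_SV x hx X := by
    rw [h.cov_eq hx (h.liftShape_smooth.clm_apply contDiffOn_const),
      h.fderiv_eq_of_eqOn hx (fun y hy => h.dF_shape_V hy), fderiv_fun_neg,
      fderiv_fun_linear_comp I (h.diffAt hx h.η_smooth), liftPhi_apply, h.dF_shape hx]
    simp
  cov_φ x hx := h.covOp_phi hx
  φ_V x hx := by rw [liftPhi_apply, h.dF_V x hx, h.pair.sq, map_neg, h.ℓ_F hx, neg_zero]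
  φ_SV x hx := by
    rw [liftPhi_apply, h.dF_shape_V hx, map_neg, h.pair.sq, neg_neg, h.ℓ_η hx]
  φ_φ x hx u := by
    rw [liftPhi_apply, h.dF_phi hx]
    simp only [map_add, map_sub, map_smul, h.pair.sq, map_neg, h.ℓ_dF x hx, h.ℓ_I_F hx,
      h.ℓ_I_η hx]
    module
  V_V x hx := by rw [liftMetric_apply, h.dF_V x hx, h.pair.isom, h.F_F x hx]
  V_SV x hx := by
    rw [liftMetric_apply, h.dF_shape_V hx, h.dF_V x hx, map_neg, h.pair.isom, h.F_η x hx,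
      neg_zero]
  SV_SV x hx := by
    rw [liftMetric_apply, h.dF_shape_V hx]
    simp [h.pair.isom, h.η_η x hx]
  gauss x hx := h.gauss hx

end IsLift

end Lift

/-! ### Hermitian algebra: tangent vectors of the space form and horizontal lifts -/

noncomputable section SpaceFormAlgebra

variable {n : ℕ}

theorem hermForm_eq_sum (c : ℝ) (z w : Fin (n + 1) → ℂ) :
    hermForm c z w = ∑ i, star (z i) * ((if i = 0 ∧ c < 0 then -1 else 1) * w i) := by
  simp [hermForm, gramMatrix, dotProduct, Matrix.mulVec_diagonal]

theorem hermForm_add_left (c : ℝ) (z z' w : Fin (n + 1) → ℂ) :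
    hermForm c (z + z') w = hermForm c z w + hermForm c z' w := by
  simp [hermForm, add_dotProduct]

theorem hermForm_add_right (c : ℝ) (z w w' : Fin (n + 1) → ℂ) :
    hermForm c z (w + w') = hermForm c z w + hermForm c z w' := by
  simp [hermForm, mulVec_add]

theorem hermForm_smul_left (c : ℝ) (a : ℂ) (z w : Fin (n + 1) → ℂ) :
    hermForm c (a • z) w = star a * hermForm c z w := by
  simp [hermForm]

theorem hermForm_smul_right (c : ℝ) (a : ℂ) (z w : Fin (n + 1) → ℂ) :
    hermForm c z (a • w) = a * hermForm c z w := by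
  simp [hermForm, mulVec_smul]

theorem star_hermForm (c : ℝ) (z w : Fin (n + 1) → ℂ) :
    star (hermForm c z w) = hermForm c w z := by
  rw [hermForm_eq_sum, hermForm_eq_sum, star_sum]
  refine Finset.sum_congr rfl fun i _ => ?_
  split_ifs <;> simp [mul_comm]

theorem hermForm_self_im (c : ℝ) (z : Fin (n + 1) → ℂ) : (hermForm c z z).im = 0 := by
  have := congrArg Complex.im (star_hermForm c z z)
  simp at this
  linarith

theorem hermForm_sub_right (c : ℝ) (z w w' : Fin (n + 1) → ℂ) :
    hermForm c z (w - w') = hermForm c z w - hermForm c z w' := by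
  simp [hermForm, mulVec_sub]

theorem rankOne_add_left (c : ℝ) (z z' w : Fin (n + 1) → ℂ) :
    rankOne c (z + z') w = rankOne c z w + rankOne c z' w := by
  simp [rankOne, add_vecMulVec, add_mul]

theorem rankOne_add_right (c : ℝ) (z w w' : Fin (n + 1) → ℂ) :
    rankOne c z (w + w') = rankOne c z w + rankOne c z w' := by
  simp [rankOne, vecMulVec_add, add_mul]

theorem rankOne_smul_left (c : ℝ) (a : ℂ) (z w : Fin (n + 1) → ℂ) :
    rankOne c (a • z) w = a • rankOne c z w := by
  simp [rankOne, smul_vecMulVec]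

theorem rankOne_smul_right (c : ℝ) (a : ℂ) (z w : Fin (n + 1) → ℂ) :
    rankOne c z (a • w) = star a • rankOne c z w := by
  simp [rankOne, vecMulVec_smul]

theorem rankOne_mulVec (c : ℝ) (z w u : Fin (n + 1) → ℂ) :
    rankOne c z w *ᵥ u = hermForm c w u • z := by
  rw [rankOne, ← mulVec_mulVec, vecMulVec_mulVec, hermForm]
  simp

theorem mul_rankOne (c : ℝ) (X : Mat n) (z w : Fin (n + 1) → ℂ) :
    X * rankOne c z w = rankOne c (X *ᵥ z) w := by
  rw [rankOne, ← mul_assoc, mul_vecMulVec, rankOne]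

theorem rankOne_mul_of_selfAdjoint (c : ℝ) {X : Mat n}
    (hX : Xᴴ * gramMatrix n c = gramMatrix n c * X) (z w : Fin (n + 1) → ℂ) :
    rankOne c z w * X = rankOne c z (X *ᵥ w) := by
  rw [rankOne, mul_assoc, ← hX, ← mul_assoc, vecMulVec_mul, rankOne, star_mulVec]

theorem rankOne_selfAdjoint (c : ℝ) (z w : Fin (n + 1) → ℂ) :
    (rankOne c z w + rankOne c w z)ᴴ * gramMatrix n c =
      gramMatrix n c * (rankOne c z w + rankOne c w z) := by
  have hg : (gramMatrix n c)ᴴ = gramMatrix n c := by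
    rw [gramMatrix, diagonal_conjTranspose]
    congr 1
    funext i
    simp only [Pi.star_apply]
    split_ifs <;> simp
  have h : ∀ z w : Fin (n + 1) → ℂ, (rankOne c z w)ᴴ * gramMatrix n c =
      gramMatrix n c * rankOne c w z := by
    intro z w
    rw [rankOne, rankOne, conjTranspose_mul, hg, conjTranspose_vecMulVec, star_star, mul_assoc]
  rw [conjTranspose_add, add_mul, mul_add, h, h, add_comm (gramMatrix n c * rankOne c w z)]

theorem hermForm_gram (c : ℝ) (z : Fin (n + 1) → ℂ) :
    hermForm c (gramMatrix n c *ᵥ z) z = ∑ i, star (z i) * z i := by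
  rw [hermForm_eq_sum]
  refine Finset.sum_congr rfl fun i _ => ?_
  rw [gramMatrix, mulVec_diagonal]
  split_ifs <;> simp

/-- The real part of the Hermitian form. -/
def reForm (n : ℕ) (c : ℝ) : (Fin (n + 1) → ℂ) →L[ℝ] (Fin (n + 1) → ℂ) →L[ℝ] ℝ :=
  (LinearMap.mk₂ ℝ (fun z w => (hermForm c z w).re)
    (fun z z' w => by simp [hermForm_add_left])
    (fun r z w => by
      rw [← Complex.coe_smul r z, hermForm_smul_left]; simp)
    (fun z w w' => by simp [hermForm_add_right])
    (fun r z w => by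
      rw [← Complex.coe_smul r w, hermForm_smul_right]; simp)).toContinuousBilinearMap

theorem reForm_apply (c : ℝ) (z w : Fin (n + 1) → ℂ) : reForm n c z w = (hermForm c z w).re := rfl

/-- Multiplication by `i`. -/
def mulI (n : ℕ) : (Fin (n + 1) → ℂ) →L[ℝ] (Fin (n + 1) → ℂ) :=
  (Complex.I • ContinuousLinearMap.id ℂ (Fin (n + 1) → ℂ)).restrictScalars ℝ

theorem mulI_apply (z : Fin (n + 1) → ℂ) : mulI n z = Complex.I • z := rfl

theorem hermForm_mulI_left (c : ℝ) (z w : Fin (n + 1) → ℂ) :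
    hermForm c (mulI n z) w = -(Complex.I * hermForm c z w) := by
  rw [mulI_apply, hermForm_smul_left]; simp

theorem hermForm_mulI_right (c : ℝ) (z w : Fin (n + 1) → ℂ) :
    hermForm c z (mulI n w) = Complex.I * hermForm c z w := by
  rw [mulI_apply, hermForm_smul_right]

theorem reForm_mulI_right (c : ℝ) (z w : Fin (n + 1) → ℂ) :
    reForm n c z (mulI n w) = (hermForm c w z).im := by
  rw [reForm_apply, hermForm_mulI_right, ← star_hermForm c z w]; simp

theorem isHermitianPair (n : ℕ) (c : ℝ) : IsHermitianPair (reForm n c) (mulI n) where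
  symm u v := by rw [reForm_apply, reForm_apply, ← star_hermForm]; simp
  nondeg u hu := by
    have h := hu (gramMatrix n c *ᵥ u)
    rw [reForm_apply, ← star_hermForm, hermForm_gram] at h
    simp only [Complex.star_def, Complex.conj_re, Complex.re_sum, ← Complex.normSq_eq_conj_mul_self,
      Complex.ofReal_re] at h
    rw [Finset.sum_eq_zero_iff_of_nonneg fun i _ => Complex.normSq_nonneg _] at h
    funext i
    exact Complex.normSq_eq_zero.1 (h i (Finset.mem_univ i))
  isom u v := by
    rw [reForm_apply, reForm_apply, hermForm_mulI_left, hermForm_mulI_right, ← mul_assoc]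
    simp
  sq u := by rw [mulI_apply, mulI_apply, smul_smul]; simp

/-- The Hermitian form is positive definite on the complement of a point of the space form. -/
theorem hermForm_pos_of_orthogonal {c : ℝ} {z w : Fin (n + 1) → ℂ}
    (hz : 0 < c * (hermForm c z z).re) (hzw : hermForm c z w = 0) (hw : w ≠ 0) :
    0 < (hermForm c w w).re := by
  have hre : ∀ z : Fin (n + 1) → ℂ, (hermForm c z z).re =
      (if c < 0 then -1 else 1) * Complex.normSq (z 0)
        + ∑ i : Fin n, Complex.normSq (z i.succ) := by
    intro z
    rw [hermForm_eq_sum, Fin.sum_univ_succ]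
    by_cases hc : c < 0 <;> simp [hc, Fin.succ_ne_zero, Complex.normSq_apply]
  have hpos : 0 < Complex.normSq (w 0) + ∑ i : Fin n, Complex.normSq (w i.succ) := by
    rw [← Fin.sum_univ_succ fun i => Complex.normSq (w i)]
    obtain ⟨i, hi⟩ := Function.ne_iff.1 hw
    exact Finset.sum_pos' (fun i _ => Complex.normSq_nonneg _)
      ⟨i, Finset.mem_univ i, Complex.normSq_pos.2 hi⟩
  rw [hre]
  by_cases hc : c < 0
  swap
  · simpa [hc] using hpos
  rw [hre] at hz
  simp only [hc, if_true] at hz ⊢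
  have hz' : ∑ i : Fin n, Complex.normSq (z i.succ) < Complex.normSq (z 0) := by nlinarith
  have h0 : star (z 0) * w 0 = ∑ i : Fin n, star (z i.succ) * w i.succ := by
    rw [hermForm_eq_sum, Fin.sum_univ_succ] at hzw
    simp only [hc, Fin.succ_ne_zero, and_true, if_true, if_false, one_mul, neg_mul,
      mul_neg] at hzw
    linear_combination -hzw
  -- Cauchy–Schwarz on the last n coordinates of the relation `h0`. As z is negative, its coordinate
  -- 0 dominates the others, so coordinate 0 of w cannot dominate.
  have h1 : Complex.normSq (z 0) * Complex.normSq (w 0) ≤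
      (∑ i : Fin n, Complex.normSq (z i.succ)) * ∑ i : Fin n, Complex.normSq (w i.succ) := by
    have h2 := congrArg (fun x => ‖x‖ ^ 2) h0
    simp only [norm_mul, norm_star, mul_pow, ← Complex.normSq_eq_norm_sq] at h2
    rw [h2, Complex.normSq_eq_norm_sq]
    calc ‖∑ i : Fin n, star (z i.succ) * w i.succ‖ ^ 2
        ≤ (∑ i : Fin n, ‖z i.succ‖ * ‖w i.succ‖) ^ 2 := by
          gcongr
          refine (norm_sum_le _ _).trans (le_of_eq ?_)
          simp
      _ ≤ _ := by
          simp only [Complex.normSq_eq_norm_sq]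
          exact Finset.sum_mul_sq_le_sq_mul_sq _ _ _
  have hA : 0 ≤ ∑ i : Fin n, Complex.normSq (z i.succ) :=
    Finset.sum_nonneg fun i _ => Complex.normSq_nonneg _
  have hB : 0 ≤ ∑ i : Fin n, Complex.normSq (w i.succ) :=
    Finset.sum_nonneg fun i _ => Complex.normSq_nonneg _
  have hD := Complex.normSq_nonneg (w 0)
  by_contra! hle
  have h3 : ∑ i : Fin n, Complex.normSq (w i.succ) ≤ Complex.normSq (w 0) := by linarith
  have h4 : (∑ i : Fin n, Complex.normSq (z i.succ)) * ∑ i : Fin n, Complex.normSq (w i.succ) ≤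
      (∑ i : Fin n, Complex.normSq (z i.succ)) * Complex.normSq (w 0) := by gcongr
  have h5 : Complex.normSq (w 0) = 0 := by
    by_contra h6
    have : 0 < Complex.normSq (w 0) := lt_of_le_of_ne hD (Ne.symm h6)
    nlinarith
  linarith

theorem hermForm_eq_of_reForm {c : ℝ} {F w : Fin (n + 1) → ℂ} (h : reForm n c w F = 0) :
    hermForm c F w = Complex.I * (reForm n c w (mulI n F) : ℝ) := by
  rw [reForm_mulI_right]
  rw [(isHermitianPair n c).symm, reForm_apply] at h
  apply Complex.ext <;> simp [h]

theorem horizontalVec_add (c : ℝ) (F v w : Fin (n + 1) → ℂ) :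
    horizontalVec c F (v + w) = horizontalVec c F v + horizontalVec c F w := by
  rw [horizontalVec, rankOne_add_left, rankOne_add_right, horizontalVec, horizontalVec, ← smul_add]
  congr 1
  abel

theorem horizontalVec_smul (c : ℝ) (F : Fin (n + 1) → ℂ) (r : ℝ) (v : Fin (n + 1) → ℂ) :
    horizontalVec c F (r • v) = r • horizontalVec c F v := by
  rw [horizontalVec, ← Complex.coe_smul r v, rankOne_smul_left, rankOne_smul_right, horizontalVec,
    smul_comm, ← Complex.coe_smul r, smul_add]
  simp

/-- The tangent vector with horizontal lift `v`, as a real linear function of `v`. -/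
def horizontalMap (c : ℝ) (F : Fin (n + 1) → ℂ) : (Fin (n + 1) → ℂ) →ₗ[ℝ] Mat n where
  toFun := horizontalVec c F
  map_add' := horizontalVec_add c F
  map_smul' := horizontalVec_smul c F

theorem horizontalMap_apply (c : ℝ) (F v : Fin (n + 1) → ℂ) :
    horizontalMap c F v = horizontalVec c F v := rfl

/-- The horizontal part of `w` at `F`. -/
def horizontalPart (κ c : ℝ) (F w : Fin (n + 1) → ℂ) : Fin (n + 1) → ℂ :=
  w - (κ * reForm n c w (mulI n F)) • mulI n F

section Pointwise

variable {κ c : ℝ} {F : Fin (n + 1) → ℂ}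

theorem hermForm_horizontalPart (hκ : κ ≠ 0) (hF : hermForm c F F = (κ⁻¹ : ℝ))
    {w : Fin (n + 1) → ℂ} (hw : reForm n c w F = 0) :
    hermForm c F (horizontalPart κ c F w) = 0 := by
  have hκ' : (κ : ℂ) ≠ 0 := by exact_mod_cast hκ
  rw [horizontalPart, hermForm_sub_right, ← Complex.coe_smul, hermForm_smul_right,
    hermForm_mulI_right, hF, hermForm_eq_of_reForm hw]
  push_cast
  field_simp
  ring

theorem horizontalMap_mulI_self (c : ℝ) (F : Fin (n + 1) → ℂ) :
    horizontalMap c F (mulI n F) = 0 := by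
  rw [horizontalMap_apply, horizontalVec, mulI_apply, rankOne_smul_left, rankOne_smul_right]
  simp

theorem horizontalMap_horizontalPart (w : Fin (n + 1) → ℂ) :
    horizontalMap c F (horizontalPart κ c F w) = horizontalMap c F w := by
  rw [horizontalPart, map_sub, map_smul, horizontalMap_mulI_self, smul_zero, sub_zero]

theorem hermForm_swap_zero {z w : Fin (n + 1) → ℂ} (h : hermForm c z w = 0) :
    hermForm c w z = 0 := by
  rw [← star_hermForm, h, star_zero]

theorem horizontalVec_mulVec (hκ : κ ≠ 0) (hF : hermForm c F F = (κ⁻¹ : ℝ))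
    {w : Fin (n + 1) → ℂ} (hw : hermForm c F w = 0) : horizontalVec c F w *ᵥ F = w := by
  have hκ' : (κ : ℂ) ≠ 0 := by exact_mod_cast hκ
  rw [horizontalVec, smul_mulVec, add_mulVec, rankOne_mulVec, rankOne_mulVec,
    hermForm_swap_zero hw, hF, zero_smul, add_zero, smul_smul]
  push_cast
  rw [inv_mul_cancel₀ (inv_ne_zero hκ'), one_smul]

theorem reForm_horizontalPart (hκ : κ ≠ 0) (hF : hermForm c F F = (κ⁻¹ : ℝ))
    (v w : Fin (n + 1) → ℂ) :
    reForm n c (horizontalPart κ c F v) (horizontalPart κ c F w) =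
      reForm n c v w - κ * reForm n c v (mulI n F) * reForm n c w (mulI n F) := by
  have hp := isHermitianPair n c
  have h1 : reForm n c F F = κ⁻¹ := by rw [reForm_apply, hF, Complex.ofReal_re]
  simp only [horizontalPart, map_sub, map_smul, _root_.sub_apply, _root_.smul_apply, smul_eq_mul,
    hp.isom, h1, hp.symm (mulI n F) w]
  field_simp
  ring

theorem ambientMetric_horizontalMap (hκ : κ = c / 4) (hc : c ≠ 0)
    (hF : hermForm c F F = (κ⁻¹ : ℝ)) {v w : Fin (n + 1) → ℂ} (hv : reForm n c v F = 0)
    (hw : reForm n c w F = 0) :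
    ambientMetric c (horizontalMap c F v) (horizontalMap c F w) =
      reForm n c v w - κ * reForm n c v (mulI n F) * reForm n c w (mulI n F) := by
  have hκ0 : κ ≠ 0 := by rw [hκ]; positivity
  have hκ' : (κ : ℂ) ≠ 0 := by exact_mod_cast hκ0
  have h1 := hermForm_horizontalPart hκ0 hF hv
  have h2 := hermForm_horizontalPart hκ0 hF hw
  rw [← reForm_horizontalPart hκ0 hF, ← horizontalMap_horizontalPart (κ := κ) v,
    ← horizontalMap_horizontalPart (κ := κ) w, horizontalMap_apply, horizontalMap_apply,
    ambientMetric_horizontalVec c F _ _ (by rw [hF]; exact_mod_cast inv_ne_zero hκ0)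
    (hermForm_swap_zero h1) h1 (hermForm_swap_zero h2) h2, hF,
    ← star_hermForm c (horizontalPart κ c F v), reForm_apply]
  push_cast
  rw [div_inv_eq_mul]
  simp only [Complex.star_def, Complex.mul_re, Complex.add_re, Complex.conj_re, Complex.ofReal_re,
    Complex.ofReal_im, mul_zero, sub_zero]
  rw [hκ]
  field_simp
  ring

theorem ambientJ_horizontalMap (hκ : κ ≠ 0) (hF : hermForm c F F = (κ⁻¹ : ℝ))
    {w : Fin (n + 1) → ℂ} (hw : reForm n c w F = 0) :
    ambientJ (lineProjector c F) (horizontalMap c F w) =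
      horizontalMap c F (mulI n w + (κ * reForm n c w (mulI n F)) • F) := by
  have h1 := hermForm_horizontalPart hκ hF hw
  rw [← horizontalMap_horizontalPart (κ := κ) w, horizontalMap_apply,
    ambientJ_horizontalVec c F _ (by rw [hF]; exact_mod_cast inv_ne_zero hκ)
    (hermForm_swap_zero h1) h1, horizontalMap_apply]
  congr 1
  rw [← mulI_apply, horizontalPart, map_sub, map_smul, (isHermitianPair n c).sq]
  module

theorem lineProjector_eq (hF : hermForm c F F = (κ⁻¹ : ℝ)) :
    lineProjector c F = κ • rankOne c F F := by
  rw [lineProjector, hF, ← Complex.coe_smul]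
  simp

theorem lineProjector_mulVec (hF : hermForm c F F = (κ⁻¹ : ℝ))
    (w : Fin (n + 1) → ℂ) : lineProjector c F *ᵥ w = (κ * hermForm c F w) • F := by
  rw [lineProjector_eq hF, ← Complex.coe_smul, smul_mulVec, rankOne_mulVec, smul_smul]

theorem lineProjector_selfAdjoint (hF : hermForm c F F = (κ⁻¹ : ℝ)) :
    (lineProjector c F)ᴴ * gramMatrix n c = gramMatrix n c * lineProjector c F := by
  have h := rankOne_selfAdjoint c ((κ / 2 : ℝ) • F) F
  have h2 : rankOne c ((κ / 2 : ℝ) • F) F + rankOne c F ((κ / 2 : ℝ) • F) =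
      lineProjector c F := by
    rw [lineProjector_eq hF, ← Complex.coe_smul, rankOne_smul_left, rankOne_smul_right,
      ← add_smul, ← Complex.coe_smul κ]
    congr 1
    simp
  rwa [h2] at h

/-- A tangent vector is determined by its horizontal lift. -/
theorem ambientTangent_eq_horizontalVec (hκ : κ ≠ 0) (hF : hermForm c F F = (κ⁻¹ : ℝ)) {X : Mat n}
    (hX : X ∈ ambientTangent c (lineProjector c F)) :
    hermForm c F (X *ᵥ F) = 0 ∧ horizontalVec c F (X *ᵥ F) = X := by
  have hκ' : (κ : ℂ) ≠ 0 := by exact_mod_cast hκ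
  obtain ⟨h1, h2⟩ := hX
  have h3 : hermForm c F (X *ᵥ F) = 0 := by
    have h4 := congrArg (fun Y => hermForm c F (Y *ᵥ F)) h2
    simp only [add_mulVec, ← mulVec_mulVec, lineProjector_mulVec hF, hF, mulVec_smul,
      hermForm_add_right, hermForm_smul_right] at h4
    push_cast at h4
    rw [mul_inv_cancel₀ hκ', one_mul, mul_right_comm, mul_inv_cancel₀ hκ', one_mul] at h4
    simpa using h4
  refine ⟨h3, ?_⟩
  conv_rhs => rw [← h2]
  rw [lineProjector_eq hF, Matrix.mul_smul, Matrix.smul_mul, mul_rankOne, rankOne_mul_of_selfAdjoint c h1,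
    horizontalVec, hF, ← Complex.coe_smul, ← Complex.coe_smul, ← smul_add]
  simp

theorem horizontalVec_mem (hκ : κ ≠ 0) (hF : hermForm c F F = (κ⁻¹ : ℝ)) {w : Fin (n + 1) → ℂ}
    (hw : hermForm c F w = 0) :
    horizontalVec c F w ∈ ambientTangent c (lineProjector c F) := by
  have hκ' : (κ : ℂ) ≠ 0 := by exact_mod_cast hκ
  have h0 : horizontalVec c F w = κ • (rankOne c w F + rankOne c F w) := by
    rw [horizontalVec, hF, ← Complex.coe_smul]; simp
  refine ⟨?_, ?_⟩
  · rw [h0, conjTranspose_smul, star_trivial, Matrix.smul_mul, Matrix.mul_smul, rankOne_selfAdjoint]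
  · have h1 := rankOne_mul_of_selfAdjoint c (lineProjector_selfAdjoint hF)
    have h2 : lineProjector c F *ᵥ F = F := by
      rw [lineProjector_mulVec hF, hF]
      push_cast
      rw [mul_inv_cancel₀ hκ', one_smul]
    have h3 : lineProjector c F *ᵥ w = 0 := by rw [lineProjector_mulVec hF, hw]; simp
    have h4 : ∀ z : Fin (n + 1) → ℂ, rankOne c z 0 = 0 := fun z => by simp [rankOne]
    have h5 : ∀ z : Fin (n + 1) → ℂ, rankOne c 0 z = 0 := fun z => by simp [rankOne]
    rw [h0, Matrix.smul_mul, Matrix.mul_smul, add_mul, mul_add, mul_rankOne, mul_rankOne, h1, h1, h2, h3, h4, h5]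
    simp

theorem tangentialProj_rankOne (hF : hermForm c F F = (κ⁻¹ : ℝ)) (v w : Fin (n + 1) → ℂ) :
    tangentialProj (lineProjector c F) (rankOne c v w) =
      rankOne c (lineProjector c F *ᵥ v) (w - lineProjector c F *ᵥ w)
        + rankOne c (v - lineProjector c F *ᵥ v) (lineProjector c F *ᵥ w) := by
  have h1 := rankOne_mul_of_selfAdjoint c (lineProjector_selfAdjoint hF)
  have h2 : ∀ z w w' : Fin (n + 1) → ℂ, rankOne c z (w - w') = rankOne c z w - rankOne c z w' := by
    intro z w w'
    rw [eq_sub_iff_add_eq, ← rankOne_add_right, sub_add_cancel]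
  have h3 : ∀ z z' w : Fin (n + 1) → ℂ, rankOne c (z - z') w = rankOne c z w - rankOne c z' w := by
    intro z w w'
    rw [eq_sub_iff_add_eq, ← rankOne_add_left, sub_add_cancel]
  change lineProjector c F * rankOne c v w * (1 - lineProjector c F)
    + (1 - lineProjector c F) * rankOne c v w * lineProjector c F = _
  rw [mul_sub, sub_mul, mul_one, one_mul, mul_rankOne, h1, sub_mul, h1, h1, h2, h3]

end Pointwise

/-- The operators `u ↦ ⟨w, u⟩ z`, as arrays of entries. -/
def rankOneMap (n : ℕ) (c : ℝ) :
    (Fin (n + 1) → ℂ) →L[ℝ] (Fin (n + 1) → ℂ) →L[ℝ] Fin (n + 1) → Fin (n + 1) → ℂ :=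
  (LinearMap.mk₂ ℝ (fun z w i j => rankOne c z w i j)
    (fun z z' w => by rw [rankOne_add_left]; rfl)
    (fun r z w => by
      rw [← Complex.coe_smul r z, rankOne_smul_left]; rfl)
    (fun z w w' => by rw [rankOne_add_right]; rfl)
    (fun r z w => by
      rw [← Complex.coe_smul r w, rankOne_smul_right]
      funext i j
      simp)).toContinuousBilinearMap

theorem rankOneMap_apply (c : ℝ) (z w : Fin (n + 1) → ℂ) :
    Matrix.of (rankOneMap n c z w) = rankOne c z w := rfl

end SpaceFormAlgebra

/-! ### Local lifts of a chart to the quadric -/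

noncomputable section ChartLift

/-- Equal dimensions turn injectivity into invertibility, and inversion of linear maps is smooth at
invertible ones. -/
theorem exists_smooth_inverse {E A W : Type*} [NormedAddCommGroup E] [NormedSpace ℝ E]
    [NormedAddCommGroup A] [NormedSpace ℝ A] [FiniteDimensional ℝ A] [NormedAddCommGroup W]
    [NormedSpace ℝ W] [FiniteDimensional ℝ W] {Ω : Set E} {Ψ : E → A →L[ℝ] W}
    (hΩ : IsOpen Ω) (hΨ : ContDiffOn ℝ ∞ Ψ Ω)
    (hd : Module.finrank ℝ A = Module.finrank ℝ W) (hi : ∀ x ∈ Ω, Function.Injective (Ψ x)) :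
    ∃ R : E → W →L[ℝ] A, ContDiffOn ℝ ∞ R Ω ∧ ∀ x ∈ Ω, (∀ a, R x (Ψ x a) = a) ∧
      ∀ w, Ψ x (R x w) = w := by
  have he : ∀ x ∈ Ω, ∃ e : A ≃L[ℝ] W, (e : A →L[ℝ] W) = Ψ x := by
    intro x hx
    refine ⟨(LinearEquiv.ofInjectiveOfFinrankEq (Ψ x).toLinearMap (hi x hx) hd)
      |>.toContinuousLinearEquiv, ?_⟩
    ext a
    rfl
  have : CompleteSpace A := FiniteDimensional.complete ℝ A
  refine ⟨fun x => (Ψ x).inverse, ?_, ?_⟩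
  · intro x hx
    obtain ⟨e, he⟩ := he x hx
    have h1 : ContDiffAt ℝ ∞ ContinuousLinearMap.inverse (Ψ x) := he ▸ contDiffAt_map_inverse e
    exact (h1.comp x (hΨ.contDiffAt (hΩ.mem_nhds hx))).contDiffWithinAt
  · intro x hx
    obtain ⟨e, he⟩ := he x hx
    simp only [← he, ContinuousLinearMap.inverse_equiv]
    exact ⟨fun a => e.symm_apply_apply a, fun w => e.apply_symm_apply w⟩

theorem fderiv_bilinear_apply {E W W' Z : Type*} [NormedAddCommGroup E] [NormedSpace ℝ E]
    [NormedAddCommGroup W] [NormedSpace ℝ W] [NormedAddCommGroup W'] [NormedSpace ℝ W']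
    [NormedAddCommGroup Z] [NormedSpace ℝ Z]
    (L : W →L[ℝ] W' →L[ℝ] Z) {f : E → W} {g : E → W'} {x : E} (hf : DifferentiableAt ℝ f x)
    (hg : DifferentiableAt ℝ g x) (X : E) :
    fderiv ℝ (fun y => L (f y) (g y)) x X = L (fderiv ℝ f x X) (g x) + L (f x) (fderiv ℝ g x X) := by
  rw [(L.hasFDerivAt_of_bilinear hf.hasFDerivAt hg.hasFDerivAt).fderiv]
  simp [add_comm]

variable {n : ℕ} {H : Type*} [NormedAddCommGroup H] [NormedSpace ℝ H]

/-- A hypersurface of the space form with a unit normal field, in a chart. -/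
structure IsChartHypersurface (c : ℝ) (O : Set H) (p ν : H → Fin (n + 1) → Fin (n + 1) → ℂ) :
    Prop where
  isOpen : IsOpen O
  p_smooth : ContDiffOn ℝ ∞ p O
  ν_smooth : ContDiffOn ℝ ∞ ν O
  p_mem : ∀ x ∈ O, Matrix.of (p x) ∈ complexSpaceForm n c
  immersive : ∀ x ∈ O, Function.Injective (fderiv ℝ p x)
  tangent : ∀ x ∈ O, Matrix.of (ν x) ∈ ambientTangent c (Matrix.of (p x))
  unit : ∀ x ∈ O, ambientMetric c (Matrix.of (ν x)) (Matrix.of (ν x)) = 1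
  normal : ∀ x ∈ O, ∀ v, ambientMetric c (Matrix.of (ν x)) (Matrix.of (fderiv ℝ p x v)) = 0

theorem IsChartHypersurface.mono {c : ℝ} {O O' : Set H} {p ν : H → Fin (n + 1) → Fin (n + 1) → ℂ}
    (h : IsChartHypersurface c O p ν) (hO : O' ⊆ O) (ho : IsOpen O') :
    IsChartHypersurface c O' p ν where
  isOpen := ho
  p_smooth := h.p_smooth.mono hO
  ν_smooth := h.ν_smooth.mono hO
  p_mem x hx := h.p_mem x (hO hx)
  immersive x hx := h.immersive x (hO hx)
  tangent x hx := h.tangent x (hO hx)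
  unit x hx := h.unit x (hO hx)
  normal x hx := h.normal x (hO hx)

/-- The matrix-vector product, for arrays of entries. -/
def mulVecMap (n : ℕ) : (Fin (n + 1) → Fin (n + 1) → ℂ) →L[ℝ] (Fin (n + 1) → ℂ) →L[ℝ]
    (Fin (n + 1) → ℂ) :=
  (LinearMap.mk₂ ℝ (fun X z => Matrix.of X *ᵥ z)
    (fun X Y z => by
      have : Matrix.of (X + Y) = Matrix.of X + Matrix.of Y := rfl
      rw [this, add_mulVec])
    (fun r X z => by
      have : Matrix.of (r • X) = r • Matrix.of X := rfl
      rw [this, smul_mulVec])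
    (fun X z z' => by rw [mulVec_add])
    (fun r X z => by rw [mulVec_smul])).toContinuousBilinearMap

theorem mulVecMap_apply (X : Fin (n + 1) → Fin (n + 1) → ℂ) (z : Fin (n + 1) → ℂ) :
    mulVecMap n X z = Matrix.of X *ᵥ z := rfl

theorem lineProjector_smul (c : ℝ) {a : ℂ} (ha : a ≠ 0) (z : Fin (n + 1) → ℂ) :
    lineProjector c (a • z) = lineProjector c z := by
  rw [lineProjector, hermForm_smul_left, hermForm_smul_right, rankOne_smul_left,
    rankOne_smul_right, smul_smul, smul_smul, lineProjector]
  congr 1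
  have : star a ≠ 0 := star_ne_zero.2 ha
  field_simp

/-- The field `(x, θ) ↦ exp (i θ) g x`. -/
def phaseLift (g : H → Fin (n + 1) → ℂ) (y : H × ℝ) : Fin (n + 1) → ℂ :=
  Complex.exp (Complex.I * y.2) • g y.1

theorem phaseLift_smooth {g : H → Fin (n + 1) → ℂ} {O : Set H} (hg : ContDiffOn ℝ ∞ g O) :
    ContDiffOn ℝ ∞ (phaseLift g) (O ×ˢ univ) := by
  have h1 : ContDiff ℝ ∞ fun y : H × ℝ => Complex.exp (Complex.I * (y.2 : ℂ)) :=
    (contDiff_const.mul (Complex.ofRealCLM.contDiff.comp contDiff_snd)).cexp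
  exact h1.contDiffOn.smul (hg.comp contDiffOn_fst fun y hy => hy.1)

theorem fderiv_phaseLift {g : H → Fin (n + 1) → ℂ} {y : H × ℝ}
    (hg : DifferentiableAt ℝ (phaseLift g) y) :
    fderiv ℝ (phaseLift g) y (0, 1) = mulI n (phaseLift g y) := by
  have h1 : HasDerivAt (fun t : ℝ => y + t • ((0, 1) : H × ℝ)) (0, 1) 0 := by
    simpa using ((hasDerivAt_id (0 : ℝ)).smul_const ((0, 1) : H × ℝ)).const_add y
  have h2 : HasDerivAt (fun t : ℝ => phaseLift g (y + t • ((0, 1) : H × ℝ)))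
      (fderiv ℝ (phaseLift g) y (0, 1)) 0 := by
    have hg' : HasFDerivAt (phaseLift g) (fderiv ℝ (phaseLift g) y)
        (y + (0 : ℝ) • ((0, 1) : H × ℝ)) := by simpa using hg.hasFDerivAt
    exact hg'.comp_hasDerivAt (0 : ℝ) h1
  have h3 : HasDerivAt (fun t : ℝ => Complex.exp (Complex.I * ((y.2 + t : ℝ) : ℂ)) • g y.1)
      (mulI n (phaseLift g y)) 0 := by
    have h4 : HasDerivAt (fun t : ℝ => Complex.I * ((y.2 + t : ℝ) : ℂ)) Complex.I 0 := by
      have := (((hasDerivAt_id (0 : ℝ)).const_add y.2).ofReal_comp).const_mul Complex.I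
      simpa using this
    have h5 := h4.cexp.smul_const (g y.1)
    have h6 : (Complex.exp (Complex.I * ((y.2 + 0 : ℝ) : ℂ)) * Complex.I) • g y.1 =
        mulI n (phaseLift g y) := by
      simp [mulI_apply, phaseLift, smul_smul, mul_comm]
    rwa [h6] at h5
  refine h2.unique (h3.congr_of_eventuallyEq ?_)
  filter_upwards with t
  simp [phaseLift]

/-- The lift of a chart of a hypersurface to the quadric in `ℂⁿ⁺¹`. -/
structure IsChartLift (c : ℝ) (O : Set H) (p ν : H → Fin (n + 1) → Fin (n + 1) → ℂ)
    (F η : H × ℝ → Fin (n + 1) → ℂ) (ℓ : H × ℝ → (Fin (n + 1) → ℂ) →L[ℝ] H × ℝ) : Prop where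
  chart : IsChartHypersurface c O p ν
  lift : IsLift (reForm n c) (mulI n) (c / 4) (O ×ˢ univ) F η ℓ (0, 1)
  hermForm_F : ∀ y ∈ O ×ˢ univ, hermForm c (F y) (F y) = ((c / 4)⁻¹ : ℝ)
  p_eq : ∀ y ∈ O ×ˢ univ, Matrix.of (p y.1) = lineProjector c (F y)
  η_eq : ∀ y ∈ O ×ˢ univ, η y = Matrix.of (ν y.1) *ᵥ F y

theorem fderiv_comp_fst {Z : Type*} [NormedAddCommGroup Z] [NormedSpace ℝ Z] {p : H → Z}
    {y : H × ℝ} (hp : DifferentiableAt ℝ p y.1) (u : H × ℝ) :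
    fderiv ℝ (fun y : H × ℝ => p y.1) y u = fderiv ℝ p y.1 u.1 := by
  have h1 : HasFDerivAt (fun y : H × ℝ => p y.1) ((fderiv ℝ p y.1).comp
    (ContinuousLinearMap.fst ℝ H ℝ)) y := hp.hasFDerivAt.comp y hasFDerivAt_fst
  rw [h1.fderiv]
  rfl

theorem fderiv_p_eq {c : ℝ} {O : Set H} {p ν : H → Fin (n + 1) → Fin (n + 1) → ℂ}
    (h : IsChartHypersurface c O p ν) {F : H × ℝ → Fin (n + 1) → ℂ} {κ : ℝ}
    (hFs : ContDiffOn ℝ ∞ F (O ×ˢ univ))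
    (hF : ∀ y ∈ O ×ˢ univ, hermForm c (F y) (F y) = (κ⁻¹ : ℝ))
    (hp : ∀ y ∈ O ×ˢ univ, Matrix.of (p y.1) = lineProjector c (F y))
    {y : H × ℝ} (hy : y ∈ O ×ˢ univ) (u : H × ℝ) :
    Matrix.of (fderiv ℝ p y.1 u.1) = horizontalMap c (F y) (fderiv ℝ F y u) := by
  have hn := (h.isOpen.prod isOpen_univ).mem_nhds hy
  have hFd : DifferentiableAt ℝ F y := (hFs.contDiffAt hn).differentiableAt (by simp)
  have hpd : DifferentiableAt ℝ p y.1 :=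
    (h.p_smooth.contDiffAt (h.isOpen.mem_nhds hy.1)).differentiableAt (by simp)
  have h1 : (fun y : H × ℝ => p y.1) =ᶠ[nhds y] fun y => κ • rankOneMap n c (F y) (F y) := by
    filter_upwards [hn] with z hz
    exact (hp z hz).trans (lineProjector_eq (hF z hz))
  have h2 : DifferentiableAt ℝ (fun y => rankOneMap n c (F y) (F y)) y :=
    ((rankOneMap n c).hasFDerivAt_of_bilinear hFd.hasFDerivAt hFd.hasFDerivAt).differentiableAt
  rw [← fderiv_comp_fst hpd, h1.fderiv_eq, fderiv_fun_const_smul h2, _root_.smul_apply,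
    fderiv_bilinear_apply _ hFd hFd, horizontalMap_apply, horizontalVec, hF y hy,
    ← Complex.ofReal_inv, inv_inv, Complex.coe_smul]
  rfl

/-- Apply the projectors p x to a fixed vector z₀ of the line p x₀. Near x₀ the image stays nonzero
of the right sign, and the factor √(4 / r) rescales it to square 4/c. -/
theorem IsChartHypersurface.exists_section {c : ℝ} {O : Set H}
    {p ν : H → Fin (n + 1) → Fin (n + 1) → ℂ}
    (h : IsChartHypersurface c O p ν) {x₀ : H} (hx₀ : x₀ ∈ O) :
    ∃ O' ⊆ O, x₀ ∈ O' ∧ IsOpen O' ∧ ∃ ζ : H → Fin (n + 1) → ℂ, ContDiffOn ℝ ∞ ζ O' ∧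
      ∀ x ∈ O', hermForm c (ζ x) (ζ x) = ((c / 4)⁻¹ : ℝ) ∧
        Matrix.of (p x) = lineProjector c (ζ x) := by
  obtain ⟨z₀, hz₀, hp₀⟩ := h.p_mem x₀ hx₀
  have hproj : ∀ z w : Fin (n + 1) → ℂ, lineProjector c z *ᵥ w =
      ((hermForm c z z)⁻¹ * hermForm c z w) • z := by
    intro z w
    rw [lineProjector, smul_mulVec, rankOne_mulVec, smul_smul]
  set g : H → Fin (n + 1) → ℂ := fun x => mulVecMap n (p x) z₀ with hg
  have hgs : ContDiffOn ℝ ∞ g O :=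
    ((mulVecMap n).contDiff.comp_contDiffOn h.p_smooth).clm_apply contDiffOn_const
  set r : H → ℝ := fun x => c * reForm n c (g x) (g x) with hr
  have hrs : ContDiffOn ℝ ∞ r O :=
    contDiffOn_const.mul (((reForm n c).contDiff.comp_contDiffOn hgs).clm_apply hgs)
  refine ⟨O ∩ r ⁻¹' Ioi 0, inter_subset_left, ⟨hx₀, ?_⟩,
    hrs.continuousOn.isOpen_inter_preimage h.isOpen isOpen_Ioi,
    fun x => √(4 / r x) • g x, ?_, ?_⟩
  · have hne : hermForm c z₀ z₀ ≠ 0 := by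
      intro h0; rw [h0] at hz₀; simp at hz₀
    have : g x₀ = z₀ := by
      rw [hg]
      simp only [mulVecMap_apply]
      rw [hp₀, hproj, inv_mul_cancel₀ hne, one_smul]
    simp only [mem_preimage, mem_Ioi, hr, this, reForm_apply]
    exact hz₀
  · refine ContDiffOn.smul (ContDiffOn.sqrt (contDiffOn_const.div (hrs.mono inter_subset_left)
      fun x hx => ?_) fun x hx => ?_) (hgs.mono inter_subset_left)
    · exact (mem_Ioi.1 hx.2).ne'
    · exact (div_pos (by norm_num) (mem_Ioi.1 hx.2)).ne'
  · rintro x ⟨hx, hrx⟩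
    have hrx' : 0 < r x := hrx
    obtain ⟨z, hz, hpz⟩ := h.p_mem x hx
    have hgx : g x = ((hermForm c z z)⁻¹ * hermForm c z z₀) • z := by
      rw [hg]
      simp only [mulVecMap_apply]
      rw [hpz, hproj]
    have ha : (hermForm c z z)⁻¹ * hermForm c z z₀ ≠ 0 := by
      intro h0
      rw [h0, zero_smul] at hgx
      simp only [hr, hgx] at hrx'
      simp at hrx'
    have hs : 0 < √(4 / r x) := Real.sqrt_pos.2 (by positivity)
    constructor
    · have h1 : hermForm c (g x) (g x) = ((r x / c : ℝ) : ℂ) := by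
        have hc : c ≠ 0 := by rintro rfl; simp at hz
        apply Complex.ext
        · rw [Complex.ofReal_re, hr]
          field_simp
          rfl
        · rw [Complex.ofReal_im, hermForm_self_im]
      have hc : c ≠ 0 := by rintro rfl; simp at hz
      change hermForm c (√(4 / r x) • g x) (√(4 / r x) • g x) = _
      rw [← Complex.coe_smul, hermForm_smul_left, hermForm_smul_right, h1, ← mul_assoc,
        Complex.star_def, Complex.conj_ofReal, ← Complex.ofReal_mul, ← Complex.ofReal_mul,
        Real.mul_self_sqrt (by positivity)]
      congr 1
      field_simp
    · change _ = lineProjector c (√(4 / r x) • g x)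
      rw [← Complex.coe_smul, lineProjector_smul c (by exact_mod_cast hs.ne'), hgx,
        lineProjector_smul c ha, hpz]

theorem IsChartHypersurface.exists_isChartLift [FiniteDimensional ℝ H] {c : ℝ} (hc : c ≠ 0)
    (hd : Module.finrank ℝ H + 1 = 2 * n) {O : Set H} {p ν : H → Fin (n + 1) → Fin (n + 1) → ℂ}
    (h : IsChartHypersurface c O p ν) {x₀ : H} (hx₀ : x₀ ∈ O) :
    ∃ O' ⊆ O, x₀ ∈ O' ∧ ∃ F η ℓ, IsChartLift c O' p ν F η ℓ := by
  obtain ⟨O', hO, hx₀', ho, ζ, hζs, hζ⟩ := h.exists_section hx₀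
  replace h := h.mono hO ho
  have hκ : c / 4 ≠ 0 := by positivity
  have hpair := isHermitianPair n c
  set F : H × ℝ → Fin (n + 1) → ℂ := phaseLift ζ with hF
  set η : H × ℝ → Fin (n + 1) → ℂ := phaseLift fun x => mulVecMap n (ν x) (ζ x) with hη
  have hopen := ho.prod (isOpen_univ (X := ℝ))
  have hFs : ContDiffOn ℝ ∞ F (O' ×ˢ univ) := phaseLift_smooth hζs
  have hηs : ContDiffOn ℝ ∞ η (O' ×ˢ univ) := phaseLift_smooth
    (((mulVecMap n).contDiff.comp_contDiffOn h.ν_smooth).clm_apply hζs)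
  have hdiff : ∀ {f : H × ℝ → Fin (n + 1) → ℂ}, ContDiffOn ℝ ∞ f (O' ×ˢ univ) →
      ∀ y ∈ O' ×ˢ univ, DifferentiableAt ℝ f y := fun hf y hy =>
    (hf.contDiffAt (hopen.mem_nhds hy)).differentiableAt (by simp)
  have hphase : ∀ θ : ℝ, Complex.exp (Complex.I * θ) ≠ 0 := fun θ => Complex.exp_ne_zero _
  have hFF : ∀ y ∈ O' ×ˢ univ, hermForm c (F y) (F y) = ((c / 4)⁻¹ : ℝ) := by
    intro y hy
    rw [hF, phaseLift, hermForm_smul_left, hermForm_smul_right, (hζ y.1 hy.1).1, ← mul_assoc,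
      Complex.star_def, ← Complex.exp_conj, ← Complex.exp_add]
    simp
  have hp : ∀ y ∈ O' ×ˢ univ, Matrix.of (p y.1) = lineProjector c (F y) := by
    intro y hy
    rw [hF, phaseLift, lineProjector_smul c (hphase y.2), (hζ y.1 hy.1).2]
  have hηeq : ∀ y, η y = Matrix.of (ν y.1) *ᵥ F y := by
    intro y
    rw [hη, hF, phaseLift, phaseLift, mulVec_smul, mulVecMap_apply]
  have hBFF : ∀ y ∈ O' ×ˢ univ, reForm n c (F y) (F y) = (c / 4)⁻¹ := by
    intro y hy
    rw [reForm_apply, hFF y hy, Complex.ofReal_re]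
  have hdFF : ∀ y ∈ O' ×ˢ univ, ∀ u, reForm n c (fderiv ℝ F y u) (F y) = 0 := by
    intro y hy u
    have h1 : (fun y => reForm n c (F y) (F y)) =ᶠ[nhds y] fun _ => (c / 4)⁻¹ := by
      filter_upwards [hopen.mem_nhds hy] with z hz using hBFF z hz
    have h2 := fderiv_bilinear_apply (reForm n c) (hdiff hFs y hy) (hdiff hFs y hy) u
    rw [h1.fderiv_eq, hpair.symm (F y)] at h2
    simp only [fderiv_const_apply, _root_.zero_apply] at h2
    linarith
  have hdF := fun y hy u => fderiv_p_eq h hFs hFF hp (y := y) hy u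
  have htan : ∀ y ∈ O' ×ˢ univ, hermForm c (F y) (η y) = 0 ∧
      horizontalMap c (F y) (η y) = Matrix.of (ν y.1) := by
    intro y hy
    have := h.tangent y.1 hy.1
    rw [hp y hy] at this
    rw [hηeq, horizontalMap_apply]
    exact ambientTangent_eq_horizontalVec hκ (hFF y hy) this
  have hFη : ∀ y ∈ O' ×ˢ univ, reForm n c (F y) (η y) = 0 := by
    intro y hy
    rw [reForm_apply, (htan y hy).1, Complex.zero_re]
  have hηI : ∀ y ∈ O' ×ˢ univ, reForm n c (η y) (mulI n (F y)) = 0 := by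
    intro y hy
    rw [reForm_mulI_right, (htan y hy).1, Complex.zero_im]
  have hηF : ∀ y ∈ O' ×ˢ univ, reForm n c (η y) (F y) = 0 := by
    intro y hy
    rw [hpair.symm, hFη y hy]
  have hηη : ∀ y ∈ O' ×ˢ univ, reForm n c (η y) (η y) = 1 := by
    intro y hy
    have h1 := h.unit y.1 hy.1
    rw [← (htan y hy).2, ambientMetric_horizontalMap rfl hc (hFF y hy) (hηF y hy) (hηF y hy),
      hηI y hy] at h1
    simpa using h1
  have hηdF : ∀ y ∈ O' ×ˢ univ, ∀ u, reForm n c (η y) (fderiv ℝ F y u) = 0 := by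
    intro y hy u
    have h1 := h.normal y.1 hy.1 u.1
    rw [← (htan y hy).2, hdF y hy, ambientMetric_horizontalMap rfl hc (hFF y hy) (hηF y hy)
      (hdFF y hy u), hηI y hy] at h1
    simpa using h1
  have hdFV : ∀ y ∈ O' ×ˢ univ, fderiv ℝ F y (0, 1) = mulI n (F y) := fun y hy =>
    fderiv_phaseLift (hdiff hFs y hy)
  -- The map (u, s, t) ↦ dF(u) + sF + tη is bijective: it is injective, and both sides have real
  -- dimension 2n + 2. The field ℓ is the first component of its inverse.
  set Ψ : H × ℝ → (H × ℝ) × ℝ × ℝ →L[ℝ] Fin (n + 1) → ℂ := fun y =>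
    (fderiv ℝ F y).comp (ContinuousLinearMap.fst ℝ (H × ℝ) (ℝ × ℝ))
      + ((ContinuousLinearMap.fst ℝ ℝ ℝ).comp
        (ContinuousLinearMap.snd ℝ (H × ℝ) (ℝ × ℝ))).smulRight (F y)
      + ((ContinuousLinearMap.snd ℝ ℝ ℝ).comp
        (ContinuousLinearMap.snd ℝ (H × ℝ) (ℝ × ℝ))).smulRight (η y) with hΨ
  have hΨa : ∀ y u s t, Ψ y (u, s, t) = fderiv ℝ F y u + s • F y + t • η y := fun y u s t => rfl
  have hΨs : ContDiffOn ℝ ∞ Ψ (O' ×ˢ univ) :=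
    (((hFs.fderiv_of_isOpen hopen (by simp)).clm_comp contDiffOn_const).add
      (contDiffOn_const.smulRight hFs)).add (contDiffOn_const.smulRight hηs)
  have hcoef : ∀ y ∈ O' ×ˢ univ, ∀ u s t,
      s = c / 4 * reForm n c (Ψ y (u, s, t)) (F y) ∧ t = reForm n c (Ψ y (u, s, t)) (η y) := by
    intro y hy u s t
    rw [hΨa]
    simp only [map_add, map_smul, _root_.add_apply, _root_.smul_apply, smul_eq_mul, hdFF y hy,
      hBFF y hy, hηF y hy, hFη y hy, hηη y hy, hpair.symm _ (η y), hηdF y hy]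
    constructor
    · field_simp; ring
    · ring
  have hΨi : ∀ y ∈ O' ×ˢ univ, Function.Injective (Ψ y) := by
    intro y hy
    rw [injective_iff_map_eq_zero]
    rintro ⟨u, s, t⟩ h0
    obtain ⟨h1, h2⟩ := hcoef y hy u s t
    rw [h0] at h1 h2
    simp only [map_zero, _root_.zero_apply, mul_zero] at h1 h2
    rw [hΨa, h1, h2] at h0
    simp only [zero_smul, add_zero] at h0
    have h3 := hdF y hy u
    rw [h0, map_zero] at h3
    have h4 : u.1 = 0 := h.immersive y.1 hy.1 (by rw [map_zero]; exact h3)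
    have h5 : u = u.2 • ((0, 1) : H × ℝ) := by ext <;> simp [h4]
    rw [h5, map_smul, hdFV y hy] at h0
    have h6 := congrArg (fun w => reForm n c w (mulI n (F y))) h0
    simp only [map_smul, _root_.smul_apply, hpair.isom, hBFF y hy, map_zero, _root_.zero_apply,
      smul_eq_mul, mul_eq_zero, inv_eq_zero] at h6
    rw [h5, h6.resolve_right hκ, h1, h2]
    simp
  have hdim : Module.finrank ℝ ((H × ℝ) × ℝ × ℝ) = Module.finrank ℝ (Fin (n + 1) → ℂ) := by
    simp only [Module.finrank_prod, Module.finrank_self, Module.finrank_pi_fintype,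
      Complex.finrank_real_complex, Finset.sum_const, Finset.card_univ, Fintype.card_fin,
      smul_eq_mul]
    omega
  obtain ⟨R, hRs, hR⟩ := exists_smooth_inverse hopen hΨs hdim hΨi
  refine ⟨O', hO, hx₀', F, η, fun y => (ContinuousLinearMap.fst ℝ (H × ℝ) (ℝ × ℝ)).comp (R y),
    h, ?_, hFF, hp, fun y _ => hηeq y⟩
  exact {
    pair := hpair
    isOpen := hopen
    κ_ne := hκ
    F_smooth := hFs
    η_smooth := hηs
    ℓ_smooth := contDiffOn_const.clm_comp hRs
    F_F := hBFF
    η_η := hηη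
    F_η := hFη
    η_dF := hηdF
    dF_V := hdFV
    dη_V := fun y hy => fderiv_phaseLift (hdiff hηs y hy)
    ℓ_dF := fun y hy v => by
      have h1 := (hR y hy).1 (v, 0, 0)
      rw [hΨa, zero_smul, zero_smul, add_zero, add_zero] at h1
      simp [h1]
    dF_ℓ := fun y hy w => by
      have h1 := (hR y hy).2 w
      obtain ⟨h2, h3⟩ := hcoef y hy (R y w).1 (R y w).2.1 (R y w).2.2
      have h4 : ((R y w).1, (R y w).2.1, (R y w).2.2) = R y w := rfl
      rw [h4, h1] at h2 h3
      rw [← h4, hΨa, h2, h3] at h1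
      simp only [ContinuousLinearMap.comp_apply, ContinuousLinearMap.coe_fst']
      rw [sub_sub, eq_sub_iff_add_eq, ← add_assoc]
      exact h1 }

end ChartLift

/-! ### Spectral theory at a point: from principal curvatures to the cubic relation -/

noncomputable section PointModel

/-- The spectral theorem for a positive definite form that is not given by an instance on the space.
-/
theorem iSup_eigenspace_eq_top_of_symm {U : Type*} [AddCommGroup U] [Module ℝ U]
    [FiniteDimensional ℝ U] (b : U →ₗ[ℝ] U →ₗ[ℝ] ℝ) (hb : ∀ u v, b u v = b v u)
    (hpos : ∀ u, u ≠ 0 → 0 < b u u) (T : Module.End ℝ U) (hT : ∀ u v, b (T u) v = b u (T v)) :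
    ⨆ μ, Module.End.eigenspace T μ = ⊤ := by
  let core : InnerProductSpace.Core ℝ U :=
    { inner := fun u v => b u v
      conj_inner_symm := fun u v => by simpa using hb v u
      re_inner_nonneg := fun u => by
        by_cases h : u = 0
        · simp [h]
        · exact (hpos u h).le
      add_left := fun u v w => by simp
      smul_left := fun u v r => by simp
      definite := fun u h => by
        by_contra h0
        exact (hpos u h0).ne' h }
  let _ := core.toNormedAddCommGroup
  let _ : InnerProductSpace ℝ U := InnerProductSpace.ofCore core.toCore
  have hs : T.IsSymmetric := fun u v => hT u v
  exact Submodule.orthogonal_eq_bot_iff.1 hs.orthogonalComplement_iSup_eigenspaces_eq_bot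

/-- The images under `D` of the vectors `v` with `Sh v = μ D v`. -/
def principalImage {X Y : Type*} [AddCommGroup X] [Module ℝ X] [AddCommGroup Y] [Module ℝ Y]
    (D Sh : X →ₗ[ℝ] Y) (μ : ℝ) : Submodule ℝ Y :=
  (LinearMap.ker (Sh - μ • D)).map D

theorem mem_principalImage {X Y : Type*} [AddCommGroup X] [Module ℝ X] [AddCommGroup Y] [Module ℝ Y]
    {D Sh : X →ₗ[ℝ] Y} {μ : ℝ} {Z : Y} :
    Z ∈ principalImage D Sh μ ↔ ∃ v, Sh v = μ • D v ∧ D v = Z := by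
  simp [principalImage, sub_eq_zero]

variable {n : ℕ} {X E : Type*} [AddCommGroup X] [Module ℝ X] [NormedAddCommGroup E]
  [NormedSpace ℝ E]

/-- The set of the `μ` for which the Hopf vector is not orthogonal to the `μ`-eigenspace. -/
def hopfSet (c : ℝ) (P N : Mat n) (D Sh : X →ₗ[ℝ] Mat n) : Set ℝ :=
  {μ | ∃ Z ∈ principalImage D Sh μ, ambientMetric c (ambientJ P N) Z ≠ 0}

/-- The tangent space of a hypersurface at a point, with normal vector `N`, differential `D` and
shape operator `Sh`, described through the tangent space `E` of its lift to the quadric. -/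
structure IsPointModel (c : ℝ) (P N : Mat n) (D Sh : X →ₗ[ℝ] Mat n) (G : E →L[ℝ] E →L[ℝ] ℝ)
    (S φ : E →L[ℝ] E) (V : E) (π : E →ₗ[ℝ] Mat n) : Prop where
  c_ne : c ≠ 0
  symm : ∀ u v, G u v = G v u
  S_symm : ∀ u v, G (S u) v = G u (S v)
  φ_skew : ∀ u v, G (φ u) v = -G u (φ v)
  φ_V : φ V = 0
  φ_SV : φ (S V) = 0
  φ_φ : ∀ u, φ (φ u) = -u + G u (S V) • S V + (c / 4 * G u V) • V
  V_V : G V V = (c / 4)⁻¹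
  V_SV : G V (S V) = 0
  SV_SV : G (S V) (S V) = 1
  pos : ∀ u, G u V = 0 → u ≠ 0 → 0 < G u u
  exists_lift : ∀ v, ∃ u, G u V = 0 ∧ π u = D v
  exists_image : ∀ u, ∃ v, D v = π u
  shape : ∀ u v, G u V = 0 → D v = π u → Sh v = π (S u)
  ker : ∀ u, G u V = 0 → π u = 0 → u = 0
  π_V : π V = 0
  metric : ∀ u w, G u V = 0 → G w V = 0 → ambientMetric c (π u) (π w) = G u w
  unit : ambientMetric c N N = 1
  normal : ∀ u, ambientMetric c N (π u) = 0
  J_N : ambientJ P N = -π (S V)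
  J_π : ∀ u, ambientJ P (π u) = π (φ u) + G u (S V) • N

/-- The shape operator of the hypersurface, extended by zero to the vertical direction. -/
def horizontalShape (κ : ℝ) (G : E →L[ℝ] E →L[ℝ] ℝ) (S : E →L[ℝ] E) (V : E) : E →L[ℝ] E :=
  S - (κ • G (S V)).smulRight V - (κ • G V).smulRight (S V)

theorem horizontalShape_apply (κ : ℝ) (G : E →L[ℝ] E →L[ℝ] ℝ) (S : E →L[ℝ] E) (V u : E) :
    horizontalShape κ G S V u = S u - (κ * G (S V) u) • V - (κ * G V u) • S V := rfl

/-- The horizontal eigenvectors of the shape operator. -/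
def horizontalEigen (κ : ℝ) (G : E →L[ℝ] E →L[ℝ] ℝ) (S : E →L[ℝ] E) (V : E) (μ : ℝ) :
    Submodule ℝ E where
  carrier := {u | G V u = 0 ∧ horizontalShape κ G S V u = μ • u}
  zero_mem' := by simp
  add_mem' := by
    rintro u v ⟨h1, h2⟩ ⟨h3, h4⟩
    refine ⟨by simp [h1, h3], by rw [map_add, h2, h4, smul_add]⟩
  smul_mem' := by
    rintro r u ⟨h1, h2⟩
    refine ⟨by simp [h1], by rw [map_smul, h2, smul_comm]⟩

theorem pair_aeval {G : E →L[ℝ] E →L[ℝ] ℝ} {R : E →L[ℝ] E} (hR : ∀ u v, G (R u) v = G u (R v))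
    {u : E} {μ : ℝ} (hu : R u = μ • u) (q : Polynomial ℝ) (a : E) :
    G (Polynomial.aeval R q a) u = q.eval μ * G a u := by
  induction q using Polynomial.induction_on' with
  | add p q hp hq => simp [hp, hq, add_mul]
  | monomial m r =>
    have : ∀ m : ℕ, G ((R ^ m) a) u = μ ^ m * G a u := by
      intro m
      induction m with
      | zero => simp
      | succ k ih => rw [pow_succ', mul_apply_eq_comp, hR, hu, map_smul, ih, smul_eq_mul]; ring
    simp only [Polynomial.aeval_monomial, Algebra.algebraMap_eq_smul_one, smul_mul_assoc, one_mul,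
      _root_.smul_apply, map_smul, this, Polynomial.eval_monomial, smul_eq_mul]
    ring

namespace IsPointModel

variable {c : ℝ} {P N : Mat n} {D Sh : X →ₗ[ℝ] Mat n} {G : E →L[ℝ] E →L[ℝ] ℝ}
  {S φ : E →L[ℝ] E} {V : E} {π : E →ₗ[ℝ] Mat n}

theorem κ_ne (h : IsPointModel c P N D Sh G S φ V π) : c / 4 ≠ 0 :=
  div_ne_zero h.c_ne (by norm_num)

theorem V_SSV (h : IsPointModel c P N D Sh G S φ V π) : G V (S (S V)) = 1 := by
  rw [← h.S_symm, h.SV_SV]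

theorem SV_V (h : IsPointModel c P N D Sh G S φ V π) : G (S V) V = 0 := by
  rw [h.symm, h.V_SV]

theorem horizontalShape_V (h : IsPointModel c P N D Sh G S φ V π) :
    horizontalShape (c / 4) G S V V = 0 := by
  rw [horizontalShape_apply, h.SV_V, h.V_V, mul_inv_cancel₀ h.κ_ne]
  simp

theorem horizontalShape_symm (h : IsPointModel c P N D Sh G S φ V π) (u v : E) :
    G (horizontalShape (c / 4) G S V u) v = G u (horizontalShape (c / 4) G S V v) := by
  simp only [horizontalShape_apply, map_sub, map_smul, _root_.sub_apply, _root_.smul_apply,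
    smul_eq_mul]
  rw [h.S_symm u v, h.symm u V, h.symm u (S V)]
  ring

theorem horizontalShape_horizontal (h : IsPointModel c P N D Sh G S φ V π) (u : E) :
    G V (horizontalShape (c / 4) G S V u) = 0 := by
  rw [← h.horizontalShape_symm, h.horizontalShape_V]
  simp

/-- On horizontal vectors S and `horizontalShape` differ by a multiple of V, which π kills, while π
is injective on horizontal vectors. -/
theorem mem_principalImage_iff (h : IsPointModel c P N D Sh G S φ V π) {μ : ℝ} {Z : Mat n} :
    Z ∈ principalImage D Sh μ ↔ ∃ u ∈ horizontalEigen (c / 4) G S V μ, π u = Z := by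
  rw [mem_principalImage]
  constructor
  · rintro ⟨v, hv, rfl⟩
    obtain ⟨u, hu, huv⟩ := h.exists_lift v
    refine ⟨u, ⟨by rw [h.symm, hu], ?_⟩, huv⟩
    rw [h.shape u v hu huv.symm, ← huv, ← map_smul, ← sub_eq_zero, ← map_sub] at hv
    rw [← sub_eq_zero]
    refine h.ker _ ?_ ?_
    · rw [h.symm, map_sub, h.horizontalShape_horizontal, map_smul, h.symm V, hu]; simp
    · rw [horizontalShape_apply, h.symm V u, hu, mul_zero, zero_smul, sub_zero, sub_right_comm,
        map_sub, hv, map_smul, h.π_V]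
      simp
  · rintro ⟨u, ⟨hu, he⟩, rfl⟩
    obtain ⟨v, hv⟩ := h.exists_image u
    refine ⟨v, ?_, hv⟩
    rw [h.shape u v (by rw [h.symm, hu]) hv, hv, ← map_smul, ← he, horizontalShape_apply, hu]
    simp [h.π_V]

theorem π_injOn (h : IsPointModel c P N D Sh G S φ V π) {u v : E} (hu : G V u = 0)
    (hv : G V v = 0) (huv : π u = π v) : u = v := by
  rw [← sub_eq_zero]
  exact h.ker _ (by rw [h.symm, map_sub, hu, hv, sub_zero]) (by rw [map_sub, huv, sub_self])

theorem mem_of_ne (h : IsPointModel c P N D Sh G S φ V π) {μ : ℝ} {u : E}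
    (hu : u ∈ horizontalEigen (c / 4) G S V μ) (h0 : u ≠ 0) : principalImage D Sh μ ≠ ⊥ := by
  intro hb
  have h1 : π u ∈ principalImage D Sh μ := h.mem_principalImage_iff.2 ⟨u, hu, rfl⟩
  rw [hb, Submodule.mem_bot] at h1
  exact h0 (h.ker u (by rw [h.symm, hu.1]) h1)

theorem hopfSet_eq (h : IsPointModel c P N D Sh G S φ V π) :
    hopfSet c P N D Sh = {μ | ∃ u ∈ horizontalEigen (c / 4) G S V μ, G (S V) u ≠ 0} := by
  ext μ
  simp only [hopfSet, mem_ofPred_eq, h.mem_principalImage_iff, h.J_N]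
  have hm : ∀ u ∈ horizontalEigen (c / 4) G S V μ, ambientMetric c (-π (S V)) (π u) =
      -G (S V) u := by
    intro u hu
    rw [← map_neg, h.metric _ _ (by simp [h.SV_V]) (by rw [h.symm, hu.1])]
    simp
  constructor
  · rintro ⟨Z, ⟨u, hu, rfl⟩, hne⟩
    exact ⟨u, hu, by rw [hm u hu] at hne; exact neg_ne_zero.1 hne⟩
  · rintro ⟨u, hu, hne⟩
    exact ⟨_, ⟨u, hu, rfl⟩, by rw [hm u hu]; exact neg_ne_zero.2 hne⟩

theorem hopfSet_subset (h : IsPointModel c P N D Sh G S φ V π) :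
    hopfSet c P N D Sh ⊆ {μ | principalImage D Sh μ ≠ ⊥} := by
  rw [h.hopfSet_eq]
  rintro μ ⟨u, hu, hne⟩
  exact h.mem_of_ne hu (by rintro rfl; simp at hne)

theorem horizontalShape_SV (h : IsPointModel c P N D Sh G S φ V π) :
    horizontalShape (c / 4) G S V (S V) = S (S V) - (c / 4) • V := by
  rw [horizontalShape_apply, h.SV_SV, h.V_SV]
  simp

theorem horizontalShape_SSV (h : IsPointModel c P N D Sh G S φ V π) :
    horizontalShape (c / 4) G S V (S (S V)) =
      S (S (S V)) - (c / 4 * G (S V) (S (S V))) • V - (c / 4) • S V := by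
  rw [horizontalShape_apply, h.V_SSV, mul_one]

/-- If φS²V = 0, then φ² puts S²V in the span of V and SV, so SV is an eigenvector of
`horizontalShape`. The Hopf vector would then lie in one principal curvature space, not two. -/
theorem a_ne (h : IsPointModel c P N D Sh G S φ V π) {l₁ l₂ : ℝ} (hne : l₁ ≠ l₂)
    (hl : hopfSet c P N D Sh = {l₁, l₂}) : φ (S (S V)) ≠ 0 := by
  intro h0
  have h1 := h.φ_φ (S (S V))
  rw [h0, map_zero, h.symm _ V, h.V_SSV, mul_one] at h1
  have h2 : horizontalShape (c / 4) G S V (S V) = G (S (S V)) (S V) • S V := by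
    rw [h.horizontalShape_SV]
    linear_combination (norm := module) h1
  have h3 : ∀ μ ∈ hopfSet c P N D Sh, μ = G (S (S V)) (S V) := by
    intro μ hμ
    rw [h.hopfSet_eq] at hμ
    obtain ⟨u, hu, hu0⟩ := hμ
    have h4 := h.horizontalShape_symm (S V) u
    rw [h2, hu.2, map_smul, map_smul, _root_.smul_apply, smul_eq_mul, smul_eq_mul] at h4
    exact (mul_right_cancel₀ hu0 h4).symm
  rw [hl] at h3
  exact hne ((h3 l₁ (by simp)).trans (h3 l₂ (by simp)).symm)

section FiniteDimensional

variable [FiniteDimensional ℝ E]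

/-- The horizontal vectors are sums of eigenvectors. -/
theorem mem_iSup (h : IsPointModel c P N D Sh G S φ V π) {u : E} (hu : G V u = 0) :
    u ∈ ⨆ μ, horizontalEigen (c / 4) G S V μ := by
  have hc := h.c_ne
  -- G may be negative on V. This form removes the vertical part of G and adds a positive one;
  -- `horizontalShape` remains symmetric for it because its values are horizontal.
  let b : E →ₗ[ℝ] E →ₗ[ℝ] ℝ := LinearMap.mk₂ ℝ
    (fun u v => G u v - c / 4 * G V u * G V v + G V u * G V v)
    (fun u u' v => by simp; ring) (fun r u v => by simp; ring)
    (fun u v v' => by simp; ring) (fun r u v => by simp; ring)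
  have hb : ∀ u v, b u v = G u v - c / 4 * G V u * G V v + G V u * G V v := fun u v => rfl
  have htop := iSup_eigenspace_eq_top_of_symm b (fun u v => by rw [hb, hb, h.symm u v]; ring)
    (fun w hw => by
      rw [hb]
      by_cases h0 : G V w = 0
      · rw [h0]
        have := h.pos w (by rw [h.symm, h0]) hw
        linarith
      · have h1 : G (w - (c / 4 * G V w) • V) (w - (c / 4 * G V w) • V) =
            G w w - c / 4 * G V w * G V w := by
          simp only [map_sub, map_smul, _root_.sub_apply, _root_.smul_apply, smul_eq_mul, h.V_V,
            h.symm w V]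
          field_simp
          ring
        have h2 : 0 ≤ G (w - (c / 4 * G V w) • V) (w - (c / 4 * G V w) • V) := by
          by_cases h3 : w - (c / 4 * G V w) • V = 0
          · rw [h3]; simp
          · refine (h.pos _ ?_ h3).le
            simp only [map_sub, map_smul, _root_.sub_apply, _root_.smul_apply, smul_eq_mul, h.V_V,
              h.symm w V]
            field_simp
            ring
        have h4 : 0 < G V w * G V w := mul_self_pos.2 h0
        linarith)
    (horizontalShape (c / 4) G S V : E →ₗ[ℝ] E)
    (fun u v => by
      rw [hb, hb, ContinuousLinearMap.coe_coe, h.horizontalShape_horizontal,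
        h.horizontalShape_horizontal, h.horizontalShape_symm]
      ring)
  -- Projection along V. It sends eigenvectors to horizontal eigenvectors: an eigenvector is either
  -- already horizontal or belongs to the eigenvalue 0.
  let pr : E →ₗ[ℝ] E := LinearMap.id - ((c / 4) • (G V : E →ₗ[ℝ] ℝ)).smulRight V
  have hpr : ∀ w, pr w = w - (c / 4 * G V w) • V := fun w => rfl
  have hle : ∀ w : E, pr w ∈ ⨆ μ, horizontalEigen (c / 4) G S V μ := by
    intro w
    have hw : w ∈ ⨆ μ, Module.End.eigenspace (horizontalShape (c / 4) G S V : E →ₗ[ℝ] E) μ := by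
      rw [htop]; trivial
    refine Submodule.iSup_induction _ (motive := fun w => pr w ∈ _) hw ?_ ?_ ?_
    · intro μ w hw
      rw [Module.End.mem_eigenspace_iff, ContinuousLinearMap.coe_coe] at hw
      refine Submodule.mem_iSup_of_mem μ ⟨?_, ?_⟩
      · rw [hpr, map_sub, map_smul, h.V_V, smul_eq_mul]
        field_simp
        ring
      · have h1 := h.horizontalShape_horizontal w
        rw [hw, map_smul, smul_eq_mul] at h1
        rw [hpr, map_sub, map_smul, h.horizontalShape_V, hw, smul_zero, sub_zero, smul_sub,
          smul_smul]
        have : μ * (c / 4 * G V w) = 0 := by linear_combination c / 4 * h1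
        rw [this, zero_smul, sub_zero]
    · simp
    · intro v w hv hw
      rw [map_add]
      exact Submodule.add_mem _ hv hw
  have := hle u
  rwa [hpr, hu, mul_zero, zero_smul, sub_zero] at this

theorem eq_zero_of_orthogonal (h : IsPointModel c P N D Sh G S φ V π) {z : E} (hz : G V z = 0)
    (ho : ∀ μ, ∀ u ∈ horizontalEigen (c / 4) G S V μ, G z u = 0) : z = 0 := by
  have h1 : ∀ u ∈ ⨆ μ, horizontalEigen (c / 4) G S V μ, G z u = 0 := by
    intro u hu
    refine Submodule.iSup_induction _ (motive := fun u => G z u = 0) hu ho (map_zero _) ?_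
    intro v w hv hw
    rw [map_add, hv, hw, add_zero]
  by_contra h0
  exact (h.pos z (by rw [h.symm, hz]) h0).ne' (h1 z (h.mem_iSup hz))

theorem finite_curvatures (h : IsPointModel c P N D Sh G S φ V π) :
    {μ | principalImage D Sh μ ≠ ⊥}.Finite := by
  refine (Module.End.finite_hasEigenvalue
    (horizontalShape (c / 4) G S V : Module.End ℝ E)).subset fun μ hμ => ?_
  obtain ⟨Z, hZ, hZ0⟩ := Submodule.exists_mem_ne_zero_of_ne_bot hμ
  obtain ⟨u, hu, rfl⟩ := h.mem_principalImage_iff.1 hZ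
  exact Module.End.hasEigenvalue_of_hasEigenvector (x := u)
    ⟨Module.End.mem_eigenspace_iff.2 hu.2, fun h0 => hZ0 (by rw [h0, map_zero])⟩

theorem aeval_horizontal (h : IsPointModel c P N D Sh G S φ V π) {Λ : Finset ℝ}
    (hΛ : {μ | principalImage D Sh μ ≠ ⊥} = Λ) {u : E} (hu : G V u = 0) :
    Polynomial.aeval (horizontalShape (c / 4) G S V)
      (∏ μ ∈ Λ, (Polynomial.X - Polynomial.C μ)) u = 0 := by
  refine Submodule.iSup_induction _ (motive := fun u => Polynomial.aeval
    (horizontalShape (c / 4) G S V) (∏ μ ∈ Λ, (Polynomial.X - Polynomial.C μ)) u = 0)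
    (h.mem_iSup hu) ?_ (map_zero _) ?_
  · intro μ w hw
    by_cases h0 : w = 0
    · rw [h0, map_zero]
    · have hμ : μ ∈ Λ := by
        rw [← Finset.mem_coe, ← hΛ]
        exact h.mem_of_ne hw h0
      rw [aeval_apply_of_eigen hw.2, Polynomial.eval_prod,
        Finset.prod_eq_zero hμ (by simp), zero_smul]
  · intro v w hv hw
    rw [map_add, hv, hw, add_zero]

/-- The pairing of the Hopf vector with its component in the `μ`-eigenspace. -/
def hopfPairing (κ : ℝ) (Λ : Finset ℝ) (G : E →L[ℝ] E →L[ℝ] ℝ) (S : E →L[ℝ] E) (V : E) (μ : ℝ) :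
    ℝ :=
  G (S V) (Polynomial.aeval (horizontalShape κ G S V) (Lagrange.basis Λ id μ) (S V))

/-- The Lagrange polynomial is the spectral projection to the μ-space, so `hopfPairing` is the
squared length of the projection of SV. It varies continuously with the point, which makes
membership an open condition. -/
theorem mem_hopfSet_iff (h : IsPointModel c P N D Sh G S φ V π) {Λ : Finset ℝ}
    (hΛ : {μ | principalImage D Sh μ ≠ ⊥} = Λ) {μ : ℝ} (hμ : μ ∈ Λ) :
    μ ∈ hopfSet c P N D Sh ↔ hopfPairing (c / 4) Λ G S V μ ≠ 0 := by
  set R := horizontalShape (c / 4) G S V with hR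
  set q := Lagrange.basis Λ id μ with hq
  have hq1 : q.eval μ = 1 := by
    have := Lagrange.eval_basis_self (v := id) (injOn_id (Λ : Set ℝ)) hμ
    simpa using this
  have hhor : ∀ p : Polynomial ℝ, ∀ w, G V w = 0 → G V (Polynomial.aeval R p w) = 0 := by
    intro p w hw
    rw [h.symm, pair_aeval h.horizontalShape_symm (u := V) (μ := 0)
      (by rw [h.horizontalShape_V, zero_smul]), h.symm w, hw, mul_zero]
  have hmem : Polynomial.aeval R q (S V) ∈ horizontalEigen (c / 4) G S V μ := by
    refine ⟨hhor q _ h.V_SV, ?_⟩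
    obtain ⟨r, hr⟩ := sub_mul_lagrange_basis Λ hμ
    have h1 := congrArg (fun p => Polynomial.aeval R p (S V)) hr
    have h2 := h.aeval_horizontal hΛ h.V_SV
    rw [← hR] at h2
    simp only [map_mul, map_sub, Polynomial.aeval_X, Polynomial.aeval_C, mul_apply_eq_comp,
      h2, map_zero, _root_.sub_apply,
      Algebra.algebraMap_eq_smul_one, _root_.smul_apply, one_apply_eq_self] at h1
    exact sub_eq_zero.1 (by simpa using h1)
  rw [h.hopfSet_eq, hopfPairing]
  constructor
  · rintro ⟨u, hu, hne⟩ h0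
    have h1 := pair_aeval h.horizontalShape_symm hu.2 q (S V)
    rw [hq1, one_mul] at h1
    have h2 := pair_aeval h.horizontalShape_symm hmem.2 q (S V)
    rw [hq1, one_mul, ← hR, h0] at h2
    have h3 : Polynomial.aeval R q (S V) = 0 := by
      by_contra h4
      exact (h.pos _ (by rw [h.symm, hmem.1]) h4).ne' h2
    rw [← hR, h3] at h1
    exact hne (by simpa using h1.symm)
  · intro hne
    exact ⟨_, hmem, hne⟩

/-- Let R be `horizontalShape`. As SV has components only for l₁ and l₂, it is annihilated by (R -
l₁)(R - l₂). The corrections by which R differs from S account for the κ in the coefficients. -/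
theorem cubic (h : IsPointModel c P N D Sh G S φ V π) {l₁ l₂ : ℝ}
    (hl : hopfSet c P N D Sh = {l₁, l₂}) :
    S (S (S V)) = (l₁ + l₂) • S (S V) - (l₁ * l₂ - c / 4) • S V
      + (c / 4 * (G (S V) (S (S V)) - (l₁ + l₂))) • V := by
  set R := horizontalShape (c / 4) G S V with hR
  have h1 : R (R (S V)) - (l₁ + l₂) • R (S V) + (l₁ * l₂) • S V = 0 := by
    refine h.eq_zero_of_orthogonal ?_ ?_
    · simp [hR, h.horizontalShape_horizontal, h.V_SV]
    · intro μ u hu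
      have h2 : (μ - l₁) * (μ - l₂) * G (S V) u = 0 := by
        by_cases h0 : G (S V) u = 0
        · rw [h0, mul_zero]
        · have : μ ∈ hopfSet c P N D Sh := by rw [h.hopfSet_eq]; exact ⟨u, hu, h0⟩
          rw [hl] at this
          rcases this with rfl | rfl <;> simp
      simp only [map_add, map_sub, map_smul, _root_.add_apply, _root_.sub_apply,
        _root_.smul_apply, smul_eq_mul, hR, h.horizontalShape_symm, hu.2]
      linear_combination h2
  rw [hR, h.horizontalShape_SV, map_sub, map_smul, h.horizontalShape_SSV,
    h.horizontalShape_V] at h1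
  linear_combination (norm := module) h1

theorem spectral (h : IsPointModel c P N D Sh G S φ V π) {Λ : Finset ℝ}
    (hΛ : {μ | principalImage D Sh μ ≠ ⊥} = Λ) {l₁ l₂ : ℝ}
    (hl : hopfSet c P N D Sh = {l₁, l₂}) {u : E} (h1 : G u V = 0) (h2 : G u (S V) = 0)
    (h3 : G u (S (S V)) = 0) :
    Polynomial.aeval S (∏ μ ∈ Λ, (Polynomial.X - Polynomial.C μ)) u = 0 := by
  have hinv : ∀ w ∈ cyclicOrth G S V, S w ∈ cyclicOrth G S V := by
    rintro w ⟨hw1, hw2, hw3⟩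
    refine ⟨?_, ?_, ?_⟩ <;> rw [h.S_symm]
    · exact hw2
    · exact hw3
    · rw [h.cubic hl]; simp [hw1, hw2, hw3]
  have hR : ∀ w ∈ cyclicOrth G S V, horizontalShape (c / 4) G S V w = S w := by
    rintro w ⟨hw1, hw2, hw3⟩
    rw [horizontalShape_apply, h.symm _ w, hw2, h.symm _ w, hw1]
    simp
  have hpow : ∀ m : ℕ, (S ^ m) u ∈ cyclicOrth G S V ∧
      (horizontalShape (c / 4) G S V ^ m) u = (S ^ m) u := by
    intro m
    induction m with
    | zero => exact ⟨⟨h1, h2, h3⟩, rfl⟩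
    | succ k ih =>
      rw [pow_succ', mul_apply_eq_comp, pow_succ', mul_apply_eq_comp, ih.2, hR _ ih.1]
      exact ⟨hinv _ ih.1, rfl⟩
  have hq : ∀ q : Polynomial ℝ, Polynomial.aeval S q u =
      Polynomial.aeval (horizontalShape (c / 4) G S V) q u := by
    intro q
    induction q using Polynomial.induction_on' with
    | add p q hp hq => simp [hp, hq]
    | monomial m r =>
      simp [Polynomial.aeval_monomial, Algebra.algebraMap_eq_smul_one, (hpow m).2]
  rw [hq, h.aeval_horizontal hΛ (by rw [h.symm, h1])]

end FiniteDimensional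

end IsPointModel

end PointModel

/-! ### Charts as models, and local constancy of the two Hopf curvatures -/

noncomputable section ChartModel

variable {n : ℕ} {H : Type*} [NormedAddCommGroup H] [NormedSpace ℝ H]

/-- The differential of a matrix-valued map, given by its entries. -/
def chartDiff (p : H → Fin (n + 1) → Fin (n + 1) → ℂ) (x : H) : H →ₗ[ℝ] Mat n :=
  (Matrix.ofLinearEquiv ℝ).toLinearMap ∘ₗ (fderiv ℝ p x).toLinearMap

/-- The shape operator in a chart. -/
def chartShape (p ν : H → Fin (n + 1) → Fin (n + 1) → ℂ) (x : H) : H →ₗ[ℝ] Mat n :=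
  -(tangentialProj (Matrix.of (p x)) ∘ₗ chartDiff ν x)

theorem chartDiff_apply (p : H → Fin (n + 1) → Fin (n + 1) → ℂ) (x v : H) :
    chartDiff p x v = Matrix.of (fderiv ℝ p x v) := rfl

namespace IsChartLift

variable {c : ℝ} {O : Set H} {p ν : H → Fin (n + 1) → Fin (n + 1) → ℂ}
  {F η : H × ℝ → Fin (n + 1) → ℂ} {ℓ : H × ℝ → (Fin (n + 1) → ℂ) →L[ℝ] H × ℝ}

theorem chartDiff_eq (h : IsChartLift c O p ν F η ℓ) {y : H × ℝ} (hy : y ∈ O ×ˢ univ)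
    (u : H × ℝ) : chartDiff p y.1 u.1 = horizontalMap c (F y) (fderiv ℝ F y u) :=
  fderiv_p_eq h.chart h.lift.F_smooth h.hermForm_F h.p_eq hy u

theorem c_ne (h : IsChartLift c O p ν F η ℓ) : c ≠ 0 := fun h0 => h.lift.κ_ne (by rw [h0, zero_div])

theorem hermForm_F_η (h : IsChartLift c O p ν F η ℓ) {y : H × ℝ} (hy : y ∈ O ×ˢ univ) :
    hermForm c (F y) (η y) = 0 ∧ horizontalMap c (F y) (η y) = Matrix.of (ν y.1) := by
  have := h.chart.tangent y.1 hy.1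
  rw [h.p_eq y hy] at this
  rw [h.η_eq y hy, horizontalMap_apply]
  exact ambientTangent_eq_horizontalVec h.lift.κ_ne (h.hermForm_F y hy) this

theorem reForm_mulI_F (h : IsChartLift c O p ν F η ℓ) {y : H × ℝ} (hy : y ∈ O ×ˢ univ)
    (u : H × ℝ) : reForm n c (fderiv ℝ F y u) (mulI n (F y)) =
      liftMetric (reForm n c) F y u (0, 1) := by
  rw [liftMetric_apply, h.lift.dF_V y hy]

/-- The matrix of the normal is κ(ηF* + Fη*). Differentiating and projecting to the tangent space
leaves only the horizontal part of dη, for dF(u) is horizontal, and dη(u) = -dF(Su). -/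
theorem chartShape_eq (h : IsChartLift c O p ν F η ℓ) {y : H × ℝ} (hy : y ∈ O ×ˢ univ)
    {u : H × ℝ} (hu : liftMetric (reForm n c) F y u (0, 1) = 0) :
    chartShape p ν y.1 u.1 = chartDiff p y.1 (liftShape η ℓ y u).1 := by
  have hFF := h.hermForm_F y hy
  have hn := h.lift.isOpen.mem_nhds hy
  have hFd := h.lift.diffAt hy h.lift.F_smooth
  have hηd := h.lift.diffAt hy h.lift.η_smooth
  have hνd : DifferentiableAt ℝ ν y.1 :=
    (h.chart.ν_smooth.contDiffAt (h.chart.isOpen.mem_nhds hy.1)).differentiableAt (by simp)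
  have hκ := h.lift.κ_ne
  have h1 : (fun y : H × ℝ => ν y.1) =ᶠ[nhds y]
      fun y => (c / 4) • (rankOneMap n c (η y) (F y) + rankOneMap n c (F y) (η y)) := by
    filter_upwards [hn] with z hz
    have h2 := (h.hermForm_F_η hz).2
    rw [horizontalMap_apply, horizontalVec, h.hermForm_F z hz, ← Complex.ofReal_inv, inv_inv,
      Complex.coe_smul] at h2
    exact h2.symm
  have hd1 : DifferentiableAt ℝ (fun y => rankOneMap n c (η y) (F y)) y :=
    ((rankOneMap n c).hasFDerivAt_of_bilinear hηd.hasFDerivAt hFd.hasFDerivAt).differentiableAt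
  have hd2 : DifferentiableAt ℝ (fun y => rankOneMap n c (F y) (η y)) y :=
    ((rankOneMap n c).hasFDerivAt_of_bilinear hFd.hasFDerivAt hηd.hasFDerivAt).differentiableAt
  have h3 : chartDiff ν y.1 u.1 = (c / 4) • (rankOne c (fderiv ℝ η y u) (F y)
      + rankOne c (η y) (fderiv ℝ F y u)
      + (rankOne c (fderiv ℝ F y u) (η y) + rankOne c (F y) (fderiv ℝ η y u))) := by
    rw [chartDiff_apply, ← fderiv_comp_fst hνd, h1.fderiv_eq,
      fderiv_fun_const_smul (hd1.fun_add hd2), fderiv_fun_add hd1 hd2, _root_.smul_apply,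
      _root_.add_apply, fderiv_bilinear_apply _ hηd hFd, fderiv_bilinear_apply _ hFd hηd]
    rfl
  have hdη := h.lift.dη_F hy u
  have e1 : lineProjector c (F y) *ᵥ η y = 0 := by
    rw [lineProjector_mulVec hFF, (h.hermForm_F_η hy).1]; simp
  have e2 : lineProjector c (F y) *ᵥ fderiv ℝ F y u = 0 := by
    rw [lineProjector_mulVec hFF, hermForm_eq_of_reForm (h.lift.dF_F hy u), h.reForm_mulI_F hy, hu]
    simp
  have e3 : lineProjector c (F y) *ᵥ F y = F y := by
    rw [lineProjector_mulVec hFF, hFF]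
    have : (c : ℂ) ≠ 0 := by exact_mod_cast h.c_ne
    push_cast
    rw [mul_inv_cancel₀ (div_ne_zero this (by norm_num)), one_smul]
  have e4 : fderiv ℝ η y u - lineProjector c (F y) *ᵥ fderiv ℝ η y u =
      horizontalPart (c / 4) c (F y) (fderiv ℝ η y u) := by
    rw [lineProjector_mulVec hFF, hermForm_eq_of_reForm hdη, horizontalPart, mulI_apply,
      ← Complex.coe_smul, smul_smul]
    congr 2
    push_cast
    ring
  have z1 : ∀ z : Fin (n + 1) → ℂ, rankOne c z 0 = 0 := fun z => by simp [rankOne]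
  have z2 : ∀ z : Fin (n + 1) → ℂ, rankOne c 0 z = 0 := fun z => by simp [rankOne]
  rw [chartShape, LinearMap.neg_apply, LinearMap.comp_apply, h3, h.p_eq y hy, map_smul]
  simp only [map_add, tangentialProj_rankOne hFF, e1, e2, e3, e4, sub_self, sub_zero, z1, z2,
    add_zero, zero_add]
  rw [h.chartDiff_eq hy, h.lift.dF_shape hy, map_neg,
    ← horizontalMap_horizontalPart (κ := c / 4), horizontalMap_apply, horizontalVec, hFF,
    ← Complex.ofReal_inv, inv_inv, Complex.coe_smul]

theorem isPointModel (h : IsChartLift c O p ν F η ℓ) {y : H × ℝ} (hy : y ∈ O ×ˢ univ) :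
    IsPointModel c (Matrix.of (p y.1)) (Matrix.of (ν y.1)) (chartDiff p y.1) (chartShape p ν y.1)
      (liftMetric (reForm n c) F y) (liftShape η ℓ y) (liftPhi (mulI n) F ℓ y) (0, 1)
      (chartDiff p y.1 ∘ₗ LinearMap.fst ℝ H ℝ) := by
  have hm := h.lift.isModel
  have hFF := h.hermForm_F y hy
  have hκ := h.lift.κ_ne
  have hpair := h.lift.pair
  have hcd := h.chartDiff_eq hy
  have hc := h.c_ne
  have hsub : ∀ v : H, liftMetric (reForm n c) F y
      ((v, 0) - (c / 4 * liftMetric (reForm n c) F y (v, 0) (0, 1)) • ((0, 1) : H × ℝ)) (0, 1) =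
      0 := by
    intro v
    simp only [map_sub, map_smul, _root_.sub_apply, _root_.smul_apply, smul_eq_mul, hm.V_V y hy]
    field_simp
    ring
  have hηF : reForm n c (η y) (F y) = 0 := by rw [hpair.symm, h.lift.F_η y hy]
  have hηI : reForm n c (η y) (mulI n (F y)) = 0 := by
    rw [← h.lift.dF_V y hy, h.lift.η_dF y hy]
  have hinj : Function.Injective (chartDiff p y.1) := h.chart.immersive y.1 hy.1
  exact {
    c_ne := h.c_ne
    symm := hm.symm y hy
    S_symm := hm.S_symm y hy
    φ_skew := hm.φ_skew y hy
    φ_V := hm.φ_V y hy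
    φ_SV := hm.φ_SV y hy
    φ_φ := hm.φ_φ y hy
    V_V := hm.V_V y hy
    V_SV := hm.V_SV y hy
    SV_SV := hm.SV_SV y hy
    pos := fun u hu hu0 => by
      rw [liftMetric_apply, reForm_apply]
      refine hermForm_pos_of_orthogonal (z := F y) ?_ ?_ ?_
      · rw [hFF, Complex.ofReal_re]
        have := h.c_ne
        have h4 : c * (c / 4)⁻¹ = 4 := by field_simp
        rw [h4]; norm_num
      · rw [hermForm_eq_of_reForm (h.lift.dF_F hy u), h.reForm_mulI_F hy, hu]
        simp
      · intro h0
        exact hu0 (h.lift.dF_injective hy (by rw [h0, map_zero]))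
    exists_lift := fun v => ⟨_, hsub v, by
      rw [LinearMap.comp_apply, LinearMap.fst_apply]
      simp⟩
    exists_image := fun u => ⟨u.1, rfl⟩
    shape := fun u v hu hv => by
      rw [hinj hv]
      exact h.chartShape_eq hy hu
    ker := fun u hu h0 => by
      have h1 : u.1 = 0 := hinj (by rw [map_zero]; exact h0)
      have h2 : u = u.2 • ((0, 1) : H × ℝ) := by ext <;> simp [h1]
      rw [h2] at hu ⊢
      rw [map_smul, _root_.smul_apply, hm.V_V y hy, smul_eq_mul, mul_eq_zero] at hu
      rw [hu.resolve_right (inv_ne_zero hκ), zero_smul]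
    π_V := by simp
    metric := fun u w hu hw => by
      rw [LinearMap.comp_apply, LinearMap.comp_apply, LinearMap.fst_apply, LinearMap.fst_apply,
        hcd, hcd, ambientMetric_horizontalMap rfl h.c_ne hFF (h.lift.dF_F hy u)
        (h.lift.dF_F hy w), h.reForm_mulI_F hy, hu, liftMetric_apply]
      ring
    unit := h.chart.unit y.1 hy.1
    normal := fun u => h.chart.normal y.1 hy.1 u.1
    J_N := by
      rw [← (h.hermForm_F_η hy).2, h.p_eq y hy, ambientJ_horizontalMap hκ hFF hηF, hηI, mul_zero,
        zero_smul, add_zero, LinearMap.comp_apply, LinearMap.fst_apply, hcd,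
        h.lift.dF_shape_V hy, map_neg, neg_neg]
    J_π := fun u => by
      rw [LinearMap.comp_apply, LinearMap.comp_apply, LinearMap.fst_apply, LinearMap.fst_apply,
        hcd, hcd, h.p_eq y hy, ambientJ_horizontalMap hκ hFF (h.lift.dF_F hy u),
        h.reForm_mulI_F hy, h.lift.dF_phi hy, ← (h.hermForm_F_η hy).2, ← map_smul, ← map_add,
        sub_add_cancel] }

theorem mono (h : IsChartLift c O p ν F η ℓ) {O' : Set H} (hO : O' ⊆ O) (ho : IsOpen O') :
    IsChartLift c O' p ν F η ℓ where
  chart := h.chart.mono hO ho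
  lift :=
    { h.lift with
      isOpen := ho.prod isOpen_univ
      F_smooth := h.lift.F_smooth.mono (prod_mono_left hO)
      η_smooth := h.lift.η_smooth.mono (prod_mono_left hO)
      ℓ_smooth := h.lift.ℓ_smooth.mono (prod_mono_left hO)
      F_F := fun x hx => h.lift.F_F x (prod_mono_left hO hx)
      η_η := fun x hx => h.lift.η_η x (prod_mono_left hO hx)
      F_η := fun x hx => h.lift.F_η x (prod_mono_left hO hx)
      η_dF := fun x hx => h.lift.η_dF x (prod_mono_left hO hx)
      dF_V := fun x hx => h.lift.dF_V x (prod_mono_left hO hx)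
      dη_V := fun x hx => h.lift.dη_V x (prod_mono_left hO hx)
      ℓ_dF := fun x hx => h.lift.ℓ_dF x (prod_mono_left hO hx)
      dF_ℓ := fun x hx => h.lift.dF_ℓ x (prod_mono_left hO hx) }
  hermForm_F y hy := h.hermForm_F y (prod_mono_left hO hy)
  p_eq y hy := h.p_eq y (prod_mono_left hO hy)
  η_eq y hy := h.η_eq y (prod_mono_left hO hy)

end IsChartLift

/-- The smaller of the two principal curvatures to which the Hopf field is not orthogonal. -/
def hopfCurvature₁ (c l : ℝ) : ℝ := (3 * l - √(-c - 3 * l ^ 2)) / 2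

/-- The larger of the two principal curvatures to which the Hopf field is not orthogonal. -/
def hopfCurvature₂ (c l : ℝ) : ℝ := (3 * l + √(-c - 3 * l ^ 2)) / 2

theorem pair_eq_of_sum_prod {a b a' b' : ℝ} (hs : a + b = a' + b') (hp : a * b = a' * b') :
    ({a, b} : Set ℝ) = {a', b'} := by
  have h1 : (a - a') * (a - b') = 0 := by linear_combination a * hs - hp
  rcases mul_eq_zero.1 h1 with h | h
  · have ha : a = a' := by linarith
    have hb : b = b' := by linarith
    rw [ha, hb]
  · have ha : a = b' := by linarith
    have hb : b = a' := by linarith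
    rw [ha, hb, pair_comm]

theorem hopfCurvature_add (c l : ℝ) : hopfCurvature₁ c l + hopfCurvature₂ c l = 3 * l := by
  unfold hopfCurvature₁ hopfCurvature₂; ring

theorem hopfCurvature_mul {c l : ℝ} (h : c / 4 + l ^ 2 < 0) :
    hopfCurvature₁ c l * hopfCurvature₂ c l = 3 * l ^ 2 + c / 4 := by
  have hs : √(-c - 3 * l ^ 2) ^ 2 = -c - 3 * l ^ 2 := Real.sq_sqrt (by nlinarith)
  unfold hopfCurvature₁ hopfCurvature₂
  linear_combination -(1 / 4) * hs

theorem hopfCurvature_lt {c l : ℝ} (h : c / 4 + l ^ 2 < 0) :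
    hopfCurvature₁ c l < hopfCurvature₂ c l := by
  have hs : 0 < √(-c - 3 * l ^ 2) := Real.sqrt_pos.2 (by nlinarith)
  unfold hopfCurvature₁ hopfCurvature₂
  linarith

theorem IsModel.horizontalShape_smooth {E : Type*} [NormedAddCommGroup E] [NormedSpace ℝ E]
    {κ : ℝ} {Ω : Set E} {G : E → E →L[ℝ] E →L[ℝ] ℝ} {Γ : E → E →L[ℝ] E →L[ℝ] E}
    {S φ : E → E →L[ℝ] E} {V : E} (h : IsModel κ Ω G Γ S φ V) :
    ContDiffOn ℝ ∞ (fun y => horizontalShape κ (G y) (S y) V) Ω := by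
  have hSV : ContDiffOn ℝ ∞ (fun y => S y V) Ω := h.S_smooth.clm_apply contDiffOn_const
  exact (h.S_smooth.sub (((h.G_smooth.clm_apply hSV).const_smul κ).smulRight contDiffOn_const)).sub
    (((h.G_smooth.clm_apply contDiffOn_const).const_smul κ).smulRight hSV)

namespace IsChartLift

variable {c : ℝ} {O : Set H} {p ν : H → Fin (n + 1) → Fin (n + 1) → ℂ}
  {F η : H × ℝ → Fin (n + 1) → ℂ} {ℓ : H × ℝ → (Fin (n + 1) → ℂ) →L[ℝ] H × ℝ}

theorem hopfPairing_continuousOn (h : IsChartLift c O p ν F η ℓ) (Λ : Finset ℝ) (μ : ℝ) :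
    ContinuousOn (fun y => IsPointModel.hopfPairing (c / 4) Λ (liftMetric (reForm n c) F y) (liftShape η ℓ y)
      (0, 1) μ) (O ×ˢ univ) := by
  have hm := h.lift.isModel
  have hSV : ContDiffOn ℝ ∞ (fun y => liftShape η ℓ y (0, 1)) (O ×ˢ univ) :=
    hm.S_smooth.clm_apply contDiffOn_const
  exact ((hm.G_smooth.clm_apply hSV).clm_apply
    (hm.horizontalShape_smooth.aeval (Lagrange.basis Λ id μ) |>.clm_apply
      hSV)).continuousOn

/-- By `mem_hopfSet_iff` each of the two values stays in the set near x₀; since the set has exactly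
two elements everywhere, nothing else can enter. -/
theorem exists_hopfSet_eq [FiniteDimensional ℝ H] (h : IsChartLift c O p ν F η ℓ) {Λ : Finset ℝ}
    (hΛ : ∀ x ∈ O, {μ | principalImage (chartDiff p x) (chartShape p ν x) μ ≠ ⊥} = Λ)
    (h2 : ∀ x ∈ O, (hopfSet c (Matrix.of (p x)) (Matrix.of (ν x)) (chartDiff p x)
      (chartShape p ν x)).ncard = 2) {x₀ : H} (hx₀ : x₀ ∈ O) :
    ∃ O' ⊆ O, x₀ ∈ O' ∧ IsOpen O' ∧ ∃ l₁ l₂, l₁ ≠ l₂ ∧ ∀ x ∈ O',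
      hopfSet c (Matrix.of (p x)) (Matrix.of (ν x)) (chartDiff p x) (chartShape p ν x) =
        {l₁, l₂} := by
  obtain ⟨l₁, l₂, hne, hl⟩ := ncard_eq_two.1 (h2 x₀ hx₀)
  have hy₀ : (x₀, (0 : ℝ)) ∈ O ×ˢ univ := ⟨hx₀, trivial⟩
  have hsub := (h.isPointModel hy₀).hopfSet_subset
  rw [hΛ x₀ hx₀, hl] at hsub
  have hsub' : ({l₁, l₂} : Set ℝ) ⊆ hopfSet c (Matrix.of (p x₀)) (Matrix.of (ν x₀))
    (chartDiff p x₀) (chartShape p ν x₀) := hl.ge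
  have key : ∀ μ ∈ ({l₁, l₂} : Set ℝ), ∃ O' ⊆ O, x₀ ∈ O' ∧ IsOpen O' ∧ ∀ x ∈ O',
      μ ∈ hopfSet c (Matrix.of (p x)) (Matrix.of (ν x)) (chartDiff p x) (chartShape p ν x) := by
    intro μ hμ
    have hc : ContinuousOn (fun x : H => IsPointModel.hopfPairing (c / 4) Λ
        (liftMetric (reForm n c) F (x, (0 : ℝ))) (liftShape η ℓ (x, (0 : ℝ))) (0, 1) μ) O :=
      (h.hopfPairing_continuousOn Λ μ).comp (by fun_prop) fun x hx => ⟨hx, trivial⟩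
    refine ⟨_, inter_subset_left, ⟨hx₀, ?_⟩,
      hc.isOpen_inter_preimage h.chart.isOpen (isOpen_compl_singleton (x := (0 : ℝ))), ?_⟩
    · exact ((h.isPointModel hy₀).mem_hopfSet_iff (hΛ x₀ hx₀) (hsub hμ)).1 (hsub' hμ)
    · rintro x ⟨hx, hx'⟩
      exact ((h.isPointModel (y := (x, 0)) ⟨hx, trivial⟩).mem_hopfSet_iff (hΛ x hx)
        (hsub hμ)).2 hx'
  obtain ⟨O₁, hO₁, hx₁, ho₁, hm₁⟩ := key l₁ (by simp)
  obtain ⟨O₂, hO₂, hx₂, ho₂, hm₂⟩ := key l₂ (by simp)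
  refine ⟨O₁ ∩ O₂, fun x hx => hO₁ hx.1, ⟨hx₁, hx₂⟩, ho₁.inter ho₂, l₁, l₂, hne, ?_⟩
  intro x hx
  have hc2 := h2 x (hO₁ hx.1)
  refine (eq_of_subset_of_ncard_le ?_ ?_ (finite_of_ncard_ne_zero (by rw [hc2]; norm_num))).symm
  · rintro μ (rfl | rfl)
    · exact hm₁ x hx.1
    · exact hm₂ x hx.2
  · rw [hc2, ncard_pair hne]

theorem exists_isModelTriple [FiniteDimensional ℝ H] (h : IsChartLift c O p ν F η ℓ) {Λ : Finset ℝ}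
    (hΛ : ∀ x ∈ O, {μ | principalImage (chartDiff p x) (chartShape p ν x) μ ≠ ⊥} = Λ)
    (h2 : ∀ x ∈ O, (hopfSet c (Matrix.of (p x)) (Matrix.of (ν x)) (chartDiff p x)
      (chartShape p ν x)).ncard = 2) {x₀ : H} (hx₀ : x₀ ∈ O) :
    ∃ O' ⊆ O, x₀ ∈ O' ∧ IsOpen O' ∧ ∃ l, c / 4 + l ^ 2 < 0 ∧
      (∀ x ∈ O', hopfSet c (Matrix.of (p x)) (Matrix.of (ν x)) (chartDiff p x)
        (chartShape p ν x) = {hopfCurvature₁ c l, hopfCurvature₂ c l}) ∧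
      ∃ Ω ⊆ O ×ˢ univ, (∀ x ∈ O', (x, (0 : ℝ)) ∈ Ω) ∧
        IsModelDouble (c / 4) l l Λ Ω (liftMetric (reForm n c) F) (liftGamma F ℓ)
          (liftShape η ℓ) (liftPhi (mulI n) F ℓ) (0, 1) := by
  obtain ⟨O₁, hO₁, hx₁, ho₁, l₁, l₂, hne, hl⟩ := h.exists_hopfSet_eq hΛ h2 hx₀
  have h' := h.mono hO₁ ho₁
  have hm : IsModelTwo (c / 4) (l₁ + l₂) (l₁ * l₂ - c / 4) Λ (O₁ ×ˢ univ)
      (liftMetric (reForm n c) F) (liftGamma F ℓ) (liftShape η ℓ) (liftPhi (mulI n) F ℓ)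
      (0, 1) :=
    { h'.lift.isModel with
      cubic := fun y hy => (h'.isPointModel hy).cubic (hl y.1 hy.1)
      -- As e₂ + κ = l₁l₂, the discriminant is (l₁ - l₂)².
      disc := by
        have : (l₁ - l₂) ^ 2 ≠ 0 := pow_ne_zero 2 (sub_ne_zero.2 hne)
        intro h0
        apply this
        linear_combination h0
      pos := fun y hy => (h'.isPointModel hy).pos
      a_ne := fun y hy => (h'.isPointModel hy).a_ne hne (hl y.1 hy.1)
      spectral := fun y hy u h1 h2 h3 =>
        (h'.isPointModel hy).spectral (hΛ y.1 (hO₁ hy.1)) (hl y.1 hy.1) h1 h2 h3 }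
  obtain ⟨Ω, hΩ, hxΩ, l, he₁, he₂, hneg, hd⟩ :=
    hm.exists_isModelTriple (x := (x₀, (0 : ℝ))) ⟨hx₁, trivial⟩
  have hcont : Continuous fun x : H => (x, (0 : ℝ)) := by fun_prop
  refine ⟨(fun x : H => (x, (0 : ℝ))) ⁻¹' Ω, fun x hx => hO₁ (hΩ hx).1, hxΩ,
    hd.isOpen.preimage hcont, l, hneg, ?_, Ω, fun y hy => ⟨hO₁ (hΩ hy).1, trivial⟩,
    fun x hx => hx, hd⟩
  intro x hx
  rw [hl x (hΩ hx).1]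
  refine pair_eq_of_sum_prod ?_ ?_
  · rw [he₁, hopfCurvature_add]
  · rw [hopfCurvature_mul hneg]; linear_combination he₂

end IsChartLift

end ChartModel

/-! ### The weights of the Hopf vector and the frame U₁, U₂, A -/

noncomputable section TriplePoint

/-- The squared length of the component of the Hopf vector in the principal curvature space of `α`,
if the Hopf vector has nonzero components for `α` and `β` only. -/
def hopfWeight (c l α β : ℝ) : ℝ := 4 * (β - 2 * l) * (α - l) ^ 2 / (c * (α - β))

/-- From the sum and the product, (l - λ₁)(l - λ₂) = κ + l² < 0, so l lies strictly between λ₁ and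
λ₂. -/
theorem hopfCurvature₁_lt {c l : ℝ} (h : c / 4 + l ^ 2 < 0) : hopfCurvature₁ c l < l := by
  have hs := hopfCurvature_add c l
  have hp := hopfCurvature_mul h
  have hlt := hopfCurvature_lt h
  nlinarith

theorem lt_hopfCurvature₂ {c l : ℝ} (h : c / 4 + l ^ 2 < 0) : l < hopfCurvature₂ c l := by
  have hs := hopfCurvature_add c l
  have hp := hopfCurvature_mul h
  have hlt := hopfCurvature_lt h
  nlinarith

/-- Here λ₂ - 2l = l - λ₁ is positive and the denominator is a product of two negative numbers. The
second weight is treated in the same way after two sign changes. -/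
theorem hopfWeight₁_pos {c l : ℝ} (h : c / 4 + l ^ 2 < 0) :
    0 < hopfWeight c l (hopfCurvature₁ c l) (hopfCurvature₂ c l) := by
  have h1 := hopfCurvature₁_lt h
  have hs := hopfCurvature_add c l
  have hlt := hopfCurvature_lt h
  have h2 : 0 < (hopfCurvature₁ c l - l) ^ 2 := by
    apply sq_pos_of_neg; linarith
  have h3 : 0 < hopfCurvature₂ c l - 2 * l := by linarith
  have h4 : 0 < c * (hopfCurvature₁ c l - hopfCurvature₂ c l) :=
    mul_pos_of_neg_of_neg (by nlinarith) (by linarith)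
  unfold hopfWeight
  positivity

theorem hopfWeight₂_pos {c l : ℝ} (h : c / 4 + l ^ 2 < 0) :
    0 < hopfWeight c l (hopfCurvature₂ c l) (hopfCurvature₁ c l) := by
  have h1 := lt_hopfCurvature₂ h
  have hs := hopfCurvature_add c l
  have hlt := hopfCurvature_lt h
  have h2 : 0 < (hopfCurvature₂ c l - l) ^ 2 := by
    apply sq_pos_of_pos; linarith
  have h3 : 0 < 2 * l - hopfCurvature₁ c l := by linarith
  have h4 : 0 < -c * (hopfCurvature₂ c l - hopfCurvature₁ c l) :=
    mul_pos (by nlinarith) (by linarith)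
  have h5 : hopfWeight c l (hopfCurvature₂ c l) (hopfCurvature₁ c l) =
      4 * (2 * l - hopfCurvature₁ c l) * (hopfCurvature₂ c l - l) ^ 2 /
        (-c * (hopfCurvature₂ c l - hopfCurvature₁ c l)) := by
    rw [hopfWeight, neg_mul, div_neg, ← neg_div]
    ring
  rw [h5]
  positivity

variable {n : ℕ} {X E : Type*} [AddCommGroup X] [Module ℝ X] [NormedAddCommGroup E]
  [NormedSpace ℝ E]

/-- The component of the Hopf vector `-S V` for the principal curvature `α`, if the other one is
`β`. -/
def hopfVec (κ : ℝ) (S : E →L[ℝ] E) (V : E) (α β : ℝ) : E :=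
  (α - β)⁻¹ • (κ • V - S (S V) + β • S V)

/-- The data of `IsPointModel` at a point where the shape operator satisfies `(S - l)³ V = 0`. -/
structure IsTriplePoint (c l : ℝ) (P N : Mat n) (D Sh : X →ₗ[ℝ] Mat n) (G : E →L[ℝ] E →L[ℝ] ℝ)
    (S φ : E →L[ℝ] E) (V : E) (π : E →ₗ[ℝ] Mat n) : Prop
    extends IsPointModel c P N D Sh G S φ V π where
  neg : c / 4 + l ^ 2 < 0
  cubic : S (S (S V)) = (3 * l) • S (S V) - (3 * l ^ 2) • S V + l ^ 3 • V
  S_a : S (φ (S (S V))) = l • φ (S (S V))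
  split : ∀ u ∈ cyclicOrth G S V, ∃ v ∈ cyclicOrth G S V, ∃ w ∈ cyclicOrth G S V,
    u = v + w ∧ S v = l • v ∧ l • S w = -(c / 4) • w
  φ_perp : ∀ u ∈ cyclicOrth G S V, ∀ w ∈ cyclicOrth G S V, l • S u = -(c / 4) • u →
    l • S w = -(c / 4) • w → G (φ u) w = 0

/-- The vectors `U₁`, `U₂`, `A` at a point of the hypersurface. -/
structure IsHopfFrame (c l : ℝ) (P N : Mat n) (D Sh : X →ₗ[ℝ] Mat n) (U₁ U₂ A : Mat n) : Prop where
  mem₁ : U₁ ∈ principalImage D Sh (hopfCurvature₁ c l)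
  mem₂ : U₂ ∈ principalImage D Sh (hopfCurvature₂ c l)
  mem_A : A ∈ principalImage D Sh l
  unit₁ : ambientMetric c U₁ U₁ = 1
  unit₂ : ambientMetric c U₂ U₂ = 1
  unit_A : ambientMetric c A A = 1
  hopf : ambientJ P N = √(hopfWeight c l (hopfCurvature₁ c l) (hopfCurvature₂ c l)) • U₁
    + √(hopfWeight c l (hopfCurvature₂ c l) (hopfCurvature₁ c l)) • U₂
  J₁ : ambientJ P U₁ = -(√(hopfWeight c l (hopfCurvature₂ c l) (hopfCurvature₁ c l)) • A)
    - √(hopfWeight c l (hopfCurvature₁ c l) (hopfCurvature₂ c l)) • N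
  J₂ : ambientJ P U₂ = √(hopfWeight c l (hopfCurvature₁ c l) (hopfCurvature₂ c l)) • A
    - √(hopfWeight c l (hopfCurvature₂ c l) (hopfCurvature₁ c l)) • N
  J_A : ambientJ P A = √(hopfWeight c l (hopfCurvature₂ c l) (hopfCurvature₁ c l)) • U₁
    - √(hopfWeight c l (hopfCurvature₁ c l) (hopfCurvature₂ c l)) • U₂

namespace IsTriplePoint

variable {c l : ℝ} {P N : Mat n} {D Sh : X →ₗ[ℝ] Mat n} {G : E →L[ℝ] E →L[ℝ] ℝ}
  {S φ : E →L[ℝ] E} {V : E} {π : E →ₗ[ℝ] Mat n}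

theorem SV_SSV (h : IsTriplePoint c l P N D Sh G S φ V π) :
    G (S V) (S (S V)) = 3 * l + l ^ 3 * (c / 4)⁻¹ := by
  have h1 := congrArg (G V) h.cubic
  rw [← h.S_symm] at h1
  simpa [h.V_SSV, h.V_SV, h.V_V] using h1

section pair

variable {α β : ℝ}

/-- The triple root fixes G(SV, S²V) = 3l + l³/κ (`SV_SSV`). This turns the squared length of the
α-component of the Hopf vector into the stated formula for bᵢ². -/
theorem weight_eq (h : IsTriplePoint c l P N D Sh G S φ V π) (hs : α + β = 3 * l)
    (hp : α * β = 3 * l ^ 2 + c / 4) (hne : α ≠ β) :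
    (G (S V) (S (S V)) - β) / (α - β) = hopfWeight c l α β := by
  have hc := h.c_ne
  have h1 := sub_ne_zero.2 hne
  rw [h.SV_SSV, hopfWeight]
  field_simp
  have hb : β = 3 * l - α := by linarith
  subst hb
  linear_combination (-4 * α) * hp

theorem hopfVec_horizontal (h : IsTriplePoint c l P N D Sh G S φ V π) :
    G V (hopfVec (c / 4) S V α β) = 0 := by
  have hc := h.c_ne
  simp only [hopfVec, map_smul, map_add, map_sub, h.V_V, h.V_SSV, h.V_SV, smul_eq_mul]
  field_simp
  ring

theorem hopfVec_SV (h : IsTriplePoint c l P N D Sh G S φ V π) (hs : α + β = 3 * l)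
    (hp : α * β = 3 * l ^ 2 + c / 4) (hne : α ≠ β) :
    G (hopfVec (c / 4) S V α β) (S V) = -hopfWeight c l α β := by
  rw [← h.weight_eq hs hp hne, h.symm]
  simp only [hopfVec, map_smul, map_add, map_sub, h.SV_V, h.SV_SV, smul_eq_mul]
  ring

theorem φ_hopfVec (h : IsTriplePoint c l P N D Sh G S φ V π) :
    φ (hopfVec (c / 4) S V α β) = -(α - β)⁻¹ • φ (S (S V)) := by
  simp only [hopfVec, map_smul, map_add, map_sub, h.φ_V, h.φ_SV]
  module

theorem hopfVec_add (hne : α ≠ β) (κ : ℝ) :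
    hopfVec κ S V α β + hopfVec κ S V β α = -S V := by
  have h1 := sub_ne_zero.2 hne
  have h2 : (β - α)⁻¹ = -(α - β)⁻¹ := by rw [← neg_sub, inv_neg]
  rw [hopfVec, hopfVec, h2]
  match_scalars <;> field_simp <;> ring

theorem hopfVec_smul_add (hne : α ≠ β) (κ : ℝ) :
    α • hopfVec κ S V α β + β • hopfVec κ S V β α = κ • V - S (S V) := by
  have h1 := sub_ne_zero.2 hne
  have h2 : (β - α)⁻¹ = -(α - β)⁻¹ := by rw [← neg_sub, inv_neg]
  rw [hopfVec, hopfVec, h2]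
  match_scalars <;> field_simp <;> ring

theorem hopfVec_eigen (h : IsTriplePoint c l P N D Sh G S φ V π) (hs : α + β = 3 * l)
    (hp : α * β = 3 * l ^ 2 + c / 4) :
    hopfVec (c / 4) S V α β ∈ horizontalEigen (c / 4) G S V α := by
  refine ⟨h.hopfVec_horizontal, ?_⟩
  have hc := h.c_ne
  simp only [hopfVec, map_smul, map_add, map_sub, h.horizontalShape_V, h.horizontalShape_SV,
    h.horizontalShape_SSV, h.cubic, h.SV_SSV]
  have hb : β = 3 * l - α := by linarith
  subst hb
  have h3 : c / 4 * (3 * l + l ^ 3 * (c / 4)⁻¹) = 3 * l * (c / 4) + l ^ 3 := by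
    field_simp
  rw [h3, smul_comm α]
  congr 1
  linear_combination (norm := module) (-hp) • (S V)

theorem hopfVec_orthogonal (h : IsTriplePoint c l P N D Sh G S φ V π) (hs : α + β = 3 * l)
    (hp : α * β = 3 * l ^ 2 + c / 4) (hne : α ≠ β) :
    G (hopfVec (c / 4) S V α β) (hopfVec (c / 4) S V β α) = 0 := by
  have h1 := h.horizontalShape_symm (hopfVec (c / 4) S V α β) (hopfVec (c / 4) S V β α)
  rw [(h.hopfVec_eigen hs hp).2, (h.hopfVec_eigen (by linarith) (by linarith)).2, map_smul,
    map_smul, _root_.smul_apply, smul_eq_mul, smul_eq_mul] at h1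
  have h2 : (α - β) * G (hopfVec (c / 4) S V α β) (hopfVec (c / 4) S V β α) = 0 := by
    linear_combination h1
  exact (mul_eq_zero.1 h2).resolve_left (sub_ne_zero.2 hne)

theorem hopfVec_self (h : IsTriplePoint c l P N D Sh G S φ V π) (hs : α + β = 3 * l)
    (hp : α * β = 3 * l ^ 2 + c / 4) (hne : α ≠ β) :
    G (hopfVec (c / 4) S V α β) (hopfVec (c / 4) S V α β) = hopfWeight c l α β := by
  have h1 := congrArg (G (hopfVec (c / 4) S V α β)) (hopfVec_add (S := S) (V := V) hne (c / 4))
  rw [map_add, h.hopfVec_orthogonal hs hp hne, map_neg, h.hopfVec_SV hs hp hne] at h1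
  linarith

end pair

theorem a_horizontal (h : IsTriplePoint c l P N D Sh G S φ V π) : G V (φ (S (S V))) = 0 := by
  rw [h.symm, h.φ_skew, h.φ_V, map_zero, neg_zero]

theorem a_mem (h : IsTriplePoint c l P N D Sh G S φ V π) : φ (S (S V)) ∈ cyclicOrth G S V := by
  refine ⟨by rw [h.symm, h.a_horizontal], by rw [h.φ_skew, h.φ_SV, map_zero, neg_zero], ?_⟩
  have h1 := h.φ_skew (S (S V)) (S (S V))
  rw [h.symm (S (S V))] at h1
  linarith

theorem horizontalShape_of_mem (h : IsTriplePoint c l P N D Sh G S φ V π) {u : E}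
    (hu : u ∈ cyclicOrth G S V) : horizontalShape (c / 4) G S V u = S u := by
  rw [horizontalShape_apply, h.symm _ u, hu.2.1, h.symm _ u, hu.1]
  simp

theorem mem_horizontalEigen (h : IsTriplePoint c l P N D Sh G S φ V π) {u : E} {μ : ℝ}
    (hu : u ∈ cyclicOrth G S V) (hS : S u = μ • u) : u ∈ horizontalEigen (c / 4) G S V μ :=
  ⟨by rw [h.symm, hu.1], by rw [h.horizontalShape_of_mem hu, hS]⟩

theorem hopfVec_pair_mem (h : IsTriplePoint c l P N D Sh G S φ V π) {u : E} {α β : ℝ}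
    (hu : u ∈ cyclicOrth G S V) : G (hopfVec (c / 4) S V α β) u = 0 := by
  rw [h.symm]
  simp [hopfVec, hu.1, hu.2.1, hu.2.2]

theorem φ_a (h : IsTriplePoint c l P N D Sh G S φ V π) {α β : ℝ} (hs : α + β = 3 * l)
    (hp : α * β = 3 * l ^ 2 + c / 4) (hne : α ≠ β) :
    φ (φ (S (S V))) = (α - β) • (hopfWeight c l β α • hopfVec (c / 4) S V α β
      - hopfWeight c l α β • hopfVec (c / 4) S V β α) := by
  have h1 := sub_ne_zero.2 hne
  have h1' := sub_ne_zero.2 hne.symm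
  rw [h.φ_φ, h.symm, h.symm _ V, h.V_SSV, ← h.weight_eq hs hp hne,
    ← h.weight_eq (by linarith) (by linarith) hne.symm]
  have e1 := hopfVec_add (S := S) (V := V) hne (c / 4)
  have e2 := hopfVec_smul_add (S := S) (V := V) hne (c / 4)
  linear_combination (norm := skip) (G (S V) (S (S V))) • e1 - e2
  have h2 : β - α = -(α - β) := by ring
  rw [h2]
  match_scalars <;> field_simp <;> ring

theorem a_a (h : IsTriplePoint c l P N D Sh G S φ V π) {α β : ℝ} (hs : α + β = 3 * l)
    (hp : α * β = 3 * l ^ 2 + c / 4) (hne : α ≠ β) :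
    G (φ (S (S V))) (φ (S (S V))) =
      (α - β) ^ 2 * (hopfWeight c l α β * hopfWeight c l β α) := by
  have e2 := hopfVec_smul_add (S := S) (V := V) hne (c / 4)
  have e3 : S (S V) = (c / 4) • V - (α • hopfVec (c / 4) S V α β + β • hopfVec (c / 4) S V β α) := by
    rw [e2]; abel
  have o1 := h.hopfVec_orthogonal hs hp hne
  have o2 := h.hopfVec_self hs hp hne
  have o3 := h.hopfVec_self (α := β) (β := α) (by linarith) (by linarith) hne.symm
  rw [h.φ_skew, h.φ_a hs hp hne]
  nth_rewrite 1 [e3]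
  simp only [map_sub, map_add, map_smul, _root_.sub_apply, _root_.add_apply, _root_.smul_apply,
    h.hopfVec_horizontal, smul_eq_mul, o1, o2, o3,
    h.symm (hopfVec (c / 4) S V β α) (hopfVec (c / 4) S V α β)]
  ring

/-- The vectors `U₁`, `U₂`, `A` in terms of the lift. -/
theorem isHopfFrame (h : IsTriplePoint c l P N D Sh G S φ V π) {α β b₁ b₂ : ℝ}
    (hα : α = hopfCurvature₁ c l) (hβ : β = hopfCurvature₂ c l)
    (hb₁ : b₁ = √(hopfWeight c l α β)) (hb₂ : b₂ = √(hopfWeight c l β α)) :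
    IsHopfFrame c l P N D Sh (b₁⁻¹ • π (hopfVec (c / 4) S V α β))
      (b₂⁻¹ • π (hopfVec (c / 4) S V β α))
      (((α - β) * b₁ * b₂)⁻¹ • π (φ (S (S V)))) := by
  have hs : α + β = 3 * l := by rw [hα, hβ, hopfCurvature_add]
  have hp : α * β = 3 * l ^ 2 + c / 4 := by rw [hα, hβ, hopfCurvature_mul h.neg]
  have hne : α ≠ β := by rw [hα, hβ]; exact (hopfCurvature_lt h.neg).ne
  have hs' : β + α = 3 * l := by linarith
  have hp' : β * α = 3 * l ^ 2 + c / 4 := by linarith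
  have hw₁ : 0 < hopfWeight c l α β := by rw [hα, hβ]; exact hopfWeight₁_pos h.neg
  have hw₂ : 0 < hopfWeight c l β α := by rw [hα, hβ]; exact hopfWeight₂_pos h.neg
  have q₁ : b₁ ^ 2 = hopfWeight c l α β := by rw [hb₁, Real.sq_sqrt hw₁.le]
  have q₂ : b₂ ^ 2 = hopfWeight c l β α := by rw [hb₂, Real.sq_sqrt hw₂.le]
  have p₁ : b₁ ≠ 0 := by rw [hb₁]; exact (Real.sqrt_pos.2 hw₁).ne'
  have p₂ : b₂ ≠ 0 := by rw [hb₂]; exact (Real.sqrt_pos.2 hw₂).ne'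
  have hd := sub_ne_zero.2 hne
  have hmem : ∀ {μ : ℝ} {u : E} (r : ℝ), u ∈ horizontalEigen (c / 4) G S V μ →
      r • π u ∈ principalImage D Sh μ := fun r hu =>
    Submodule.smul_mem _ _ (h.mem_principalImage_iff.2 ⟨_, hu, rfl⟩)
  have hmet : ∀ (r : ℝ) (u : E), G u V = 0 → ambientMetric c (r • π u) (r • π u) =
      r ^ 2 * G u u := by
    intro r u hu
    rw [← map_smul, h.metric _ _ (by simp [hu]) (by simp [hu])]
    simp; ring
  have hJ : ∀ (r : ℝ) (u : E), ambientJ P (r • π u) = r • (π (φ u) + G u (S V) • N) := by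
    intro r u
    rw [← map_smul, h.J_π]
    simp [smul_smul]
  have hv₁ := h.hopfVec_SV hs hp hne
  have hv₂ := h.hopfVec_SV hs' hp' hne.symm
  have hd' : (β - α)⁻¹ = -(α - β)⁻¹ := by rw [← neg_sub, inv_neg]
  exact {
    mem₁ := hα ▸ hmem _ (h.hopfVec_eigen hs hp)
    mem₂ := hβ ▸ hmem _ (h.hopfVec_eigen hs' hp')
    mem_A := hmem _ (h.mem_horizontalEigen h.a_mem h.S_a)
    unit₁ := by
      rw [hmet _ _ (by rw [h.symm, h.hopfVec_horizontal]), h.hopfVec_self hs hp hne, ← q₁]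
      field_simp
    unit₂ := by
      rw [hmet _ _ (by rw [h.symm, h.hopfVec_horizontal]), h.hopfVec_self hs' hp' hne.symm, ← q₂]
      field_simp
    unit_A := by
      rw [hmet _ _ h.a_mem.1, h.a_a hs hp hne, ← q₁, ← q₂]
      field_simp
    hopf := by
      rw [← hα, ← hβ, ← hb₁, ← hb₂, smul_smul, smul_smul, mul_inv_cancel₀ p₁, mul_inv_cancel₀ p₂,
        one_smul, one_smul, ← map_add, hopfVec_add hne, h.J_N, map_neg]
    J₁ := by
      rw [← hα, ← hβ, ← hb₁, ← hb₂, hJ, h.φ_hopfVec, map_smul, hv₁, ← q₁]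
      match_scalars <;> field_simp
    J₂ := by
      rw [← hα, ← hβ, ← hb₁, ← hb₂, hJ, h.φ_hopfVec, map_smul, hv₂, ← q₂, hd']
      match_scalars <;> field_simp
    J_A := by
      rw [← hα, ← hβ, ← hb₁, ← hb₂, hJ, h.φ_a hs hp hne, h.a_mem.2.1, ← q₁, ← q₂, zero_smul, add_zero]
      simp only [map_smul, map_sub]
      match_scalars <;> field_simp }

end IsTriplePoint

/-- The eigenvalues λ₁ and λ₂ differ and D is injective, so the Hopf vector has only one
decomposition; then A is recovered from J U₁ because b₂ ≠ 0. This uniqueness lets local frames be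
glued. -/
theorem IsHopfFrame.unique {c l : ℝ} {P N : Mat n} {D Sh : X →ₗ[ℝ] Mat n} {U₁ U₂ A U₁' U₂' A' : Mat n}
    (h : IsHopfFrame c l P N D Sh U₁ U₂ A) (h' : IsHopfFrame c l P N D Sh U₁' U₂' A')
    (hl : c / 4 + l ^ 2 < 0) (hD : Function.Injective D) : U₁ = U₁' ∧ U₂ = U₂' ∧ A = A' := by
  have p₁ := (Real.sqrt_pos.2 (hopfWeight₁_pos hl)).ne'
  have p₂ := (Real.sqrt_pos.2 (hopfWeight₂_pos hl)).ne'
  have e := h.hopf.symm.trans h'.hopf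
  set b₁ := √(hopfWeight c l (hopfCurvature₁ c l) (hopfCurvature₂ c l))
  set b₂ := √(hopfWeight c l (hopfCurvature₂ c l) (hopfCurvature₁ c l))
  have e1 : b₁ • (U₁ - U₁') = b₂ • (U₂' - U₂) := by
    linear_combination (norm := module) e
  have m1 : b₁ • (U₁ - U₁') ∈ principalImage D Sh (hopfCurvature₁ c l) :=
    Submodule.smul_mem _ _ (Submodule.sub_mem _ h.mem₁ h'.mem₁)
  have m2 : b₁ • (U₁ - U₁') ∈ principalImage D Sh (hopfCurvature₂ c l) := by
    rw [e1]
    exact Submodule.smul_mem _ _ (Submodule.sub_mem _ h'.mem₂ h.mem₂)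
  obtain ⟨v, hv, hv'⟩ := mem_principalImage.1 m1
  obtain ⟨w, hw, hw'⟩ := mem_principalImage.1 m2
  have hvw : v = w := hD (hv'.trans hw'.symm)
  subst hvw
  have h0 : (hopfCurvature₁ c l - hopfCurvature₂ c l) • D v = 0 := by
    rw [sub_smul, ← hv, ← hw, sub_self]
  have h1 : D v = 0 :=
    (smul_eq_zero.1 h0).resolve_left (sub_ne_zero.2 (hopfCurvature_lt hl).ne)
  rw [hv'] at h1
  have u1 : U₁ = U₁' := sub_eq_zero.1 ((smul_eq_zero.1 h1).resolve_left p₁)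
  rw [e1] at h1
  have u2 : U₂' = U₂ := sub_eq_zero.1 ((smul_eq_zero.1 h1).resolve_left p₂)
  refine ⟨u1, u2.symm, ?_⟩
  have h3 := h.J₁
  rw [u1, h'.J₁] at h3
  have h4 : b₂ • A = b₂ • A' := by linear_combination (norm := module) h3
  exact smul_right_injective _ p₂ h4

end TriplePoint

/-! ### Decomposition of the tangent space, and dimensions of the principal spaces -/

noncomputable section TripleDecomposition

variable {n : ℕ} {X E : Type*} [AddCommGroup X] [Module ℝ X] [NormedAddCommGroup E]
  [NormedSpace ℝ E]

/-- The eigenvectors of `S` for the eigenvalue `-κ / l` that are orthogonal to `V`, `S V` and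
`S² V`; the zero space if `l = 0`. -/
def residualSpace (κ l : ℝ) (G : E →L[ℝ] E →L[ℝ] ℝ) (S : E →L[ℝ] E) (V : E) : Submodule ℝ E :=
  cyclicOrth G S V ⊓ LinearMap.ker (l • S.toLinearMap + κ • LinearMap.id)

theorem mem_residualSpace {κ l : ℝ} {G : E →L[ℝ] E →L[ℝ] ℝ} {S : E →L[ℝ] E} {V u : E} :
    u ∈ residualSpace κ l G S V ↔ u ∈ cyclicOrth G S V ∧ l • S u = -κ • u := by
  rw [residualSpace, Submodule.mem_inf, LinearMap.mem_ker, neg_smul, eq_neg_iff_add_eq_zero]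
  rfl

theorem finrank_eq_one_of_unit {c : ℝ} {Q : Submodule ℝ (Mat n)} {U : Mat n} (hU : U ∈ Q)
    (h1 : ambientMetric c U U = 1) (h : ∀ Z ∈ Q, ∃ r : ℝ, r • U = Z) : Module.finrank ℝ Q = 1 := by
  refine finrank_eq_one_iff'.2 ⟨⟨U, hU⟩, fun h0 => ?_, fun Z => ?_⟩
  · rw [show U = 0 from Subtype.ext_iff.1 h0] at h1
    simp [ambientMetric] at h1
  · obtain ⟨r, hr⟩ := h Z Z.2
    exact ⟨r, Subtype.ext hr⟩

namespace IsTriplePoint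

variable {c l : ℝ} {P N : Mat n} {D Sh : X →ₗ[ℝ] Mat n} {G : E →L[ℝ] E →L[ℝ] ℝ}
  {S φ : E →L[ℝ] E} {V : E} {π : E →ₗ[ℝ] Mat n}

/-- The eigenvalues l and -κ/l differ since κ + l² ≠ 0. Writing the second eigenvalue equation
without division keeps l = 0 admissible. -/
theorem eigen_pair (h : IsTriplePoint c l P N D Sh G S φ V π) {v w : E} (hv : S v = l • v)
    (hw : l • S w = -(c / 4) • w) : G v w = 0 := by
  have h1 := h.S_symm v w
  rw [hv, map_smul, _root_.smul_apply, smul_eq_mul] at h1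
  have h2 := congrArg (G v) hw
  rw [map_smul, map_smul, ← h1, smul_eq_mul, smul_eq_mul] at h2
  have h3 : (c / 4 + l ^ 2) * G v w = 0 := by linear_combination h2
  exact (mul_eq_zero.1 h3).resolve_left h.neg.ne

theorem eq_zero_of_self (h : IsTriplePoint c l P N D Sh G S φ V π) {u : E}
    (hu : u ∈ cyclicOrth G S V) (h0 : G u u = 0) : u = 0 := by
  by_contra h1
  exact (h.pos u hu.1 h1).ne' h0

/-- Split φw into an l-part and a residual part. By `φ_perp` the residual part is orthogonal to φw,
hence to itself, and so it vanishes. -/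
theorem φ_residual (h : IsTriplePoint c l P N D Sh G S φ V π) {w : E}
    (hw : w ∈ residualSpace (c / 4) l G S V) :
    φ w ∈ cyclicOrth G S V ∧ S (φ w) = l • φ w ∧ G (φ w) (φ (S (S V))) = 0 ∧
      φ (φ w) = -w := by
  obtain ⟨hw1, hw2⟩ := mem_residualSpace.1 hw
  have hwa : G w (φ (S (S V))) = 0 := by rw [h.symm]; exact h.eigen_pair h.S_a hw2
  have hφφ : φ (φ w) = -w := by rw [h.φ_φ, hw1.1, hw1.2.1]; simp
  have hmem : φ w ∈ cyclicOrth G S V := by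
    refine ⟨?_, ?_, ?_⟩ <;> rw [h.φ_skew]
    · rw [h.φ_V, map_zero, neg_zero]
    · rw [h.φ_SV, map_zero, neg_zero]
    · rw [hwa, neg_zero]
  obtain ⟨v', hv', w', hw', hsum, hSv, hSw⟩ := h.split _ hmem
  have h1 := h.φ_perp w hw1 w' hw' hw2 hSw
  rw [hsum, map_add, _root_.add_apply, h.eigen_pair hSv hSw, zero_add] at h1
  have h2 := h.eq_zero_of_self hw' h1
  rw [h2, add_zero] at hsum
  refine ⟨hmem, by rw [hsum, hSv], ?_, hφφ⟩
  rw [← neg_neg (G (φ w) _), ← h.φ_skew, hφφ, map_neg, _root_.neg_apply, hw1.2.2, neg_zero, neg_zero]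

theorem horizontal_decomposition (h : IsTriplePoint c l P N D Sh G S φ V π) {α β : ℝ}
    (hα : α = hopfCurvature₁ c l) (hβ : β = hopfCurvature₂ c l) {u : E} (hu : G V u = 0) :
    ∃ x y : ℝ, ∃ v ∈ cyclicOrth G S V, ∃ w ∈ residualSpace (c / 4) l G S V, S v = l • v ∧
      u = x • hopfVec (c / 4) S V α β + y • hopfVec (c / 4) S V β α + v + w := by
  have hs : α + β = 3 * l := by rw [hα, hβ, hopfCurvature_add]
  have hp : α * β = 3 * l ^ 2 + c / 4 := by rw [hα, hβ, hopfCurvature_mul h.neg]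
  have hne : α ≠ β := by rw [hα, hβ]; exact (hopfCurvature_lt h.neg).ne
  have hw₁ : hopfWeight c l α β ≠ 0 := by rw [hα, hβ]; exact (hopfWeight₁_pos h.neg).ne'
  have hw₂ : hopfWeight c l β α ≠ 0 := by rw [hα, hβ]; exact (hopfWeight₂_pos h.neg).ne'
  have o1 := h.hopfVec_orthogonal hs hp hne
  have o2 := h.hopfVec_self hs hp hne
  have o3 := h.hopfVec_self (α := β) (β := α) (by linarith) (by linarith) hne.symm
  have o4 := h.hopfVec_horizontal (α := α) (β := β)
  have o5 := h.hopfVec_horizontal (α := β) (β := α)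
  have e1 : S V = -(hopfVec (c / 4) S V α β + hopfVec (c / 4) S V β α) := by
    rw [hopfVec_add hne, neg_neg]
  have e3 : S (S V) =
      (c / 4) • V - (α • hopfVec (c / 4) S V α β + β • hopfVec (c / 4) S V β α) := by
    rw [hopfVec_smul_add hne]; abel
  set u₁ := hopfVec (c / 4) S V α β
  set u₂ := hopfVec (c / 4) S V β α
  set z := u - (G u u₁ / hopfWeight c l α β) • u₁ - (G u u₂ / hopfWeight c l β α) • u₂ with hz
  have z0 : G z V = 0 := by
    simp only [hz, map_sub, map_smul, _root_.sub_apply, _root_.smul_apply, h.symm _ V, hu, o4, o5]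
    simp
  have z1 : G z u₁ = 0 := by
    simp only [hz, map_sub, map_smul, _root_.sub_apply, _root_.smul_apply, h.symm u₂ u₁, o1, o2,
      smul_eq_mul]
    field_simp; ring
  have z2 : G z u₂ = 0 := by
    simp only [hz, map_sub, map_smul, _root_.sub_apply, _root_.smul_apply, o1, o3, smul_eq_mul]
    field_simp; ring
  have zm : z ∈ cyclicOrth G S V := by
    refine ⟨z0, ?_, ?_⟩
    · rw [e1]; simp [z1, z2]
    · rw [e3]; simp [z0, z1, z2]
  obtain ⟨v, hv, w, hw, hsum, hSv, hSw⟩ := h.split z zm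
  refine ⟨G u u₁ / hopfWeight c l α β, G u u₂ / hopfWeight c l β α, v, hv, w,
    mem_residualSpace.2 ⟨hw, hSw⟩, hSv, ?_⟩
  rw [add_assoc, ← hsum, hz]
  abel

/-- Pair the eigenvalue equation with each component. The conclusions are implications so that the
coincidence of -κ/l with λ₂ remains allowed. -/
theorem eigen_decomposition (h : IsTriplePoint c l P N D Sh G S φ V π) {α β : ℝ}
    (hα : α = hopfCurvature₁ c l) (hβ : β = hopfCurvature₂ c l) {u : E} {μ : ℝ}
    (hu : u ∈ horizontalEigen (c / 4) G S V μ) :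
    ∃ x y : ℝ, ∃ v : E, ∃ w ∈ residualSpace (c / 4) l G S V,
      u = x • hopfVec (c / 4) S V α β + y • hopfVec (c / 4) S V β α + v + w ∧
      (μ ≠ α → x = 0) ∧ (μ ≠ β → y = 0) ∧ (μ ≠ l → v = 0) ∧ (c / 4 + l * μ ≠ 0 → w = 0) := by
  have hs : α + β = 3 * l := by rw [hα, hβ, hopfCurvature_add]
  have hp : α * β = 3 * l ^ 2 + c / 4 := by rw [hα, hβ, hopfCurvature_mul h.neg]
  have hne : α ≠ β := by rw [hα, hβ]; exact (hopfCurvature_lt h.neg).ne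
  have hw₁ : hopfWeight c l α β ≠ 0 := by rw [hα, hβ]; exact (hopfWeight₁_pos h.neg).ne'
  have hw₂ : hopfWeight c l β α ≠ 0 := by rw [hα, hβ]; exact (hopfWeight₂_pos h.neg).ne'
  obtain ⟨x, y, v, hv, w, hw, hSv, rfl⟩ := h.horizontal_decomposition hα hβ hu.1
  obtain ⟨hw1, hw2⟩ := mem_residualSpace.1 hw
  have o1 := h.hopfVec_orthogonal hs hp hne
  have o1' := h.hopfVec_orthogonal (α := β) (β := α) (by linarith) (by linarith) hne.symm
  have o2 := h.hopfVec_self hs hp hne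
  have o3 := h.hopfVec_self (α := β) (β := α) (by linarith) (by linarith) hne.symm
  have p1 : ∀ α β {z : E}, z ∈ cyclicOrth G S V → G (hopfVec (c / 4) S V α β) z = 0 :=
    fun α β z hz => h.hopfVec_pair_mem hz
  have hvw := h.eigen_pair hSv hw2
  have hE := hu.2
  have eL : G v (S w) = 0 := by rw [← h.S_symm, hSv]; simp [hvw]
  have eK : l * G w (S w) = -(c / 4) * G w w := by
    have := congrArg (G w) hw2
    rwa [map_smul, map_smul] at this
  simp only [map_add, map_smul, (h.hopfVec_eigen hs hp).2,
    (h.hopfVec_eigen (α := β) (β := α) (by linarith) (by linarith)).2, h.horizontalShape_of_mem hv,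
    h.horizontalShape_of_mem hw1, hSv] at hE
  have hSwm : S w ∈ cyclicOrth G S V := by
    refine ⟨?_, ?_, ?_⟩ <;> rw [h.S_symm]
    · exact hw1.2.1
    · exact hw1.2.2
    · rw [h.cubic]; simp [hw1.1, hw1.2.1, hw1.2.2]
  refine ⟨x, y, v, w, hw, rfl, fun hμ => ?_, fun hμ => ?_, fun hμ => ?_, fun hμ => ?_⟩
  · have h1 := congrArg (G (hopfVec (c / 4) S V α β)) hE
    simp only [map_add, map_smul, smul_eq_mul, o1, o2, p1 _ _ hv, p1 _ _ hw1, p1 _ _ hSwm] at h1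
    have h2 : (μ - α) * (hopfWeight c l α β * x) = 0 := by linear_combination -h1
    exact (mul_eq_zero.1 ((mul_eq_zero.1 h2).resolve_left (sub_ne_zero.2 hμ))).resolve_left hw₁
  · have h1 := congrArg (G (hopfVec (c / 4) S V β α)) hE
    simp only [map_add, map_smul, smul_eq_mul, o1', o3, p1 _ _ hv, p1 _ _ hw1, p1 _ _ hSwm] at h1
    have h2 : (μ - β) * (hopfWeight c l β α * y) = 0 := by linear_combination -h1
    exact (mul_eq_zero.1 ((mul_eq_zero.1 h2).resolve_left (sub_ne_zero.2 hμ))).resolve_left hw₂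
  · have h1 := congrArg (G v) hE
    simp only [map_add, map_smul, smul_eq_mul, h.symm v (hopfVec _ _ _ _ _), p1 _ _ hv, hvw,
      eL] at h1
    have h2 : (μ - l) * G v v = 0 := by linear_combination -h1
    exact h.eq_zero_of_self hv ((mul_eq_zero.1 h2).resolve_left (sub_ne_zero.2 hμ))
  · have h1 := congrArg (G w) hE
    simp only [map_add, map_smul, smul_eq_mul, h.symm w (hopfVec _ _ _ _ _), p1 _ _ hw1,
      h.symm w v, hvw] at h1
    have h2 : (c / 4 + l * μ) * G w w = 0 := by linear_combination eK - l * h1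
    exact h.eq_zero_of_self hw1 ((mul_eq_zero.1 h2).resolve_left hμ)

/-- The only possible principal curvatures. -/
theorem curvature_mem (h : IsTriplePoint c l P N D Sh G S φ V π) {μ : ℝ}
    (hμ : principalImage D Sh μ ≠ ⊥) :
    μ = hopfCurvature₁ c l ∨ μ = hopfCurvature₂ c l ∨ μ = l ∨ c / 4 + l * μ = 0 := by
  by_contra! h0
  obtain ⟨Z, hZ, hZ0⟩ := Submodule.exists_mem_ne_zero_of_ne_bot hμ
  obtain ⟨u, hu, rfl⟩ := h.mem_principalImage_iff.1 hZ
  obtain ⟨x, y, v, w, hw, rfl, h1, h2, h3, h4⟩ := h.eigen_decomposition rfl rfl hu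
  rw [h1 h0.1, h2 h0.2.1, h3 h0.2.2.1, h4 h0.2.2.2] at hZ0
  simp at hZ0

theorem residual_mem (h : IsTriplePoint c l P N D Sh G S φ V π) {μ : ℝ} (hμ : c / 4 + l * μ = 0)
    {w : E} (hw : w ∈ residualSpace (c / 4) l G S V) : w ∈ horizontalEigen (c / 4) G S V μ := by
  obtain ⟨hw1, hw2⟩ := mem_residualSpace.1 hw
  refine h.mem_horizontalEigen hw1 ?_
  have hl : l ≠ 0 := by
    rintro rfl
    exact h.κ_ne (by linarith)
  refine smul_right_injective E hl ?_
  simp only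
  rw [hw2, smul_smul]
  congr 1
  linarith

theorem mem_of_residual (h : IsTriplePoint c l P N D Sh G S φ V π) {μ : ℝ}
    (hμ : c / 4 + l * μ = 0) (hne : μ ≠ hopfCurvature₁ c l) {Z : Mat n}
    (hZ : Z ∈ principalImage D Sh μ) :
    ∃ y : ℝ, ∃ w ∈ residualSpace (c / 4) l G S V, (μ ≠ hopfCurvature₂ c l → y = 0) ∧
      π (y • hopfVec (c / 4) S V (hopfCurvature₂ c l) (hopfCurvature₁ c l) + w) = Z := by
  obtain ⟨u, hu, rfl⟩ := h.mem_principalImage_iff.1 hZ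
  obtain ⟨x, y, v, w, hw, rfl, h1, h2, h3, h4⟩ := h.eigen_decomposition rfl rfl hu
  have hl : μ ≠ l := by
    rintro rfl
    have := h.neg
    nlinarith
  refine ⟨y, w, hw, h2, ?_⟩
  rw [h1 hne, h3 hl, zero_smul, zero_add, add_zero]

theorem finrank_principalImage₁ (h : IsTriplePoint c l P N D Sh G S φ V π)
    (hne : c / 4 + l * hopfCurvature₁ c l ≠ 0) :
    Module.finrank ℝ (principalImage D Sh (hopfCurvature₁ c l)) = 1 := by
  have hf := h.isHopfFrame rfl rfl rfl rfl
  refine finrank_eq_one_of_unit hf.mem₁ hf.unit₁ fun Z hZ => ?_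
  obtain ⟨u, hu, rfl⟩ := h.mem_principalImage_iff.1 hZ
  obtain ⟨x, y, v, w, hw, rfl, h1, h2, h3, h4⟩ := h.eigen_decomposition rfl rfl hu
  have hb := (Real.sqrt_pos.2 (hopfWeight₁_pos h.neg)).ne'
  refine ⟨x * √(hopfWeight c l (hopfCurvature₁ c l) (hopfCurvature₂ c l)), ?_⟩
  rw [h2 (hopfCurvature_lt h.neg).ne, h3 (hopfCurvature₁_lt h.neg).ne, h4 hne]
  simp [smul_smul, hb]

theorem finrank_principalImage₂ (h : IsTriplePoint c l P N D Sh G S φ V π)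
    (hne : c / 4 + l * hopfCurvature₂ c l ≠ 0) :
    Module.finrank ℝ (principalImage D Sh (hopfCurvature₂ c l)) = 1 := by
  have hf := h.isHopfFrame rfl rfl rfl rfl
  refine finrank_eq_one_of_unit hf.mem₂ hf.unit₂ fun Z hZ => ?_
  obtain ⟨u, hu, rfl⟩ := h.mem_principalImage_iff.1 hZ
  obtain ⟨x, y, v, w, hw, rfl, h1, h2, h3, h4⟩ := h.eigen_decomposition rfl rfl hu
  have hb := (Real.sqrt_pos.2 (hopfWeight₂_pos h.neg)).ne'
  refine ⟨y * √(hopfWeight c l (hopfCurvature₂ c l) (hopfCurvature₁ c l)), ?_⟩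
  rw [h1 (hopfCurvature_lt h.neg).ne', h3 (lt_hopfCurvature₂ h.neg).ne', h4 hne]
  simp [smul_smul, hb]

theorem residual_horizontal (h : IsTriplePoint c l P N D Sh G S φ V π) {w : E}
    (hw : w ∈ residualSpace (c / 4) l G S V) : G V w = 0 := by
  rw [h.symm]; exact (mem_residualSpace.1 hw).1.1

theorem finrank_map_residual (h : IsTriplePoint c l P N D Sh G S φ V π) (Q : Submodule ℝ E)
    (hQ : ∀ u ∈ Q, G V u = 0) : Module.finrank ℝ (Q.map π) = Module.finrank ℝ Q := by
  rw [← LinearMap.range_domRestrict]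
  refine LinearMap.finrank_range_of_inj ?_
  rintro ⟨u, hu⟩ ⟨v, hv⟩ huv
  exact Subtype.ext (h.π_injOn (hQ u hu) (hQ v hv) huv)

theorem finrank_principalImage_residual (h : IsTriplePoint c l P N D Sh G S φ V π) {μ : ℝ}
    (hμ : c / 4 + l * μ = 0) (hne₁ : μ ≠ hopfCurvature₁ c l) (hne₂ : μ ≠ hopfCurvature₂ c l) :
    Module.finrank ℝ (principalImage D Sh μ) =
      Module.finrank ℝ (residualSpace (c / 4) l G S V) := by
  have h1 : principalImage D Sh μ = (residualSpace (c / 4) l G S V).map π := by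
    ext Z
    rw [Submodule.mem_map]
    constructor
    · intro hZ
      obtain ⟨y, w, hw, hy, rfl⟩ := h.mem_of_residual hμ hne₁ hZ
      exact ⟨w, hw, by rw [hy hne₂, zero_smul, zero_add]⟩
    · rintro ⟨w, hw, rfl⟩
      exact h.mem_principalImage_iff.2 ⟨w, h.residual_mem hμ hw, rfl⟩
  rw [h1, h.finrank_map_residual _ fun u hu => h.residual_horizontal hu]

/-- When -κ/l coincides with λ₂, the principal space is the image of the residual space together
with the line of U₂, which is the summand 1. -/
theorem finrank_principalImage_residual₂ [FiniteDimensional ℝ E]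
    (h : IsTriplePoint c l P N D Sh G S φ V π) (hμ : c / 4 + l * hopfCurvature₂ c l = 0) :
    Module.finrank ℝ (principalImage D Sh (hopfCurvature₂ c l)) =
      Module.finrank ℝ (residualSpace (c / 4) l G S V) + 1 := by
  set u := hopfVec (c / 4) S V (hopfCurvature₂ c l) (hopfCurvature₁ c l) with hu
  have hs := hopfCurvature_add c l
  have hp := hopfCurvature_mul h.neg
  have huu := h.hopfVec_self (α := hopfCurvature₂ c l) (β := hopfCurvature₁ c l) (by linarith)
    (by linarith) (hopfCurvature_lt h.neg).ne'
  have hu0 : u ≠ 0 := by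
    intro h0
    rw [← hu, h0, map_zero] at huu
    exact (hopfWeight₂_pos h.neg).ne huu
  have hdis : residualSpace (c / 4) l G S V ⊓ Submodule.span ℝ {u} = ⊥ := by
    rw [eq_bot_iff]
    rintro w ⟨hw1, hw2⟩
    obtain ⟨r, rfl⟩ := Submodule.mem_span_singleton.1 hw2
    have h1 := h.hopfVec_pair_mem (α := hopfCurvature₂ c l) (β := hopfCurvature₁ c l)
      (mem_residualSpace.1 hw1).1
    rw [map_smul, ← hu, hu, huu, smul_eq_mul] at h1
    have h2 := (mul_eq_zero.1 h1).resolve_right (hopfWeight₂_pos h.neg).ne'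
    rw [h2, zero_smul]
    exact Submodule.zero_mem _
  have h1 := Submodule.finrank_sup_add_finrank_inf_eq (residualSpace (c / 4) l G S V)
    (Submodule.span ℝ {u})
  rw [hdis, finrank_bot, add_zero, finrank_span_singleton hu0] at h1
  have hmem : u ∈ horizontalEigen (c / 4) G S V (hopfCurvature₂ c l) :=
    h.hopfVec_eigen (by linarith) (by linarith)
  have hle : residualSpace (c / 4) l G S V ⊔ Submodule.span ℝ {u} ≤
      horizontalEigen (c / 4) G S V (hopfCurvature₂ c l) := by
    refine sup_le (fun w hw => h.residual_mem hμ hw) ?_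
    rw [Submodule.span_singleton_le_iff_mem]
    exact hmem
  have h2 : principalImage D Sh (hopfCurvature₂ c l) =
      (residualSpace (c / 4) l G S V ⊔ Submodule.span ℝ {u}).map π := by
    ext Z
    rw [Submodule.mem_map]
    constructor
    · intro hZ
      obtain ⟨y, w, hw, -, rfl⟩ := h.mem_of_residual hμ (hopfCurvature_lt h.neg).ne' hZ
      refine ⟨_, Submodule.add_mem _ (Submodule.mem_sup_right ?_) (Submodule.mem_sup_left hw), rfl⟩
      exact Submodule.smul_mem _ _ (Submodule.mem_span_singleton_self u)
    · rintro ⟨z, hz, rfl⟩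
      exact h.mem_principalImage_iff.2 ⟨z, hle hz, rfl⟩
  rw [h2, h.finrank_map_residual _ fun z hz => (hle hz).1, h1]

/-- The residual space, its image under φ, and the four vectors V, u₁, u₂, a are mutually orthogonal
and thus independent in E. -/
theorem finrank_residual_le [FiniteDimensional ℝ E] (h : IsTriplePoint c l P N D Sh G S φ V π) :
    2 * Module.finrank ℝ (residualSpace (c / 4) l G S V) + 4 ≤ Module.finrank ℝ E := by
  have hs := hopfCurvature_add c l
  have hp := hopfCurvature_mul h.neg
  have hne := (hopfCurvature_lt h.neg).ne
  set α := hopfCurvature₁ c l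
  set β := hopfCurvature₂ c l
  have hw₁ : hopfWeight c l α β ≠ 0 := (hopfWeight₁_pos h.neg).ne'
  have hw₂ : hopfWeight c l β α ≠ 0 := (hopfWeight₂_pos h.neg).ne'
  have o1 := h.hopfVec_orthogonal hs hp hne
  have o1' := h.hopfVec_orthogonal (α := β) (β := α) (by linarith) (by linarith) hne.symm
  have o2 := h.hopfVec_self hs hp hne
  have o3 := h.hopfVec_self (α := β) (β := α) (by linarith) (by linarith) hne.symm
  have o4 := h.hopfVec_horizontal (α := α) (β := β)
  have o5 := h.hopfVec_horizontal (α := β) (β := α)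
  have p1 : ∀ α β {z : E}, z ∈ cyclicOrth G S V → G (hopfVec (c / 4) S V α β) z = 0 :=
    fun α β z hz => h.hopfVec_pair_mem hz
  have haa := h.a_a hs hp hne
  have ham := h.a_mem
  have q₁ : ∀ z ∈ cyclicOrth G S V, G (hopfVec (c / 4) S V α β) z = 0 := fun z => p1 _ _
  have q₂ : ∀ z ∈ cyclicOrth G S V, G (hopfVec (c / 4) S V β α) z = 0 := fun z => p1 _ _
  set K := residualSpace (c / 4) l G S V with hK
  set u₁ := hopfVec (c / 4) S V α β
  set u₂ := hopfVec (c / 4) S V β α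
  set a := φ (S (S V)) with ha
  let T : (K × K × ℝ × ℝ × ℝ × ℝ) →ₗ[ℝ] E :=
    K.subtype.coprod ((φ.toLinearMap ∘ₗ K.subtype).coprod
      ((LinearMap.toSpanSingleton ℝ E V).coprod ((LinearMap.toSpanSingleton ℝ E u₁).coprod
        ((LinearMap.toSpanSingleton ℝ E u₂).coprod (LinearMap.toSpanSingleton ℝ E a)))))
  have hT : ∀ q, T q = q.1 + (φ q.2.1 + (q.2.2.1 • V + (q.2.2.2.1 • u₁ +
      (q.2.2.2.2.1 • u₂ + q.2.2.2.2.2 • a)))) := fun q => rfl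
  have hinj : Function.Injective T := by
    rw [injective_iff_map_eq_zero]
    rintro ⟨⟨u, hu⟩, ⟨w, hw⟩, r₀, r₁, r₂, r₃⟩ hq
    rw [hT] at hq
    simp only at hq
    obtain ⟨hw1, hw2, hw3, hw4⟩ := h.φ_residual hw
    have hu1 := (mem_residualSpace.1 hu).1
    have hu2 := (mem_residualSpace.1 hu).2
    have e0 := congrArg (G V) hq
    have e1 := congrArg (G u₁) hq
    have e2 := congrArg (G u₂) hq
    have e3 := congrArg (G u) hq
    have e4 := congrArg (G a) hq
    have hw3' : G (φ w) a = 0 := hw3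
    have hua : G a u = 0 := h.eigen_pair h.S_a hu2
    have huw : G u (φ w) = 0 := by
      rw [h.symm]; exact h.eigen_pair hw2 hu2
    have hc := h.c_ne
    simp only [map_add, map_smul, map_zero, smul_eq_mul, o1, o1', o2, o3, o4, o5, h.V_V,
      h.residual_horizontal hu, h.symm V (φ w), hw1.1, h.symm V a, ham.1, h.symm _ V,
      q₁ _ ham, q₁ _ hw1, q₁ _ hu1, q₂ _ ham, q₂ _ hw1, q₂ _ hu1, mul_zero, add_zero, zero_add, h.symm u u₁, h.symm u u₂,
      h.symm a u₁, h.symm a u₂, h.symm u a, hua, huw, h.symm a (φ w), hw3', haa] at e0 e1 e2 e3 e4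
    have z0 : r₀ = 0 := (mul_eq_zero.1 e0).resolve_right (inv_ne_zero h.κ_ne)
    have z1 : r₁ = 0 := (mul_eq_zero.1 e1).resolve_right hw₁
    have z2 : r₂ = 0 := (mul_eq_zero.1 e2).resolve_right hw₂
    have z3 : u = 0 := h.eq_zero_of_self hu1 e3
    have z4 : r₃ = 0 := (mul_eq_zero.1 e4).resolve_right
      (mul_ne_zero (pow_ne_zero 2 (sub_ne_zero.2 hne)) (mul_ne_zero hw₁ hw₂))
    subst z0 z1 z2 z3 z4
    simp only [zero_smul, add_zero, zero_add] at hq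
    rw [hq, map_zero, eq_comm, neg_eq_zero] at hw4
    subst hw4
    rfl
  have := LinearMap.finrank_le_finrank_of_injective hinj
  simp only [Module.finrank_prod, Module.finrank_self] at this
  omega

/-- The operator (S - l)³ kills the cyclic space and the l-eigenvectors, and is multiplication by
(-κ/l - l)³ on the residual space. After division it is a projection onto that space, so its trace
is the dimension. -/
theorem trace_eq [FiniteDimensional ℝ E] (h : IsTriplePoint c l P N D Sh G S φ V π)
    (hl : l ≠ 0) :
    (Module.finrank ℝ (residualSpace (c / 4) l G S V) : ℝ) =
      LinearMap.trace ℝ E (((-(c / 4) / l - l) ^ 3)⁻¹ • ((S - l • ContinuousLinearMap.id ℝ E) ^ 3 :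
        E →L[ℝ] E)).toLinearMap := by
  have hk : -(c / 4) / l - l ≠ 0 := by
    intro h0
    have hneg := h.neg
    have : -(c / 4) / l = l := by linarith
    rw [div_eq_iff hl] at this
    nlinarith
  set T : E →L[ℝ] E := S - l • ContinuousLinearMap.id ℝ E with hT
  have hT' : ∀ u, T u = S u - l • u := fun u => rfl
  have hT3 : ∀ u, (T ^ 3) u = T (T (T u)) := fun u => rfl
  have c0 : T (T (T V)) = 0 := by
    simp only [hT', map_sub, map_smul, h.cubic]
    module
  have c1 : T (T (T (S V))) = 0 := by
    have h1 := congrArg S c0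
    have h2 : ∀ u, S (T u) = T (S u) := fun u => by simp [hT']
    rwa [h2, h2, h2, map_zero] at h1
  have c2 : T (T (T (S (S V)))) = 0 := by
    have h1 := congrArg S c1
    have h2 : ∀ u, S (T u) = T (S u) := fun u => by simp [hT']
    rwa [h2, h2, h2, map_zero] at h1
  have c3 : ∀ w ∈ residualSpace (c / 4) l G S V, T w = (-(c / 4) / l - l) • w := by
    intro w hw
    have h1 := (mem_residualSpace.1 hw).2
    rw [hT', sub_smul, sub_left_inj]
    refine smul_right_injective E hl ?_
    simp only
    rw [h1, smul_smul]
    congr 1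
    field_simp
  have hQ : ∀ w ∈ residualSpace (c / 4) l G S V,
      (((-(c / 4) / l - l) ^ 3)⁻¹ • (T ^ 3 : E →L[ℝ] E)) w = w := by
    intro w hw
    rw [_root_.smul_apply, hT3, c3 w hw, map_smul, c3 w hw, map_smul, map_smul, c3 w hw,
      smul_smul, smul_smul, smul_smul]
    convert one_smul ℝ w using 2
    rw [mul_assoc, mul_assoc, ← pow_two, ← pow_succ', inv_mul_cancel₀ (pow_ne_zero 3 hk)]
  refine (LinearMap.IsProj.trace (p := residualSpace (c / 4) l G S V) ⟨fun u => ?_, hQ⟩).symm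
  have hu : G V (u - (c / 4 * G V u) • V) = 0 := by
    have := h.c_ne
    rw [map_sub, map_smul, h.V_V, smul_eq_mul]
    field_simp
    ring
  obtain ⟨x, y, v, hv, w, hw, hSv, hsum⟩ := h.horizontal_decomposition rfl rfl hu
  have hv0 : T v = 0 := by rw [hT', hSv, sub_self]
  have c4 : ∀ α β, T (T (T (hopfVec (c / 4) S V α β))) = 0 := by
    intro α β
    simp only [hopfVec, map_smul, map_add, map_sub, c0, c1, c2]
    simp
  have hfin : (((-(c / 4) / l - l) ^ 3)⁻¹ • (T ^ 3 : E →L[ℝ] E)) u = w := by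
    have key : ∀ z, (((-(c / 4) / l - l) ^ 3)⁻¹ • (T ^ 3 : E →L[ℝ] E)) z =
        ((-(c / 4) / l - l) ^ 3)⁻¹ • T (T (T z)) := fun z => rfl
    rw [sub_eq_iff_eq_add.1 hsum, map_add, map_add _ _ w, hQ w hw, key, key]
    simp only [map_add, map_smul, c0, c4, hv0, smul_zero, add_zero, zero_add]
  change (((-(c / 4) / l - l) ^ 3)⁻¹ • (T ^ 3 : E →L[ℝ] E)) u ∈ _
  rw [hfin]
  exact hw

/-- The principal curvature space of `-c / (4 l)` without `U₂` is real, and `J` maps it into that of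
`l`. -/
theorem J_residual (h : IsTriplePoint c l P N D Sh G S φ V π) {U₁ U₂ A : Mat n}
    (hf : IsHopfFrame c l P N D Sh U₁ U₂ A) (hD : Function.Injective D) {μ : ℝ}
    (hμ : c / 4 + l * μ = 0) (hne : μ ≠ hopfCurvature₁ c l) {Z : Mat n}
    (hZ : Z ∈ principalImage D Sh μ) (hZU : ambientMetric c Z U₂ = 0) :
    ambientJ P Z ∈ principalImage D Sh l ∧ ambientMetric c (ambientJ P Z) A = 0 ∧
      ∀ Y ∈ principalImage D Sh μ, ambientMetric c Y U₂ = 0 →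
        ambientMetric c (ambientJ P Z) Y = 0 := by
  obtain ⟨-, hU, hA⟩ := hf.unique (h.isHopfFrame rfl rfl rfl rfl) h.neg hD
  have hs := hopfCurvature_add c l
  have hp := hopfCurvature_mul h.neg
  have huu := h.hopfVec_self (α := hopfCurvature₂ c l) (β := hopfCurvature₁ c l) (by linarith)
    (by linarith) (hopfCurvature_lt h.neg).ne'
  have hhor := h.hopfVec_horizontal (α := hopfCurvature₂ c l) (β := hopfCurvature₁ c l)
  have key : ∀ Z ∈ principalImage D Sh μ, ambientMetric c Z U₂ = 0 →
      ∃ w ∈ residualSpace (c / 4) l G S V, π w = Z := by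
    intro Z hZ hZU
    obtain ⟨y, w, hw, -, rfl⟩ := h.mem_of_residual hμ hne hZ
    have hwm := (mem_residualSpace.1 hw).1
    rw [hU, ← map_smul, h.metric _ _ ?_ ?_] at hZU
    · simp only [map_add, map_smul, _root_.add_apply, _root_.smul_apply, huu, smul_eq_mul,
        h.symm w, h.hopfVec_pair_mem hwm] at hZU
      have h1 : y = 0 := by
        have hb := (Real.sqrt_pos.2 (hopfWeight₂_pos h.neg)).ne'
        have hb2 := (hopfWeight₂_pos h.neg).ne'
        simpa [hb, hb2] using hZU
      exact ⟨w, hw, by rw [h1, zero_smul, zero_add]⟩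
    · rw [h.symm]; simp [hhor, h.residual_horizontal hw]
    · rw [h.symm]; simp [hhor]
  obtain ⟨w, hw, rfl⟩ := key Z hZ hZU
  obtain ⟨hw1, hw2, hw3, hw4⟩ := h.φ_residual hw
  have hJ : ambientJ P (π w) = π (φ w) := by
    rw [h.J_π, (mem_residualSpace.1 hw).1.2.1, zero_smul, add_zero]
  rw [hJ]
  refine ⟨h.mem_principalImage_iff.2 ⟨_, h.mem_horizontalEigen hw1 hw2, rfl⟩, ?_, ?_⟩
  · rw [hA, ← map_smul, h.metric _ _ hw1.1 (by simp [h.a_mem.1]), map_smul, hw3, smul_zero]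
  · intro Y hY hYU
    obtain ⟨w', hw', rfl⟩ := key Y hY hYU
    rw [h.metric _ _ hw1.1 (mem_residualSpace.1 hw').1.1]
    exact h.eigen_pair hw2 (mem_residualSpace.1 hw').2

theorem metric_residual (h : IsTriplePoint c l P N D Sh G S φ V π) {U₁ U₂ A : Mat n}
    (hf : IsHopfFrame c l P N D Sh U₁ U₂ A) (hD : Function.Injective D) {μ : ℝ}
    (hμ : c / 4 + l * μ = 0) (hne : μ ≠ hopfCurvature₁ c l) (hne₂ : μ ≠ hopfCurvature₂ c l)
    {Z : Mat n} (hZ : Z ∈ principalImage D Sh μ) : ambientMetric c Z U₂ = 0 := by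
  obtain ⟨-, hU, -⟩ := hf.unique (h.isHopfFrame rfl rfl rfl rfl) h.neg hD
  obtain ⟨y, w, hw, hy, rfl⟩ := h.mem_of_residual hμ hne hZ
  have hwm := (mem_residualSpace.1 hw).1
  rw [hy hne₂, zero_smul, zero_add, hU, ← map_smul, h.metric _ _ hwm.1 (by
    rw [h.symm, map_smul, h.hopfVec_horizontal, smul_zero]), map_smul, h.symm,
    h.hopfVec_pair_mem hwm, smul_zero]

end IsTriplePoint

end TripleDecomposition

/-! ### Smooth local frames and local constancy of dimensions -/

noncomputable section TripleLift

theorem IsModelDouble.cubic_eq {E : Type*} [NormedAddCommGroup E] [NormedSpace ℝ E] {κ l : ℝ}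
    {Λ : Finset ℝ} {Ω : Set E} {G : E → E →L[ℝ] E →L[ℝ] ℝ} {Γ : E → E →L[ℝ] E →L[ℝ] E}
    {S φ : E → E →L[ℝ] E} {V : E} (h : IsModelDouble κ l l Λ Ω G Γ S φ V) {x : E} (hx : x ∈ Ω) :
    S x (S x (S x V)) = (3 * l) • S x (S x V) - (3 * l ^ 2) • S x V + l ^ 3 • V := by
  have h1 := h.e₃_eq x hx
  rw [IsModelTwo.e₃] at h1
  rw [h.cubic x hx, h1]
  module

theorem IsModelDouble.exists_split {E : Type*} [NormedAddCommGroup E] [NormedSpace ℝ E]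
    [FiniteDimensional ℝ E] {κ l : ℝ}
    {Λ : Finset ℝ} {Ω : Set E} {G : E → E →L[ℝ] E →L[ℝ] ℝ} {Γ : E → E →L[ℝ] E →L[ℝ] E}
    {S φ : E → E →L[ℝ] E} {V : E} (h : IsModelDouble κ l l Λ Ω G Γ S φ V) {x : E} (hx : x ∈ Ω)
    {u : E} (hu : u ∈ cyclicOrth (G x) (S x) V) :
    ∃ v ∈ cyclicOrth (G x) (S x) V, ∃ w ∈ cyclicOrth (G x) (S x) V,
      u = v + w ∧ S x v = l • v ∧ l • S x w = -κ • w := by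
  obtain ⟨e, he, hsum⟩ := h.exists_eigendecomposition hx hu
  refine ⟨∑ μ ∈ Λ with μ = l, e μ, ?_, ∑ μ ∈ Λ with μ ≠ l, e μ, ?_, ?_, ?_, ?_⟩
  · exact Submodule.sum_mem _ fun μ hμ => (he μ (Finset.mem_filter.1 hμ).1).2
  · exact Submodule.sum_mem _ fun μ hμ => (he μ (Finset.mem_filter.1 hμ).1).2
  · rw [← hsum, Finset.sum_filter_add_sum_filter_not]
  · rw [map_sum, Finset.smul_sum]
    refine Finset.sum_congr rfl fun μ hμ => ?_
    obtain ⟨hμ1, hμ2⟩ := Finset.mem_filter.1 hμ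
    rw [(he μ hμ1).1, hμ2]
  · rw [map_sum, Finset.smul_sum, Finset.smul_sum]
    refine Finset.sum_congr rfl fun μ hμ => ?_
    obtain ⟨hμ1, hμ2⟩ := Finset.mem_filter.1 hμ
    by_cases h0 : e μ = 0
    · rw [h0, map_zero, smul_zero, smul_zero]
    · have h1 := h.eigenvalue_eq hx hμ1 hμ2 (he μ hμ1).1 (he μ hμ1).2.1 h0
      rw [(he μ hμ1).1, smul_smul]
      congr 1
      linarith

variable {n : ℕ} {H : Type*} [NormedAddCommGroup H] [NormedSpace ℝ H]

/-- A lift of a chart on whose part over `Ω` the operator `S - l` is nilpotent on the cyclic space of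
the vertical vector. -/
structure IsTripleLift (c l : ℝ) (Λ : Finset ℝ) (O : Set H) (Ω : Set (H × ℝ))
    (p ν : H → Fin (n + 1) → Fin (n + 1) → ℂ) (F η : H × ℝ → Fin (n + 1) → ℂ)
    (ℓ : H × ℝ → (Fin (n + 1) → ℂ) →L[ℝ] H × ℝ) : Prop extends IsChartLift c O p ν F η ℓ where
  neg : c / 4 + l ^ 2 < 0
  subset : Ω ⊆ O ×ˢ univ
  model : IsModelDouble (c / 4) l l Λ Ω (liftMetric (reForm n c) F) (liftGamma F ℓ)
    (liftShape η ℓ) (liftPhi (mulI n) F ℓ) (0, 1)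

namespace IsTripleLift

variable {c l : ℝ} {Λ : Finset ℝ} {O : Set H} {Ω : Set (H × ℝ)}
  {p ν : H → Fin (n + 1) → Fin (n + 1) → ℂ} {F η : H × ℝ → Fin (n + 1) → ℂ}
  {ℓ : H × ℝ → (Fin (n + 1) → ℂ) →L[ℝ] H × ℝ}

theorem chartDiff_injective (h : IsTripleLift c l Λ O Ω p ν F η ℓ) {y : H × ℝ} (hy : y ∈ Ω) :
    Function.Injective (chartDiff p y.1) :=
  h.chart.immersive y.1 (h.subset hy).1

theorem slice_isOpen (h : IsTripleLift c l Λ O Ω p ν F η ℓ) :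
    IsOpen {x : H | (x, (0 : ℝ)) ∈ Ω} :=
  h.model.isOpen.preimage (by fun_prop)

variable [FiniteDimensional ℝ H]

theorem isTriplePoint (h : IsTripleLift c l Λ O Ω p ν F η ℓ) {y : H × ℝ} (hy : y ∈ Ω) :
    IsTriplePoint c l (Matrix.of (p y.1)) (Matrix.of (ν y.1)) (chartDiff p y.1)
      (chartShape p ν y.1) (liftMetric (reForm n c) F y) (liftShape η ℓ y)
      (liftPhi (mulI n) F ℓ y) (0, 1) (chartDiff p y.1 ∘ₗ LinearMap.fst ℝ H ℝ) where
  toIsPointModel := h.toIsChartLift.isPointModel (h.subset hy)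
  neg := h.neg
  cubic := h.model.cubic_eq hy
  S_a := h.model.S_a y hy
  split := fun u hu => h.model.exists_split hy hu
  φ_perp := fun u _ w _ hSu hSw => by
    have hκ := h.lift.κ_ne
    -- For l = 0 the equation reads 0 = -κw, so w = 0; otherwise u and w are eigenvectors for -κ/l.
    by_cases hl : l = 0
    · rw [hl, zero_smul, eq_comm, smul_eq_zero] at hSw
      rw [hSw.resolve_left (neg_ne_zero.2 hκ), map_zero]
    · have hμ : ∀ w : H × ℝ, l • liftShape η ℓ y w = -(c / 4) • w →
          liftShape η ℓ y w = (-(c / 4) / l) • w := by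
        intro w hw
        refine smul_right_injective _ hl ?_
        simp only
        rw [hw, smul_smul]
        congr 1
        field_simp
      refine h.model.φ_eigen_eigen hy (μ := -(c / 4) / l) ?_ (hμ u hSu) (hμ w hSw)
      intro h0
      have hneg := h.neg
      rw [div_eq_iff hl] at h0
      nlinarith

theorem exists_frame (h : IsTripleLift c l Λ O Ω p ν F η ℓ) :
    ∃ U₁ U₂ A : H → Fin (n + 1) → Fin (n + 1) → ℂ,
      ContDiffOn ℝ ∞ U₁ {x | (x, (0 : ℝ)) ∈ Ω} ∧ ContDiffOn ℝ ∞ U₂ {x | (x, (0 : ℝ)) ∈ Ω} ∧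
      ContDiffOn ℝ ∞ A {x | (x, (0 : ℝ)) ∈ Ω} ∧
      ∀ x, (x, (0 : ℝ)) ∈ Ω → IsHopfFrame c l (Matrix.of (p x)) (Matrix.of (ν x)) (chartDiff p x)
        (chartShape p ν x) (Matrix.of (U₁ x)) (Matrix.of (U₂ x)) (Matrix.of (A x)) := by
  have hm := h.model
  have hslice : ContDiff ℝ ∞ fun x : H => (x, (0 : ℝ)) := contDiff_id.prodMk contDiff_const
  have hmaps : MapsTo (fun x : H => (x, (0 : ℝ))) {x : H | (x, (0 : ℝ)) ∈ Ω} Ω := fun x hx => hx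
  have hS : ContDiffOn ℝ ∞ (fun x : H => liftShape η ℓ (x, (0 : ℝ))) {x : H | (x, (0 : ℝ)) ∈ Ω} :=
    hm.S_smooth.comp hslice.contDiffOn hmaps
  have hφ : ContDiffOn ℝ ∞ (fun x : H => liftPhi (mulI n) F ℓ (x, (0 : ℝ)))
      {x : H | (x, (0 : ℝ)) ∈ Ω} := hm.φ_smooth.comp hslice.contDiffOn hmaps
  have hSV := hS.clm_apply (contDiffOn_const (c := ((0, 1) : H × ℝ)))
  have hSSV := hS.clm_apply hSV
  have hp : ContDiffOn ℝ ∞ (fderiv ℝ p) {x : H | (x, (0 : ℝ)) ∈ Ω} :=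
    (h.chart.p_smooth.fderiv_of_isOpen h.chart.isOpen (by simp)).mono fun x hx => (h.subset hx).1
  have hv : ∀ α β : ℝ, ContDiffOn ℝ ∞
      (fun x : H => hopfVec (c / 4) (liftShape η ℓ (x, (0 : ℝ))) (0, 1) α β)
      {x : H | (x, (0 : ℝ)) ∈ Ω} := fun α β =>
    ((contDiffOn_const.sub hSSV).add (hSV.const_smul β)).const_smul (α - β)⁻¹
  refine ⟨fun x => (√(hopfWeight c l (hopfCurvature₁ c l) (hopfCurvature₂ c l)))⁻¹ •
      fderiv ℝ p x (hopfVec (c / 4) (liftShape η ℓ (x, (0 : ℝ))) (0, 1) (hopfCurvature₁ c l)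
        (hopfCurvature₂ c l)).1,
    fun x => (√(hopfWeight c l (hopfCurvature₂ c l) (hopfCurvature₁ c l)))⁻¹ •
      fderiv ℝ p x (hopfVec (c / 4) (liftShape η ℓ (x, (0 : ℝ))) (0, 1) (hopfCurvature₂ c l)
        (hopfCurvature₁ c l)).1,
    fun x => ((hopfCurvature₁ c l - hopfCurvature₂ c l) *
      √(hopfWeight c l (hopfCurvature₁ c l) (hopfCurvature₂ c l)) *
      √(hopfWeight c l (hopfCurvature₂ c l) (hopfCurvature₁ c l)))⁻¹ •
      fderiv ℝ p x (liftPhi (mulI n) F ℓ (x, (0 : ℝ)) (liftShape η ℓ (x, (0 : ℝ))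
        (liftShape η ℓ (x, (0 : ℝ)) (0, 1)))).1, ?_, ?_, ?_, fun x hx => (h.isTriplePoint hx).isHopfFrame rfl rfl rfl rfl⟩
  · exact (hp.clm_apply (hv _ _).fst).const_smul _
  · exact (hp.clm_apply (hv _ _).fst).const_smul _
  · exact (hp.clm_apply (hφ.clm_apply hSSV).fst).const_smul _

/-- By `trace_eq` the dimension is a continuous function of the point, and integers at distance less
than 1 are equal. -/
theorem finrank_residual_eventually (h : IsTripleLift c l Λ O Ω p ν F η ℓ) (hl : l ≠ 0) {x₀ : H}
    (hx₀ : (x₀, (0 : ℝ)) ∈ Ω) : ∀ᶠ x in nhds x₀,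
      Module.finrank ℝ (residualSpace (c / 4) l (liftMetric (reForm n c) F (x, (0 : ℝ)))
        (liftShape η ℓ (x, (0 : ℝ))) (0, 1)) =
      Module.finrank ℝ (residualSpace (c / 4) l (liftMetric (reForm n c) F (x₀, (0 : ℝ)))
        (liftShape η ℓ (x₀, (0 : ℝ))) (0, 1)) := by
  have hn := h.slice_isOpen.mem_nhds hx₀
  have hS : ContinuousAt (fun x : H => liftShape η ℓ (x, (0 : ℝ))) x₀ :=
    (h.model.S_smooth.continuousOn.comp (t := Ω) (s := {x : H | (x, (0 : ℝ)) ∈ Ω})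
      (f := fun x : H => (x, (0 : ℝ))) (by fun_prop) fun x hx => hx).continuousAt hn
  let tr : (H × ℝ →L[ℝ] H × ℝ) →ₗ[ℝ] ℝ :=
    LinearMap.trace ℝ (H × ℝ) ∘ₗ ContinuousLinearMap.coeLM ℝ
  have htr : Continuous tr := tr.continuous_of_finiteDimensional
  have h0 : ContinuousAt (fun x : H => (((-(c / 4) / l - l) ^ 3)⁻¹ •
      (liftShape η ℓ (x, (0 : ℝ)) - l • ContinuousLinearMap.id ℝ (H × ℝ)) ^ 3)) x₀ := by
    fun_prop
  have hc : ContinuousAt (fun x : H => tr (((-(c / 4) / l - l) ^ 3)⁻¹ •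
      (liftShape η ℓ (x, (0 : ℝ)) - l • ContinuousLinearMap.id ℝ (H × ℝ)) ^ 3)) x₀ :=
    htr.continuousAt.comp h0
  have h1 : ∀ x, (x, (0 : ℝ)) ∈ Ω → tr (((-(c / 4) / l - l) ^ 3)⁻¹ •
      (liftShape η ℓ (x, (0 : ℝ)) - l • ContinuousLinearMap.id ℝ (H × ℝ)) ^ 3) =
      Module.finrank ℝ (residualSpace (c / 4) l (liftMetric (reForm n c) F (x, (0 : ℝ)))
        (liftShape η ℓ (x, (0 : ℝ))) (0, 1)) := fun x hx =>
    ((h.isTriplePoint hx).trace_eq hl).symm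
  have h2 := hc.eventually (Metric.ball_mem_nhds _ one_pos)
  filter_upwards [h2, hn] with x hx hx'
  rw [h1 x hx', h1 x₀ hx₀, Real.dist_eq] at hx
  have h3 : |((Module.finrank ℝ (residualSpace (c / 4) l (liftMetric (reForm n c) F (x, (0 : ℝ)))
        (liftShape η ℓ (x, (0 : ℝ))) (0, 1)) : ℤ) -
      (Module.finrank ℝ (residualSpace (c / 4) l (liftMetric (reForm n c) F (x₀, (0 : ℝ)))
        (liftShape η ℓ (x₀, (0 : ℝ))) (0, 1)) : ℤ))| < 1 := by
    exact_mod_cast hx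
  have h4 := Int.abs_lt_one_iff.1 h3
  omega

theorem finrank_principalImage_eventually (h : IsTripleLift c l Λ O Ω p ν F η ℓ) (hl : 0 < l)
    {x₀ : H} (hx₀ : (x₀, (0 : ℝ)) ∈ Ω) : ∀ᶠ x in nhds x₀,
      Module.finrank ℝ (principalImage (chartDiff p x) (chartShape p ν x) (-c / (4 * l))) =
      Module.finrank ℝ (principalImage (chartDiff p x₀) (chartShape p ν x₀) (-c / (4 * l))) := by
  have hμ : c / 4 + l * (-c / (4 * l)) = 0 := by
    field_simp
    ring
  have hneg := h.neg
  have hlt := hopfCurvature₁_lt hneg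
  have hne₁ : -c / (4 * l) ≠ hopfCurvature₁ c l := by
    intro h0
    rw [h0] at hμ
    nlinarith
  filter_upwards [h.finrank_residual_eventually hl.ne' hx₀, h.slice_isOpen.mem_nhds hx₀]
    with x hx hx'
  by_cases hne₂ : -c / (4 * l) = hopfCurvature₂ c l
  · rw [hne₂] at hμ ⊢
    have e1 := (h.isTriplePoint hx').finrank_principalImage_residual₂ hμ
    have e2 := (h.isTriplePoint hx₀).finrank_principalImage_residual₂ hμ
    rw [e1, e2, hx]
  · have e1 := (h.isTriplePoint hx').finrank_principalImage_residual hμ hne₁ hne₂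
    have e2 := (h.isTriplePoint hx₀).finrank_principalImage_residual hμ hne₁ hne₂
    rw [e1, e2, hx]

end IsTripleLift

end TripleLift

/-! ### The case l = 0: a constant complex null line -/

noncomputable section NullLine

/-- A solution of a linear first order equation that vanishes at a point vanishes nearby. -/
theorem eventually_eq_zero_of_fderiv {H : Type*} [NormedAddCommGroup H] [NormedSpace ℝ H]
    {f : H → ℝ} {g : H → H →L[ℝ] ℝ} {x₀ : H}
    (hf : ∀ᶠ x in nhds x₀, DifferentiableAt ℝ f x ∧ ∀ v, fderiv ℝ f x v = g x v * f x)
    (hg : ContinuousAt g x₀) (h0 : f x₀ = 0) : ∀ᶠ x in nhds x₀, f x = 0 := by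
  have h1 : ∀ᶠ x in nhds x₀, ‖g x‖ < ‖g x₀‖ + 1 :=
    hg.norm.eventually (gt_mem_nhds (lt_add_one _))
  obtain ⟨r, hr, hball⟩ := Metric.eventually_nhds_iff_ball.1 (hf.and h1)
  filter_upwards [Metric.ball_mem_nhds x₀ hr] with x hx
  set γ : ℝ → H := fun t => x₀ + t • (x - x₀) with hγ
  have hγmem : ∀ t ∈ Icc (0 : ℝ) 1, γ t ∈ Metric.ball x₀ r := by
    intro t ht
    rw [Metric.mem_ball, dist_eq_norm] at hx ⊢
    rw [hγ, add_sub_cancel_left, norm_smul, Real.norm_of_nonneg ht.1]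
    nlinarith [norm_nonneg (x - x₀), ht.1, ht.2]
  have hγd : ∀ t, HasDerivAt γ (x - x₀) t := fun t => by
    have := ((hasDerivAt_id t).smul_const (x - x₀)).const_add x₀
    rwa [one_smul] at this
  have hd : ∀ t ∈ Icc (0 : ℝ) 1,
      HasDerivAt (fun t => f (γ t)) (fderiv ℝ f (γ t) (x - x₀)) t := fun t ht =>
    (hball _ (hγmem t ht)).1.1.hasFDerivAt.comp_hasDerivAt t (hγd t)
  -- Along the segment from x₀ to x the function satisfies |f'| ≤ K|f| and starts at zero, so it
  -- vanishes by Grönwall's inequality.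
  have key := eq_zero_of_abs_deriv_le_mul_abs_self_of_eq_zero_right
    (f := fun t => f (γ t)) (f' := fun t => fderiv ℝ f (γ t) (x - x₀))
    (K := (‖g x₀‖ + 1) * ‖x - x₀‖) (a := 0) (b := 1)
    (fun t ht => (hd t ht).continuousAt.continuousWithinAt)
    (fun t ht => (hd t (Ico_subset_Icc_self ht)).hasDerivWithinAt) (by simp [hγ, h0])
    (fun t ht => by
      obtain ⟨⟨-, h2⟩, h3⟩ := hball _ (hγmem t (Ico_subset_Icc_self ht))
      rw [h2, norm_mul]
      gcongr
      exact ((g (γ t)).le_opNorm _).trans (by gcongr))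
    1 (by simp)
  simpa [hγ] using key

variable {n : ℕ}

/-- The matrix `κ rankOne w w` for the null vector `w` of the lift that corresponds to `S² V`, if the
triple root is zero; `A` is the unit vector of `IsHopfFrame`. -/
def nullMat (c : ℝ) (P A : Mat n) : Mat n :=
  ((c / 4) • (1 : Mat n) + √(-(c / 4)) • A) * P * ((c / 4) • (1 : Mat n) + √(-(c / 4)) • A)

/-- The matrix `-κ rankOne η w` for the null vector `w` as in `nullMat` and the normal vector `η`. -/
def normalMat (c : ℝ) (P N A : Mat n) : Mat n :=
  Complex.I • (N * P * ((c / 4) • (1 : Mat n) + √(-(c / 4)) • A))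

theorem normalMat_neg (c : ℝ) (P N A : Mat n) : normalMat c P (-N) A = -normalMat c P N A := by
  simp [normalMat]

/-- For l = 0 the Hopf curvatures are ±√(-c)/2 and b₁² = b₂² = 1/2, so the normalizing factor of A
in `isHopfFrame` is -1/√(-κ). -/
theorem IsTriplePoint.smul_A_of_zero {X E : Type*} [AddCommGroup X] [Module ℝ X]
    [NormedAddCommGroup E] [NormedSpace ℝ E] {c : ℝ} {P N : Mat n} {D Sh : X →ₗ[ℝ] Mat n}
    {G : E →L[ℝ] E →L[ℝ] ℝ} {S φ : E →L[ℝ] E} {V : E} {π : E →ₗ[ℝ] Mat n}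
    (h : IsTriplePoint c 0 P N D Sh G S φ V π) {U₁ U₂ A : Mat n}
    (hf : IsHopfFrame c 0 P N D Sh U₁ U₂ A) (hD : Function.Injective D) :
    √(-(c / 4)) • A = -π (φ (S (S V))) := by
  obtain ⟨-, -, hA⟩ := hf.unique (h.isHopfFrame rfl rfl rfl rfl) h.neg hD
  have hc : c < 0 := by linarith [h.neg]
  have h1 : 0 < √(-c) := Real.sqrt_pos.2 (by linarith)
  have h2 : √(-c) ^ 2 = -c := Real.sq_sqrt (by linarith)
  have h3 : √(-(c / 4)) = √(-c) / 2 := by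
    rw [Real.sqrt_eq_iff_mul_self_eq (by linarith) (by positivity)]
    linear_combination -(1 / 4) * h2
  have h4 : hopfCurvature₁ c 0 = -√(-c) / 2 := by simp [hopfCurvature₁]
  have h5 : hopfCurvature₂ c 0 = √(-c) / 2 := by simp [hopfCurvature₂]
  have h6 : hopfWeight c 0 (hopfCurvature₁ c 0) (hopfCurvature₂ c 0) = 1 / 2 := by
    rw [hopfWeight, h4, h5]
    have hc' := hc.ne
    field_simp
    linear_combination (4 * √(-c)) * h2
  have h7 : hopfWeight c 0 (hopfCurvature₂ c 0) (hopfCurvature₁ c 0) = 1 / 2 := by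
    rw [hopfWeight, h4, h5]
    have hc' := hc.ne
    field_simp
    linear_combination (-4 * √(-c)) * h2
  rw [hA, h6, h7, h4, h5, h3, mul_assoc, Real.mul_self_sqrt (by norm_num), smul_smul]
  have h8 : √(-c) / 2 * ((-√(-c) / 2 - √(-c) / 2) * (1 / 2))⁻¹ = -1 := by
    field_simp
    ring
  rw [h8, neg_one_smul]

/-- A common phase of z and w does not change zw*. This removes the phase terms from the derivatives
of ww* and ηw*. -/
theorem rankOneMap_mulI (c : ℝ) (z w : Fin (n + 1) → ℂ) :
    rankOneMap n c (mulI n z) w + rankOneMap n c z (mulI n w) = 0 := by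
  change Matrix.of.symm (rankOne c (mulI n z) w + rankOne c z (mulI n w)) = _
  rw [mulI_apply, mulI_apply, rankOne_smul_left, rankOne_smul_right]
  simp

variable {H : Type*} [NormedAddCommGroup H] [NormedSpace ℝ H]

/-- The image of `S² V` under the differential of the lift. -/
def nullVec (F η : H × ℝ → Fin (n + 1) → ℂ) (ℓ : H × ℝ → (Fin (n + 1) → ℂ) →L[ℝ] H × ℝ)
    (y : H × ℝ) : Fin (n + 1) → ℂ :=
  fderiv ℝ F y (liftShape η ℓ y (liftShape η ℓ y (0, 1)))

/-- A linear functional on matrices, on their arrays of entries. -/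
def arrayFunctional (ϕ : Mat n →ₗ[ℝ] ℝ) : (Fin (n + 1) → Fin (n + 1) → ℂ) →L[ℝ] ℝ :=
  (ϕ ∘ₗ (Matrix.ofLinearEquiv ℝ).toLinearMap).toContinuousLinearMap

theorem arrayFunctional_apply (ϕ : Mat n →ₗ[ℝ] ℝ) (z : Fin (n + 1) → Fin (n + 1) → ℂ) :
    arrayFunctional ϕ z = ϕ (Matrix.of z) := rfl

/-- The logarithmic derivative of the null vector along the slice. -/
def nullForm (c : ℝ) (F η : H × ℝ → Fin (n + 1) → ℂ)
    (ℓ : H × ℝ → (Fin (n + 1) → ℂ) →L[ℝ] H × ℝ) (x : H) : H →L[ℝ] ℝ :=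
  (liftMetric (reForm n c) F (x, 0) (liftPhi (mulI n) F ℓ (x, 0)
    (liftShape η ℓ (x, 0) (liftShape η ℓ (x, 0) (0, 1))))).comp (ContinuousLinearMap.inl ℝ H ℝ)

theorem hasFDerivAt_slice {Z : Type*} [NormedAddCommGroup Z] [NormedSpace ℝ Z] {f : H × ℝ → Z}
    {x : H} (hf : DifferentiableAt ℝ f (x, 0)) :
    HasFDerivAt (fun x : H => f (x, 0)) ((fderiv ℝ f (x, 0)).comp (ContinuousLinearMap.inl ℝ H ℝ))
      x :=
  hf.hasFDerivAt.comp x (hasFDerivAt_prodMk_left x (0 : ℝ))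

theorem fderiv_functional_slice {f : H × ℝ → Fin (n + 1) → Fin (n + 1) → ℂ} {x : H}
    (hf : DifferentiableAt ℝ f (x, 0)) (ϕ : Mat n →ₗ[ℝ] ℝ) :
    DifferentiableAt ℝ (fun x : H => arrayFunctional ϕ (f (x, 0))) x ∧
      ∀ v, fderiv ℝ (fun x : H => arrayFunctional ϕ (f (x, 0))) x v =
        arrayFunctional ϕ (fderiv ℝ f (x, 0) (v, 0)) := by
  have h1 := (arrayFunctional ϕ).hasFDerivAt.comp x (hasFDerivAt_slice hf)
  exact ⟨h1.differentiableAt, fun v => by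
    change fderiv ℝ (arrayFunctional ϕ ∘ fun x : H => f (x, 0)) x v = _
    rw [h1.fderiv]
    rfl⟩

namespace IsTripleLift

variable {c : ℝ} {Λ : Finset ℝ} {O : Set H} {Ω : Set (H × ℝ)}
  {p ν : H → Fin (n + 1) → Fin (n + 1) → ℂ} {F η : H × ℝ → Fin (n + 1) → ℂ}
  {ℓ : H × ℝ → (Fin (n + 1) → ℂ) →L[ℝ] H × ℝ}

theorem nullVec_smooth (h : IsTripleLift c 0 Λ O Ω p ν F η ℓ) :
    ContDiffOn ℝ ∞ (nullVec F η ℓ) (O ×ˢ univ) :=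
  h.lift.dF_smooth.clm_apply (h.lift.liftShape_smooth.clm_apply
    (h.lift.liftShape_smooth.clm_apply contDiffOn_const))

theorem nullForm_continuousAt (h : IsTripleLift c 0 Λ O Ω p ν F η ℓ) {x₀ : H}
    (hx₀ : (x₀, (0 : ℝ)) ∈ Ω) : ContinuousAt (nullForm c F η ℓ) x₀ := by
  have hm := h.model
  have hn := hm.isOpen.mem_nhds hx₀
  have hs : ContinuousAt (fun x : H => (x, (0 : ℝ))) x₀ := by fun_prop
  have hS : ContinuousAt (fun x : H => liftShape η ℓ (x, (0 : ℝ))) x₀ :=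
    (hm.S_smooth.continuousOn.continuousAt hn).comp (f := fun x : H => (x, (0 : ℝ))) hs
  have hG : ContinuousAt (fun x : H => liftMetric (reForm n c) F (x, (0 : ℝ))) x₀ :=
    (hm.G_smooth.continuousOn.continuousAt hn).comp (f := fun x : H => (x, (0 : ℝ))) hs
  have hφ : ContinuousAt (fun x : H => liftPhi (mulI n) F ℓ (x, (0 : ℝ))) x₀ :=
    (hm.φ_smooth.continuousOn.continuousAt hn).comp (f := fun x : H => (x, (0 : ℝ))) hs
  unfold nullForm
  fun_prop

theorem nullForm_apply (h : IsTripleLift c 0 Λ O Ω p ν F η ℓ) {x : H}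
    (hx : (x, (0 : ℝ)) ∈ Ω) (v : H) : nullForm c F η ℓ x v =
      liftMetric (reForm n c) F (x, 0) (v, 0) (liftPhi (mulI n) F ℓ (x, 0)
        (liftShape η ℓ (x, 0) (liftShape η ℓ (x, 0) (0, 1)))) := by
  rw [h.model.symm _ hx]
  rfl

variable [FiniteDimensional ℝ H]

theorem SSSV_of_zero (h : IsTripleLift c 0 Λ O Ω p ν F η ℓ) {y : H × ℝ} (hy : y ∈ Ω) :
    liftShape η ℓ y (liftShape η ℓ y (liftShape η ℓ y (0, 1))) = 0 := by
  rw [(h.isTriplePoint hy).cubic]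
  simp

theorem dF_a (h : IsTripleLift c 0 Λ O Ω p ν F η ℓ) {y : H × ℝ} (hy : y ∈ Ω) :
    fderiv ℝ F y (liftPhi (mulI n) F ℓ y (liftShape η ℓ y (liftShape η ℓ y (0, 1)))) =
      mulI n (nullVec F η ℓ y) + (c / 4) • F y := by
  have hp := h.isTriplePoint hy
  rw [h.lift.dF_phi (h.subset hy), hp.symm _ (0, 1), hp.V_SSV, hp.symm _ (liftShape η ℓ y (0, 1)),
    hp.SV_SSV, nullVec]
  simp

/-- Transport `cov_w₂_of_zero` by dF. The field a goes to iW + κF, and the term in F cancels against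
the one in the Gauss formula. So dW is a complex multiple of W: the line ℂW is constant. -/
theorem fderiv_nullVec (h : IsTripleLift c 0 Λ O Ω p ν F η ℓ) {y : H × ℝ} (hy : y ∈ Ω)
    (X : H × ℝ) : fderiv ℝ (nullVec F η ℓ) y X =
      liftMetric (reForm n c) F y X (liftShape η ℓ y (liftShape η ℓ y (0, 1))) •
          mulI n (nullVec F η ℓ y)
        + liftMetric (reForm n c) F y X (liftPhi (mulI n) F ℓ y
          (liftShape η ℓ y (liftShape η ℓ y (0, 1)))) • nullVec F η ℓ y := by
  have hy' := h.subset hy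
  have hp := h.isTriplePoint hy
  have hZ : ContDiffOn ℝ ∞ (fun y => liftShape η ℓ y (liftShape η ℓ y (0, 1))) (O ×ˢ univ) :=
    h.lift.liftShape_smooth.clm_apply (h.lift.liftShape_smooth.clm_apply contDiffOn_const)
  have h1 := h.model.cov_w₂_of_zero hy X
  have h2 := congrArg (fderiv ℝ F y) h1
  rw [cov, map_add, map_add, map_smul, map_smul, h.dF_a hy] at h2
  change fderiv ℝ (fun y => fderiv ℝ F y (liftShape η ℓ y (liftShape η ℓ y (0, 1)))) y X = _
  rw [h.lift.fderiv_dF_apply hy' hZ, h.lift.snd_eq hy', hp.S_symm, h.SSSV_of_zero hy, map_zero,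
    zero_smul]
  change _ = _ + _ • fderiv ℝ F y (liftShape η ℓ y (liftShape η ℓ y (0, 1))) at h2
  rw [nullVec] at *
  linear_combination (norm := module) h2

/-- Subtract from X its components along V, SV and S²V; S kills the remainder by `S_of_zero`, and
S³V = 0. Thus S has values in the span of SV and S²V. -/
theorem S_eq_of_zero (h : IsTripleLift c 0 Λ O Ω p ν F η ℓ) {y : H × ℝ} (hy : y ∈ Ω)
    (X : H × ℝ) : liftShape η ℓ y X =
      liftMetric (reForm n c) F y X (liftShape η ℓ y (liftShape η ℓ y (0, 1))) •
        liftShape η ℓ y (0, 1)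
      + liftMetric (reForm n c) F y X (liftShape η ℓ y (0, 1)) •
        liftShape η ℓ y (liftShape η ℓ y (0, 1)) := by
  have hp := h.isTriplePoint hy
  have hm : X - liftMetric (reForm n c) F y X (liftShape η ℓ y (liftShape η ℓ y (0, 1))) •
      ((0, 1) : H × ℝ) - liftMetric (reForm n c) F y X (liftShape η ℓ y (0, 1)) •
      liftShape η ℓ y (0, 1) - (liftMetric (reForm n c) F y X (0, 1) -
        liftMetric (reForm n c) F y X (liftShape η ℓ y (liftShape η ℓ y (0, 1))) / (c / 4)) •
      liftShape η ℓ y (liftShape η ℓ y (0, 1)) ∈ cyclicOrth (liftMetric (reForm n c) F y)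
        (liftShape η ℓ y) (0, 1) := by
    have hc := h.c_ne
    have h1 : liftMetric (reForm n c) F y (liftShape η ℓ y (0, 1))
        (liftShape η ℓ y (liftShape η ℓ y (0, 1))) = 0 := by rw [hp.SV_SSV]; simp
    have h2 : liftMetric (reForm n c) F y (liftShape η ℓ y (liftShape η ℓ y (0, 1)))
        (liftShape η ℓ y (liftShape η ℓ y (0, 1))) = 0 := by
      rw [hp.S_symm, h.SSSV_of_zero hy, map_zero]
    have h3 := hp.symm (liftShape η ℓ y (liftShape η ℓ y (0, 1))) (0, 1)
    have h4 := hp.symm (liftShape η ℓ y (liftShape η ℓ y (0, 1))) (liftShape η ℓ y (0, 1))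
    rw [hp.V_SSV] at h3
    rw [h1] at h4
    refine ⟨?_, ?_, ?_⟩ <;>
      simp only [map_sub, map_smul, _root_.sub_apply, _root_.smul_apply, smul_eq_mul, hp.V_V,
        hp.V_SV, hp.V_SSV, hp.SV_V, hp.SV_SV, h1, h2, h3, h4]
    · field_simp; ring
    · ring
    · ring
  have h1 := h.model.S_of_zero hy hm
  simp only [map_sub, map_smul, h.SSSV_of_zero hy, smul_zero, sub_zero] at h1
  linear_combination (norm := module) h1

theorem fderiv_η_of_zero (h : IsTripleLift c 0 Λ O Ω p ν F η ℓ) {y : H × ℝ} (hy : y ∈ Ω)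
    (X : H × ℝ) : fderiv ℝ η y X =
      liftMetric (reForm n c) F y X (liftShape η ℓ y (liftShape η ℓ y (0, 1))) • mulI n (η y)
        - liftMetric (reForm n c) F y X (liftShape η ℓ y (0, 1)) • nullVec F η ℓ y := by
  have h1 := h.lift.dF_shape (h.subset hy) X
  rw [h.S_eq_of_zero hy X, map_add, map_smul, map_smul, h.lift.dF_shape_V (h.subset hy)] at h1
  rw [nullVec]
  linear_combination (norm := module) h1

theorem fderiv_null (h : IsTripleLift c 0 Λ O Ω p ν F η ℓ) {y : H × ℝ} (hy : y ∈ Ω)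
    (X : H × ℝ) : fderiv ℝ (fun y => rankOneMap n c (nullVec F η ℓ y) (nullVec F η ℓ y)) y X =
      (2 * liftMetric (reForm n c) F y X (liftPhi (mulI n) F ℓ y
          (liftShape η ℓ y (liftShape η ℓ y (0, 1))))) •
        rankOneMap n c (nullVec F η ℓ y) (nullVec F η ℓ y) := by
  have hd := h.lift.diffAt (h.subset hy) h.nullVec_smooth
  have h0 := rankOneMap_mulI c (nullVec F η ℓ y) (nullVec F η ℓ y)
  rw [fderiv_bilinear_apply _ hd hd, h.fderiv_nullVec hy]
  simp only [map_add, map_smul, _root_.add_apply, _root_.smul_apply]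
  linear_combination (norm := module)
    (liftMetric (reForm n c) F y X (liftShape η ℓ y (liftShape η ℓ y (0, 1)))) • h0

/-- The phase terms cancel, and the inhomogeneous term is a multiple of WW*. A functional that
annihilates WW* therefore gives a solution of a homogeneous linear equation. -/
theorem fderiv_normal (h : IsTripleLift c 0 Λ O Ω p ν F η ℓ) {y : H × ℝ} (hy : y ∈ Ω)
    (X : H × ℝ) : fderiv ℝ (fun y => rankOneMap n c (η y) (nullVec F η ℓ y)) y X =
      liftMetric (reForm n c) F y X (liftPhi (mulI n) F ℓ y
          (liftShape η ℓ y (liftShape η ℓ y (0, 1)))) • rankOneMap n c (η y) (nullVec F η ℓ y)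
        - liftMetric (reForm n c) F y X (liftShape η ℓ y (0, 1)) •
          rankOneMap n c (nullVec F η ℓ y) (nullVec F η ℓ y) := by
  have hd := h.lift.diffAt (h.subset hy) h.nullVec_smooth
  have hd' := h.lift.diffAt (h.subset hy) h.lift.η_smooth
  have h0 := rankOneMap_mulI c (η y) (nullVec F η ℓ y)
  rw [fderiv_bilinear_apply _ hd' hd, h.fderiv_nullVec hy, h.fderiv_η_of_zero hy]
  simp only [map_add, map_sub, map_smul, _root_.sub_apply, _root_.smul_apply]
  linear_combination (norm := module)
    (liftMetric (reForm n c) F y X (liftShape η ℓ y (liftShape η ℓ y (0, 1)))) • h0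

/-- The matrix κ + √(-κ)A is self-adjoint and maps F to -iW. Hence the expressions in P, N and A,
which do not involve the choice of a lift, are multiples of WW* and ηW*. -/
theorem nullMat_normalMat_eq (h : IsTripleLift c 0 Λ O Ω p ν F η ℓ) {y : H × ℝ} (hy : y ∈ Ω)
    {U₁ U₂ A : Mat n} (hf : IsHopfFrame c 0 (Matrix.of (p y.1)) (Matrix.of (ν y.1))
      (chartDiff p y.1) (chartShape p ν y.1) U₁ U₂ A) :
    nullMat c (Matrix.of (p y.1)) A =
        (c / 4) • Matrix.of (rankOneMap n c (nullVec F η ℓ y) (nullVec F η ℓ y)) ∧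
      normalMat c (Matrix.of (p y.1)) (Matrix.of (ν y.1)) A =
        -((c / 4) • Matrix.of (rankOneMap n c (η y) (nullVec F η ℓ y))) := by
  have hy' := h.subset hy
  have hFF := h.hermForm_F y hy'
  have hκ := h.lift.κ_ne
  have hp := h.isTriplePoint hy
  have hA := hp.smul_A_of_zero hf (h.chartDiff_injective hy)
  rw [LinearMap.comp_apply, LinearMap.fst_apply, h.toIsChartLift.chartDiff_eq hy'] at hA
  set a := liftPhi (mulI n) F ℓ y (liftShape η ℓ y (liftShape η ℓ y (0, 1))) with ha
  have haF : hermForm c (F y) (fderiv ℝ F y a) = 0 := by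
    rw [hermForm_eq_of_reForm (h.lift.dF_F hy' a), h.toIsChartLift.reForm_mulI_F hy', hp.a_mem.1]
    simp
  have hself := (horizontalVec_mem hκ hFF haF).1
  rw [horizontalMap_apply] at hA
  set M := (c / 4) • (1 : Mat n) + √(-(c / 4)) • A with hM
  have hM' : M = (c / 4) • (1 : Mat n) - horizontalVec c (F y) (fderiv ℝ F y a) := by
    rw [hM, hA, sub_eq_add_neg]
  have hMs : Mᴴ * gramMatrix n c = gramMatrix n c * M := by
    rw [hM', conjTranspose_sub, sub_mul, mul_sub, hself]
    simp
  have hMF : M *ᵥ F y = -mulI n (nullVec F η ℓ y) := by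
    rw [hM', sub_mulVec, horizontalVec_mulVec hκ hFF haF, ha, h.dF_a hy, smul_mulVec, one_mulVec]
    abel
  have hP : Matrix.of (p y.1) = (c / 4) • rankOne c (F y) (F y) := by
    rw [h.p_eq y hy', lineProjector_eq hFF]
  have e1 : ∀ z : Fin (n + 1) → ℂ, rankOne c z (-mulI n (nullVec F η ℓ y)) =
      Complex.I • rankOne c z (nullVec F η ℓ y) := by
    intro z
    rw [mulI_apply, ← neg_smul, rankOne_smul_right]
    simp
  have e2 : ∀ z : Fin (n + 1) → ℂ, rankOne c (-mulI n (nullVec F η ℓ y)) z =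
      -(Complex.I • rankOne c (nullVec F η ℓ y) z) := by
    intro z
    rw [mulI_apply, ← neg_smul, rankOne_smul_left, neg_smul]
  constructor
  · rw [nullMat, ← hM, hP, Matrix.mul_smul, Matrix.smul_mul, mul_rankOne,
      rankOne_mul_of_selfAdjoint c hMs, hMF, e1, e2, rankOneMap_apply]
    simp [smul_smul]
  · rw [normalMat, ← hM, hP, Matrix.mul_smul, Matrix.smul_mul, mul_rankOne,
      rankOne_mul_of_selfAdjoint c hMs, hMF, e1, rankOneMap_apply, ← h.η_eq y hy', smul_comm,
      smul_smul]
    simp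

theorem null_eventually (h : IsTripleLift c 0 Λ O Ω p ν F η ℓ) {x₀ : H}
    (hx₀ : (x₀, (0 : ℝ)) ∈ Ω) (ϕ : Mat n →ₗ[ℝ] ℝ)
    (h0 : arrayFunctional ϕ (rankOneMap n c (nullVec F η ℓ (x₀, 0)) (nullVec F η ℓ (x₀, 0))) = 0) :
    ∀ᶠ x in nhds x₀, arrayFunctional ϕ
      (rankOneMap n c (nullVec F η ℓ (x, 0)) (nullVec F η ℓ (x, 0))) = 0 := by
  refine eventually_eq_zero_of_fderiv (g := (2 : ℝ) • nullForm c F η ℓ) ?_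
    ((h.nullForm_continuousAt hx₀).const_smul _) h0
  filter_upwards [h.slice_isOpen.mem_nhds hx₀] with x hx
  have hd := h.lift.diffAt (h.subset hx) h.nullVec_smooth
  have hN := ((rankOneMap n c).hasFDerivAt_of_bilinear hd.hasFDerivAt
    hd.hasFDerivAt).differentiableAt
  obtain ⟨h1, h2⟩ := fderiv_functional_slice hN ϕ
  refine ⟨h1, fun v => ?_⟩
  rw [h2, h.fderiv_null hx, map_smul, ← h.nullForm_apply hx]
  rfl

theorem normal_eventually (h : IsTripleLift c 0 Λ O Ω p ν F η ℓ) {x₀ : H}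
    (hx₀ : (x₀, (0 : ℝ)) ∈ Ω) (ϕ : Mat n →ₗ[ℝ] ℝ)
    (h0 : arrayFunctional ϕ (rankOneMap n c (nullVec F η ℓ (x₀, 0)) (nullVec F η ℓ (x₀, 0))) = 0)
    (h0' : arrayFunctional ϕ (rankOneMap n c (η (x₀, 0)) (nullVec F η ℓ (x₀, 0))) = 0) :
    ∀ᶠ x in nhds x₀, arrayFunctional ϕ
      (rankOneMap n c (η (x, 0)) (nullVec F η ℓ (x, 0))) = 0 := by
  refine eventually_eq_zero_of_fderiv (g := nullForm c F η ℓ) ?_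
    (h.nullForm_continuousAt hx₀) h0'
  filter_upwards [h.slice_isOpen.mem_nhds hx₀, h.null_eventually hx₀ ϕ h0] with x hx hx'
  have hd := h.lift.diffAt (h.subset hx) h.nullVec_smooth
  have hd' := h.lift.diffAt (h.subset hx) h.lift.η_smooth
  have hN := ((rankOneMap n c).hasFDerivAt_of_bilinear hd'.hasFDerivAt
    hd.hasFDerivAt).differentiableAt
  obtain ⟨h1, h2⟩ := fderiv_functional_slice hN ϕ
  refine ⟨h1, fun v => ?_⟩
  rw [h2, h.fderiv_normal hx, map_sub, map_smul, map_smul, hx', h.nullForm_apply hx, smul_zero,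
    sub_zero]
  rfl

theorem nullMat_eventually (h : IsTripleLift c 0 Λ O Ω p ν F η ℓ) {x₀ : H}
    (hx₀ : (x₀, (0 : ℝ)) ∈ Ω) (ϕ : Mat n →ₗ[ℝ] ℝ) {U₁ U₂ A : Mat n}
    (hf : IsHopfFrame c 0 (Matrix.of (p x₀)) (Matrix.of (ν x₀)) (chartDiff p x₀)
      (chartShape p ν x₀) U₁ U₂ A) (h0 : ϕ (nullMat c (Matrix.of (p x₀)) A) = 0) :
    ∀ᶠ x in nhds x₀, ∀ U₁ U₂ A, IsHopfFrame c 0 (Matrix.of (p x)) (Matrix.of (ν x))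
      (chartDiff p x) (chartShape p ν x) U₁ U₂ A → ϕ (nullMat c (Matrix.of (p x)) A) = 0 := by
  have hκ := h.lift.κ_ne
  rw [(h.nullMat_normalMat_eq hx₀ hf).1, map_smul, smul_eq_mul] at h0
  filter_upwards [h.slice_isOpen.mem_nhds hx₀, h.null_eventually hx₀ ϕ
    ((mul_eq_zero.1 h0).resolve_left hκ)] with x hx hx' U₁ U₂ A hf
  rw [(h.nullMat_normalMat_eq hx hf).1, map_smul, ← arrayFunctional_apply, hx', smul_zero]

theorem normalMat_eventually (h : IsTripleLift c 0 Λ O Ω p ν F η ℓ) {x₀ : H}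
    (hx₀ : (x₀, (0 : ℝ)) ∈ Ω) (ϕ : Mat n →ₗ[ℝ] ℝ) {U₁ U₂ A : Mat n}
    (hf : IsHopfFrame c 0 (Matrix.of (p x₀)) (Matrix.of (ν x₀)) (chartDiff p x₀)
      (chartShape p ν x₀) U₁ U₂ A) (h0 : ϕ (nullMat c (Matrix.of (p x₀)) A) = 0)
    (h0' : ϕ (normalMat c (Matrix.of (p x₀)) (Matrix.of (ν x₀)) A) = 0) :
    ∀ᶠ x in nhds x₀, ∀ U₁ U₂ A, IsHopfFrame c 0 (Matrix.of (p x)) (Matrix.of (ν x))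
      (chartDiff p x) (chartShape p ν x) U₁ U₂ A →
        ϕ (normalMat c (Matrix.of (p x)) (Matrix.of (ν x)) A) = 0 := by
  have hκ := h.lift.κ_ne
  rw [(h.nullMat_normalMat_eq hx₀ hf).1, map_smul, smul_eq_mul] at h0
  rw [(h.nullMat_normalMat_eq hx₀ hf).2, map_neg, neg_eq_zero, map_smul, smul_eq_mul] at h0'
  filter_upwards [h.slice_isOpen.mem_nhds hx₀, h.normal_eventually hx₀ ϕ
    ((mul_eq_zero.1 h0).resolve_left hκ) ((mul_eq_zero.1 h0').resolve_left hκ)]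
    with x hx hx' U₁ U₂ A hf
  rw [(h.nullMat_normalMat_eq hx hf).2, map_neg, map_smul, ← arrayFunctional_apply, hx', smul_zero,
    neg_zero]

/-- There is a functional that vanishes on `nullMat` and is positive on `normalMat`. -/
theorem exists_functional (h : IsTripleLift c 0 Λ O Ω p ν F η ℓ) {y : H × ℝ} (hy : y ∈ Ω)
    {U₁ U₂ A : Mat n} (hf : IsHopfFrame c 0 (Matrix.of (p y.1)) (Matrix.of (ν y.1))
      (chartDiff p y.1) (chartShape p ν y.1) U₁ U₂ A) :
    ∃ ϕ : Mat n →ₗ[ℝ] ℝ, ϕ (nullMat c (Matrix.of (p y.1)) A) = 0 ∧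
      0 < ϕ (normalMat c (Matrix.of (p y.1)) (Matrix.of (ν y.1)) A) := by
  have hy' := h.subset hy
  have hp := h.isTriplePoint hy
  have hκ := h.lift.κ_ne
  have hpair := h.lift.pair
  obtain ⟨e1, e2⟩ := h.nullMat_normalMat_eq hy hf
  have hWF : hermForm c (nullVec F η ℓ y) (F y) = -Complex.I := by
    have h1 := hermForm_eq_of_reForm (h.lift.dF_F hy'
      (liftShape η ℓ y (liftShape η ℓ y (0, 1))))
    rw [h.toIsChartLift.reForm_mulI_F hy', hp.symm, hp.V_SSV] at h1
    rw [nullVec, ← star_hermForm, h1]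
    simp
  have hηW : reForm n c (η y) (nullVec F η ℓ y) = 0 := h.lift.η_dF y hy' _
  -- Pairs iη with the image of F. As ⟨W, F⟩ = -i, the matrix WW* gives a multiple of Re⟨η, W⟩ = 0,
  -- and ηW* a nonzero multiple of the square of η; the sign is chosen for κ < 0.
  let ϕ : Mat n →ₗ[ℝ] ℝ :=
    { toFun := fun X => -reForm n c (mulI n (η y)) (X *ᵥ F y)
      map_add' := fun X Y => by rw [add_mulVec, map_add, neg_add]
      map_smul' := fun r X => by
        rw [smul_mulVec, map_smul, RingHom.id_apply, smul_neg] }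
  have hϕ : ∀ X, ϕ X = -reForm n c (mulI n (η y)) (X *ᵥ F y) := fun X => rfl
  have e3 : (-Complex.I) • nullVec F η ℓ y = -mulI n (nullVec F η ℓ y) := by
    rw [neg_smul, mulI_apply]
  have e4 : (-Complex.I) • η y = -mulI n (η y) := by rw [neg_smul, mulI_apply]
  refine ⟨ϕ, ?_, ?_⟩
  · rw [e1, map_smul, hϕ, rankOneMap_apply, rankOne_mulVec, hWF, e3, map_neg, hpair.isom, hηW]
    simp
  · rw [e2, map_neg, map_smul, hϕ, rankOneMap_apply, rankOne_mulVec, hWF, e4, map_neg, hpair.isom,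
      h.lift.η_η y hy']
    have := h.neg
    simp only [smul_eq_mul]
    nlinarith

end IsTripleLift

end NullLine

/-! ### Transport between charts and the manifold -/

noncomputable section Charts

section Transport

variable {X X' Y E : Type*} [AddCommGroup X] [Module ℝ X] [AddCommGroup X'] [Module ℝ X']
  [AddCommGroup Y] [Module ℝ Y] [NormedAddCommGroup E] [NormedSpace ℝ E] {n : ℕ} {c l : ℝ}
  {P N U₁ U₂ A : Mat n}

theorem principalImage_comp (L : X' ≃ₗ[ℝ] X) (D Sh : X →ₗ[ℝ] Y) (μ : ℝ) :
    principalImage (D ∘ₗ L.toLinearMap) (Sh ∘ₗ L.toLinearMap) μ = principalImage D Sh μ := by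
  ext Z
  simp only [mem_principalImage, LinearMap.comp_apply, LinearEquiv.coe_coe]
  exact ⟨fun ⟨v, h⟩ => ⟨L v, h⟩, fun ⟨v, h⟩ => ⟨L.symm v, by simpa using h⟩⟩

theorem principalImage_neg (D Sh : X →ₗ[ℝ] Y) (μ : ℝ) :
    principalImage D (-Sh) μ = principalImage D Sh (-μ) := by
  ext Z
  simp only [mem_principalImage, LinearMap.neg_apply, neg_smul, neg_eq_iff_eq_neg]

theorem hopfSet_congr {D Sh : X →ₗ[ℝ] Mat n} {D' Sh' : X' →ₗ[ℝ] Mat n}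
    (hT : ∀ μ, principalImage D Sh μ = principalImage D' Sh' μ) :
    hopfSet c P N D Sh = hopfSet c P N D' Sh' := by
  simp only [hopfSet, hT]

theorem IsHopfFrame.congr {D Sh : X →ₗ[ℝ] Mat n} {D' Sh' : X' →ₗ[ℝ] Mat n}
    (hT : ∀ μ, principalImage D Sh μ = principalImage D' Sh' μ)
    (h : IsHopfFrame c l P N D Sh U₁ U₂ A) : IsHopfFrame c l P N D' Sh' U₁ U₂ A :=
  { h with
    mem₁ := hT _ ▸ h.mem₁
    mem₂ := hT _ ▸ h.mem₂
    mem_A := hT _ ▸ h.mem_A }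

theorem IsTriplePoint.comp_equiv {D Sh : X →ₗ[ℝ] Mat n} {G : E →L[ℝ] E →L[ℝ] ℝ}
    {S φ : E →L[ℝ] E} {V : E} {π : E →ₗ[ℝ] Mat n} (h : IsTriplePoint c l P N D Sh G S φ V π)
    (L : X' ≃ₗ[ℝ] X) :
    IsTriplePoint c l P N (D ∘ₗ L.toLinearMap) (Sh ∘ₗ L.toLinearMap) G S φ V π :=
  { h with
    exists_lift := fun v => h.exists_lift (L v)
    exists_image := fun u => by
      obtain ⟨v, hv⟩ := h.exists_image u
      exact ⟨L.symm v, by simpa using hv⟩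
    shape := fun u v hu hv => h.shape u (L v) hu hv }

end Transport

/-- Write Z as a tangential part plus t times the normal. Orthogonality to the hypersurface makes
the tangential part orthogonal to itself, hence zero, and the unit length gives t = ±1. -/
theorem IsChartLift.normal_unique {n : ℕ} {H : Type*} [NormedAddCommGroup H] [NormedSpace ℝ H]
    {c : ℝ} {O : Set H} {p ν : H → Fin (n + 1) → Fin (n + 1) → ℂ}
    {F η : H × ℝ → Fin (n + 1) → ℂ} {ℓ : H × ℝ → (Fin (n + 1) → ℂ) →L[ℝ] H × ℝ}
    (h : IsChartLift c O p ν F η ℓ) {x : H} (hx : x ∈ O) {Z : Mat n}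
    (hZ : Z ∈ ambientTangent c (Matrix.of (p x))) (hunit : ambientMetric c Z Z = 1)
    (hperp : ∀ v, ambientMetric c Z (chartDiff p x v) = 0) :
    Z = Matrix.of (ν x) ∨ Z = -Matrix.of (ν x) := by
  have hy : (x, (0 : ℝ)) ∈ O ×ˢ (univ : Set ℝ) := ⟨hx, mem_univ _⟩
  have hm := h.isPointModel hy
  have hp := h.p_eq _ hy
  rw [hp] at hZ
  obtain ⟨h1, h2⟩ := ambientTangent_eq_horizontalVec h.lift.κ_ne (h.hermForm_F _ hy) hZ
  set y : H × ℝ := (x, 0) with hyx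
  have h3 : reForm n c (Z *ᵥ F y) (F y) = 0 := by
    rw [reForm_apply, ← star_hermForm, h1]; simp
  have h4 := h.lift.dF_ℓ y hy (Z *ᵥ F y)
  rw [h3, mul_zero, zero_smul, sub_zero] at h4
  obtain ⟨t, ht⟩ : ∃ t : ℝ, reForm n c (Z *ᵥ F y) (η y) = t := ⟨_, rfl⟩
  rw [ht] at h4
  have h5 : Z = chartDiff p x (ℓ y (Z *ᵥ F y)).1 + t • Matrix.of (ν x) := by
    have h6 := h.chartDiff_eq hy (ℓ y (Z *ᵥ F y))
    rw [h4, map_sub, map_smul, (h.hermForm_F_η hy).2, horizontalMap_apply, h2] at h6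
    rw [h6]
    abel
  obtain ⟨u, hu, hu'⟩ := hm.exists_lift (ℓ y (Z *ᵥ F y)).1
  rw [← hu'] at h5
  have hadd : ∀ X Y Z : Mat n,
      ambientMetric c (X + Y) Z = ambientMetric c X Z + ambientMetric c Y Z :=
    fun X Y Z => by simp [ambientMetric, add_mul, mul_add]
  have hsmul : ∀ (r : ℝ) (X Y : Mat n), ambientMetric c (r • X) Y = r * ambientMetric c X Y :=
    fun r X Y => by simp [ambientMetric]; ring
  have h7 : ambientMetric c Z (chartDiff p x u.1) = 0 := hperp _
  have h8 : liftMetric (reForm n c) F y u u = 0 := by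
    rw [← hm.metric u u hu hu]
    rw [h5, hadd, hsmul] at h7
    have h9 := hm.normal u
    change ambientMetric c (Matrix.of (ν x)) (chartDiff p x u.1) = 0 at h9
    rw [h9, mul_zero, add_zero] at h7
    exact h7
  have hu0 : u = 0 := by
    by_contra h0
    exact (hm.pos u hu h0).ne' h8
  rw [hu0, map_zero, zero_add] at h5
  have hcomm : ambientMetric c (Matrix.of (ν x)) (t • Matrix.of (ν x)) =
      t * ambientMetric c (Matrix.of (ν x)) (Matrix.of (ν x)) := by
    rw [← hsmul, ambientMetric, Matrix.trace_mul_comm, ambientMetric]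
  rw [h5, hsmul, hcomm, h.chart.unit x hx, mul_one, mul_self_eq_one_iff] at hunit
  rw [h5]
  rcases hunit with rfl | rfl
  · exact Or.inl (one_smul _ _)
  · exact Or.inr (by rw [neg_smul, one_smul])

section Manifold

variable {n : ℕ} {M : Type*} [TopologicalSpace M]
  [ChartedSpace (EuclideanSpace ℝ (Fin (2 * n - 1))) M]

local notation "𝔼" => EuclideanSpace ℝ (Fin (2 * n - 1))

/-- The entries of a matrix-valued map, in the chart at `p₀`. -/
def inChart (p₀ : M) (g : M → Mat n) : 𝔼 → Fin (n + 1) → Fin (n + 1) → ℂ :=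
  entries g ∘ (chartAt 𝔼 p₀).symm

theorem of_inChart {p₀ q : M} (hq : q ∈ (chartAt 𝔼 p₀).source) (g : M → Mat n) :
    Matrix.of (inChart p₀ g (chartAt 𝔼 p₀ q)) = g q := by
  rw [inChart, Function.comp_apply, (chartAt 𝔼 p₀).left_inv hq]
  rfl

variable [IsManifold (𝓡 (2 * n - 1)) ∞ M]

theorem SmoothOn.inChart {g : M → Mat n} {W : Set M} (hg : SmoothOn g W) (p₀ : M) :
    ContDiffOn ℝ ∞ (inChart p₀ g) ((chartAt 𝔼 p₀).target ∩ (chartAt 𝔼 p₀).symm ⁻¹' W) :=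
  contMDiffOn_iff_contDiffOn.1 (hg.comp' (contMDiffOn_chart_symm (I := 𝓡 (2 * n - 1))))

/-- The differential of the chart at `p₀`. -/
def chartEquiv {p₀ q : M} (hq : q ∈ (chartAt 𝔼 p₀).source) :
    TangentSpace (𝓡 (2 * n - 1)) q ≃ₗ[ℝ] 𝔼 :=
  have : IsManifold (𝓡 (2 * n - 1)) 1 M := .of_le (n := ∞) (by simp)
  ((mdifferentiable_chart (I := 𝓡 (2 * n - 1)) p₀).mfderiv hq).toLinearEquiv

theorem diffAt_eq {g : M → Mat n} {W : Set M} (hW : IsOpen W) (hg : SmoothOn g W) {p₀ q : M}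
    (hq : q ∈ (chartAt 𝔼 p₀).source) (hqW : q ∈ W) :
    diffAt g q = chartDiff (inChart p₀ g) (chartAt 𝔼 p₀ q) ∘ₗ (chartEquiv hq).toLinearMap := by
  have : IsManifold (𝓡 (2 * n - 1)) 1 M := .of_le (n := ∞) (by simp)
  have h1 := hg.inChart p₀
  have ho := (chartAt 𝔼 p₀).isOpen_inter_preimage_symm hW
  have hqO : chartAt 𝔼 p₀ q ∈ (chartAt 𝔼 p₀).target ∩ (chartAt 𝔼 p₀).symm ⁻¹' W :=
    ⟨(chartAt 𝔼 p₀).map_source hq, by rw [mem_preimage, (chartAt 𝔼 p₀).left_inv hq]; exact hqW⟩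
  have h2 : entries g =ᶠ[nhds q] inChart p₀ g ∘ chartAt 𝔼 p₀ := by
    filter_upwards [(chartAt 𝔼 p₀).open_source.mem_nhds hq] with r hr
    exact (congrArg Matrix.of.symm (of_inChart hr g)).symm
  have h3 := ((h1.contDiffAt (ho.mem_nhds hqO)).differentiableAt (by simp)).mdifferentiableAt
  have h4 := mfderiv_comp q h3 ((mdifferentiable_chart (I := 𝓡 (2 * n - 1)) p₀).mdifferentiableAt hq)
  rw [diffAt, h2.mfderiv_eq, h4, mfderiv_eq_fderiv]
  rfl

variable {c : ℝ} {f ξ : M → Mat n} {W : Set M}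

theorem shapeOperator_eq (hW : IsOpen W)
    (hξ : IsUnitNormalOn c f ξ W) {p₀ q : M} (hq : q ∈ (chartAt 𝔼 p₀).source) (hqW : q ∈ W) :
    shapeOperator f ξ q = chartShape (inChart p₀ f) (inChart p₀ ξ) (chartAt 𝔼 p₀ q) ∘ₗ
      (chartEquiv hq).toLinearMap := by
  rw [shapeOperator, covDerivAt, diffAt_eq hW hξ.smooth hq hqW, chartShape, of_inChart hq]
  rfl

theorem principalSpace_eq (hf : IsRealHypersurface c f) (hW : IsOpen W)
    (hξ : IsUnitNormalOn c f ξ W) {p₀ q : M} (hq : q ∈ (chartAt 𝔼 p₀).source) (hqW : q ∈ W)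
    (μ : ℝ) : principalImage (diffAt f q) (shapeOperator f ξ q) μ =
      principalImage (chartDiff (inChart p₀ f) (chartAt 𝔼 p₀ q))
        (chartShape (inChart p₀ f) (inChart p₀ ξ) (chartAt 𝔼 p₀ q)) μ := by
  rw [diffAt_eq isOpen_univ hf.smooth hq (mem_univ q), shapeOperator_eq hW hξ hq hqW,
    principalImage_comp]

theorem isChartHypersurface (hf : IsRealHypersurface c f) (hW : IsOpen W)
    (hξ : IsUnitNormalOn c f ξ W) (p₀ : M) :
    IsChartHypersurface c ((chartAt 𝔼 p₀).target ∩ (chartAt 𝔼 p₀).symm ⁻¹' W) (inChart p₀ f)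
      (inChart p₀ ξ) := by
  have hq : ∀ x ∈ (chartAt 𝔼 p₀).target ∩ (chartAt 𝔼 p₀).symm ⁻¹' W,
      ∃ q ∈ (chartAt 𝔼 p₀).source, q ∈ W ∧ chartAt 𝔼 p₀ q = x := fun x hx =>
    ⟨_, (chartAt 𝔼 p₀).map_target hx.1, hx.2, (chartAt 𝔼 p₀).right_inv hx.1⟩
  have hd : ∀ q (hq : q ∈ (chartAt 𝔼 p₀).source) v,
      Matrix.of (fderiv ℝ (inChart p₀ f) (chartAt 𝔼 p₀ q) v) =
        diffAt f q ((chartEquiv hq).symm v) := by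
    intro q hq v
    rw [diffAt_eq isOpen_univ hf.smooth hq (mem_univ q), LinearMap.comp_apply,
      LinearEquiv.coe_coe, LinearEquiv.apply_symm_apply]
    rfl
  exact {
    isOpen := (chartAt 𝔼 p₀).isOpen_inter_preimage_symm hW
    p_smooth := (hf.smooth.inChart p₀).mono fun x hx => ⟨hx.1, mem_univ _⟩
    ν_smooth := hξ.smooth.inChart p₀
    p_mem := fun x hx => hf.mem_spaceForm _
    immersive := fun x hx v w hvw => by
      obtain ⟨q, hq, -, rfl⟩ := hq x hx
      have := congrArg Matrix.of hvw
      rw [hd q hq, hd q hq] at this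
      exact (chartEquiv hq).symm.injective (hf.immersive q this)
    tangent := fun x hx => hξ.tangent _ hx.2
    unit := fun x hx => hξ.unit _ hx.2
    normal := fun x hx v => by
      obtain ⟨q, hq, hqW, rfl⟩ := hq x hx
      rw [hd q hq, of_inChart hq]
      exact hξ.normal q hqW _ }

end Manifold

end Charts

/-! ### Local structure theorem on the manifold -/

noncomputable section Datum

variable {n : ℕ} {M : Type*} [TopologicalSpace M]
  [ChartedSpace (EuclideanSpace ℝ (Fin (2 * n - 1))) M]

local notation "𝔼" => EuclideanSpace ℝ (Fin (2 * n - 1))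

/-- `U₁`, `U₂`, `A` are the frame vectors of the hypersurface `f` at `q`. -/
def IsFrameAt (c l : ℝ) (f ξ : M → Mat n) (q : M) (U₁ U₂ A : Mat n) : Prop :=
  IsHopfFrame c l (f q) (ξ q) (diffAt f q) (shapeOperator f ξ q) U₁ U₂ A

/-- On the open set `W` the hypersurface `f` has the local structure that the Gauss and Codazzi
equations impose, where `l` is the triple root. -/
structure IsTripleDatum (c l : ℝ) (f ξ : M → Mat n) (W : Set M) : Prop where
  isOpen : IsOpen W
  normal : IsUnitNormalOn c f ξ W
  neg : c / 4 + l ^ 2 < 0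
  hopf : ∀ q ∈ W, hopfSet c (f q) (ξ q) (diffAt f q) (shapeOperator f ξ q) =
    {hopfCurvature₁ c l, hopfCurvature₂ c l}
  const : ∃ Λ : Set ℝ, ∀ q ∈ W, principalCurvatures f ξ q = Λ
  point : ∀ q ∈ W, ∃ (G : 𝔼 × ℝ →L[ℝ] 𝔼 × ℝ →L[ℝ] ℝ) (S φ : 𝔼 × ℝ →L[ℝ] 𝔼 × ℝ) (V : 𝔼 × ℝ)
    (π : 𝔼 × ℝ →ₗ[ℝ] Mat n),
    IsTriplePoint c l (f q) (ξ q) (diffAt f q) (shapeOperator f ξ q) G S φ V π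
  exists_frame : ∃ U₁ U₂ A : M → Mat n, SmoothOn U₁ W ∧ SmoothOn U₂ W ∧ SmoothOn A W ∧
    ∀ q ∈ W, IsFrameAt c l f ξ q (U₁ q) (U₂ q) (A q)
  finrank_eventually : 0 < l → ∀ q ∈ W, ∀ᶠ r in nhds q,
    Module.finrank ℝ (principalSpace f ξ r (-c / (4 * l))) =
      Module.finrank ℝ (principalSpace f ξ q (-c / (4 * l)))
  eq_or_neg : ∀ q ∈ W, ∀ Z ∈ ambientTangent c (f q), ambientMetric c Z Z = 1 →
    (∀ v, ambientMetric c Z (diffAt f q v) = 0) → Z = ξ q ∨ Z = -ξ q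
  nullMat_eventually : l = 0 → ∀ q ∈ W, ∀ (ϕ : Mat n →ₗ[ℝ] ℝ) (U₁ U₂ A : Mat n),
    IsFrameAt c l f ξ q U₁ U₂ A → ϕ (nullMat c (f q) A) = 0 →
    ∀ᶠ r in nhds q, ∀ U₁ U₂ A, IsFrameAt c l f ξ r U₁ U₂ A → ϕ (nullMat c (f r) A) = 0
  normalMat_eventually : l = 0 → ∀ q ∈ W, ∀ (ϕ : Mat n →ₗ[ℝ] ℝ) (U₁ U₂ A : Mat n),
    IsFrameAt c l f ξ q U₁ U₂ A → ϕ (nullMat c (f q) A) = 0 → ϕ (normalMat c (f q) (ξ q) A) = 0 →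
    ∀ᶠ r in nhds q, ∀ U₁ U₂ A, IsFrameAt c l f ξ r U₁ U₂ A → ϕ (normalMat c (f r) (ξ r) A) = 0
  exists_functional : l = 0 → ∀ q ∈ W, ∀ U₁ U₂ A : Mat n, IsFrameAt c l f ξ q U₁ U₂ A →
    ∃ ϕ : Mat n →ₗ[ℝ] ℝ, ϕ (nullMat c (f q) A) = 0 ∧ 0 < ϕ (normalMat c (f q) (ξ q) A)

variable [IsManifold (𝓡 (2 * n - 1)) ∞ M]

theorem SmoothOn.of_inChart {W : Set M} {p₀ : M} {O : Set 𝔼}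
    {U : 𝔼 → Fin (n + 1) → Fin (n + 1) → ℂ} (hU : ContDiffOn ℝ ∞ U O)
    (hW : ∀ q ∈ W, q ∈ (chartAt 𝔼 p₀).source ∧ chartAt 𝔼 p₀ q ∈ O) :
    SmoothOn (fun q => Matrix.of (U (chartAt 𝔼 p₀ q))) W :=
  (hU.contMDiffOn.comp' (contMDiffOn_chart (I := 𝓡 (2 * n - 1)) (x := p₀))).mono
    fun q hq => hW q hq

theorem exists_isTripleDatum {c : ℝ} {f ξ : M → Mat n} {W : Set M} (hn : 2 ≤ n) (hc : c ≠ 0)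
    (hf : IsRealHypersurface c f) (h2 : HasHopfNumber c f 2) (hW : IsOpen W)
    (hξ : IsUnitNormalOn c f ξ W) {Λ : Set ℝ} (hΛ : ∀ q ∈ W, principalCurvatures f ξ q = Λ)
    {p₀ : M} (hp₀ : p₀ ∈ W) : ∃ W' ⊆ W, p₀ ∈ W' ∧ ∃ l, IsTripleDatum c l f ξ W' := by
  set e := chartAt 𝔼 p₀ with he
  have hd : Module.finrank ℝ 𝔼 + 1 = 2 * n := by
    rw [finrank_euclideanSpace_fin]
    omega
  have hp₀' : p₀ ∈ e.source := mem_chart_source 𝔼 p₀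
  have hmem : ∀ q ∈ e.source, q ∈ W → e q ∈ e.target ∩ e.symm ⁻¹' W := fun q hq hqW =>
    ⟨e.map_source hq, by rw [mem_preimage, e.left_inv hq]; exact hqW⟩
  have hmem' : ∀ q ∈ e.source, e q ∈ e.target ∩ e.symm ⁻¹' W → q ∈ W := fun q hq h => by
    have := h.2
    rwa [mem_preimage, e.left_inv hq] at this
  have hT : ∀ q ∈ e.source, q ∈ W → ∀ μ, principalImage (diffAt f q) (shapeOperator f ξ q) μ =
      principalImage (chartDiff (inChart p₀ f) (e q))
        (chartShape (inChart p₀ f) (inChart p₀ ξ) (e q)) μ :=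
    fun q hq hqW μ => principalSpace_eq hf hW hξ hq hqW μ
  obtain ⟨O₁, hO₁, hx₁, F, η, ℓ, hlift⟩ := (isChartHypersurface hf hW hξ p₀).exists_isChartLift hc
    hd (hmem p₀ hp₀' hp₀)
  have hcurv : ∀ x ∈ O₁, {μ | principalImage (chartDiff (inChart p₀ f) x)
      (chartShape (inChart p₀ f) (inChart p₀ ξ) x) μ ≠ ⊥} = Λ := by
    intro x hx
    have hx' := hO₁ hx
    have hq := e.map_target hx'.1
    have h1 := hΛ _ hx'.2
    rw [← h1, principalCurvatures]
    ext μ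
    change _ ↔ principalImage (diffAt f _) (shapeOperator f ξ _) μ ≠ ⊥
    rw [hT _ hq hx'.2, e.right_inv hx'.1]
    rfl
  have hhopf : ∀ q ∈ e.source, q ∈ W →
      hopfSet c (f q) (ξ q) (diffAt f q) (shapeOperator f ξ q) =
      hopfSet c (Matrix.of (inChart p₀ f (e q))) (Matrix.of (inChart p₀ ξ (e q)))
        (chartDiff (inChart p₀ f) (e q)) (chartShape (inChart p₀ f) (inChart p₀ ξ) (e q)) := by
    intro q hq hqW
    rw [of_inChart hq, of_inChart hq]
    exact hopfSet_congr (hT q hq hqW)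
  have hcard : ∀ x ∈ O₁, (hopfSet c (Matrix.of (inChart p₀ f x)) (Matrix.of (inChart p₀ ξ x))
        (chartDiff (inChart p₀ f) x) (chartShape (inChart p₀ f) (inChart p₀ ξ) x)).ncard = 2 := by
    intro x hx
    have hx' := hO₁ hx
    have h1 := hhopf _ (e.map_target hx'.1) hx'.2
    rw [e.right_inv hx'.1] at h1
    rw [← h1]
    exact h2 W ξ hW hξ _ hx'.2
  -- The constant set of principal curvatures consists of eigenvalues of one operator in finite
  -- dimension, so the Lagrange polynomials are available.
  have hfin : Λ.Finite := by
    rw [← hcurv _ hx₁]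
    exact (hlift.isPointModel (y := (e p₀, 0)) ⟨hx₁, mem_univ _⟩).finite_curvatures
  obtain ⟨O₂, hO₂, hx₂, ho₂, l, hneg, hl, Ω, hΩ, hO₂Ω, hmodel⟩ :=
    hlift.exists_isModelTriple (Λ := hfin.toFinset) (by simpa using hcurv) hcard hx₁
  have ht : IsTripleLift c l hfin.toFinset O₁ Ω (inChart p₀ f) (inChart p₀ ξ) F η ℓ :=
    { hlift with neg := hneg, subset := hΩ, model := hmodel }
  have hW' : ∀ q ∈ e.source ∩ e ⁻¹' O₂, q ∈ W ∧ (e q, (0 : ℝ)) ∈ Ω := fun q hq =>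
    ⟨hmem' q hq.1 (hO₁ (hO₂ hq.2)), hO₂Ω _ hq.2⟩
  have hopen : IsOpen (e.source ∩ e ⁻¹' O₂) := e.isOpen_inter_preimage ho₂
  have hframe : ∀ q ∈ e.source ∩ e ⁻¹' O₂, ∀ U₁ U₂ A, IsFrameAt c l f ξ q U₁ U₂ A ↔
      IsHopfFrame c l (Matrix.of (inChart p₀ f (e q))) (Matrix.of (inChart p₀ ξ (e q)))
        (chartDiff (inChart p₀ f) (e q)) (chartShape (inChart p₀ f) (inChart p₀ ξ) (e q))
        U₁ U₂ A := by
    intro q hq U₁ U₂ A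
    rw [of_inChart hq.1, of_inChart hq.1]
    exact ⟨.congr (hT q hq.1 (hW' q hq).1), .congr fun μ => (hT q hq.1 (hW' q hq).1 μ).symm⟩
  have hev : ∀ q ∈ e.source ∩ e ⁻¹' O₂, ∀ R : 𝔼 → Prop, (∀ᶠ x in nhds (e q), R x) →
      ∀ᶠ r in nhds q, r ∈ e.source ∩ e ⁻¹' O₂ ∧ R (e r) := fun q hq R hR =>
    (Filter.eventually_of_mem (hopen.mem_nhds hq) fun _ h => h).and ((e.continuousAt hq.1).eventually hR)
  refine ⟨e.source ∩ e ⁻¹' O₂, fun q hq => (hW' q hq).1, ⟨hp₀', hx₂⟩, l, ?_⟩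
  exact {
    isOpen := hopen
    normal :=
      { smooth := hξ.smooth.mono fun q hq => (hW' q hq).1
        tangent := fun q hq => hξ.tangent q (hW' q hq).1
        unit := fun q hq => hξ.unit q (hW' q hq).1
        normal := fun q hq => hξ.normal q (hW' q hq).1 }
    neg := hneg
    hopf := fun q hq => by rw [hhopf q hq.1 (hW' q hq).1, hl _ hq.2]
    const := ⟨Λ, fun q hq => hΛ q (hW' q hq).1⟩
    point := fun q hq => by
      have h1 := (ht.isTriplePoint (hW' q hq).2).comp_equiv (chartEquiv hq.1)
      rw [of_inChart hq.1, of_inChart hq.1, ← shapeOperator_eq hW hξ hq.1 (hW' q hq).1,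
        ← diffAt_eq isOpen_univ hf.smooth hq.1 (mem_univ q)] at h1
      exact ⟨_, _, _, _, _, h1⟩
    exists_frame := by
      obtain ⟨U₁, U₂, A, hU₁, hU₂, hA, hU⟩ := ht.exists_frame
      have hs : ∀ q ∈ e.source ∩ e ⁻¹' O₂, q ∈ e.source ∧ e q ∈ {x | (x, (0 : ℝ)) ∈ Ω} :=
        fun q hq => ⟨hq.1, (hW' q hq).2⟩
      exact ⟨_, _, _, .of_inChart hU₁ hs, .of_inChart hU₂ hs, .of_inChart hA hs,
        fun q hq => (hframe q hq _ _ _).2 (hU _ (hW' q hq).2)⟩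
    finrank_eventually := fun hl q hq => by
      filter_upwards [hev q hq _ (ht.finrank_principalImage_eventually hl (hW' q hq).2)]
        with r ⟨hr, hr'⟩
      change Module.finrank ℝ (principalImage (diffAt f r) (shapeOperator f ξ r) _) =
        Module.finrank ℝ (principalImage (diffAt f q) (shapeOperator f ξ q) _)
      rw [hT r hr.1 (hW' r hr).1, hT q hq.1 (hW' q hq).1]
      exact hr'
    eq_or_neg := fun q hq Z hZ h1 hZ' => by
      rw [← of_inChart hq.1 ξ]
      refine hlift.normal_unique (hO₂ hq.2) (by rwa [of_inChart hq.1]) h1 fun v => ?_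
      have := hZ' ((chartEquiv hq.1).symm v)
      rwa [diffAt_eq isOpen_univ hf.smooth hq.1 (mem_univ q), LinearMap.comp_apply,
        LinearEquiv.coe_coe, LinearEquiv.apply_symm_apply] at this
    nullMat_eventually := by
      rintro rfl q hq ϕ U₁ U₂ A hU h0
      rw [← of_inChart hq.1 f] at h0
      filter_upwards [hev q hq _ (ht.nullMat_eventually (hW' q hq).2 ϕ
        ((hframe q hq _ _ _).1 hU) h0)] with r ⟨hr, hr'⟩ U₁ U₂ A hU
      have := hr' U₁ U₂ A ((hframe r hr _ _ _).1 hU)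
      rwa [of_inChart hr.1] at this
    normalMat_eventually := by
      rintro rfl q hq ϕ U₁ U₂ A hU h0 h0'
      rw [← of_inChart hq.1 f] at h0 h0'
      rw [← of_inChart hq.1 ξ] at h0'
      filter_upwards [hev q hq _ (ht.normalMat_eventually (hW' q hq).2 ϕ
        ((hframe q hq _ _ _).1 hU) h0 h0')] with r ⟨hr, hr'⟩ U₁ U₂ A hU
      have := hr' U₁ U₂ A ((hframe r hr _ _ _).1 hU)
      rwa [of_inChart hr.1, of_inChart hr.1] at this
    exists_functional := by
      rintro rfl q hq U₁ U₂ A hU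
      have h1 := ht.exists_functional (hW' q hq).2 ((hframe q hq _ _ _).1 hU)
      rwa [of_inChart hq.1, of_inChart hq.1] at h1 }

end Datum

/-! ### Comparison of local data whose normals differ by a sign -/

noncomputable section Comparison

variable {n : ℕ} {M : Type*} [TopologicalSpace M]
  [ChartedSpace (EuclideanSpace ℝ (Fin (2 * n - 1))) M]
  {c l l' ε : ℝ} {f ξ ξ' : M → Mat n} {W W' : Set M} {q : M}

theorem shapeOperator_of_eventuallyEq (hε : ε = 1 ∨ ε = -1)
    (h : ∀ᶠ r in nhds q, ξ' r = ε • ξ r) :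
    shapeOperator f ξ' q = ε • shapeOperator f ξ q := by
  have h1 : entries ξ' =ᶠ[nhds q] ε • entries ξ := by
    filter_upwards [h] with r hr
    funext i j
    exact congrFun (congrFun hr i) j
  have h2 : diffAt ξ' q = ε • diffAt ξ q := by
    refine LinearMap.ext fun v => congrArg Matrix.of
      (?_ : mfderiv (𝓡 (2 * n - 1)) 𝓘(ℝ, Fin (n + 1) → Fin (n + 1) → ℂ) (entries ξ') q v =
        ε • mfderiv (𝓡 (2 * n - 1)) 𝓘(ℝ, Fin (n + 1) → Fin (n + 1) → ℂ) (entries ξ) q v)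
    refine (DFunLike.congr_fun h1.mfderiv_eq v).trans ?_
    rcases hε with rfl | rfl
    · rw [one_smul, one_smul]
      rfl
    · rw [neg_one_smul, neg_one_smul, mfderiv_neg]
      rfl
  rw [shapeOperator, covDerivAt, h2, LinearMap.comp_smul, shapeOperator, covDerivAt, smul_neg]

theorem principalImage_smul {X Y : Type*} [AddCommGroup X] [Module ℝ X] [AddCommGroup Y]
    [Module ℝ Y] (hε : ε = 1 ∨ ε = -1) (D Sh : X →ₗ[ℝ] Y) (μ : ℝ) :
    principalImage D (ε • Sh) μ = principalImage D Sh (ε * μ) := by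
  rcases hε with rfl | rfl
  · rw [one_smul, one_mul]
  · rw [neg_one_smul, neg_one_mul, principalImage_neg]

theorem principalSpace_of_eventuallyEq (hε : ε = 1 ∨ ε = -1)
    (h : ∀ᶠ r in nhds q, ξ' r = ε • ξ r) (μ : ℝ) :
    principalSpace f ξ' q μ = principalSpace f ξ q (ε * μ) := by
  change principalImage (diffAt f q) (shapeOperator f ξ' q) μ = _
  rw [shapeOperator_of_eventuallyEq hε h, principalImage_smul hε]
  rfl

theorem ambientJ_smul (r : ℝ) (P X : Mat n) : ambientJ P (r • X) = r • ambientJ P X := by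
  simp only [ambientJ, Matrix.smul_mul, Matrix.mul_smul, ← smul_sub]
  rw [smul_comm]

theorem ambientMetric_smul_left (r : ℝ) (X Y : Mat n) :
    ambientMetric c (r • X) Y = r * ambientMetric c X Y := by
  simp [ambientMetric]; ring

theorem ambientMetric_smul_right (r : ℝ) (X Y : Mat n) :
    ambientMetric c X (r • Y) = r * ambientMetric c X Y := by
  simp [ambientMetric]; ring

theorem hopfSet_of_eventuallyEq (hε : ε = 1 ∨ ε = -1) (h : ∀ᶠ r in nhds q, ξ' r = ε • ξ r) :
    hopfSet c (f q) (ξ' q) (diffAt f q) (shapeOperator f ξ' q) =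
      {μ | ε * μ ∈ hopfSet c (f q) (ξ q) (diffAt f q) (shapeOperator f ξ q)} := by
  have hε0 : ε ≠ 0 := by rcases hε with rfl | rfl <;> norm_num
  ext μ
  simp only [hopfSet, mem_ofPred_eq, shapeOperator_of_eventuallyEq hε h, principalImage_smul hε,
    h.self_of_nhds, ambientJ_smul, ambientMetric_smul_left, mul_ne_zero_iff, hε0, ne_eq,
    not_false_eq_true, true_and]

/-- A change of sign of the normal negates the two Hopf curvatures. Their sum is 3l, so l is negated
too. -/
theorem eq_of_hopfCurvature_pair (hε : ε = 1 ∨ ε = -1) (h : c / 4 + l ^ 2 < 0)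
    (h' : c / 4 + l' ^ 2 < 0)
    (he : ({hopfCurvature₁ c l', hopfCurvature₂ c l'} : Set ℝ) =
      {μ | ε * μ ∈ ({hopfCurvature₁ c l, hopfCurvature₂ c l} : Set ℝ)}) : l' = ε * l := by
  have h1 := hopfCurvature_lt h
  have h1' := hopfCurvature_lt h'
  have h2 := hopfCurvature_add c l
  have h2' := hopfCurvature_add c l'
  have e1 : hopfCurvature₁ c l' ∈ {μ | ε * μ ∈ ({hopfCurvature₁ c l, hopfCurvature₂ c l} : Set ℝ)} :=
    he ▸ mem_insert _ _
  have e2 : hopfCurvature₂ c l' ∈ {μ | ε * μ ∈ ({hopfCurvature₁ c l, hopfCurvature₂ c l} : Set ℝ)} :=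
    he ▸ mem_insert_of_mem _ (mem_singleton _)
  rw [mem_ofPred_eq, mem_insert_iff, mem_singleton_iff] at e1 e2
  rcases hε with rfl | rfl <;> rcases e1 with e1 | e1 <;> rcases e2 with e2 | e2 <;>
    linarith

theorem SmoothOn.continuousAt (hξ : SmoothOn ξ W) (hW : IsOpen W) (hq : q ∈ W) :
    ContinuousAt ξ q :=
  (ContMDiffOn.continuousOn hξ).continuousAt (hW.mem_nhds hq)

theorem continuous_ambientMetric (c : ℝ) :
    Continuous fun x : Mat n × Mat n => ambientMetric c x.1 x.2 :=
  continuous_const.mul (Complex.continuous_re.comp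
    (continuous_fst.matrix_mul continuous_snd).matrix_trace)

namespace IsTripleDatum

/-- The normals agree up to sign at each point, and the continuous function ⟨ξ', ξ⟩ with values ±1
has locally constant sign. -/
theorem exists_sign (h : IsTripleDatum c l f ξ W) (hW' : IsOpen W') (hξ' : IsUnitNormalOn c f ξ' W')
    (hq : q ∈ W) (hq' : q ∈ W') : ∃ ε : ℝ, (ε = 1 ∨ ε = -1) ∧ ∀ᶠ r in nhds q, ξ' r = ε • ξ r := by
  have hn : ∀ᶠ r in nhds q, r ∈ W ∧ r ∈ W' :=
    (Filter.eventually_of_mem (h.isOpen.mem_nhds hq) fun _ h => h).and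
      (Filter.eventually_of_mem (hW'.mem_nhds hq') fun _ h => h)
  have hpm : ∀ r, r ∈ W ∧ r ∈ W' → ξ' r = ξ r ∨ ξ' r = -ξ r := fun r hr =>
    h.eq_or_neg r hr.1 _ (hξ'.tangent r hr.2) (hξ'.unit r hr.2) (hξ'.normal r hr.2)
  have hc : ContinuousAt (fun r => ambientMetric c (ξ' r) (ξ r)) q :=
    ContinuousAt.comp (g := fun x : Mat n × Mat n => ambientMetric c x.1 x.2)
      (f := fun r => (ξ' r, ξ r)) (continuous_ambientMetric c).continuousAt
      ((hξ'.smooth.continuousAt hW' hq').prodMk (h.normal.smooth.continuousAt h.isOpen hq))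
  have hm : ∀ r ∈ W, ambientMetric c (-ξ r) (ξ r) = -1 := fun r hr => by
    rw [← neg_one_smul ℝ, ambientMetric_smul_left, h.normal.unit r hr, mul_one]
  rcases hpm q ⟨hq, hq'⟩ with h0 | h0
  · refine ⟨1, Or.inl rfl, ?_⟩
    have h1 : 0 < ambientMetric c (ξ' q) (ξ q) := by rw [h0, h.normal.unit q hq]; norm_num
    filter_upwards [hn, hc.eventually (lt_mem_nhds h1)] with r hr hr'
    rcases hpm r hr with h2 | h2
    · rw [h2, one_smul]
    · rw [h2, hm r hr.1] at hr'
      norm_num at hr'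
  · refine ⟨-1, Or.inr rfl, ?_⟩
    have h1 : ambientMetric c (ξ' q) (ξ q) < 0 := by rw [h0, hm q hq]; norm_num
    filter_upwards [hn, hc.eventually (gt_mem_nhds h1)] with r hr hr'
    rcases hpm r hr with h2 | h2
    · rw [h2, h.normal.unit r hr.1] at hr'
      norm_num at hr'
    · rw [h2, neg_one_smul]

theorem root_eq (h : IsTripleDatum c l f ξ W) (h' : IsTripleDatum c l' f ξ' W') (hq : q ∈ W)
    (hq' : q ∈ W') (hε : ε = 1 ∨ ε = -1) (he : ∀ᶠ r in nhds q, ξ' r = ε • ξ r) : l' = ε * l := by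
  refine eq_of_hopfCurvature_pair hε h.neg h'.neg ?_
  rw [← h.hopf q hq, ← h'.hopf q hq', hopfSet_of_eventuallyEq hε he]

end IsTripleDatum

/-- For l = 0 one has λ₂ = -λ₁ and b₁ = b₂. Passing to -ξ replaces (U₁, U₂) by (-U₂, -U₁) and leaves
A unchanged, so A is defined without a choice of normal. -/
theorem IsFrameAt.congr {U₁ U₂ A : Mat n} (h : IsFrameAt c 0 f ξ q U₁ U₂ A)
    (hε : ε = 1 ∨ ε = -1) (he : ∀ᶠ r in nhds q, ξ' r = ε • ξ r) :
    ∃ U₁' U₂', IsFrameAt c 0 f ξ' q U₁' U₂' A := by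
  have h1 := shapeOperator_of_eventuallyEq (f := f) hε he
  have h2 := he.self_of_nhds
  rcases hε with rfl | rfl
  · rw [one_smul] at h1 h2
    refine ⟨U₁, U₂, ?_⟩
    rw [IsFrameAt, h1, h2]
    exact h
  · have h3 : hopfCurvature₂ c 0 = -hopfCurvature₁ c 0 := by
      simp [hopfCurvature₁, hopfCurvature₂]; ring
    have h4 : hopfWeight c 0 (hopfCurvature₂ c 0) (hopfCurvature₁ c 0) =
        hopfWeight c 0 (hopfCurvature₁ c 0) (hopfCurvature₂ c 0) := by
      rw [h3, hopfWeight, hopfWeight, show c * (-hopfCurvature₁ c 0 - hopfCurvature₁ c 0) =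
        -(c * (hopfCurvature₁ c 0 - -hopfCurvature₁ c 0)) by ring, div_neg, ← neg_div]
      ring
    refine ⟨(-1 : ℝ) • U₂, (-1 : ℝ) • U₁, ?_⟩
    rw [IsFrameAt, h1, h2]
    have hJ₁ := h.J₁
    have hJ₂ := h.J₂
    have hJA := h.J_A
    have hhopf := h.hopf
    rw [h4] at hJ₁ hJ₂ hJA hhopf
    exact {
      mem₁ := by
        rw [principalImage_smul (Or.inr rfl), show -1 * hopfCurvature₁ c 0 = hopfCurvature₂ c 0 by
          rw [h3]; ring]
        exact Submodule.smul_mem _ _ h.mem₂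
      mem₂ := by
        rw [principalImage_smul (Or.inr rfl), show -1 * hopfCurvature₂ c 0 = hopfCurvature₁ c 0 by
          rw [h3]; ring]
        exact Submodule.smul_mem _ _ h.mem₁
      mem_A := by
        rw [principalImage_smul (Or.inr rfl), mul_zero]
        exact h.mem_A
      unit₁ := by rw [ambientMetric_smul_left, ambientMetric_smul_right, h.unit₂]; norm_num
      unit₂ := by rw [ambientMetric_smul_left, ambientMetric_smul_right, h.unit₁]; norm_num
      unit_A := h.unit_A
      hopf := by rw [h4, ambientJ_smul, hhopf]; module
      J₁ := by rw [h4, ambientJ_smul, hJ₂]; module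
      J₂ := by rw [h4, ambientJ_smul, hJ₁]; module
      J_A := by rw [h4, hJA]; module }

theorem IsTripleDatum.frame_eq (h : IsTripleDatum c 0 f ξ W) (h' : IsTripleDatum c 0 f ξ' W')
    (hf : IsRealHypersurface c f) (hq : q ∈ W) (hq' : q ∈ W') {U₁ U₂ A U₁' U₂' A' : Mat n}
    (hU : IsFrameAt c 0 f ξ q U₁ U₂ A) (hU' : IsFrameAt c 0 f ξ' q U₁' U₂' A') : A = A' := by
  obtain ⟨ε, hε, he⟩ := h.exists_sign h'.isOpen h'.normal hq hq'
  obtain ⟨V₁, V₂, hV⟩ := hU.congr hε he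
  exact (hV.unique hU' h.neg (hf.immersive q)).2.2

variable [IsManifold (𝓡 (2 * n - 1)) ∞ M]

/-- Near each point, a unit normal field that agrees up to sign with the one of a datum has a
datum. -/
theorem IsTripleDatum.exists_sign_smul (h : IsTripleDatum c l f ξ W) (hn : 2 ≤ n) (hc : c ≠ 0)
    (hf : IsRealHypersurface c f) (h2 : HasHopfNumber c f 2) (hε : ε = 1 ∨ ε = -1)
    (hW' : IsOpen W') (hs : W' ⊆ W) (hq : q ∈ W') (he : ∀ r ∈ W', ξ' r = ε • ξ r) :
    ∃ W'' ⊆ W', q ∈ W'' ∧ IsTripleDatum c (ε * l) f ξ' W'' := by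
  have hξ := h.normal
  have hev : ∀ r ∈ W', ∀ᶠ t in nhds r, ξ' t = ε • ξ t := fun r hr =>
    Filter.eventually_of_mem (hW'.mem_nhds hr) he
  have hξ' : IsUnitNormalOn c f ξ' W' :=
    { smooth := by
        have h1 : ContMDiffOn (𝓡 (2 * n - 1)) 𝓘(ℝ, Fin (n + 1) → Fin (n + 1) → ℂ) ∞
            (ε • entries ξ) W' := by
          have h3 := hξ.smooth.mono hs
          rcases hε with rfl | rfl
          · rwa [one_smul]
          · rw [neg_one_smul]
            exact ContMDiffOn.neg h3
        refine h1.congr fun r hr => ?_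
        funext i j
        exact congrFun (congrFun (he r hr) i) j
      tangent := fun r hr => by
        rw [he r hr]
        exact Submodule.smul_mem _ _ (hξ.tangent r (hs hr))
      unit := fun r hr => by
        rw [he r hr, ambientMetric_smul_left, ambientMetric_smul_right, hξ.unit r (hs hr)]
        rcases hε with rfl | rfl <;> norm_num
      normal := fun r hr v => by
        rw [he r hr, ambientMetric_smul_left, hξ.normal r (hs hr), mul_zero] }
  obtain ⟨Λ, hΛ⟩ := h.const
  obtain ⟨W'', hs', hq', l', hd⟩ := exists_isTripleDatum (Λ := {μ | ε * μ ∈ Λ}) hn hc hf h2 hW' hξ'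
    (fun r hr => by
      ext μ
      rw [mem_ofPred_eq, ← hΛ r (hs hr), principalCurvatures, mem_ofPred_eq,
        principalSpace_of_eventuallyEq hε (hev r hr)]
      rfl) hq
  rw [h.root_eq hd (hs hq) hq' hε (hev q hq)] at hd
  exact ⟨W'', hs', hq', hd⟩

theorem exists_isTripleDatum_nonneg (hn : 2 ≤ n) (hc : c ≠ 0) (hf : IsRealHypersurface c f)
    (h1 : HasConstantPrincipalCurvatures c f) (h2 : HasHopfNumber c f 2) (p : M) :
    ∃ (l : ℝ) (ξ : M → Mat n) (W : Set M), 0 ≤ l ∧ p ∈ W ∧ IsTripleDatum c l f ξ W := by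
  obtain ⟨W, hW, hp, ξ, hξ, Λ, hΛ⟩ := h1 p
  obtain ⟨W', -, hp', l, hd⟩ := exists_isTripleDatum hn hc hf h2 hW hξ hΛ hp
  rcases le_total 0 l with hl | hl
  · exact ⟨l, ξ, W', hl, hp', hd⟩
  · obtain ⟨W'', -, hp'', hd'⟩ := hd.exists_sign_smul hn hc hf h2 (Or.inr rfl) hd.isOpen
      Subset.rfl hp' (ξ' := (-1 : ℝ) • ξ) fun r _ => rfl
    exact ⟨_, _, W'', by linarith, hp'', hd'⟩

end Comparison

/-! ### A global unit normal field -/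

noncomputable section GlobalNormal

theorem continuous_add_smul {n : ℕ} (a b : ℝ) :
    Continuous fun X : Mat n => a • (1 : Mat n) + b • X :=
  Continuous.add continuous_const (Continuous.const_smul continuous_id b)

theorem continuous_nullMat {n : ℕ} (c : ℝ) :
    Continuous fun x : Mat n × Mat n => nullMat c x.1 x.2 := by
  have h : Continuous fun x : Mat n × Mat n => (c / 4) • (1 : Mat n) + √(-(c / 4)) • x.2 :=
    (continuous_add_smul _ _).comp continuous_snd
  exact Continuous.matrix_mul (Continuous.matrix_mul h continuous_fst) h

theorem continuous_normalMat {n : ℕ} (c : ℝ) :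
    Continuous fun x : (Mat n × Mat n) × Mat n => normalMat c x.1.1 x.1.2 x.2 := by
  have h : Continuous fun x : (Mat n × Mat n) × Mat n =>
      (c / 4) • (1 : Mat n) + √(-(c / 4)) • x.2 :=
    (continuous_add_smul _ _).comp continuous_snd
  have h1 : Continuous fun x : (Mat n × Mat n) × Mat n => x.1.2 := continuous_snd.comp continuous_fst
  have h2 : Continuous fun x : (Mat n × Mat n) × Mat n => x.1.1 := continuous_fst.comp continuous_fst
  exact Continuous.const_smul (Continuous.matrix_mul (Continuous.matrix_mul h1 h2) h) Complex.I

variable {n : ℕ} {M : Type*} [TopologicalSpace M]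
  [ChartedSpace (EuclideanSpace ℝ (Fin (2 * n - 1))) M] [IsManifold (𝓡 (2 * n - 1)) ∞ M]
  {c l : ℝ} {f : M → Mat n}

/-- The diagonal field q ↦ ξ q q coincides with the local field ξ p on W p, so it inherits
smoothness and the local structure. -/
theorem exists_global_normal_of_consistent (hn : 2 ≤ n) (hc : c ≠ 0) (hf : IsRealHypersurface c f)
    (h2 : HasHopfNumber c f 2) {ξ : M → M → Mat n} {W : M → Set M} (hp : ∀ p, p ∈ W p)
    (hd : ∀ p, IsTripleDatum c l f (ξ p) (W p)) (hcons : ∀ p, ∀ q ∈ W p, ξ q q = ξ p q) :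
    ∃ ξ : M → Mat n, IsUnitNormalOn c f ξ univ ∧ ∀ p, ∃ W, p ∈ W ∧ IsTripleDatum c l f ξ W := by
  have hD : ∀ p, ∃ W, p ∈ W ∧ IsTripleDatum c l f (fun q => ξ q q) W := by
    intro p
    obtain ⟨W', -, hpW, hW⟩ := (hd p).exists_sign_smul hn hc hf h2 (Or.inl rfl) (hd p).isOpen
      Subset.rfl (hp p) (ξ' := fun q => ξ q q) fun q hq => by rw [hcons p q hq, one_smul]
    rw [one_mul] at hW
    exact ⟨W', hpW, hW⟩
  choose W' hpW hW' using hD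
  exact ⟨fun q => ξ q q,
    { smooth := fun p _ =>
        (((hW' p).normal.smooth.contMDiffAt ((hW' p).isOpen.mem_nhds (hpW p)))).contMDiffWithinAt
      tangent := fun p _ => (hW' p).normal.tangent p (hpW p)
      unit := fun p _ => (hW' p).normal.unit p (hpW p)
      normal := fun p _ => (hW' p).normal.normal p (hpW p) }, fun p => ⟨_, hpW p, hW' p⟩⟩

/-- If two of the local normals were opposite at a point, `root_eq` would give l = -l. -/
theorem exists_global_normal_of_pos (hn : 2 ≤ n) (hc : c ≠ 0) (hf : IsRealHypersurface c f)
    (h2 : HasHopfNumber c f 2) (hl : 0 < l) {ξ : M → M → Mat n} {W : M → Set M} (hp : ∀ p, p ∈ W p)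
    (hd : ∀ p, IsTripleDatum c l f (ξ p) (W p)) :
    ∃ ξ : M → Mat n, IsUnitNormalOn c f ξ univ ∧ ∀ p, ∃ W, p ∈ W ∧ IsTripleDatum c l f ξ W := by
  refine exists_global_normal_of_consistent hn hc hf h2 hp hd fun p q hq => ?_
  obtain ⟨ε, hε, he⟩ := (hd p).exists_sign (hd q).isOpen (hd q).normal hq (hp q)
  have h1 := (hd p).root_eq (hd q) hq (hp q) hε he
  rw [he.self_of_nhds]
  rcases hε with rfl | rfl
  · rw [one_smul]
  · linarith

/-- Since A does not see the sign of ξ, `nullMat` is globally defined. A functional that kills it at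
one point kills it everywhere; if moreover it is nonzero on `normalMat` at that point, it is so
everywhere, and ξ is chosen such that the value is positive. -/
theorem exists_global_normal_of_zero [PreconnectedSpace M] (hn : 2 ≤ n) (hc : c ≠ 0)
    (hf : IsRealHypersurface c f)
    (h2 : HasHopfNumber c f 2) {ξ : M → M → Mat n} {W : M → Set M} (hp : ∀ p, p ∈ W p)
    (hd : ∀ p, IsTripleDatum c 0 f (ξ p) (W p)) :
    ∃ ξ : M → Mat n, IsUnitNormalOn c f ξ univ ∧ ∀ p, ∃ W, p ∈ W ∧ IsTripleDatum c 0 f ξ W := by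
  rcases isEmpty_or_nonempty M with hM | ⟨⟨p₀⟩⟩
  · exact ⟨f, ⟨fun p => hM.elim p, fun p => hM.elim p, fun p => hM.elim p, fun p => hM.elim p⟩,
      fun p => hM.elim p⟩
  choose U₁ U₂ A hU₁ hU₂ hA hU using fun p => (hd p).exists_frame
  have hAeq : ∀ p q, q ∈ W p → A p q = A q q := fun p q hq =>
    (hd p).frame_eq (hd q) hf hq (hp q) (hU p q hq) (hU q q (hp q))
  obtain ⟨ϕ, hϕ, hϕ'⟩ := (hd p₀).exists_functional rfl p₀ (hp p₀) _ _ _ (hU p₀ p₀ (hp p₀))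
  have hϕc : Continuous ϕ := ϕ.continuous_of_finiteDimensional
  have hWn : ∀ p, ∀ᶠ r in nhds p, r ∈ W p := fun p => (hd p).isOpen.mem_nhds (hp p)
  have hfc : ∀ p, ContinuousAt f p := fun p => hf.smooth.continuousAt isOpen_univ (mem_univ p)
  have hAc : ∀ p, ∀ q ∈ W p, ContinuousAt (A p) q := fun p q hq =>
    (hA p).continuousAt (hd p).isOpen hq
  have hξc : ∀ p, ∀ q ∈ W p, ContinuousAt (ξ p) q := fun p q hq =>
    (hd p).normal.smooth.continuousAt (hd p).isOpen hq
  -- The zero set is closed by continuity, and open because the restriction of ϕ solves a linear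
  -- first order equation; M is connected.
  have hnull : ∀ q, ϕ (nullMat c (f q) (A q q)) = 0 := by
    have hcl : IsClopen {q | ϕ (nullMat c (f q) (A q q)) = 0} := by
      constructor
      · rw [← isOpen_compl_iff, isOpen_iff_eventually]
        intro q hq
        have h1 : ContinuousAt (fun r => ϕ (nullMat c (f r) (A q r))) q :=
          hϕc.continuousAt.comp (ContinuousAt.comp (g := fun x : Mat n × Mat n => nullMat c x.1 x.2)
            (f := fun r => (f r, A q r)) (continuous_nullMat c).continuousAt
            ((hfc q).prodMk (hAc q q (hp q))))
        filter_upwards [h1.eventually (isOpen_ne.mem_nhds hq), hWn q] with r hr hrW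
        rwa [hAeq q r hrW] at hr
      · rw [isOpen_iff_eventually]
        intro q hq
        filter_upwards [(hd q).nullMat_eventually rfl q (hp q) ϕ _ _ _ (hU q q (hp q)) hq, hWn q]
          with r hr hrW
        rw [← hAeq q r hrW]
        exact hr _ _ _ (hU q r hrW)
    intro q
    have := hcl.eq_univ ⟨p₀, hϕ⟩
    exact this.ge (mem_univ q)
  have hcont : ∀ p, ∀ q ∈ W p,
      ContinuousAt (fun r => ϕ (normalMat c (f r) (ξ p r) (A p r))) q := fun p q hq =>
    hϕc.continuousAt.comp (ContinuousAt.comp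
      (g := fun x : (Mat n × Mat n) × Mat n => normalMat c x.1.1 x.1.2 x.2)
      (f := fun r => ((f r, ξ p r), A p r)) (continuous_normalMat c).continuousAt
      (((hfc q).prodMk (hξc p q hq)).prodMk (hAc p q hq)))
  have hsign : ∀ p q, q ∈ W p → ξ q q = ξ p q ∨ ξ q q = -ξ p q := fun p q hq =>
    (hd p).eq_or_neg q hq _ ((hd q).normal.tangent q (hp q)) ((hd q).normal.unit q (hp q))
      ((hd q).normal.normal q (hp q))
  have hzero : ∀ p q, q ∈ W p → (ϕ (normalMat c (f q) (ξ q q) (A q q)) = 0 ↔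
      ϕ (normalMat c (f q) (ξ p q) (A p q)) = 0) := by
    intro p q hq
    rw [hAeq p q hq]
    rcases hsign p q hq with h | h
    · rw [h]
    · rw [h, normalMat_neg, map_neg, neg_eq_zero]
  -- Now the roles are exchanged: continuity makes the nonvanishing set open, and the linear
  -- equation makes its complement open. Only the vanishing matters, so the sign ambiguity of ξ is
  -- harmless.
  have hne : ∀ q, ϕ (normalMat c (f q) (ξ q q) (A q q)) ≠ 0 := by
    have hcl : IsClopen {q | ϕ (normalMat c (f q) (ξ q q) (A q q)) ≠ 0} := by
      constructor
      · rw [← isOpen_compl_iff, isOpen_iff_eventually]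
        intro q hq
        filter_upwards [(hd q).normalMat_eventually rfl q (hp q) ϕ _ _ _ (hU q q (hp q)) (hnull q)
          (not_not.1 hq), hWn q] with r hr hrW
        exact not_not.2 ((hzero q r hrW).2 (hr _ _ _ (hU q r hrW)))
      · rw [isOpen_iff_eventually]
        intro q hq
        filter_upwards [(hcont q q (hp q)).eventually (isOpen_ne.mem_nhds hq), hWn q] with r hr hrW
        exact fun h => hr ((hzero q r hrW).1 h)
    intro q
    have := hcl.eq_univ ⟨p₀, hϕ'.ne'⟩
    exact this.ge (mem_univ q)
  have hpos : ∀ p, ∃ (ξ' : M → Mat n) (W' : Set M), p ∈ W' ∧ W' ⊆ W p ∧ IsTripleDatum c 0 f ξ' W' ∧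
      ∀ r ∈ W', (ξ' r = ξ p r ∨ ξ' r = -ξ p r) ∧ 0 < ϕ (normalMat c (f r) (ξ' r) (A r r)) := by
    intro p
    obtain ⟨ε, hε, h0⟩ : ∃ ε : ℝ, (ε = 1 ∨ ε = -1) ∧
        0 < ε * ϕ (normalMat c (f p) (ξ p p) (A p p)) := by
      rcases (hne p).lt_or_gt with h | h
      · exact ⟨-1, Or.inr rfl, by linarith⟩
      · exact ⟨1, Or.inl rfl, by linarith⟩
    obtain ⟨V, hV, hVo, hpV⟩ := eventually_nhds_iff.1
      ((((hcont p p (hp p)).const_mul ε).eventually (lt_mem_nhds h0)).and (hWn p))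
    obtain ⟨W', hW', hpW', hD⟩ := (hd p).exists_sign_smul hn hc hf h2 hε hVo (fun r hr => (hV r hr).2)
      hpV (ξ' := fun r => ε • ξ p r) fun r _ => rfl
    rw [mul_zero] at hD
    refine ⟨_, W', hpW', fun r hr => (hV r (hW' hr)).2, hD, fun r hr => ?_⟩
    have h1 := (hV r (hW' hr)).1
    rw [hAeq p r (hV r (hW' hr)).2] at h1
    rcases hε with rfl | rfl
    · rw [one_mul] at h1
      simp only [one_smul]
      exact ⟨Or.inl trivial, h1⟩
    · rw [neg_one_mul] at h1
      simp only [neg_one_smul]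
      exact ⟨Or.inr trivial, by rwa [normalMat_neg, map_neg]⟩
  choose ξ' W' hp' hs hd' hξ' using hpos
  refine exists_global_normal_of_consistent hn hc hf h2 hp' hd' fun p q hq => ?_
  rcases (hd' p).eq_or_neg q hq _ ((hd' q).normal.tangent q (hp' q))
    ((hd' q).normal.unit q (hp' q)) ((hd' q).normal.normal q (hp' q)) with h | h
  · exact h
  · have h1 := (hξ' p q hq).2
    have h2 := (hξ' q q (hp' q)).2
    rw [h, normalMat_neg, map_neg] at h2
    linarith

theorem exists_global_normal [PreconnectedSpace M] (hn : 2 ≤ n) (hc : c ≠ 0)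
    (hf : IsRealHypersurface c f) (h1 : HasConstantPrincipalCurvatures c f)
    (h2 : HasHopfNumber c f 2) :
    ∃ (l : ℝ) (ξ : M → Mat n), 0 ≤ l ∧ IsUnitNormalOn c f ξ univ ∧
      ∀ p, ∃ W, p ∈ W ∧ IsTripleDatum c l f ξ W := by
  choose l ξ W hl hp hd using exists_isTripleDatum_nonneg hn hc hf h1 h2
  -- Neighbouring values agree up to sign and are nonnegative, hence are equal.
  have hloc : IsLocallyConstant l := by
    rw [IsLocallyConstant.iff_eventually_eq]
    intro p
    filter_upwards [(hd p).isOpen.mem_nhds (hp p)] with q hq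
    obtain ⟨ε, hε, he⟩ := (hd p).exists_sign (hd q).isOpen (hd q).normal hq (hp q)
    have h1 := (hd p).root_eq (hd q) hq (hp q) hε he
    have h2 := hl p
    have h3 := hl q
    rcases hε with rfl | rfl <;> linarith
  obtain ⟨L, hL, hlL⟩ : ∃ L, 0 ≤ L ∧ ∀ p, l p = L := by
    rcases isEmpty_or_nonempty M with hM | ⟨⟨p₀⟩⟩
    · exact ⟨0, le_rfl, fun p => hM.elim p⟩
    · exact ⟨l p₀, hl p₀, fun p => hloc.apply_eq_of_preconnectedSpace p p₀⟩
  simp only [hlL] at hd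
  rcases hL.eq_or_lt with rfl | hpos
  · obtain ⟨ξ, hξ, h⟩ := exists_global_normal_of_zero hn hc hf h2 hp hd
    exact ⟨0, ξ, le_rfl, hξ, h⟩
  · obtain ⟨ξ, hξ, h⟩ := exists_global_normal_of_pos hn hc hf h2 hpos hp hd
    exact ⟨L, ξ, hL, hξ, h⟩

end GlobalNormal

/-! ### Global frame, list of principal curvatures and multiplicities -/

noncomputable section Global

variable {n : ℕ} {M : Type*} [TopologicalSpace M]
  [ChartedSpace (EuclideanSpace ℝ (Fin (2 * n - 1))) M] {c l : ℝ} {f ξ : M → Mat n}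

theorem exists_global_frame (hf : IsRealHypersurface c f)
    (hd : ∀ p, ∃ W, p ∈ W ∧ IsTripleDatum c l f ξ W) :
    ∃ U₁ U₂ A : M → Mat n, SmoothOn U₁ univ ∧ SmoothOn U₂ univ ∧ SmoothOn A univ ∧
      ∀ q, IsFrameAt c l f ξ q (U₁ q) (U₂ q) (A q) := by
  choose W hp hd using hd
  choose U₁ U₂ A hU₁ hU₂ hA hU using fun p => (hd p).exists_frame
  have heq : ∀ p, ∀ q ∈ W p, U₁ p q = U₁ q q ∧ U₂ p q = U₂ q q ∧ A p q = A q q := fun p q hq =>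
    (hU p q hq).unique (hU q q (hp q)) (hd p).neg (hf.immersive q)
  have hs : ∀ U : M → M → Mat n, (∀ p, SmoothOn (U p) (W p)) → (∀ p, ∀ q ∈ W p, U p q = U q q) →
      SmoothOn (fun q => U q q) univ := by
    intro U hU he p _
    have h1 := ContMDiffOn.congr (hU p) (f₁ := entries fun q => U q q) fun q hq => by
      funext i j
      exact congrFun (congrFun (he p q hq).symm i) j
    exact (h1.contMDiffAt ((hd p).isOpen.mem_nhds (hp p))).contMDiffWithinAt
  exact ⟨fun q => U₁ q q, fun q => U₂ q q, fun q => A q q, hs U₁ hU₁ fun p q hq => (heq p q hq).1,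
    hs U₂ hU₂ fun p q hq => (heq p q hq).2.1, hs A hA fun p q hq => (heq p q hq).2.2,
    fun q => hU q q (hp q)⟩

theorem exists_finrank_eq [PreconnectedSpace M] [Nonempty M]
    (hd : ∀ p, ∃ W, p ∈ W ∧ IsTripleDatum c l f ξ W) (hl : 0 < l) :
    ∃ m : ℕ, ∀ p, Module.finrank ℝ (principalSpace f ξ p (-c / (4 * l))) = m := by
  have hloc : IsLocallyConstant fun p =>
      Module.finrank ℝ (principalSpace f ξ p (-c / (4 * l))) := by
    rw [IsLocallyConstant.iff_eventually_eq]
    intro p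
    obtain ⟨W, hp, hd⟩ := hd p
    exact hd.finrank_eventually hl p hp
  exact ⟨_, fun p => hloc.apply_eq_of_preconnectedSpace p (Classical.arbitrary M)⟩

/-- The numbers `λ₁`, `λ₂`, `λ₃ = l` and `λ₄`. -/
def curvatureList (c l : ℝ) : ℕ → ℝ
  | 1 => hopfCurvature₁ c l
  | 2 => hopfCurvature₂ c l
  | 3 => l
  -- Meant for the index 4; the index 0 and indices above 4 play no role.
  | _ => -c / (4 * l)

theorem curvatureList_image_three (c l : ℝ) : curvatureList c l '' Icc 1 3 =
    {hopfCurvature₁ c l, hopfCurvature₂ c l, l} := by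
  have : Icc 1 3 = ({1, 2, 3} : Set ℕ) := by
    ext i
    simp only [mem_Icc, mem_insert_iff, mem_singleton_iff]
    omega
  rw [this, image_insert_eq, image_insert_eq, image_singleton]
  rfl

theorem curvatureList_image_four (c l : ℝ) : curvatureList c l '' Icc 1 4 =
    {hopfCurvature₁ c l, hopfCurvature₂ c l, l, -c / (4 * l)} := by
  have : Icc 1 4 = ({1, 2, 3, 4} : Set ℕ) := by
    ext i
    simp only [mem_Icc, mem_insert_iff, mem_singleton_iff]
    omega
  rw [this, image_insert_eq, image_insert_eq, image_insert_eq, image_singleton]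
  rfl

theorem injOn_curvatureList_three (h : c / 4 + l ^ 2 < 0) :
    InjOn (curvatureList c l) (Icc 1 3) := by
  have h1 := hopfCurvature₁_lt h
  have h2 := lt_hopfCurvature₂ h
  rintro i ⟨hi, hi'⟩ j ⟨hj, hj'⟩ hij
  interval_cases i <;> interval_cases j <;> first | rfl | (simp only [curvatureList] at hij; linarith)

theorem injOn_curvatureList_four (h : c / 4 + l ^ 2 < 0) (hl : 0 < l)
    (hne : -c / (4 * l) ≠ hopfCurvature₂ c l) : InjOn (curvatureList c l) (Icc 1 4) := by
  have h1 := hopfCurvature₁_lt h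
  have h2 := lt_hopfCurvature₂ h
  have h3 : l < -c / (4 * l) := by
    rw [lt_div_iff₀ (by positivity)]
    nlinarith
  rintro i ⟨hi, hi'⟩ j ⟨hj, hj'⟩ hij
  interval_cases i <;> interval_cases j <;> first | rfl |
    (simp only [curvatureList] at hij; first | linarith | exact absurd hij hne | exact absurd hij.symm hne)

/-- If -κ/l = λ₂, the sum and product of the Hopf curvatures give (λ₂ - l)(λ₂ - 3l) = 0. As λ₂ > l
this means λ₂ = 3l, whence λ₁ = 0 and c = -12l². -/
theorem hopfCurvature_of_residual (h : c / 4 + l ^ 2 < 0) (hl : 0 ≤ l)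
    (hμ : c / 4 + l * hopfCurvature₂ c l = 0) : hopfCurvature₁ c l = 0 ∧
      hopfCurvature₂ c l = √(-3 * c) / 2 ∧ l = √(-c) / (2 * √3) := by
  have hs := hopfCurvature_add c l
  have hp := hopfCurvature_mul h
  have hlt := lt_hopfCurvature₂ h
  have h2 : hopfCurvature₂ c l = 3 * l := by
    have h3 : (hopfCurvature₂ c l - l) * (hopfCurvature₂ c l - 3 * l) = 0 := by
      linear_combination hopfCurvature₂ c l * hs - hp - hμ
    rcases mul_eq_zero.1 h3 with h4 | h4 <;> linarith
  have hc : c = -12 * l ^ 2 := by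
    rw [h2] at hμ
    linarith
  have h12 : √(-c) = 2 * √3 * l := by
    rw [Real.sqrt_eq_iff_mul_self_eq (by nlinarith) (by positivity), hc]
    linear_combination (-4 * l ^ 2) * Real.sq_sqrt (show (0 : ℝ) ≤ 3 by norm_num)
  have h36 : √(-3 * c) = 6 * l := by
    rw [Real.sqrt_eq_iff_mul_self_eq (by nlinarith) (by positivity), hc]
    ring
  refine ⟨by linarith, by rw [h2, h36]; ring, ?_⟩
  rw [h12]
  field_simp

/-- Excludes this value of λ₃ when there are four principal curvatures, since then λ₂ and λ₄ would
coincide. -/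
theorem residual_of_eq (hl : 0 ≤ l) (hc : c < 0) (h : l = √(-c) / (2 * √3)) :
    c / 4 + l * hopfCurvature₂ c l = 0 := by
  have h3 : c = -12 * l ^ 2 := by
    rw [h, div_pow, mul_pow, Real.sq_sqrt (by linarith), Real.sq_sqrt (by norm_num)]
    ring
  have h4 : √(-c - 3 * l ^ 2) = 3 * l := by
    rw [Real.sqrt_eq_iff_mul_self_eq (by nlinarith) (by positivity), h3]
    ring
  rw [hopfCurvature₂, h4, h3]
  ring

variable {p : M}

theorem IsFrameAt.ne_bot {U₁ U₂ A : Mat n} (h : IsFrameAt c l f ξ p U₁ U₂ A) :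
    {hopfCurvature₁ c l, hopfCurvature₂ c l, l} ⊆ principalCurvatures f ξ p := by
  have key : ∀ (μ : ℝ) (Z : Mat n), Z ∈ principalSpace f ξ p μ → ambientMetric c Z Z = 1 →
      μ ∈ principalCurvatures f ξ p := by
    intro μ Z hZ h1 h0
    rw [h0, Submodule.mem_bot] at hZ
    rw [hZ] at h1
    simp [ambientMetric] at h1
  rintro μ (rfl | rfl | rfl)
  · exact key _ _ h.mem₁ h.unit₁
  · exact key _ _ h.mem₂ h.unit₂
  · exact key _ _ h.mem_A h.unit_A

namespace IsTripleDatum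

variable {W : Set M}

theorem curvature_mem (h : IsTripleDatum c l f ξ W) (hp : p ∈ W) {μ : ℝ}
    (hμ : μ ∈ principalCurvatures f ξ p) :
    μ = hopfCurvature₁ c l ∨ μ = hopfCurvature₂ c l ∨ μ = l ∨ c / 4 + l * μ = 0 := by
  obtain ⟨G, S, φ, V, π, h⟩ := h.point p hp
  exact h.curvature_mem hμ

/-- For l ≥ 0 and λ₁ < l one has κ + lλ₁ ≤ κ + l² < 0, so λ₁ never coincides with -κ/l. -/
theorem finrank_principalSpace₁ (h : IsTripleDatum c l f ξ W) (hp : p ∈ W) (hl : 0 ≤ l) :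
    Module.finrank ℝ (principalSpace f ξ p (hopfCurvature₁ c l)) = 1 := by
  obtain ⟨G, S, φ, V, π, h⟩ := h.point p hp
  have h1 := h.neg
  have h2 := hopfCurvature₁_lt h.neg
  exact h.finrank_principalImage₁ (by nlinarith)

theorem finrank_principalSpace₂ (h : IsTripleDatum c l f ξ W) (hp : p ∈ W)
    (hμ : c / 4 + l * hopfCurvature₂ c l ≠ 0) :
    Module.finrank ℝ (principalSpace f ξ p (hopfCurvature₂ c l)) = 1 := by
  obtain ⟨G, S, φ, V, π, h⟩ := h.point p hp
  exact h.finrank_principalImage₂ hμ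

theorem finrank_principalSpace_le (h : IsTripleDatum c l f ξ W) (hn : 2 ≤ n) (hp : p ∈ W) {μ : ℝ}
    (hμ : c / 4 + l * μ = 0) (hne₁ : μ ≠ hopfCurvature₁ c l) (hne₂ : μ ≠ hopfCurvature₂ c l) :
    Module.finrank ℝ (principalSpace f ξ p μ) + 2 ≤ n := by
  obtain ⟨G, S, φ, V, π, h⟩ := h.point p hp
  have h1 := h.finrank_principalImage_residual hμ hne₁ hne₂
  have h2 := h.finrank_residual_le
  rw [Module.finrank_prod, finrank_euclideanSpace_fin, Module.finrank_self] at h2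
  change Module.finrank ℝ (principalImage (diffAt f p) (shapeOperator f ξ p) μ) + 2 ≤ n
  omega

theorem finrank_principalSpace₂_le (h : IsTripleDatum c l f ξ W) (hn : 2 ≤ n) (hp : p ∈ W)
    (hμ : c / 4 + l * hopfCurvature₂ c l = 0) :
    1 ≤ Module.finrank ℝ (principalSpace f ξ p (hopfCurvature₂ c l)) ∧
      Module.finrank ℝ (principalSpace f ξ p (hopfCurvature₂ c l)) + 1 ≤ n := by
  obtain ⟨G, S, φ, V, π, h⟩ := h.point p hp
  have h1 := h.finrank_principalImage_residual₂ hμ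
  have h2 := h.finrank_residual_le
  rw [Module.finrank_prod, finrank_euclideanSpace_fin, Module.finrank_self] at h2
  change 1 ≤ Module.finrank ℝ (principalImage (diffAt f p) (shapeOperator f ξ p) _) ∧
    Module.finrank ℝ (principalImage (diffAt f p) (shapeOperator f ξ p) _) + 1 ≤ n
  omega

theorem J_residual (h : IsTripleDatum c l f ξ W) (hf : IsRealHypersurface c f) (hp : p ∈ W)
    {U₁ U₂ A : Mat n} (hU : IsFrameAt c l f ξ p U₁ U₂ A) {μ : ℝ} (hμ : c / 4 + l * μ = 0)
    (hne : μ ≠ hopfCurvature₁ c l) {Z : Mat n} (hZ : Z ∈ principalSpace f ξ p μ)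
    (hZU : ambientMetric c Z U₂ = 0) :
    ambientJ (f p) Z ∈ principalSpace f ξ p l ∧ ambientMetric c (ambientJ (f p) Z) A = 0 ∧
      ∀ Y ∈ principalSpace f ξ p μ, ambientMetric c Y U₂ = 0 →
        ambientMetric c (ambientJ (f p) Z) Y = 0 := by
  obtain ⟨G, S, φ, V, π, h⟩ := h.point p hp
  exact h.J_residual hU (hf.immersive p) hμ hne hZ hZU

theorem metric_residual (h : IsTripleDatum c l f ξ W) (hf : IsRealHypersurface c f) (hp : p ∈ W)
    {U₁ U₂ A : Mat n} (hU : IsFrameAt c l f ξ p U₁ U₂ A) {μ : ℝ} (hμ : c / 4 + l * μ = 0)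
    (hne₁ : μ ≠ hopfCurvature₁ c l) (hne₂ : μ ≠ hopfCurvature₂ c l) {Z : Mat n}
    (hZ : Z ∈ principalSpace f ξ p μ) : ambientMetric c Z U₂ = 0 := by
  obtain ⟨G, S, φ, V, π, h⟩ := h.point p hp
  exact h.metric_residual hU (hf.immersive p) hμ hne₁ hne₂ hZ

end IsTripleDatum

/-- Either there are three principal curvatures, or there are four and the fourth one is
`-c / (4 l)`. -/
theorem principalCurvatures_cases [PreconnectedSpace M] [Nonempty M] (hn : 2 ≤ n) (hl : 0 ≤ l)
    (hneg : c / 4 + l ^ 2 < 0) {U₁ U₂ A : M → Mat n}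
    (hd : ∀ p, ∃ W, p ∈ W ∧ IsTripleDatum c l f ξ W)
    (hU : ∀ p, IsFrameAt c l f ξ p (U₁ p) (U₂ p) (A p)) :
    ((∀ p, principalCurvatures f ξ p = {hopfCurvature₁ c l, hopfCurvature₂ c l, l}) ∧
      ((∀ p, Module.finrank ℝ (principalSpace f ξ p (hopfCurvature₂ c l)) = 1) ∨
        c / 4 + l * hopfCurvature₂ c l = 0 ∧ ∃ k : ℕ, 2 ≤ k ∧ k ≤ n - 1 ∧
          ∀ p, k = Module.finrank ℝ (principalSpace f ξ p (hopfCurvature₂ c l)))) ∨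
    (0 < l ∧ -c / (4 * l) ≠ hopfCurvature₂ c l ∧
      (∀ p, principalCurvatures f ξ p =
        {hopfCurvature₁ c l, hopfCurvature₂ c l, l, -c / (4 * l)}) ∧
      (∀ p, Module.finrank ℝ (principalSpace f ξ p (hopfCurvature₂ c l)) = 1) ∧
      ∃ k : ℕ, 2 ≤ k ∧ k ≤ n - 1 ∧
        ∀ p, k = Module.finrank ℝ (principalSpace f ξ p (-c / (4 * l))) + 1) := by
  have hsub : ∀ p, {hopfCurvature₁ c l, hopfCurvature₂ c l, l} ⊆ principalCurvatures f ξ p :=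
    fun p => (hU p).ne_bot
  have three : (∀ p μ, μ ∈ principalCurvatures f ξ p → c / 4 + l * μ = 0 →
      μ = hopfCurvature₂ c l) → ∀ p,
      principalCurvatures f ξ p = {hopfCurvature₁ c l, hopfCurvature₂ c l, l} := by
    refine fun h p => Subset.antisymm (fun μ hμ => ?_) (hsub p)
    obtain ⟨W, hp, hd⟩ := hd p
    rcases hd.curvature_mem hp hμ with h1 | h1 | h1 | h1
    · exact Or.inl h1
    · exact Or.inr (Or.inl h1)
    · exact Or.inr (Or.inr h1)
    · exact Or.inr (Or.inl (h p μ hμ h1))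
  rcases hl.eq_or_lt with rfl | hl
  · refine Or.inl ⟨three fun p μ _ h => ?_, Or.inl fun p => ?_⟩
    · nlinarith
    · obtain ⟨W, hp, hd⟩ := hd p
      exact hd.finrank_principalSpace₂ hp (by nlinarith)
  have hμ : ∀ μ, c / 4 + l * μ = 0 ↔ μ = -c / (4 * l) := by
    intro μ
    rw [eq_div_iff (by positivity)]
    constructor <;> intro h <;> linarith
  obtain ⟨m, hm⟩ := exists_finrank_eq hd hl
  have hne₁ : -c / (4 * l) ≠ hopfCurvature₁ c l := by
    intro h0
    have h1 := (hμ _).2 h0.symm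
    have h2 := hopfCurvature₁_lt hneg
    nlinarith
  by_cases h2 : c / 4 + l * hopfCurvature₂ c l = 0
  · have h3 := (hμ _).1 h2
    rw [← h3] at hm
    refine Or.inl ⟨three fun p μ _ h => by rw [(hμ μ).1 h, h3], ?_⟩
    -- Here λ₂ = -κ/l. If m = 1 the residual space is zero, which belongs to the alternative of
    -- multiplicity one; otherwise m ≥ 2.
    by_cases hm1 : m = 1
    · exact Or.inl fun p => by rw [hm, hm1]
    · obtain ⟨p⟩ := ‹Nonempty M›
      obtain ⟨W, hp, hd⟩ := hd p
      have h4 := hd.finrank_principalSpace₂_le hn hp h2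
      rw [hm] at h4
      exact Or.inr ⟨h2, m, by omega, by omega, fun p => (hm p).symm⟩
  · have hne₂ : -c / (4 * l) ≠ hopfCurvature₂ c l := fun h0 => h2 ((hμ _).2 h0.symm)
    have hdim : ∀ p, Module.finrank ℝ (principalSpace f ξ p (hopfCurvature₂ c l)) = 1 := by
      intro p
      obtain ⟨W, hp, hd⟩ := hd p
      exact hd.finrank_principalSpace₂ hp h2
    have hfd : ∀ p, principalSpace f ξ p (-c / (4 * l)) = ⊥ ↔ m = 0 := by
      intro p
      rw [← hm p, Submodule.finrank_eq_zero]
    by_cases hm0 : m = 0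
    · refine Or.inl ⟨three fun p μ h h' => ?_, Or.inl hdim⟩
      rw [(hμ μ).1 h'] at h
      exact absurd ((hfd p).2 hm0) h
    -- With k = m + 1, the nonzero space gives k ≥ 2, and m + 2 ≤ n gives k ≤ n - 1.
    · refine Or.inr ⟨hl, hne₂, fun p => ?_, hdim, m + 1, by omega, ?_, fun p => by rw [hm]⟩
      · refine Subset.antisymm (fun μ hμ' => ?_) ?_
        · obtain ⟨W, hp, hd⟩ := hd p
          have := hd.curvature_mem hp hμ'
          rwa [hμ] at this
        · rintro μ (h | h | h | h)
          · exact hsub p (Or.inl h)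
          · exact hsub p (Or.inr (Or.inl h))
          · exact hsub p (Or.inr (Or.inr h))
          · rw [mem_singleton_iff.1 h]
            exact fun h0 => hm0 ((hfd p).1 h0)
      · obtain ⟨p⟩ := ‹Nonempty M›
        obtain ⟨W, hp, hd⟩ := hd p
        have h4 := hd.finrank_principalSpace_le hn hp ((hμ _).2 rfl) hne₁ hne₂
        rw [hm] at h4
        omega

end Global

/-! ### The classification -/

theorem mainTheorem2 (n : ℕ) (hn : 2 ≤ n) (c : ℝ) :
    (0 < c → ∀ (M : Type*) [TopologicalSpace M]
      [ChartedSpace (EuclideanSpace ℝ (Fin (2 * n - 1))) M] [IsManifold (𝓡 (2 * n - 1)) ∞ M]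
      [Nonempty M] (f : M → Mat n),
      IsRealHypersurface c f → HasConstantPrincipalCurvatures c f → ¬ HasHopfNumber c f 2) ∧
    (c < 0 → ∀ (M : Type*) [TopologicalSpace M]
      [ChartedSpace (EuclideanSpace ℝ (Fin (2 * n - 1))) M] [IsManifold (𝓡 (2 * n - 1)) ∞ M]
      [ConnectedSpace M] (f : M → Mat n),
      IsRealHypersurface c f → HasConstantPrincipalCurvatures c f → HasHopfNumber c f 2 →
      ∃ (ξ : M → Mat n) (g : ℕ) (lam : ℕ → ℝ) (b₁ b₂ : ℝ) (U₁ U₂ A : M → Mat n),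
        IsUnitNormalOn c f ξ univ ∧
        (g = 3 ∨ g = 4) ∧
        InjOn lam (Icc 1 g) ∧
        (∀ p, principalCurvatures f ξ p = lam '' Icc 1 g) ∧
        -- the Hopf vector field
        (0 < b₁ ∧ 0 < b₂ ∧
          IsUnitSection c f ξ (lam 1) U₁ ∧ IsUnitSection c f ξ (lam 2) U₂ ∧
          (∀ p, ambientJ (f p) (ξ p) = b₁ • U₁ p + b₂ • U₂ p) ∧
          b₁ ^ 2 = 4 * (lam 2 - 2 * lam 3) * (lam 1 - lam 3) ^ 2 / (c * (lam 1 - lam 2)) ∧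
          b₂ ^ 2 = 4 * (lam 1 - 2 * lam 3) * (lam 2 - lam 3) ^ 2 / (c * (lam 2 - lam 1))) ∧
        -- the vector field `A`
        (IsUnitSection c f ξ (lam 3) A ∧
          (∀ p, ambientJ (f p) (U₁ p) = -(b₂ • A p) - b₁ • ξ p) ∧
          (∀ p, ambientJ (f p) (U₂ p) = b₁ • A p - b₂ • ξ p) ∧
          (∀ p, ambientJ (f p) (A p) = b₂ • U₁ p - b₁ • U₂ p)) ∧
        -- the first three principal curvatures
        (0 ≤ lam 3 ∧ lam 3 < √(-c) / 2 ∧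
          lam 1 = (3 * lam 3 - √(-c - 3 * lam 3 ^ 2)) / 2 ∧
          lam 2 = (3 * lam 3 + √(-c - 3 * lam 3 ^ 2)) / 2) ∧
        (∀ p, Module.finrank ℝ (principalSpace f ξ p (lam 1)) = 1) ∧
        -- four principal curvatures
        (g = 4 →
          (∀ p, Module.finrank ℝ (principalSpace f ξ p (lam 2)) = 1) ∧
          (∃ k : ℕ, 2 ≤ k ∧ k ≤ n - 1 ∧
            ∀ p, k = Module.finrank ℝ (principalSpace f ξ p (lam 4)) + 1) ∧
          (∀ p, ∀ X ∈ principalSpace f ξ p (lam 4), ∀ Y ∈ principalSpace f ξ p (lam 4),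
            ambientMetric c (ambientJ (f p) X) Y = 0) ∧
          (∀ p, ∀ X ∈ principalSpace f ξ p (lam 4),
            ambientJ (f p) X ∈ principalSpace f ξ p (lam 3) ∧
              ambientMetric c (ambientJ (f p) X) (A p) = 0) ∧
          lam 3 ≠ 0 ∧ lam 3 ≠ √(-c) / (2 * √3) ∧ lam 4 = -c / (4 * lam 3)) ∧
        -- three principal curvatures
        (g = 3 →
          (∀ p, Module.finrank ℝ (principalSpace f ξ p (lam 2)) = 1) ∨
          ((∃ k : ℕ, 2 ≤ k ∧ k ≤ n - 1 ∧
              ∀ p, k = Module.finrank ℝ (principalSpace f ξ p (lam 2))) ∧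
            (∀ p, ∀ X ∈ principalSpace f ξ p (lam 2), ambientMetric c X (U₂ p) = 0 →
              ∀ Y ∈ principalSpace f ξ p (lam 2), ambientMetric c Y (U₂ p) = 0 →
                ambientMetric c (ambientJ (f p) X) Y = 0) ∧
            (∀ p, ∀ X ∈ principalSpace f ξ p (lam 2), ambientMetric c X (U₂ p) = 0 →
              ambientJ (f p) X ∈ principalSpace f ξ p (lam 3) ∧
                ambientMetric c (ambientJ (f p) X) (A p) = 0) ∧
            lam 1 = 0 ∧ lam 2 = √(-3 * c) / 2 ∧ lam 3 = √(-c) / (2 * √3)))) := by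
  constructor
  · intro hc M _ _ _ _ f hf h1 h2
    obtain ⟨l, ξ, W, -, -, hd⟩ :=
      exists_isTripleDatum_nonneg hn hc.ne' hf h1 h2 (Classical.arbitrary M)
    -- The inequality κ + l² < 0 is impossible for c > 0.
    have := hd.neg
    nlinarith [sq_nonneg l]
  · intro hc M _ _ _ _ f hf h1 h2
    obtain ⟨l, ξ, hl, hξ, hd⟩ := exists_global_normal hn hc.ne hf h1 h2
    have hd₀ := hd
    choose W hp hd' using hd₀
    have hneg : c / 4 + l ^ 2 < 0 := (hd' (Classical.arbitrary M)).neg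
    obtain ⟨U₁, U₂, A, hU₁, hU₂, hA, hU⟩ := exists_global_frame hf hd
    have hw₁ := hopfWeight₁_pos hneg
    have hw₂ := hopfWeight₂_pos hneg
    have hlt : l < √(-c) / 2 := by
      rw [lt_div_iff₀ two_pos]
      exact Real.lt_sqrt_of_sq_lt (by nlinarith)
    have hdim₁ : ∀ p, Module.finrank ℝ (principalSpace f ξ p (hopfCurvature₁ c l)) = 1 := fun p =>
      (hd' p).finrank_principalSpace₁ (hp p) hl
    have hHopf := And.intro (Real.sqrt_pos.2 hw₁) <| And.intro (Real.sqrt_pos.2 hw₂) <|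
      And.intro (IsUnitSection.mk (f := f) (ξ := ξ) hU₁ (fun p => (hU p).mem₁)
        fun p => (hU p).unit₁) <|
      And.intro (IsUnitSection.mk (f := f) (ξ := ξ) hU₂ (fun p => (hU p).mem₂)
        fun p => (hU p).unit₂) <|
      And.intro (fun p => (hU p).hopf) <| And.intro (Real.sq_sqrt hw₁.le) (Real.sq_sqrt hw₂.le)
    have hA' := And.intro (IsUnitSection.mk (f := f) (ξ := ξ) hA (fun p => (hU p).mem_A)
        fun p => (hU p).unit_A) <|
      And.intro (fun p => (hU p).J₁) <| And.intro (fun p => (hU p).J₂) fun p => (hU p).J_A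
    rcases principalCurvatures_cases hn hl hneg hd hU with
      ⟨hcurv, hcase⟩ | ⟨hl', hne₂, hcurv, hdim₂, k, hk⟩
    · refine ⟨ξ, 3, curvatureList c l, _, _, U₁, U₂, A, hξ, Or.inl rfl,
        injOn_curvatureList_three hneg, fun p => by rw [hcurv, curvatureList_image_three], hHopf,
        hA', ⟨hl, hlt, rfl, rfl⟩, hdim₁, fun h => by omega, fun _ => ?_⟩
      rcases hcase with h | ⟨hμ, hk⟩
      · exact Or.inl h
      · have hJ := fun (p : M) (X : Mat n) (hX : X ∈ principalSpace f ξ p (hopfCurvature₂ c l))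
            (hX' : ambientMetric c X (U₂ p) = 0) =>
          (hd' p).J_residual hf (hp p) (hU p) hμ (hopfCurvature_lt hneg).ne' hX hX'
        exact Or.inr ⟨hk, fun p X hX hX' => (hJ p X hX hX').2.2,
          fun p X hX hX' => ⟨(hJ p X hX hX').1, (hJ p X hX hX').2.1⟩,
          hopfCurvature_of_residual hneg hl hμ⟩
    · have hμ : c / 4 + l * (-c / (4 * l)) = 0 := by
        field_simp
        ring
      have hne₁ : -c / (4 * l) ≠ hopfCurvature₁ c l := by
        intro h0
        have h3 := hopfCurvature₁_lt hneg
        rw [h0] at hμ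
        nlinarith
      have hperp : ∀ p, ∀ X ∈ principalSpace f ξ p (-c / (4 * l)),
          ambientMetric c X (U₂ p) = 0 := fun p X hX =>
        (hd' p).metric_residual hf (hp p) (hU p) hμ hne₁ hne₂ hX
      have hJ := fun (p : M) (X : Mat n) (hX : X ∈ principalSpace f ξ p (-c / (4 * l))) =>
        (hd' p).J_residual hf (hp p) (hU p) hμ hne₁ hX (hperp p X hX)
      refine ⟨ξ, 4, curvatureList c l, _, _, U₁, U₂, A, hξ, Or.inr rfl,
        injOn_curvatureList_four hneg hl' hne₂, fun p => by rw [hcurv, curvatureList_image_four],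
        hHopf, hA', ⟨hl, hlt, rfl, rfl⟩, hdim₁, fun _ => ?_, fun h => by omega⟩
      refine ⟨hdim₂, ⟨k, hk⟩, fun p X hX Y hY => (hJ p X hX).2.2 Y hY (hperp p Y hY),
        fun p X hX => ⟨(hJ p X hX).1, (hJ p X hX).2.1⟩, hl'.ne', fun h => ?_, rfl⟩
      -- For this value of λ₃ the number λ₄ would equal λ₂.
      have h3 := residual_of_eq hl hc h
      refine hne₂ (mul_left_cancel₀ hl'.ne' ?_)
      linarith
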